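/- **Setting.** All manifolds, maps, actions and vector fields are smooth, and manifolds are finite-dimensional. An *invariant measure* of a vector field $Z$ on a manifold $N$ is a measure $\mu$ on $N$ which in every chart has the form $\rho(y)\,dy$ with a smooth, everywhere positive density $\rho$, and which satisfies $\mathcal L_Z\mu=0$, i.e. $\sum_i\partial(\rho Z_i)/\partial y_i=0$ in every chart. Let $G$ be a compact connected Lie group with Lie algebra $\mathfrak g$, let $\langle\cdot,\cdot\rangle$ be an $\mathrm{Ad}_G$-invariant scalar product on $\mathfrak g$, and let $\mathcal I:\mathfrak g\to\mathfrak g$ be a linear operator that is symmetric with respect to $\langle\cdot,\cdot\rangle$. Let $H\subset G$ be a closed subgroup with Lie algebra $\mathfrak h$, and let $\mathfrak d=\mathfrak h^\perp$. Assume that the quadratic form $\langle\mathcal I\omega,\omega\rangle$ is nondegenerate on $g^{-1}\mathfrak d g$ for every $g\in G$ (which always holds if $\mathcal I$ is positive definite). Let $Q=H\backslash G$ be the manifold of cosets $Hg$, with projection $\pi:G\to Q$. For $q=\pi(g)$ and $v\in T_qQ$ let $\Phi(q,v)\in g^{-1}\mathfrak d g$ be the unique element with $d\pi_g\bigl(g\cdot\Phi(q,v)\bigr)=v$;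 it does not depend on the choice of $g$ over $q$. Let $V:Q\to\mathbb R$ be a smooth potential (for example $V=0$) and put $$L(q,\dot q)=\tfrac12\langle\mathcal I\Phi(q,\dot q),\Phi(q,\dot q)\rangle-V(q).$$ The *reduced LR system* is $$\Bigl(\frac{\partial L}{\partial q}-\frac{d}{dt}\frac{\partial L}{\partial\dot q},\,\xi\Bigr)=\bigl\langle\mathcal I\Phi(q,\dot q),\ \mathrm{pr}_{g^{-1}\mathfrak h g}[\Phi(q,\dot q),\Phi(q,\xi)]\bigr\rangle\qquad\text{for all }\xi\in T_qQ,\quad q=\pi(g),$$ where $\mathrm{pr}_{g^{-1}\mathfrak h g}$ is the orthogonal projection of $\mathfrak g$ to $g^{-1}\mathfrak h g$. **Theorem 3.3.** The solutions $(q,\dot q)$ of the reduced LR system are exactly the integral curves of a smooth vector field on $TQ$, and this field has an invariant measure. The Legendre transformation $(q,\dot q)\mapsto(q,\partial L/\partial\dot q)$ is a smooth bijection $TQ\to T^*Q$ which carries the field to a smooth vector field on $T^*Q$, and that field has an invariant measure as well. **Lemma 3.4.** Let a compact Lie group $K$ act freely on a manifold $N$, let $\pi:N\to N/K$ be the projection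 to the quotient manifold, and let $Z$ be a $K$-invariant vector field on $N$ with an invariant measure $\mu$ (which need not be $K$-invariant). Then the reduced vector field on $N/K$ (the field $\bar Z$ with $d\pi(Z)=\bar Z\circ\pi$) exists, is smooth, and has an invariant measure, namely the average of $\mu$ over the fibres, i.e. the push-forward $\pi_*\mu$. -/

import Mathlib

open scoped Manifold ContDiff

noncomputable section

/-! ### Volumes on manifolds and their invariance under vector fields -/

section Volume

variable {E : Type*} [NormedAddCommGroup E] [NormedSpace ℝ E]
  {H : Type*} [TopologicalSpace H] (I : ModelWithCorners ℝ E H)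
  {N : Type*} [TopologicalSpace N] [ChartedSpace H N]

/-- The expression, in the chart around `x₀`, of a vector field `Z` on a manifold. -/
def chartField (Z : (x : N) → TangentSpace I x) (x₀ : N) (y : E) : E :=
  mfderiv I 𝓘(ℝ, E) (extChartAt I x₀) ((extChartAt I x₀).symm y) (Z ((extChartAt I x₀).symm y))

/-- The divergence `∑ᵢ ∂Fᵢ/∂yᵢ` of a vector field on a vector space. -/
def divergence (F : E → E) (y : E) : ℝ := LinearMap.trace ℝ E (fderiv ℝ F y)

/-- A vector field on a manifold is smooth as a section of the tangent bundle. -/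
def IsSmoothField [IsManifold I 1 N] (Z : (x : N) → TangentSpace I x) : Prop :=
  ContMDiff I I.tangent ∞ (fun x => (⟨x, Z x⟩ : TangentBundle I N))

variable [FiniteDimensional ℝ E] [MeasurableSpace E] [BorelSpace E]
  [MeasurableSpace N] [BorelSpace N]

/-- On the domain of the chart around `x₀`, the measure `μ` is `ρ(y) dy`. -/
def HasChartDensity (μ : MeasureTheory.Measure N) (x₀ : N) (ρ : E → ℝ) : Prop :=
  ∀ s : Set N, MeasurableSet s → s ⊆ (extChartAt I x₀).source →
    μ s = ∫⁻ y in extChartAt I x₀ '' s, ENNReal.ofReal (ρ y) ∂MeasureTheory.Measure.addHaar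

/-- `μ` is a volume (a measure which in every chart is `ρ(y) dy` with a smooth and everywhere
positive density `ρ`) that is invariant under the dynamical system `ẋ = Z(x)`, i.e. its Lie
derivative along `Z`, which in a chart is `∑ᵢ ∂(ρ Zᵢ)/∂yᵢ dy`, vanishes. -/
def IsInvariantVolume (Z : (x : N) → TangentSpace I x) (μ : MeasureTheory.Measure N) : Prop :=
  ∀ x₀ : N, ∃ ρ : E → ℝ,
    ContDiffOn ℝ ∞ ρ (extChartAt I x₀).target ∧
    (∀ y ∈ (extChartAt I x₀).target, 0 < ρ y) ∧
    HasChartDensity I μ x₀ ρ ∧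
    ∀ y ∈ (extChartAt I x₀).target, divergence (fun y' => ρ y' • chartField I Z x₀ y') y = 0

end Volume

/-! ### LR systems and their reduction -/

section LieAlgebra

variable {E : Type*} [NormedAddCommGroup E] [NormedSpace ℝ E]
  {G : Type*} [TopologicalSpace G] [ChartedSpace E G] [Group G]

variable (E) in
/-- The adjoint action `ξ ↦ g ξ g⁻¹` of a Lie group on its Lie algebra. -/
def lieAd (g : G) : GroupLieAlgebra 𝓘(ℝ, E) G →L[ℝ] GroupLieAlgebra 𝓘(ℝ, E) G :=
  mfderiv 𝓘(ℝ, E) 𝓘(ℝ, E) (fun x : G => g * x * g⁻¹) 1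

variable (E) in
/-- The Lie algebra of a closed subgroup `H`: the velocities at the identity of curves in `H`. -/
def subgroupLieAlgebra (H : Subgroup G) : Submodule ℝ (GroupLieAlgebra 𝓘(ℝ, E) G) :=
  Submodule.span ℝ {ξ | ∃ γ : ℝ → G, γ 0 = 1 ∧ (∀ t, γ t ∈ H) ∧
    HasMFDerivAt 𝓘(ℝ, ℝ) 𝓘(ℝ, E) γ 0 ((1 : ℝ →L[ℝ] ℝ).smulRight (ξ : E))}

end LieAlgebra

/-- The data of a left-invariant kinetic energy on a Lie group `G`: an `Ad`-invariant scalar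
product `⟨·,·⟩` on the Lie algebra and an inertia operator, symmetric with respect to it. -/
structure InertiaData (E : Type*) [NormedAddCommGroup E] [NormedSpace ℝ E]
    (G : Type*) [TopologicalSpace G] [ChartedSpace E G] [Group G] where
  /-- the scalar product -/
  form : LinearMap.BilinForm ℝ (GroupLieAlgebra 𝓘(ℝ, E) G)
  form_symm : ∀ ξ η, form ξ η = form η ξ
  form_pos : ∀ ξ, ξ ≠ 0 → 0 < form ξ ξ
  form_ad : ∀ (g : G) ξ η, form (lieAd E g ξ) (lieAd E g η) = form ξ η
  /-- the inertia operator -/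
  inertia : GroupLieAlgebra 𝓘(ℝ, E) G →ₗ[ℝ] GroupLieAlgebra 𝓘(ℝ, E) G
  inertia_symm : ∀ ξ η, form (inertia ξ) η = form ξ (inertia η)

/-- The space `H \ G` of cosets `H g`. -/
abbrev CosetSpace {G : Type*} [Group G] (H : Subgroup G) : Type _ :=
  Quotient (QuotientGroup.rightRel H)

/-- The projection `G → H \ G`. -/
def cosetProj {G : Type*} [Group G] (H : Subgroup G) (g : G) : CosetSpace H :=
  Quotient.mk (QuotientGroup.rightRel H) g

namespace InertiaData

variable {E : Type*} [NormedAddCommGroup E] [NormedSpace ℝ E]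
  {G : Type*} [TopologicalSpace G] [ChartedSpace E G] [Group G] (S : InertiaData E G)
  (H : Subgroup G)

/-- `g⁻¹ 𝔥 g`, where `𝔥` is the Lie algebra of `H`. -/
def vertical (g : G) : Submodule ℝ (GroupLieAlgebra 𝓘(ℝ, E) G) :=
  (subgroupLieAlgebra E H).map (lieAd E g⁻¹).toLinearMap

/-- `g⁻¹ 𝔡 g`, where `𝔡` is the orthogonal complement of `𝔥`: the left translate to the identity
of the right-invariant constraint distribution `D_g = 𝔡 g`. -/
def horizontal (g : G) : Submodule ℝ (GroupLieAlgebra 𝓘(ℝ, E) G) :=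
  (S.form.orthogonal (subgroupLieAlgebra E H)).map (lieAd E g⁻¹).toLinearMap

/-- The kinetic energy is nondegenerate on the constraint distribution, so that the constrained
system and the reduced metric are well defined. -/
def IsRegular : Prop :=
  ∀ g : G, ∀ ξ ∈ S.horizontal H g,
    (∀ η ∈ S.horizontal H g, S.form (S.inertia ξ) η = 0) → ξ = 0

/-- A positive definite inertia operator is regular for every subgroup. -/
theorem isRegular_of_pos (h : ∀ ξ, ξ ≠ 0 → 0 < S.form (S.inertia ξ) ξ) : S.IsRegular H := by
  intro g ξ hξ h0
  by_contra hne
  exact absurd (h0 ξ hξ) (h ξ hne).ne'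

/-- The orthogonal projection of `ξ` to the subspace `W` of the Lie algebra. -/
def orthProj (W : Submodule ℝ (GroupLieAlgebra 𝓘(ℝ, E) G)) (ξ : GroupLieAlgebra 𝓘(ℝ, E) G) :
    GroupLieAlgebra 𝓘(ℝ, E) G :=
  Classical.epsilon fun η => η ∈ W ∧ ∀ ζ ∈ W, S.form (ξ - η) ζ = 0

variable {F : Type*} [NormedAddCommGroup F] [NormedSpace ℝ F]
  [ChartedSpace F (CosetSpace H)]

/-- The momentum map `Φ : T(H \ G) → 𝔤`: `Φ(q, v) = g⁻¹ X`, where `X ∈ D_g` is the horizontal lift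
of `v` at a point `g` over `q`. As `D` and `g⁻¹ X` are invariant under the left action of `H`, it
does not depend on the choice of the representative `g` of the coset `q`. -/
def Phi (q : CosetSpace H) (v : TangentSpace 𝓘(ℝ, F) q) : GroupLieAlgebra 𝓘(ℝ, E) G :=
  Classical.epsilon fun ξ => ξ ∈ S.horizontal H q.out ∧
    (mfderiv 𝓘(ℝ, E) 𝓘(ℝ, F) (cosetProj H) q.out (mulInvariantVectorField ξ q.out) : F) = v

/-- The nonholonomic term `⟨𝓘Φ(q, v), pr_{g⁻¹𝔥g} [Φ(q, v), Φ(q, ξ)]⟩`. -/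
def curvatureTerm (w : TangentBundle 𝓘(ℝ, F) (CosetSpace H))
    (ξ : TangentSpace 𝓘(ℝ, F) w.proj) : ℝ :=
  S.form (S.inertia (S.Phi H w.proj w.snd))
    (S.orthProj (vertical H w.proj.out) ⁅S.Phi H w.proj w.snd, S.Phi H w.proj ξ⁆)

/-- The reduced Lagrangian `L(q, v) = ½⟨𝓘Φ(q, v), Φ(q, v)⟩ - V(q)` on `T(H \ G)`. -/
def reducedLagrangian (V : CosetSpace H → ℝ) (w : TangentBundle 𝓘(ℝ, F) (CosetSpace H)) : ℝ :=
  (1 / 2) * S.form (S.inertia (S.Phi H w.proj w.snd)) (S.Phi H w.proj w.snd) - V w.proj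

variable [IsManifold 𝓘(ℝ, F) ∞ (CosetSpace H)]

/-- The reduced Lagrangian in the coordinates `(q, q̇)` on `T(H \ G)` around the point `w`. -/
def chartLagrangian (V : CosetSpace H → ℝ) (w : TangentBundle 𝓘(ℝ, F) (CosetSpace H))
    (y : F × F) : ℝ :=
  S.reducedLagrangian H V ((extChartAt (𝓘(ℝ, F).tangent) w).symm y)

/-- `γ = (q, q̇)` is, at the times `t ∈ s`, a motion of the reduced LR system
`(∂L/∂q - d/dt ∂L/∂q̇, ξ) = ⟨𝓘Φ(q, q̇), pr_{g⁻¹𝔥g} [Φ(q, q̇), Φ(q, ξ)]⟩` for all `ξ ∈ T_q(H \ G)`.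
The equation at time `t` is written in the coordinates around `γ t`. -/
def IsReducedMotion (V : CosetSpace H → ℝ) (γ : ℝ → TangentBundle 𝓘(ℝ, F) (CosetSpace H))
    (s : Set ℝ) : Prop :=
  ∀ t ∈ s,
    MDifferentiableAt 𝓘(ℝ, ℝ) (𝓘(ℝ, F).tangent) γ t ∧
    HasMFDerivAt 𝓘(ℝ, ℝ) 𝓘(ℝ, F) (fun τ => (γ τ).proj) t
      ((1 : ℝ →L[ℝ] ℝ).smulRight ((γ t).snd : F)) ∧
    ∀ ξ : F,
      HasDerivAt
        (fun τ => fderiv ℝ (S.chartLagrangian H V (γ t))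
          (extChartAt (𝓘(ℝ, F).tangent) (γ t) (γ τ)) (0, ξ))
        (fderiv ℝ (S.chartLagrangian H V (γ t))
          (extChartAt (𝓘(ℝ, F).tangent) (γ t) (γ t)) (ξ, 0) - S.curvatureTerm H (γ t) ξ) t

/-- `Z` is the vector field on `T(H \ G)` of the reduced LR system: its integral curves are exactly
the motions. -/
def IsReducedField (V : CosetSpace H → ℝ)
    (Z : (w : TangentBundle 𝓘(ℝ, F) (CosetSpace H)) → TangentSpace (𝓘(ℝ, F).tangent) w) : Prop :=
  ∀ (γ : ℝ → TangentBundle 𝓘(ℝ, F) (CosetSpace H)) (s : Set ℝ), IsOpen s →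
    (IsMIntegralCurveOn γ Z s ↔ S.IsReducedMotion H V γ s)

end InertiaData

/-- The cotangent bundle of a manifold modelled on `F`. -/
abbrev CotangentBundle (F : Type*) [NormedAddCommGroup F] [NormedSpace ℝ F]
    (Q : Type*) [TopologicalSpace Q] [ChartedSpace F Q] : Type _ :=
  Bundle.TotalSpace (F →L[ℝ] ℝ)
    (fun q : Q => TangentSpace 𝓘(ℝ, F) q →L[ℝ] Bundle.Trivial Q ℝ q)

/-- The Legendre transformation `(q, q̇) ↦ (q, ∂L/∂q̇)` of the reduced Lagrangian. -/
def InertiaData.legendre {E : Type*} [NormedAddCommGroup E] [NormedSpace ℝ E]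
    {G : Type*} [TopologicalSpace G] [ChartedSpace E G] [Group G] (S : InertiaData E G)
    (H : Subgroup G) {F : Type*} [NormedAddCommGroup F] [NormedSpace ℝ F]
    [ChartedSpace F (CosetSpace H)] (V : CosetSpace H → ℝ)
    (w : TangentBundle 𝓘(ℝ, F) (CosetSpace H)) : CotangentBundle F (CosetSpace H) :=
  ⟨w.proj, fderiv ℝ (fun v : F => S.reducedLagrangian H V ⟨w.proj, v⟩) w.snd⟩

end

/-!
**The invariant measure of the reduced system.** In a chart of `Q = H \ G` write `Φ(q, v) = Φ_q v`,
and let `A_q(u, w) = ⟨𝓘Φ_q u, Φ_q w⟩` and `B_q(u, w) = ⟨Φ_q u, Φ_q w⟩` be the two metrics that `Φ`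
pulls back from the Lie algebra. The reduced LR system says that `A_q(q̈, ξ)` equals a force which is
polynomial in `q̇`, and regularity is the invertibility of `A_q`; so the system is a smooth field on
`TQ`. The point is the structure equation `exists_fderiv_localPhi_add_bracket`: the vector
`D_v Φ(w) + [Φ v, Φ w]` is horizontal, hence of the form `Φ(T w)`. As `ad` is skew for `⟨·,·⟩`, the
bracket drops out of the derivative of `B`, while in the derivative of `A` it leaves the vertical
part of `[Φ v, Φ w]`, that is, the nonholonomic term. This gives (`formTrace_sub`)
`tr A⁻¹A' - tr B⁻¹B' = -2 tr A⁻¹C`, with `C(u, w) = ⟨𝓘Φ u, pr [Φ v, Φ w]⟩` and the prime for the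
derivative along `v`. The other part of the force, `⟨𝓘Φ v, pr [Φ u, Φ w]⟩`, is skew in `u, w` and
does not contribute to the divergence. Consequently `√|det A · det B| dq dq̇` is preserved on `TQ`
(`divergence_density_smul_localField`), and `√|det B / det A| dq dp` on `T*Q`
(`divergence_momentumDensity_smul_momentumField`). Both determinants are multiplied by `(det τ')²`
under a change of coordinates `τ`, and the induced changes of coordinates of `TQ` and `T*Q` have the
determinants `(det τ')²` and `1`; so these measures do not depend on the chart, and they are glued to
a global one (`exists_measure_hasChartDensity`). As `G` is compact, countably many charts suffice.

**Reduction by a free action.** The projection to the orbit space is a proper submersion. In charts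
where a submersion is linear (`exists_linearizing_chart`), pushing forward means integrating over
parallel fibres, and a partition of unity shows that the push-forward of a volume has smooth positive
densities (`exists_local_density_map`). Invariance is used in its weak form, `∫ Z g dμ = 0` for all
test functions `g` (`integral_fieldDeriv_eq_zero`, `divergence_eq_zero_of_integral_fieldDeriv`).
Since the derivative of `g ∘ π` along `Z` is that of `g` along the reduced field, composed with `π`,
the weak form passes to the quotient by the change of variables formula
(`isInvariantVolume_map_of_related`).
-/

open scoped Manifold ContDiff

noncomputable section

set_option linter.unusedSectionVars false
set_option linter.style.haveILetI false

/-! ### Vector fields and measures in charts -/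

section ChartFields

open Bundle MeasureTheory

variable {E : Type*} [NormedAddCommGroup E] [NormedSpace ℝ E]
  {H : Type*} [TopologicalSpace H] (I : ModelWithCorners ℝ E H) [I.Boundaryless]
  {N : Type*} [TopologicalSpace N] [ChartedSpace H N]

/-- The change of coordinates from the chart around `x₀` to the chart around `x₁`. -/
def chartTrans (x₀ x₁ : N) (y : E) : E := extChartAt I x₁ ((extChartAt I x₀).symm y)

/-- The domain of the change of coordinates from the chart around `x₀` to the chart around `x₁`. -/
def chartOverlap (x₀ x₁ : N) : Set E :=
  (extChartAt I x₀).target ∩ (extChartAt I x₀).symm ⁻¹' (extChartAt I x₁).source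

theorem isOpen_chartOverlap (x₀ x₁ : N) : IsOpen (chartOverlap I x₀ x₁) :=
  (continuousOn_extChartAt_symm x₀).isOpen_inter_preimage (isOpen_extChartAt_target x₀)
    (isOpen_extChartAt_source x₁)

theorem contDiffOn_chartTrans [IsManifold I ∞ N] (x₀ x₁ : N) :
    ContDiffOn ℝ ∞ (chartTrans I x₀ x₁) (chartOverlap I x₀ x₁) := by
  have := contDiffOn_ext_coord_change (I := I) (n := ∞) x₁ x₀
  refine this.mono ?_
  intro y hy
  simpa [chartOverlap] using hy

theorem chartTrans_extChartAt {x₀ x₁ x : N} (hx : x ∈ (extChartAt I x₀).source) :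
    chartTrans I x₀ x₁ (extChartAt I x₀ x) = extChartAt I x₁ x := by
  rw [chartTrans, (extChartAt I x₀).left_inv hx]

theorem extChartAt_mem_chartOverlap {x₀ x₁ x : N} (hx : x ∈ (extChartAt I x₀).source)
    (hx' : x ∈ (extChartAt I x₁).source) : extChartAt I x₀ x ∈ chartOverlap I x₀ x₁ :=
  ⟨(extChartAt I x₀).map_source hx, by
    rwa [Set.mem_preimage, (extChartAt I x₀).left_inv hx]⟩

/-- The tangent space at `x` is the model space, read in the preferred chart around `x`; so the
derivative at `x` of another chart is that of a change of coordinates. -/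
theorem mfderiv_extChartAt_eq_fderiv_chartTrans [IsManifold I ∞ N] {x₀ x : N}
    (hx : x ∈ (extChartAt I x₀).source) :
    mfderiv I 𝓘(ℝ, E) (extChartAt I x₀) x =
      fderiv ℝ (chartTrans I x x₀) (extChartAt I x x) := by
  have h : MDifferentiableAt I 𝓘(ℝ, E) (extChartAt I x₀) x :=
    haveI : IsManifold I 1 N := .of_le (n := ∞) (by norm_cast)
    mdifferentiableAt_extChartAt (by simpa using hx)
  have h1 : mfderiv I 𝓘(ℝ, E) (extChartAt I x₀) x =
      fderivWithin ℝ (chartTrans I x x₀) (Set.range I) (extChartAt I x x) := by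
    unfold mfderiv
    exact if_pos h
  rw [I.range_eq_univ, fderivWithin_univ] at h1
  exact h1

theorem chartField_extChartAt (Z : (x : N) → TangentSpace I x) {x₀ x : N}
    (hx : x ∈ (extChartAt I x₀).source) :
    chartField I Z x₀ (extChartAt I x₀ x) = mfderiv I 𝓘(ℝ, E) (extChartAt I x₀) x (Z x) := by
  rw [chartField, (extChartAt I x₀).left_inv hx]

/-- A field is smooth if and only if its expressions in the charts are smooth. -/
theorem isSmoothField_iff_contDiffOn_chartField [IsManifold I ∞ N] [IsManifold I 1 N]
    (Z : (x : N) → TangentSpace I x) :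
    IsSmoothField I Z ↔ ∀ x₀ : N, ContDiffOn ℝ ∞ (chartField I Z x₀) (extChartAt I x₀).target := by
  haveI : IsManifold I (∞ + 1) N := ‹IsManifold I ∞ N›
  haveI : ContMDiffVectorBundle ∞ E (TangentSpace I : N → Type _) I :=
    TangentBundle.contMDiffVectorBundle
  -- the fibre coordinate in the trivialization over a chart is the expression in the chart
  have key : ∀ x₀ : N, ∀ x ∈ (extChartAt I x₀).source,
      (trivializationAt E (TangentSpace I) x₀ ⟨x, Z x⟩).2 =
        chartField I Z x₀ (extChartAt I x₀ x) := by
    intro x₀ x hx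
    have hb : x ∈ (trivializationAt E (TangentSpace I) x₀).baseSet := by simpa using hx
    have h1 := TangentBundle.continuousLinearMapAt_trivializationAt (I := I) (x₀ := x₀) (x := x)
      (by simpa using hx)
    have h2 : (trivializationAt E (TangentSpace I) x₀).continuousLinearMapAt ℝ x (Z x) =
        (trivializationAt E (TangentSpace I) x₀ ⟨x, Z x⟩).2 := by
      rw [Trivialization.continuousLinearMapAt_apply, Trivialization.coe_linearMapAt_of_mem _ hb]
    rw [chartField_extChartAt I Z hx, ← h2]
    exact DFunLike.congr_fun h1 (Z x)
  constructor
  · intro h x₀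
    have h1 : ContMDiffOn I 𝓘(ℝ, E) ∞
        (fun x => (trivializationAt E (TangentSpace I) x₀ ⟨x, Z x⟩).2) (extChartAt I x₀).source := by
      have := (Trivialization.contMDiffOn_section_iff (IB := I) (n := ∞)
        (trivializationAt E (TangentSpace I) x₀) (s := Z)
        (a := (trivializationAt E (TangentSpace I) x₀).baseSet)
        (trivializationAt E (TangentSpace I) x₀).open_baseSet subset_rfl).1 h.contMDiffOn
      refine this.mono ?_
      intro x hx
      simpa using hx
    have h2 := h1.comp (contMDiffOn_extChartAt_symm (I := I) (n := ∞) x₀)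
      (fun y hy => (extChartAt I x₀).map_target hy)
    refine (contMDiffOn_iff_contDiffOn.1 h2).congr ?_
    intro y hy
    rw [Function.comp_apply, key x₀ _ ((extChartAt I x₀).map_target hy),
      (extChartAt I x₀).right_inv hy]
  · intro h x₀
    rw [Bundle.contMDiffAt_section]
    have h1 : ContMDiffOn I 𝓘(ℝ, E) ∞ (fun x => chartField I Z x₀ (extChartAt I x₀ x))
        (extChartAt I x₀).source := by
      refine ((contMDiffOn_iff_contDiffOn.2 (h x₀)).comp (t := (extChartAt I x₀).target)
        (contMDiffOn_extChartAt (I := I) (n := ∞) (x := x₀)) ?_).mono (by simp)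
      intro x hx
      exact (extChartAt I x₀).map_source (by simpa using hx)
    refine (h1.contMDiffAt (extChartAt_source_mem_nhds x₀)).congr_of_eventuallyEq ?_
    filter_upwards [extChartAt_source_mem_nhds (I := I) x₀] with x hx using key x₀ x hx

/-- The vector field whose value at `x` is given, in the chart around `x`, by the local field
`X x`. -/
def glueField (X : N → E → E) (x : N) : TangentSpace I x := X x (extChartAt I x x)

/-- If the local fields `X x₀` are related by the changes of coordinates, then they are the
expressions of the glued field in the charts. -/
theorem chartField_glueField [IsManifold I ∞ N] {X : N → E → E}
    (hX : ∀ x₀ x₁ : N, ∀ y ∈ chartOverlap I x₀ x₁,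
      fderiv ℝ (chartTrans I x₀ x₁) y (X x₀ y) = X x₁ (chartTrans I x₀ x₁ y))
    (x₀ : N) {y : E} (hy : y ∈ (extChartAt I x₀).target) :
    chartField I (glueField I X) x₀ y = X x₀ y := by
  have hx := (extChartAt I x₀).map_target hy
  have := hX ((extChartAt I x₀).symm y) x₀ _
    (extChartAt_mem_chartOverlap I (mem_extChartAt_source _) hx)
  rw [chartTrans_extChartAt I (mem_extChartAt_source _), (extChartAt I x₀).right_inv hy] at this
  rw [chartField, mfderiv_extChartAt_eq_fderiv_chartTrans I hx]
  exact this

end ChartFields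

section ChartDensities

open MeasureTheory

variable {E : Type*} [NormedAddCommGroup E] [NormedSpace ℝ E]
  {H : Type*} [TopologicalSpace H] (I : ModelWithCorners ℝ E H) [I.Boundaryless]
  {N : Type*} [TopologicalSpace N] [ChartedSpace H N]
  [FiniteDimensional ℝ E] [MeasurableSpace E] [BorelSpace E]
  [MeasurableSpace N] [BorelSpace N]

theorem measurableSet_chart_image (x₀ : N) {s : Set N} (hs : MeasurableSet s)
    (hsub : s ⊆ (extChartAt I x₀).source) : MeasurableSet (extChartAt I x₀ '' s) := by
  rw [PartialEquiv.image_eq_target_inter_inv_preimage _ hsub]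
  have hc : ContinuousOn (extChartAt I x₀).symm (extChartAt I x₀).target :=
    continuousOn_extChartAt_symm x₀
  have ht : MeasurableSet (extChartAt I x₀).target :=
    (isOpen_extChartAt_target x₀).measurableSet
  have hm : Measurable ((extChartAt I x₀).target.domRestrict (extChartAt I x₀).symm) :=
    (continuousOn_iff_continuous_domRestrict.1 hc).measurable
  have := (MeasurableEmbedding.subtype_coe ht).measurableSet_image.2 (hm hs)
  convert this using 1
  ext y
  simp [Set.domRestrict]
  tauto

/-- The measure on `N`, concentrated on the domain of the chart around `x₀`, with the density
`ρ` in this chart. The restriction to the target is needed as the inverse of the chart has junk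
values elsewhere. -/
def chartMeasure (x₀ : N) (ρ : E → ℝ) : Measure N :=
  ((Measure.addHaar.restrict (extChartAt I x₀).target).withDensity
    (fun y => ENNReal.ofReal (ρ y))).map (extChartAt I x₀).symm

theorem chartMeasure_apply (x₀ : N) (ρ : E → ℝ) {s : Set N} (hs : MeasurableSet s)
    (hsub : s ⊆ (extChartAt I x₀).source) :
    chartMeasure I x₀ ρ s =
      ∫⁻ y in extChartAt I x₀ '' s, ENNReal.ofReal (ρ y) ∂Measure.addHaar := by
  have ht : MeasurableSet (extChartAt I x₀).target :=
    (isOpen_extChartAt_target x₀).measurableSet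
  have hc : ContinuousOn (extChartAt I x₀).symm (extChartAt I x₀).target :=
    continuousOn_extChartAt_symm x₀
  have hae : AEMeasurable (extChartAt I x₀).symm
      ((Measure.addHaar.restrict (extChartAt I x₀).target).withDensity
        (fun y => ENNReal.ofReal (ρ y))) :=
    (hc.aemeasurable ht).mono_ac (withDensity_absolutelyContinuous _ _)
  have him : (extChartAt I x₀).target ∩ (extChartAt I x₀).symm ⁻¹' s = extChartAt I x₀ '' s :=
    (PartialEquiv.image_eq_target_inter_inv_preimage _ hsub).symm
  have hms := measurableSet_chart_image I x₀ hs hsub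
  have htt : extChartAt I x₀ '' s ⊆ (extChartAt I x₀).target := by
    rw [← him]; exact Set.inter_subset_left
  have hnull : NullMeasurableSet ((extChartAt I x₀).symm ⁻¹' s)
      ((Measure.addHaar.restrict (extChartAt I x₀).target).withDensity
        (fun y => ENNReal.ofReal (ρ y))) := hae.nullMeasurableSet_preimage hs
  rw [chartMeasure, Measure.map_apply_of_aemeasurable hae hs]
  rw [← Measure.restrict_eq_self_of_ae_mem (μ := Measure.withDensity _ _)
      (s := (extChartAt I x₀).target)
      ((withDensity_absolutelyContinuous _ _).ae_le (ae_restrict_mem ht))]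
  rw [Measure.restrict_apply' ht, Set.inter_comm, him, withDensity_apply _ hms,
        Measure.restrict_restrict_of_subset htt]

/-- If the densities in the charts obey the transformation rule, then the measures of two charts
agree where both charts are defined, by the change of variables formula. -/
theorem chartMeasure_eq_of_subset [IsManifold I ∞ N] {ρ : N → E → ℝ}
    (hρ : ∀ x₀ x₁ : N, ∀ y ∈ chartOverlap I x₀ x₁,
      ρ x₀ y = |(fderiv ℝ (chartTrans I x₀ x₁) y).det| * ρ x₁ (chartTrans I x₀ x₁ y))
    (x₀ x₁ : N) {s : Set N} (hs : MeasurableSet s) (h0 : s ⊆ (extChartAt I x₀).source)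
    (h1 : s ⊆ (extChartAt I x₁).source) :
    chartMeasure I x₀ (ρ x₀) s = chartMeasure I x₁ (ρ x₁) s := by
  rw [chartMeasure_apply I x₀ _ hs h0, chartMeasure_apply I x₁ _ hs h1]
  have him : extChartAt I x₁ '' s = chartTrans I x₀ x₁ '' (extChartAt I x₀ '' s) := by
    rw [Set.image_image]
    exact Set.image_congr fun x hx => (chartTrans_extChartAt I (h0 hx)).symm
  have hsub : extChartAt I x₀ '' s ⊆ chartOverlap I x₀ x₁ := by
    rintro _ ⟨x, hx, rfl⟩
    exact extChartAt_mem_chartOverlap I (h0 hx) (h1 hx)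
  rw [him, lintegral_image_eq_lintegral_abs_det_fderiv_mul Measure.addHaar
    (measurableSet_chart_image I x₀ hs h0) (f' := fun y => fderiv ℝ (chartTrans I x₀ x₁) y)]
  · refine setLIntegral_congr_fun (measurableSet_chart_image I x₀ hs h0) fun y hy => ?_
    rw [hρ x₀ x₁ y (hsub hy), ENNReal.ofReal_mul (abs_nonneg _)]
  · intro y hy
    exact ((contDiffOn_chartTrans I x₀ x₁).contDiffAt
      ((isOpen_chartOverlap I x₀ x₁).mem_nhds (hsub hy))).differentiableAt
        (by simp) |>.hasFDerivAt.hasFDerivWithinAt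
  · rintro _ ⟨x, hx, rfl⟩ _ ⟨x', hx', rfl⟩ h
    rw [chartTrans_extChartAt I (h0 hx), chartTrans_extChartAt I (h0 hx')] at h
    rw [(extChartAt I x₁).injOn (h1 hx) (h1 hx') h]

/-- Densities in the charts which transform by the Jacobian determinants of the changes of
coordinates are the densities of a measure. -/
theorem exists_measure_hasChartDensity [IsManifold I ∞ N] {ρ : N → E → ℝ}
    (hρ : ∀ x₀ x₁ : N, ∀ y ∈ chartOverlap I x₀ x₁,
      ρ x₀ y = |(fderiv ℝ (chartTrans I x₀ x₁) y).det| * ρ x₁ (chartTrans I x₀ x₁ y))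
    (c : ℕ → N) (hc : ∀ x, ∃ n, x ∈ (extChartAt I (c n)).source) :
    ∃ μ : Measure N, ∀ x₀, HasChartDensity I μ x₀ (ρ x₀) := by
  set U : ℕ → Set N := fun n => (extChartAt I (c n)).source with hU
  have hUm : ∀ n, MeasurableSet (U n) := fun n => (isOpen_extChartAt_source (c n)).measurableSet
  have hDm : ∀ n, MeasurableSet (disjointed U n) := MeasurableSet.disjointed hUm
  -- disjoint pieces of a countable cover by charts, each with the measure of its own chart
  refine ⟨Measure.sum fun n => (chartMeasure I (c n) (ρ (c n))).restrict (disjointed U n), ?_⟩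
  intro x₀ s hs hsub
  rw [Measure.sum_apply _ hs, ← chartMeasure_apply I x₀ (ρ x₀) hs hsub]
  have h1 : ∀ n, (chartMeasure I (c n) (ρ (c n))).restrict (disjointed U n) s =
      chartMeasure I x₀ (ρ x₀) (s ∩ disjointed U n) := fun n => by
    rw [Measure.restrict_apply hs]
    exact chartMeasure_eq_of_subset I hρ _ _ (hs.inter (hDm n))
      (Set.inter_subset_right.trans (disjointed_subset U n)) (Set.inter_subset_left.trans hsub)
  simp_rw [h1]
  rw [← measure_iUnion (fun i j hij => (disjoint_disjointed U hij).mono Set.inter_subset_right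
    Set.inter_subset_right) (fun n => hs.inter (hDm n)), ← Set.inter_iUnion, iUnion_disjointed,
    Set.inter_eq_left.2]
  intro x _
  exact Set.mem_iUnion.2 (hc x)

end ChartDensities

/-! ### Submersions in linearizing coordinates -/

section Submersions

open Set Filter Topology

variable {E : Type*} [NormedAddCommGroup E] [NormedSpace ℝ E]
  {F : Type*} [NormedAddCommGroup F] [NormedSpace ℝ F]
  {N : Type*} [TopologicalSpace N] [ChartedSpace E N]
  {M : Type*} [TopologicalSpace M] [ChartedSpace F M]

/-- Around a point where `f` is a submersion there are coordinates of the source in which `f`,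
read in a prescribed chart of the target, is a surjective linear map. -/
theorem exists_linearizing_chart [IsManifold 𝓘(ℝ, F) ∞ M]
    {f : N → M} {z : N} (hf : Manifold.IsSubmersionAt 𝓘(ℝ, E) 𝓘(ℝ, F) ∞ f z) {x₀ : M}
    (hz : f z ∈ (extChartAt 𝓘(ℝ, F) x₀).source) :
    ∃ (p : E →L[ℝ] F) (r : F →L[ℝ] E) (Θ : OpenPartialHomeomorph N E),
      (∀ v, p (r v) = v) ∧ z ∈ Θ.source ∧
      (∀ z' ∈ Θ.source, f z' ∈ (extChartAt 𝓘(ℝ, F) x₀).source) ∧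
      (∀ z' ∈ Θ.source, extChartAt 𝓘(ℝ, F) x₀ (f z') = p (Θ z')) ∧
      ContMDiffOn 𝓘(ℝ, E) 𝓘(ℝ, E) ∞ Θ Θ.source ∧
      ContMDiffOn 𝓘(ℝ, E) 𝓘(ℝ, E) ∞ Θ.symm Θ.target := by
  have hd := hf.domChart_mem_maximalAtlas
  have hk := hf.codChart_mem_maximalAtlas
  set d := hf.domChart
  set k := hf.codChart
  set e := hf.equiv
  set φ := chartAt F x₀
  have hφ : φ ∈ IsManifold.maximalAtlas 𝓘(ℝ, F) ∞ M := IsManifold.chart_mem_maximalAtlas x₀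
  have hw : ∀ z' ∈ d.source, k (f z') = (e (d z')).1 := by
    intro z' hz'
    have hm : d z' ∈ (d.extend 𝓘(ℝ, E)).target := by simpa using d.map_source hz'
    have := hf.writtenInCharts hm
    simpa [d, d.left_inv hz'] using this
  have hks : ∀ z' ∈ d.source, f z' ∈ k.source := fun z' hz' => hf.source_subset_preimage_source hz'
  -- the normal form of a submersion uses some chart `k` of the target; it is replaced by the
  -- prescribed chart `φ` in the first factor
  let T : OpenPartialHomeomorph (F × hf.complement) (F × hf.complement) :=
    (k.symm.trans φ).prod (OpenPartialHomeomorph.refl _)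
  let Θ : OpenPartialHomeomorph N E :=
    ((d.trans e.toHomeomorph.toOpenPartialHomeomorph).trans T).trans
      e.symm.toHomeomorph.toOpenPartialHomeomorph
  have hsrc : ∀ z', z' ∈ Θ.source ↔ z' ∈ d.source ∧ f z' ∈ φ.source := by
    intro z'
    simp only [Θ, T, OpenPartialHomeomorph.trans_source, OpenPartialHomeomorph.prod_source,
      OpenPartialHomeomorph.symm_source, mem_inter_iff, mem_preimage, mem_prod,
      Homeomorph.toOpenPartialHomeomorph_source, OpenPartialHomeomorph.refl_source, mem_univ,
      and_true, OpenPartialHomeomorph.coe_trans, Function.comp_apply,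
      Homeomorph.toOpenPartialHomeomorph_apply, ContinuousLinearEquiv.coe_toHomeomorph]
    constructor
    · rintro ⟨h1, h2, h3⟩
      refine ⟨h1, ?_⟩
      rwa [← hw z' h1, k.left_inv (hks z' h1)] at h3
    · rintro ⟨h1, h2⟩
      rw [← hw z' h1, k.left_inv (hks z' h1)]
      exact ⟨h1, k.map_source (hks z' h1), h2⟩
  have hT : ContDiffOn ℝ ∞ T T.source := by
    have h1 : ContDiffOn ℝ ∞ (k.symm.trans φ) (k.symm.trans φ).source := by
      rw [← contMDiffOn_iff_contDiffOn]
      refine (contMDiffOn_of_mem_maximalAtlas hφ).comp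
        ((contMDiffOn_symm_of_mem_maximalAtlas hk).mono ?_) ?_
      · intro y hy; simp at hy; exact hy.1
      · intro y hy; simp at hy; exact hy.2
    refine ContDiffOn.prodMk (h1.comp contDiff_fst.contDiffOn ?_) contDiff_snd.contDiffOn
    intro y hy
    exact hy.1
  have hT' : ContDiffOn ℝ ∞ T.symm T.target := by
    have h1 : ContDiffOn ℝ ∞ (k.symm.trans φ).symm (k.symm.trans φ).target := by
      rw [← contMDiffOn_iff_contDiffOn]
      refine (contMDiffOn_of_mem_maximalAtlas hk).comp
        ((contMDiffOn_symm_of_mem_maximalAtlas hφ).mono ?_) ?_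
      · intro y hy; simp [OpenPartialHomeomorph.trans_target] at hy; exact hy.1
      · intro y hy; simp [OpenPartialHomeomorph.trans_target] at hy; exact hy.2
    refine ContDiffOn.prodMk (h1.comp contDiff_fst.contDiffOn ?_) contDiff_snd.contDiffOn
    intro y hy
    exact hy.1
  refine ⟨(ContinuousLinearMap.fst ℝ F hf.complement).comp e.toContinuousLinearMap,
    e.symm.toContinuousLinearMap.comp (ContinuousLinearMap.inl ℝ F hf.complement), Θ,
    fun v => by simp, ?_, ?_, ?_, ?_, ?_⟩
  · rw [hsrc]
    exact ⟨hf.mem_domChart_source, by simpa using hz⟩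
  · intro z' hz'
    simpa using ((hsrc z').1 hz').2
  · intro z' hz'
    have h := (hsrc z').1 hz'
    have : Θ z' = e.symm (T (e (d z'))) := rfl
    rw [this]
    simp only [ContinuousLinearMap.comp_apply, ContinuousLinearEquiv.coe_coe,
      ContinuousLinearEquiv.apply_symm_apply, ContinuousLinearMap.coe_fst']
    have h2 : (T (e (d z'))).1 = φ (k.symm (e (d z')).1) := rfl
    rw [h2, ← hw z' h.1, k.left_inv (hks z' h.1)]
    simp [φ]
  · have h1 : ContMDiffOn 𝓘(ℝ, E) 𝓘(ℝ, E) ∞ (fun z' => e.symm (T (e (d z')))) Θ.source := by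
      have hA : ContMDiffOn 𝓘(ℝ, E) 𝓘(ℝ, F × hf.complement) ∞ (fun z' => e (d z')) Θ.source :=
        e.contDiff.contMDiff.comp_contMDiffOn
          ((contMDiffOn_of_mem_maximalAtlas hd).mono fun z' hz' => ((hsrc z').1 hz').1)
      refine e.symm.contDiff.contMDiff.comp_contMDiffOn
        ((contMDiffOn_iff_contDiffOn.2 hT).comp hA ?_)
      intro z' hz'
      simp only [Θ, OpenPartialHomeomorph.trans_source] at hz'
      exact hz'.1.2
    exact h1
  · have h1 : ContMDiffOn 𝓘(ℝ, E) 𝓘(ℝ, E) ∞ (fun y => d.symm (e.symm (T.symm (e y)))) Θ.target := by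
      have hmem : ∀ y ∈ Θ.target, e y ∈ T.target ∧ e.symm (T.symm (e y)) ∈ d.target := by
        intro y hy
        simp only [Θ, OpenPartialHomeomorph.trans_target] at hy
        exact ⟨hy.2.1, hy.2.2.2⟩
      refine (contMDiffOn_symm_of_mem_maximalAtlas hd).comp
        (t := d.target) (e.symm.contDiff.contMDiff.comp_contMDiffOn
          ((contMDiffOn_iff_contDiffOn.2 hT').comp (e.contDiff.contMDiff.contMDiffOn) ?_)) ?_
      · exact fun y hy => (hmem y hy).1
      · exact fun y hy => (hmem y hy).2
    exact h1

/-- A submersion has smooth local sections. -/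
theorem exists_local_section [IsManifold 𝓘(ℝ, F) ∞ M]
    {f : N → M} {z : N} (hf : Manifold.IsSubmersionAt 𝓘(ℝ, E) 𝓘(ℝ, F) ∞ f z) :
    ∃ σ : M → N, σ (f z) = z ∧ ContMDiffAt 𝓘(ℝ, F) 𝓘(ℝ, E) ∞ σ (f z) ∧
      ∀ᶠ x in 𝓝 (f z), f (σ x) = x := by
  obtain ⟨p, r, Θ, hpr, hzs, hsub, hp, -, hs⟩ := exists_linearizing_chart hf (x₀ := f z)
    (mem_extChartAt_source _)
  set φ := extChartAt 𝓘(ℝ, F) (f z) with hφ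
  -- move from `Θ z` along a complement of the kernel of `p`
  let g : M → E := fun x => Θ z + r (φ x - φ (f z))
  have hg0 : g (f z) = Θ z := by simp [g]
  have hg : ContMDiffAt 𝓘(ℝ, F) 𝓘(ℝ, E) ∞ g (f z) := by
    have h1 : ContMDiffAt 𝓘(ℝ, F) 𝓘(ℝ, F) ∞ φ (f z) := contMDiffAt_extChartAt
    have h2 : ContDiff ℝ ∞ (fun y : F => Θ z + r (y - φ (f z))) := by fun_prop
    exact h2.contMDiff.contMDiffAt.comp (f z) h1
  have ht : Θ.target ∈ 𝓝 (g (f z)) := by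
    rw [hg0]; exact Θ.open_target.mem_nhds (Θ.map_source hzs)
  refine ⟨fun x => Θ.symm (g x), ?_, ?_, ?_⟩
  · simp only [hg0]; exact Θ.left_inv hzs
  · exact (hs.contMDiffAt ht).comp (f z) hg
  · filter_upwards [hg.continuousAt.eventually ht, extChartAt_source_mem_nhds (I := 𝓘(ℝ, F)) (f z)]
      with x hx hx'
    have h1 := Θ.map_target hx
    refine φ.injOn (hsub _ h1) hx' ?_
    rw [hp _ h1, Θ.right_inv hx]
    simp only [g, map_add, map_sub, hpr, ← hp z hzs]
    abel

/-- A map on the target of a submersion is smooth at `f z` if its composition with the submersion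
is smooth at `z`. -/
theorem contMDiffAt_of_comp_submersion [IsManifold 𝓘(ℝ, F) ∞ M]
    {E₂ : Type*} [NormedAddCommGroup E₂] [NormedSpace ℝ E₂] {H₂ : Type*} [TopologicalSpace H₂]
    {J : ModelWithCorners ℝ E₂ H₂} {P : Type*} [TopologicalSpace P] [ChartedSpace H₂ P]
    {f : N → M} {z : N} (hf : Manifold.IsSubmersionAt 𝓘(ℝ, E) 𝓘(ℝ, F) ∞ f z) {h : M → P}
    (hh : ContMDiffAt 𝓘(ℝ, E) J ∞ (fun z => h (f z)) z) : ContMDiffAt 𝓘(ℝ, F) J ∞ h (f z) := by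
  obtain ⟨σ, h0, hs, he⟩ := exists_local_section hf
  have h1 : ContMDiffAt 𝓘(ℝ, F) J ∞ (fun x => h (f (σ x))) (f z) := by
    refine ContMDiffAt.comp (f z) (g := fun z => h (f z)) ?_ hs
    rwa [h0]
  refine h1.congr_of_eventuallyEq ?_
  filter_upwards [he] with x hx
  rw [hx]

theorem surjective_mfderiv_of_submersion [IsManifold 𝓘(ℝ, F) ∞ M]
    {f : N → M} {z : N} (hf : Manifold.IsSubmersionAt 𝓘(ℝ, E) 𝓘(ℝ, F) ∞ f z) :
    Function.Surjective (mfderiv 𝓘(ℝ, E) 𝓘(ℝ, F) f z) := by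
  obtain ⟨σ, h0, hs, he⟩ := exists_local_section hf
  intro v
  have h1 : HasMFDerivAt 𝓘(ℝ, F) 𝓘(ℝ, E) σ (f z) (mfderiv 𝓘(ℝ, F) 𝓘(ℝ, E) σ (f z)) :=
    (hs.mdifferentiableAt (by simp)).hasMFDerivAt
  have h2 : HasMFDerivAt 𝓘(ℝ, E) 𝓘(ℝ, F) f (σ (f z)) (mfderiv 𝓘(ℝ, E) 𝓘(ℝ, F) f z) := by
    rw [h0]
    exact (hf.contMDiffAt.mdifferentiableAt (by simp)).hasMFDerivAt
  have h3 := h2.comp (f z) h1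
  have h4 : HasMFDerivAt 𝓘(ℝ, F) 𝓘(ℝ, F) (f ∘ σ) (f z) (ContinuousLinearMap.id ℝ _) :=
    (hasMFDerivAt_id (I := 𝓘(ℝ, F)) (f z)).congr_of_eventuallyEq he
  have h5 := hasMFDerivAt_unique h3 h4
  exact ⟨_, DFunLike.congr_fun h5 v⟩

/-- Every tangent vector which a submersion annihilates is the velocity of a curve in the fibre. -/
theorem exists_curve_in_fibre_of_submersion [IsManifold 𝓘(ℝ, F) ∞ M] [IsManifold 𝓘(ℝ, E) ∞ N]
    {f : N → M} {z : N} (hf : Manifold.IsSubmersionAt 𝓘(ℝ, E) 𝓘(ℝ, F) ∞ f z)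
    {v : TangentSpace 𝓘(ℝ, E) z} (hv : mfderiv 𝓘(ℝ, E) 𝓘(ℝ, F) f z v = 0) :
    ∃ γ : ℝ → N, γ 0 = z ∧ (∀ t, f (γ t) = f z) ∧
      HasMFDerivAt 𝓘(ℝ, ℝ) 𝓘(ℝ, E) γ 0 ((1 : ℝ →L[ℝ] ℝ).smulRight (v : E)) := by
  classical
  obtain ⟨p, r, Θ, hpr, hzs, hsub, hp, hΘ, hs⟩ := exists_linearizing_chart hf (x₀ := f z)
    (mem_extChartAt_source _)
  set φ := extChartAt 𝓘(ℝ, F) (f z) with hφ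
  have hΘz : MDifferentiableAt 𝓘(ℝ, E) 𝓘(ℝ, E) Θ z :=
    (hΘ.contMDiffAt (Θ.open_source.mem_nhds hzs)).mdifferentiableAt (by simp)
  have hsz : MDifferentiableAt 𝓘(ℝ, E) 𝓘(ℝ, E) Θ.symm (Θ z) :=
    (hs.contMDiffAt (Θ.open_target.mem_nhds (Θ.map_source hzs))).mdifferentiableAt (by simp)
  let u : E := mfderiv 𝓘(ℝ, E) 𝓘(ℝ, E) Θ z v
  have hφd : MDifferentiableAt 𝓘(ℝ, F) 𝓘(ℝ, F) φ (f z) :=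
    (contMDiffAt_extChartAt (n := ∞)).mdifferentiableAt (by simp)
  have hpu : p u = 0 := by
    have h1 : HasMFDerivAt 𝓘(ℝ, E) 𝓘(ℝ, F) (φ ∘ f) z _ :=
      hφd.hasMFDerivAt.comp z (hf.contMDiffAt.mdifferentiableAt (by simp)).hasMFDerivAt
    have h2 : HasMFDerivAt 𝓘(ℝ, E) 𝓘(ℝ, F) (p ∘ Θ) z _ :=
      (p.hasMFDerivAt (x := Θ z)).comp z hΘz.hasMFDerivAt
    have h3 : (φ ∘ f) =ᶠ[𝓝 z] (p ∘ Θ) := by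
      filter_upwards [Θ.open_source.mem_nhds hzs] with z' hz' using hp z' hz'
    have h4 := hasMFDerivAt_unique h1 (h2.congr_of_eventuallyEq h3)
    have h5 := DFunLike.congr_fun h4 v
    have h6 : mfderiv 𝓘(ℝ, F) 𝓘(ℝ, F) φ (f z) (mfderiv 𝓘(ℝ, E) 𝓘(ℝ, F) f z v) = p u := h5
    rw [← h6, hv]
    exact map_zero (mfderiv 𝓘(ℝ, F) 𝓘(ℝ, F) φ (f z))
  -- a straight line in the linearizing coordinates, which stays in the fibre as `p u = 0`
  let c : ℝ → E := fun t => Θ z + t • u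
  have hc : HasDerivAt c u 0 := by
    have := ((hasDerivAt_id (0 : ℝ)).smul_const u).const_add (Θ z)
    rw [one_smul] at this
    exact this
  have hct : ∀ᶠ t in 𝓝 (0 : ℝ), c t ∈ Θ.target := by
    refine hc.continuousAt.eventually (Θ.open_target.mem_nhds ?_)
    simpa [c] using Θ.map_source hzs
  -- only the germ at `0` matters; the value `z` elsewhere keeps the whole curve in the fibre
  let γ : ℝ → N := fun t => if c t ∈ Θ.target then Θ.symm (c t) else z
  have hγ : γ =ᶠ[𝓝 0] fun t => Θ.symm (c t) := by
    filter_upwards [hct] with t ht using if_pos ht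
  refine ⟨γ, ?_, ?_, ?_⟩
  · rw [hγ.self_of_nhds]
    simpa [c] using Θ.left_inv hzs
  · intro t
    by_cases ht : c t ∈ Θ.target
    · have h0 : γ t = Θ.symm (c t) := if_pos ht
      have h1 := Θ.map_target ht
      rw [h0]
      refine φ.injOn (hsub _ h1) (mem_extChartAt_source _) ?_
      rw [hp _ h1, Θ.right_inv ht, hp z hzs]
      simp [c, hpu]
    · have h0 : γ t = z := if_neg ht
      rw [h0]
  · have h1 : HasMFDerivAt 𝓘(ℝ, ℝ) 𝓘(ℝ, E) c 0 ((1 : ℝ →L[ℝ] ℝ).smulRight u) :=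
      hc.hasFDerivAt.hasMFDerivAt
    have hc0 : c 0 = Θ z := by simp [c]
    have h2 : HasMFDerivAt 𝓘(ℝ, E) 𝓘(ℝ, E) Θ.symm (c 0)
        (mfderiv 𝓘(ℝ, E) 𝓘(ℝ, E) Θ.symm (Θ z)) := by
      rw [hc0]; exact hsz.hasMFDerivAt
    have h3 := h2.comp (0 : ℝ) h1
    refine (h3.congr_of_eventuallyEq hγ).congr_mfderiv ?_
    have h4 : HasMFDerivAt 𝓘(ℝ, E) 𝓘(ℝ, E) (Θ.symm ∘ Θ) z _ :=
      hsz.hasMFDerivAt.comp z hΘz.hasMFDerivAt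
    have h5 : HasMFDerivAt 𝓘(ℝ, E) 𝓘(ℝ, E) (Θ.symm ∘ Θ) z (ContinuousLinearMap.id ℝ _) := by
      refine (hasMFDerivAt_id (I := 𝓘(ℝ, E)) z).congr_of_eventuallyEq ?_
      filter_upwards [Θ.open_source.mem_nhds hzs] with z' hz' using Θ.left_inv hz'
    have h6 : (mfderiv 𝓘(ℝ, E) 𝓘(ℝ, E) Θ.symm (Θ z) u : E) = v :=
      DFunLike.congr_fun (hasMFDerivAt_unique h4 h5) v
    ext
    change mfderiv 𝓘(ℝ, E) 𝓘(ℝ, E) Θ.symm (Θ z) ((1 : ℝ) • u) = (1 : ℝ) • (v : E)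
    rw [one_smul, one_smul, h6]

end Submersions

/-! ### Integration over the fibres of a submersion -/

section FibreIntegration

open Set Filter Topology MeasureTheory

/-- A function which is smooth on an open set and vanishes off a closed subset of it is smooth. -/
theorem contMDiff_of_eqOn_zero {E : Type*} [NormedAddCommGroup E] [NormedSpace ℝ E]
    {H : Type*} [TopologicalSpace H] {I : ModelWithCorners ℝ E H} {N : Type*} [TopologicalSpace N]
    [ChartedSpace H N] {V : Type*} [NormedAddCommGroup V] [NormedSpace ℝ V] {h : N → V}
    {U K : Set N} (hU : IsOpen U) (hK : IsClosed K) (hKU : K ⊆ U)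
    (hh : ContMDiffOn I 𝓘(ℝ, V) ∞ h U) (h0 : ∀ x ∉ K, h x = 0) : ContMDiff I 𝓘(ℝ, V) ∞ h := by
  intro x
  by_cases hx : x ∈ U
  · exact hh.contMDiffAt (hU.mem_nhds hx)
  · have hxK : Kᶜ ∈ 𝓝 x := hK.isOpen_compl.mem_nhds fun h => hx (hKU h)
    refine (contMDiffAt_const (c := (0 : V))).congr_of_eventuallyEq ?_
    filter_upwards [hxK] with y hy using h0 y hy

variable {E : Type*} [NormedAddCommGroup E] [NormedSpace ℝ E] [FiniteDimensional ℝ E]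
  [MeasurableSpace E] [BorelSpace E]
  {F : Type*} [NormedAddCommGroup F] [NormedSpace ℝ F] [FiniteDimensional ℝ F]
  [MeasurableSpace F] [BorelSpace F]

/-- Integrating a smooth density along the fibres of a linear surjection gives a smooth density. -/
theorem exists_contDiff_density_map_linear (p : E →L[ℝ] F) (r : F →L[ℝ] E) (hpr : ∀ v, p (r v) = v)
    {d : E → ℝ} (hd : ContDiff ℝ ∞ d) (hdc : HasCompactSupport d) (hd0 : ∀ u, 0 ≤ d u) :
    ∃ δ : F → ℝ, ContDiff ℝ ∞ δ ∧ (∀ y, 0 ≤ δ y) ∧ (∀ u, 0 < d u → 0 < δ (p u)) ∧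
      ∀ g : F → ENNReal, Measurable g →
        ∫⁻ u, g (p u) * ENNReal.ofReal (d u) ∂Measure.addHaar =
          ∫⁻ y, g y * ENNReal.ofReal (δ y) ∂Measure.addHaar := by
  let e := ContinuousLinearEquiv.equivOfRightInverse p r hpr
  let W := p.toLinearMap.ker
  haveI : (Measure.map e (Measure.addHaar : Measure E)).IsAddHaarMeasure :=
    e.isAddHaarMeasure_map _
  -- the Haar measure is a multiple of the product of the Haar measures of base and fibre
  obtain ⟨κ, hκ0, hκt, hκ⟩ : ∃ κ : ENNReal, κ ≠ 0 ∧ κ ≠ ⊤ ∧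
      Measure.map e (Measure.addHaar : Measure E) =
        κ • ((Measure.addHaar : Measure F).prod (Measure.addHaar : Measure W)) := by
    set m₁ := Measure.map e (Measure.addHaar : Measure E)
    set m₂ := (Measure.addHaar : Measure F).prod (Measure.addHaar : Measure W)
    refine ⟨Measure.addHaarScalarFactor m₁ m₂, ?_, ENNReal.coe_ne_top, ?_⟩
    · simpa using (Measure.addHaarScalarFactor_pos_of_isAddHaarMeasure m₁ m₂).ne'
    · exact Measure.isAddLeftInvariant_eq_smul m₁ m₂
  have hes : ∀ q, e.symm q = r q.1 + (q.2 : E) := fun q => rfl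
  have he1 : ∀ u, (e u).1 = p u := fun u => rfl
  let G : F → W → ℝ := fun y w => d (r y + w)
  have hG : ContDiff ℝ ∞ (fun q : F × W => d (r q.1 + q.2)) := by
    have : ContDiff ℝ ∞ (fun q : F × W => r q.1 + (q.2 : E)) := e.symm.contDiff
    exact hd.comp this
  -- the fibre coordinates of the support stay in a compact set
  let k : Set W := (fun u => (e u).2) '' tsupport d
  have hk : IsCompact k := hdc.isCompact.image (by fun_prop)
  have hGk : ∀ y w, w ∉ k → G y w = 0 := by
    intro y w hw
    by_contra h
    refine hw ⟨e.symm (y, w), subset_tsupport _ ?_, by simp⟩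
    simpa [hes] using h
  have hGsup : ∀ y, HasCompactSupport (G y) := fun y =>
    HasCompactSupport.intro hk fun w hw => hGk y w hw
  have hGcont : ∀ y, Continuous (G y) := fun y => by
    have := hG.continuous.comp (Continuous.prodMk_right y)
    exact this
  have hint : ∀ y, Integrable (G y) (Measure.addHaar : Measure W) := fun y =>
    (hGcont y).integrable_of_hasCompactSupport (hGsup y)
  have hconv : ContDiff ℝ ∞ fun y => ∫ w, G y w ∂(Measure.addHaar : Measure W) := by
    -- the fibre integral is the value at `0` of a convolution with the constant `1`
    have h1 := contDiffOn_convolution_right_with_param (𝕜 := ℝ) (n := ⊤)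
      (μ := (Measure.addHaar : Measure W)) (f := fun _ => (1 : ℝ))
      (ContinuousLinearMap.mul ℝ ℝ) (g := fun y w => G y (-w)) (s := univ) (k := -k)
      isOpen_univ hk.neg (fun y w _ hw => hGk y (-w) (by simpa using hw))
      (by exact locallyIntegrable_const 1)
      (by
        have : ContDiff ℝ ∞ (fun q : F × W => d (r q.1 + (-q.2 : W))) :=
          hG.comp (contDiff_fst.prodMk contDiff_snd.neg)
        exact this.contDiffOn)
    have h2 : ContDiff ℝ ∞ (fun q : F × W => convolution (fun _ => (1 : ℝ)) (fun w => G q.1 (-w))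
        (ContinuousLinearMap.mul ℝ ℝ) (Measure.addHaar : Measure W) q.2) := by
      rw [← contDiffOn_univ, ← univ_prod_univ]
      exact h1
    have h3 := h2.comp (contDiff_id.prodMk (contDiff_const (c := (0 : W))))
    convert h3 using 2 with y
    simp [convolution_def]
  refine ⟨fun y => κ.toReal * ∫ w, G y w ∂(Measure.addHaar : Measure W),
    contDiff_const.mul hconv, fun y => ?_, fun u hu => ?_, fun g hg => ?_⟩
  · exact mul_nonneg ENNReal.toReal_nonneg (integral_nonneg fun w => hd0 _)
  · refine mul_pos (ENNReal.toReal_pos hκ0 hκt) ?_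
    refine (hGcont (p u)).integral_pos_of_hasCompactSupport_nonneg_nonzero (hGsup _)
      (fun w => hd0 _) (x := (e u).2) ?_
    have : r (p u) + ((e u).2 : E) = u := by rw [← he1, ← hes, e.symm_apply_apply]
    simp only [G, this]
    exact hu.ne'
  · have h1 : ∫⁻ u, g (p u) * ENNReal.ofReal (d u) ∂Measure.addHaar =
        ∫⁻ q, g q.1 * ENNReal.ofReal (G q.1 q.2) ∂(Measure.map e (Measure.addHaar : Measure E)) := by
      rw [lintegral_map _ e.continuous.measurable]
      · refine lintegral_congr fun u => ?_
        have : r (e u).1 + ((e u).2 : E) = u := by rw [← hes, e.symm_apply_apply]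
        simp only [he1] at this
        simp only [G, he1, this]
      · exact (hg.comp measurable_fst).mul hG.continuous.measurable.ennreal_ofReal
    rw [h1, hκ, lintegral_smul_measure, lintegral_prod]
    · rw [smul_eq_mul, ← lintegral_const_mul' _ _ hκt]
      refine lintegral_congr fun y => ?_
      change κ * ∫⁻ w, g y * ENNReal.ofReal (G y w) ∂(Measure.addHaar : Measure W) = _
      rw [lintegral_const_mul _ (hGcont y).measurable.ennreal_ofReal,
        ← ofReal_integral_eq_lintegral_ofReal (hint y) (ae_of_all _ fun w => hd0 _),
        ENNReal.ofReal_mul ENNReal.toReal_nonneg, ENNReal.ofReal_toReal hκt]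
      ring
    · exact ((hg.comp measurable_fst).mul hG.continuous.measurable.ennreal_ofReal).aemeasurable

/-- The determinant is a smooth function of a linear map. -/
theorem contDiff_det {V : Type*} [NormedAddCommGroup V] [NormedSpace ℝ V] [FiniteDimensional ℝ V]
    {n : WithTop ℕ∞} : ContDiff ℝ n (fun A : V →L[ℝ] V => A.det) := by
  let b := Module.finBasis ℝ V
  have h : (fun A : V →L[ℝ] V => A.det) =
      fun A => ∑ σ : Equiv.Perm (Fin (Module.finrank ℝ V)),
        (Equiv.Perm.sign σ : ℤ) * ∏ i, b.repr (A (b i)) (σ i) := by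
    funext A
    rw [ContinuousLinearMap.det, ← LinearMap.det_toMatrix b, Matrix.det_apply']
    simp [LinearMap.toMatrix_apply]
  rw [h]
  refine ContDiff.sum fun σ _ => contDiff_const.mul (contDiff_prod fun i _ => ?_)
  have : ContDiff ℝ n (fun v : V => b.repr v (σ i)) :=
    ((b.coord (σ i)).toContinuousLinearMap).contDiff
  exact this.comp (by fun_prop)

theorem ContDiffAt.abs_det {V : Type*} [NormedAddCommGroup V] [NormedSpace ℝ V]
    [FiniteDimensional ℝ V] {P : Type*} [NormedAddCommGroup P] [NormedSpace ℝ P]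
    {A : P → V →L[ℝ] V} {x : P} (hA : ContDiffAt ℝ ∞ A x) (h : (A x).det ≠ 0) :
    ContDiffAt ℝ ∞ (fun y => |(A y).det|) x := by
  have h1 : ContDiffAt ℝ ∞ (fun y => (A y).det) x := contDiff_det.contDiffAt.comp x hA
  exact (contDiffAt_abs (n := ⊤) h).comp x h1

end FibreIntegration

section ChartIntegrals

open Set Filter Topology MeasureTheory

variable {E : Type*} [NormedAddCommGroup E] [NormedSpace ℝ E]
  {H : Type*} [TopologicalSpace H] (I : ModelWithCorners ℝ E H) [I.Boundaryless]
  {N : Type*} [TopologicalSpace N] [ChartedSpace H N]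
  [FiniteDimensional ℝ E] [MeasurableSpace E] [BorelSpace E]
  [MeasurableSpace N] [BorelSpace N]

theorem aemeasurable_extChartAt_symm (x₀ : N) :
    AEMeasurable (extChartAt I x₀).symm
      ((Measure.addHaar : Measure E).restrict (extChartAt I x₀).target) :=
  (continuousOn_extChartAt_symm x₀).aemeasurable (isOpen_extChartAt_target x₀).measurableSet

theorem HasChartDensity.restrict_source_eq {μ : Measure N} {x₀ : N} {ρ : E → ℝ}
    (h : HasChartDensity I μ x₀ ρ) :
    μ.restrict (extChartAt I x₀).source = chartMeasure I x₀ ρ := by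
  have hsm : MeasurableSet (extChartAt I x₀).source := (isOpen_extChartAt_source x₀).measurableSet
  have ht : MeasurableSet (extChartAt I x₀).target :=
    (isOpen_extChartAt_target x₀).measurableSet
  have hae : AEMeasurable (extChartAt I x₀).symm
      ((Measure.addHaar.restrict (extChartAt I x₀).target).withDensity
        (fun y => ENNReal.ofReal (ρ y))) :=
    (aemeasurable_extChartAt_symm I x₀).mono_ac (withDensity_absolutelyContinuous _ _)
  have h0 : ∀ᵐ x ∂(chartMeasure I x₀ ρ), x ∈ (extChartAt I x₀).source := by
    rw [chartMeasure, ae_map_iff (p := fun x => x ∈ (extChartAt I x₀).source) hae hsm]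
    filter_upwards [(withDensity_absolutelyContinuous _ _).ae_le (ae_restrict_mem ht)] with y hy
    exact (extChartAt I x₀).map_target hy
  rw [← Measure.restrict_eq_self_of_ae_mem h0]
  ext s hs
  rw [Measure.restrict_apply hs, Measure.restrict_apply hs,
    h _ (hs.inter hsm) inter_subset_right, chartMeasure_apply I x₀ ρ (hs.inter hsm)
      inter_subset_right]

theorem HasChartDensity.setLIntegral_eq {μ : Measure N} {x₀ : N} {ρ : E → ℝ}
    (h : HasChartDensity I μ x₀ ρ) (hρ : ContinuousOn ρ (extChartAt I x₀).target)
    {g : N → ENNReal} (hg : Measurable g) :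
    ∫⁻ x in (extChartAt I x₀).source, g x ∂μ =
      ∫⁻ y in (extChartAt I x₀).target,
        g ((extChartAt I x₀).symm y) * ENNReal.ofReal (ρ y) ∂Measure.addHaar := by
  have ht : MeasurableSet (extChartAt I x₀).target :=
    (isOpen_extChartAt_target x₀).measurableSet
  have hae := aemeasurable_extChartAt_symm I x₀
  rw [h.restrict_source_eq, chartMeasure, lintegral_map' hg.aemeasurable
    (hae.mono_ac (withDensity_absolutelyContinuous _ _))]
  refine (lintegral_withDensity_eq_lintegral_mul₀ (hρ.aemeasurable ht).ennreal_ofReal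
    (hg.comp_aemeasurable hae)).trans ?_
  simp only [Pi.mul_apply, Function.comp_apply, mul_comm]

theorem HasChartDensity.setIntegral_eq {μ : Measure N} {x₀ : N} {ρ : E → ℝ}
    (h : HasChartDensity I μ x₀ ρ) (hρ : ContinuousOn ρ (extChartAt I x₀).target)
    (hρ0 : ∀ y ∈ (extChartAt I x₀).target, 0 ≤ ρ y) {g : N → ℝ} (hg : Measurable g) :
    ∫ x in (extChartAt I x₀).source, g x ∂μ =
      ∫ y in (extChartAt I x₀).target,
        ρ y * g ((extChartAt I x₀).symm y) ∂Measure.addHaar := by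
  have ht : MeasurableSet (extChartAt I x₀).target :=
    (isOpen_extChartAt_target x₀).measurableSet
  have hae := aemeasurable_extChartAt_symm I x₀
  rw [h.restrict_source_eq, chartMeasure, integral_map
    (hae.mono_ac (withDensity_absolutelyContinuous _ _)) hg.aestronglyMeasurable,
    integral_withDensity_eq_integral_toReal_smul₀ (hρ.aemeasurable ht).ennreal_ofReal
      (by simp)]
  refine setIntegral_congr_fun ht fun y hy => ?_
  simp only [smul_eq_mul, ENNReal.toReal_ofReal (hρ0 y hy)]

end ChartIntegrals

section Pushforward

open Set Filter Topology MeasureTheory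

theorem det_fderiv_ne_zero_of_leftInverse {E : Type*} [NormedAddCommGroup E] [NormedSpace ℝ E]
    {T S : E → E} {u : E} (hT : DifferentiableAt ℝ T u) (hS : DifferentiableAt ℝ S (T u))
    (h : ∀ᶠ u' in 𝓝 u, S (T u') = u') : (fderiv ℝ T u).det ≠ 0 := by
  have h1 : HasFDerivAt (fun u' => S (T u')) ((fderiv ℝ S (T u)).comp (fderiv ℝ T u)) u :=
    hS.hasFDerivAt.comp u hT.hasFDerivAt
  have h2 : HasFDerivAt (fun u' => S (T u')) (ContinuousLinearMap.id ℝ E) u :=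
    (hasFDerivAt_id u).congr_of_eventuallyEq h
  have h3 := congrArg ContinuousLinearMap.det (h1.unique h2)
  have h4 : (fderiv ℝ S (T u)).det * (fderiv ℝ T u).det = 1 := by
    simp only [ContinuousLinearMap.det, ContinuousLinearMap.toLinearMap_comp,
      LinearMap.det_comp] at h3
    rw [ContinuousLinearMap.det, ContinuousLinearMap.det, h3]
    exact LinearMap.det_id
  intro h0
  simp [h0] at h4

variable {E : Type*} [NormedAddCommGroup E] [NormedSpace ℝ E] [FiniteDimensional ℝ E]
  [MeasurableSpace E] [BorelSpace E]
  {F : Type*} [NormedAddCommGroup F] [NormedSpace ℝ F] [FiniteDimensional ℝ F]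
  [MeasurableSpace F] [BorelSpace F]
  {N : Type*} [TopologicalSpace N] [ChartedSpace E N] [IsManifold 𝓘(ℝ, E) ∞ N]
  [MeasurableSpace N] [BorelSpace N]
  {M : Type*} [TopologicalSpace M] [ChartedSpace F M] [IsManifold 𝓘(ℝ, F) ∞ M]
  [MeasurableSpace M] [BorelSpace M]

/-- The push-forward of a volume, cut off to the domain of a chart in which the submersion `f` is
linear, has a smooth density. -/
theorem exists_contDiff_density_map_of_tsupport_subset [T2Space N] {f : N → M} (hf : Measurable f)
    {μ : Measure N} {z : N} {ρ : E → ℝ} (hρ : ContDiffOn ℝ ∞ ρ (extChartAt 𝓘(ℝ, E) z).target)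
    (hρ0 : ∀ y ∈ (extChartAt 𝓘(ℝ, E) z).target, 0 < ρ y)
    (hμ : HasChartDensity 𝓘(ℝ, E) μ z ρ) {x₀ : M}
    (p : E →L[ℝ] F) (r : F →L[ℝ] E) (hpr : ∀ v, p (r v) = v) (Θ : OpenPartialHomeomorph N E)
    (hsub : ∀ z' ∈ Θ.source, f z' ∈ (extChartAt 𝓘(ℝ, F) x₀).source)
    (hp : ∀ z' ∈ Θ.source, extChartAt 𝓘(ℝ, F) x₀ (f z') = p (Θ z'))
    (hΘ : ContMDiffOn 𝓘(ℝ, E) 𝓘(ℝ, E) ∞ Θ Θ.source)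
    (hΘs : ContMDiffOn 𝓘(ℝ, E) 𝓘(ℝ, E) ∞ Θ.symm Θ.target)
    {c : N → ℝ} (hc : ContMDiff 𝓘(ℝ, E) 𝓘(ℝ, ℝ) ∞ c) (hcc : HasCompactSupport c)
    (hcΘ : tsupport c ⊆ Θ.source) (hcz : tsupport c ⊆ (extChartAt 𝓘(ℝ, E) z).source)
    (hc0 : ∀ z', 0 ≤ c z') :
    ∃ δ : F → ℝ, ContDiff ℝ ∞ δ ∧ (∀ y, 0 ≤ δ y) ∧
      (∀ z', 0 < c z' → 0 < δ (extChartAt 𝓘(ℝ, F) x₀ (f z'))) ∧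
      ∀ h : M → ENNReal, Measurable h →
        ∫⁻ z', h (f z') * ENNReal.ofReal (c z') ∂μ =
          ∫⁻ y in (extChartAt 𝓘(ℝ, F) x₀).target,
            h ((extChartAt 𝓘(ℝ, F) x₀).symm y) * ENNReal.ofReal (δ y) ∂Measure.addHaar := by
  classical
  set ψ := extChartAt 𝓘(ℝ, E) z with hψ
  set φ := extChartAt 𝓘(ℝ, F) x₀ with hφ
  let O : Set N := Θ.source ∩ ψ.source
  have hO : IsOpen O := Θ.open_source.inter (isOpen_extChartAt_source z)
  let U : Set E := Θ.target ∩ Θ.symm ⁻¹' ψ.source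
  have hU : IsOpen U := Θ.symm.isOpen_inter_preimage (isOpen_extChartAt_source z)
  have hUO : ∀ u ∈ U, Θ.symm u ∈ O := fun u hu => ⟨Θ.map_target hu.1, hu.2⟩
  have hOU : ∀ z' ∈ O, Θ z' ∈ U := fun z' hz' =>
    ⟨Θ.map_source hz'.1, by rw [mem_preimage, Θ.left_inv hz'.1]; exact hz'.2⟩
  -- the change of coordinates from the linearizing chart to the chart that carries the density
  let T : E → E := fun u => ψ (Θ.symm u)
  have hT : ContDiffOn ℝ ∞ T U := by
    rw [← contMDiffOn_iff_contDiffOn]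
    refine (contMDiffOn_extChartAt (n := ∞) (x := z)).comp (hΘs.mono fun u hu => hu.1) ?_
    intro u hu
    simpa [hψ] using (hUO u hu).2
  have hTt : ∀ u ∈ U, T u ∈ ψ.target := fun u hu => ψ.map_source (hUO u hu).2
  have hTinj : InjOn T U := by
    intro u hu u' hu' h
    have h1 := ψ.injOn (hUO u hu).2 (hUO u' hu').2 h
    exact Θ.symm.injOn hu.1 hu'.1 h1
  have hTd : ∀ u ∈ U, DifferentiableAt ℝ T u := fun u hu =>
    (hT.contDiffAt (hU.mem_nhds hu)).differentiableAt (by simp)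
  have hdet : ∀ u ∈ U, (fderiv ℝ T u).det ≠ 0 := by
    intro u hu
    have hV : IsOpen (ψ.target ∩ ψ.symm ⁻¹' Θ.source) :=
      (continuousOn_extChartAt_symm z).isOpen_inter_preimage (isOpen_extChartAt_target z)
        Θ.open_source
    have hS : ContDiffOn ℝ ∞ (fun y => Θ (ψ.symm y)) (ψ.target ∩ ψ.symm ⁻¹' Θ.source) := by
      rw [← contMDiffOn_iff_contDiffOn]
      exact hΘ.comp ((contMDiffOn_extChartAt_symm (n := ∞) z).mono fun u hu => hu.1)
        fun u hu => hu.2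
    have hl : ∀ u' ∈ U, ψ.symm (T u') = Θ.symm u' := fun u' hu' => ψ.left_inv (hUO u' hu').2
    refine det_fderiv_ne_zero_of_leftInverse (S := fun y => Θ (ψ.symm y)) (hTd u hu) ?_ ?_
    · refine (hS.contDiffAt (hV.mem_nhds ⟨hTt u hu, ?_⟩)).differentiableAt (by simp)
      rw [mem_preimage, hl u hu]
      exact (hUO u hu).1
    · filter_upwards [hU.mem_nhds hu] with u' hu'
      rw [hl u' hu', Θ.right_inv hu'.1]
  -- the density in the linearizing chart
  let d : E → ℝ := U.indicator fun u => c (Θ.symm u) * (|(fderiv ℝ T u).det| * ρ (T u))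
  have hd0 : ∀ u, 0 ≤ d u := fun u => indicator_nonneg (fun u hu =>
    mul_nonneg (hc0 _) (mul_nonneg (abs_nonneg _) (hρ0 _ (hTt u hu)).le)) u
  let K : Set E := Θ '' tsupport c
  have hK : IsCompact K := hcc.image_of_continuousOn (Θ.continuousOn.mono hcΘ)
  have hKU : K ⊆ U := by
    rintro _ ⟨z', hz', rfl⟩
    exact hOU z' ⟨hcΘ hz', hcz hz'⟩
  have hdK : ∀ u ∉ K, d u = 0 := by
    intro u hu
    by_cases huU : u ∈ U
    · have : c (Θ.symm u) = 0 := by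
        by_contra h
        exact hu ⟨Θ.symm u, subset_tsupport _ h, Θ.right_inv huU.1⟩
      simp [d, this]
    · exact indicator_of_notMem huU _
  have hdU : ContDiffOn ℝ ∞ d U := by
    have h1 : ContDiffOn ℝ ∞ (fun u => c (Θ.symm u)) U := by
      rw [← contMDiffOn_iff_contDiffOn]
      exact hc.comp_contMDiffOn (hΘs.mono fun u hu => hu.1)
    have h2 : ContDiffOn ℝ ∞ (fun u => |(fderiv ℝ T u).det|) U := by
      intro u hu
      refine (ContDiffAt.abs_det ?_ (hdet u hu)).contDiffWithinAt
      exact (hT.contDiffAt (hU.mem_nhds hu)).fderiv_right (by norm_cast)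
    have h3 : ContDiffOn ℝ ∞ (fun u => ρ (T u)) U := hρ.comp hT hTt
    exact (h1.mul (h2.mul h3)).congr fun u hu => indicator_of_mem hu _
  have hd : ContDiff ℝ ∞ d := by
    rw [← contMDiff_iff_contDiff]
    exact contMDiff_of_eqOn_zero hU hK.isClosed hKU (contMDiffOn_iff_contDiffOn.2 hdU) hdK
  obtain ⟨δ, hδ, hδ0, hδpos, hδint⟩ := exists_contDiff_density_map_linear p r hpr hd
    (HasCompactSupport.intro hK hdK) hd0
  refine ⟨δ, hδ, hδ0, ?_, ?_⟩
  · intro z' hz'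
    have hz : z' ∈ tsupport c := subset_tsupport _ hz'.ne'
    have hzO : z' ∈ O := ⟨hcΘ hz, hcz hz⟩
    rw [hp z' hzO.1]
    refine hδpos _ ?_
    have : d (Θ z') = c z' * (|(fderiv ℝ T (Θ z')).det| * ρ (T (Θ z'))) := by
      simp only [d, indicator_of_mem (hOU z' hzO), Θ.left_inv hzO.1]
    rw [this]
    exact mul_pos hz' (mul_pos (abs_pos.2 (hdet _ (hOU z' hzO))) (hρ0 _ (hTt _ (hOU z' hzO))))
  · intro h hh
    have htm : MeasurableSet φ.target := (isOpen_extChartAt_target x₀).measurableSet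
    have hcm : Measurable c := hc.continuous.measurable
    have hgm : Measurable (φ.target.indicator fun y => h (φ.symm y)) := by
      have h1 : Measurable (φ.target.piecewise φ.symm fun _ => x₀) :=
        (continuousOn_extChartAt_symm x₀).measurable_piecewise continuousOn_const htm
      convert (hh.comp h1).indicator htm using 1
      ext y
      by_cases hy : y ∈ φ.target <;> simp [hy]
    have hTU : T '' U ⊆ ψ.target := by
      rintro _ ⟨u, hu, rfl⟩
      exact hTt u hu
    have hTUm : MeasurableSet (T '' U) := by
      have : T '' U = ψ.target ∩ ψ.symm ⁻¹' Θ.source := by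
        ext y
        constructor
        · rintro ⟨u, hu, rfl⟩
          refine ⟨hTt u hu, ?_⟩
          rw [mem_preimage, ψ.left_inv (hUO u hu).2]
          exact (hUO u hu).1
        · rintro ⟨hy, hy'⟩
          refine ⟨Θ (ψ.symm y), hOU _ ⟨hy', ψ.map_target hy⟩, ?_⟩
          simp only [T]
          rw [Θ.left_inv hy', ψ.right_inv hy]
      rw [this]
      exact ((continuousOn_extChartAt_symm z).isOpen_inter_preimage (isOpen_extChartAt_target z)
        Θ.open_source).measurableSet
    calc ∫⁻ z', h (f z') * ENNReal.ofReal (c z') ∂μ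
        = ∫⁻ z' in ψ.source, h (f z') * ENNReal.ofReal (c z') ∂μ := by
          rw [setLIntegral_eq_of_support_subset]
          intro z' hz'
          refine hcz (subset_tsupport _ fun h0 => hz' ?_)
          simp [h0]
      _ = ∫⁻ y in ψ.target, h (f (ψ.symm y)) * ENNReal.ofReal (c (ψ.symm y)) *
            ENNReal.ofReal (ρ y) ∂Measure.addHaar :=
          hμ.setLIntegral_eq _ hρ.continuousOn ((hh.comp hf).mul hcm.ennreal_ofReal)
      _ = ∫⁻ y in T '' U, h (f (ψ.symm y)) * ENNReal.ofReal (c (ψ.symm y)) *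
            ENNReal.ofReal (ρ y) ∂Measure.addHaar := by
          rw [← lintegral_indicator (isOpen_extChartAt_target z).measurableSet,
            ← lintegral_indicator hTUm]
          refine lintegral_congr fun y => ?_
          by_cases hy : y ∈ T '' U
          · rw [indicator_of_mem hy, indicator_of_mem (hTU hy)]
          · rw [indicator_of_notMem hy]
            by_cases hy' : y ∈ ψ.target
            · have : c (ψ.symm y) = 0 := by
                by_contra h0
                have hz := subset_tsupport c (Function.mem_support.2 h0)
                refine hy ⟨Θ (ψ.symm y), hOU _ ⟨hcΘ hz, hcz hz⟩, ?_⟩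
                simp only [T]
                rw [Θ.left_inv (hcΘ hz), ψ.right_inv hy']
              rw [indicator_of_mem hy']
              simp [this]
            · exact indicator_of_notMem hy' _
      _ = ∫⁻ u in U, ENNReal.ofReal |(fderiv ℝ T u).det| *
            (h (f (ψ.symm (T u))) * ENNReal.ofReal (c (ψ.symm (T u))) *
            ENNReal.ofReal (ρ (T u))) ∂Measure.addHaar :=
          lintegral_image_eq_lintegral_abs_det_fderiv_mul _ hU.measurableSet
            (fun u hu => (hTd u hu).hasFDerivAt.hasFDerivWithinAt) hTinj _
      _ = ∫⁻ u in U, (φ.target.indicator fun y => h (φ.symm y)) (p u) *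
            ENNReal.ofReal (d u) ∂Measure.addHaar := by
          refine setLIntegral_congr_fun hU.measurableSet fun u hu => ?_
          have h1 : ψ.symm (T u) = Θ.symm u := ψ.left_inv (hUO u hu).2
          have h2 : φ (f (Θ.symm u)) = p u := by
            rw [hp _ (hUO u hu).1, Θ.right_inv hu.1]
          have h3 : p u ∈ φ.target := by
            rw [← h2]; exact φ.map_source (hsub _ (hUO u hu).1)
          have h4 : φ.symm (p u) = f (Θ.symm u) := by
            rw [← h2, φ.left_inv (hsub _ (hUO u hu).1)]
          simp only [h1, indicator_of_mem h3, h4, d, indicator_of_mem hu]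
          rw [ENNReal.ofReal_mul (hc0 _), ENNReal.ofReal_mul (abs_nonneg _)]
          ring
      _ = ∫⁻ u, (φ.target.indicator fun y => h (φ.symm y)) (p u) *
            ENNReal.ofReal (d u) ∂Measure.addHaar := by
          rw [setLIntegral_eq_of_support_subset]
          intro u hu
          by_contra h0
          refine hu ?_
          simp [d, indicator_of_notMem h0]
      _ = ∫⁻ y, (φ.target.indicator fun y => h (φ.symm y)) y *
            ENNReal.ofReal (δ y) ∂Measure.addHaar := hδint _ hgm
      _ = ∫⁻ y in φ.target, h (φ.symm y) * ENNReal.ofReal (δ y) ∂Measure.addHaar := by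
          rw [← lintegral_indicator htm]
          refine lintegral_congr fun y => ?_
          by_cases hy : y ∈ φ.target <;> simp [hy]

end Pushforward

/-! ### Densities of push-forwards -/

section LocalDensities

open Set Filter Topology MeasureTheory

variable {F : Type*} [NormedAddCommGroup F] [NormedSpace ℝ F] [FiniteDimensional ℝ F]
  [MeasurableSpace F] [BorelSpace F]
  {H : Type*} [TopologicalSpace H] (I : ModelWithCorners ℝ F H) [I.Boundaryless]
  {M : Type*} [TopologicalSpace M] [ChartedSpace H M]
  [MeasurableSpace M] [BorelSpace M]

theorem measurableSet_source_inter_preimage (x₀ : M) {t : Set F} (ht : MeasurableSet t) :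
    MeasurableSet ((extChartAt I x₀).source ∩ extChartAt I x₀ ⁻¹' t) := by
  have hs : MeasurableSet (extChartAt I x₀).source := (isOpen_extChartAt_source x₀).measurableSet
  have hm : Measurable ((extChartAt I x₀).source.domRestrict (extChartAt I x₀)) :=
    (continuousOn_iff_continuous_domRestrict.1 (continuousOn_extChartAt x₀)).measurable
  have := (MeasurableEmbedding.subtype_coe hs).measurableSet_image.2 (hm ht)
  convert this using 1
  ext y
  simp [Set.domRestrict]
  tauto

theorem image_source_inter_preimage (x₀ : M) {t : Set F} (ht : t ⊆ (extChartAt I x₀).target) :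
    extChartAt I x₀ '' ((extChartAt I x₀).source ∩ extChartAt I x₀ ⁻¹' t) = t := by
  ext y
  constructor
  · rintro ⟨x, hx, rfl⟩
    exact hx.2
  · intro hy
    refine ⟨(extChartAt I x₀).symm y, ⟨(extChartAt I x₀).map_target (ht hy), ?_⟩,
      (extChartAt I x₀).right_inv (ht hy)⟩
    rwa [mem_preimage, (extChartAt I x₀).right_inv (ht hy)]

/-- A measure which locally has smooth positive densities in a chart has a smooth positive density
on the whole domain of the chart. -/
theorem exists_hasChartDensity_of_local {m : Measure M} (x₀ : M)
    (hloc : ∀ y₀ ∈ (extChartAt I x₀).target, ∃ (W : Set F) (δ : F → ℝ), IsOpen W ∧ y₀ ∈ W ∧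
      W ⊆ (extChartAt I x₀).target ∧ ContDiff ℝ ∞ δ ∧ (∀ y ∈ W, 0 < δ y) ∧
      ∀ s : Set M, MeasurableSet s → s ⊆ (extChartAt I x₀).source → extChartAt I x₀ '' s ⊆ W →
        m s = ∫⁻ y in extChartAt I x₀ '' s, ENNReal.ofReal (δ y) ∂Measure.addHaar) :
    ∃ ρ : F → ℝ, ContDiffOn ℝ ∞ ρ (extChartAt I x₀).target ∧
      (∀ y ∈ (extChartAt I x₀).target, 0 < ρ y) ∧ HasChartDensity I m x₀ ρ := by
  classical
  set φ := extChartAt I x₀ with hφ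
  choose! W δ hW hyW hWt hδ hδ0 hint using hloc
  let ρ : F → ℝ := fun y => δ y y
  -- two local densities agree where both are defined, being almost everywhere equal
  have hagree : ∀ y₀ ∈ φ.target, ∀ y ∈ W y₀, ρ y = δ y₀ y := by
    intro y₀ hy₀ y hy
    have hyt : y ∈ φ.target := hWt y₀ hy₀ hy
    have hV : IsOpen (W y ∩ W y₀) := (hW y hyt).inter (hW y₀ hy₀)
    have hae : (fun u => ENNReal.ofReal (δ y u)) =ᵐ[Measure.addHaar.restrict (W y ∩ W y₀)]
        fun u => ENNReal.ofReal (δ y₀ u) := by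
      refine ae_eq_of_forall_setLIntegral_eq_of_sigmaFinite
        (hδ y hyt).continuous.measurable.ennreal_ofReal
        (hδ y₀ hy₀).continuous.measurable.ennreal_ofReal fun t ht _ => ?_
      rw [Measure.restrict_restrict ht]
      have htt : t ∩ (W y ∩ W y₀) ⊆ φ.target := fun u hu => hWt y hyt hu.2.1
      have him := image_source_inter_preimage I x₀ htt
      rw [← him, ← hint y hyt _ (measurableSet_source_inter_preimage I x₀ (ht.inter
        hV.measurableSet)) inter_subset_left (by rw [him]; exact fun u hu => hu.2.1),
        ← hint y₀ hy₀ _ (measurableSet_source_inter_preimage I x₀ (ht.inter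
        hV.measurableSet)) inter_subset_left (by rw [him]; exact fun u hu => hu.2.2)]
    have hae' : δ y =ᵐ[Measure.addHaar.restrict (W y ∩ W y₀)] δ y₀ := by
      filter_upwards [hae, ae_restrict_mem hV.measurableSet] with u hu huV
      exact (ENNReal.ofReal_eq_ofReal_iff (hδ0 y hyt u huV.1).le (hδ0 y₀ hy₀ u huV.2).le).1 hu
    exact Measure.eqOn_open_of_ae_eq hae' hV (hδ y hyt).continuous.continuousOn
      (hδ y₀ hy₀).continuous.continuousOn ⟨hyW y hyt, hy⟩
  refine ⟨ρ, fun y₀ hy₀ => ?_, fun y hy => hδ0 y hy y (hyW y hy), ?_⟩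
  · refine ((hδ y₀ hy₀).contDiffAt.congr_of_eventuallyEq ?_).contDiffWithinAt
    filter_upwards [(hW y₀ hy₀).mem_nhds (hyW y₀ hy₀)] with y hy using hagree y₀ hy₀ y hy
  · -- countably many of the sets `W y` cover the domain of the chart
    obtain ⟨T, hTt, hTc, hTu⟩ := TopologicalSpace.isOpen_biUnion_countable φ.target W hW
    let V : F → Set M := fun y => φ.source ∩ φ ⁻¹' W y
    have hVm : ∀ y ∈ φ.target, MeasurableSet (V y) := fun y hy =>
      measurableSet_source_inter_preimage I x₀ (hW y hy).measurableSet
    have hVu : ⋃ y ∈ T, V y = φ.source := by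
      ext x
      simp only [mem_iUnion, exists_prop]
      constructor
      · rintro ⟨y, -, hx⟩
        exact hx.1
      · intro hx
        have h1 : φ x ∈ ⋃ y ∈ T, W y := by
          rw [hTu]
          exact mem_biUnion (φ.map_source hx) (hyW _ (φ.map_source hx))
        simp only [mem_iUnion, exists_prop] at h1
        obtain ⟨y, hy, hxy⟩ := h1
        exact ⟨y, hy, hx, hxy⟩
    have hres : m.restrict φ.source = (chartMeasure I x₀ ρ).restrict φ.source := by
      rw [← hVu, Measure.restrict_biUnion_congr hTc]
      intro y hy
      have hyt := hTt hy
      ext s hs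
      have hsV : s ∩ V y ⊆ φ.source := fun x hx => hx.2.1
      have hsW : φ '' (s ∩ V y) ⊆ W y := by
        rintro _ ⟨x, hx, rfl⟩
        exact hx.2.2
      rw [Measure.restrict_apply hs, Measure.restrict_apply hs,
        chartMeasure_apply I x₀ ρ (hs.inter (hVm y hyt)) hsV,
        hint y hyt _ (hs.inter (hVm y hyt)) hsV hsW]
      refine setLIntegral_congr_fun (measurableSet_chart_image I x₀ (hs.inter (hVm y hyt)) hsV)
        fun u hu => ?_
      simp only [hagree y hyt u (hsW hu)]
    intro s hs hsub
    rw [← chartMeasure_apply I x₀ ρ hs hsub, ← Measure.restrict_eq_self m hsub, hres,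
      Measure.restrict_eq_self _ hsub]

/-- The extension by zero of a function which, in a chart, is smooth with compact support. -/
def extendChart (x₀ : M) (g : F → ℝ) : M → ℝ :=
  (extChartAt I x₀).source.indicator fun x => g (extChartAt I x₀ x)

theorem extendChart_eq_zero (x₀ : M) (g : F → ℝ) {x : M}
    (hx : x ∉ (extChartAt I x₀).symm '' tsupport g) : extendChart I x₀ g x = 0 := by
  by_cases hs : x ∈ (extChartAt I x₀).source
  · rw [extendChart, indicator_of_mem hs]
    by_contra h
    exact hx ⟨_, subset_tsupport _ h, (extChartAt I x₀).left_inv hs⟩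
  · exact indicator_of_notMem hs _

theorem isCompact_symm_image_tsupport (x₀ : M) {g : F → ℝ} (hgc : HasCompactSupport g)
    (hgt : tsupport g ⊆ (extChartAt I x₀).target) :
    IsCompact ((extChartAt I x₀).symm '' tsupport g) :=
  hgc.image_of_continuousOn ((continuousOn_extChartAt_symm x₀).mono hgt)

theorem contMDiff_extendChart [T2Space M] [IsManifold I ∞ M] (x₀ : M) {g : F → ℝ}
    (hg : ContDiff ℝ ∞ g) (hgc : HasCompactSupport g)
    (hgt : tsupport g ⊆ (extChartAt I x₀).target) :
    ContMDiff I 𝓘(ℝ, ℝ) ∞ (extendChart I x₀ g) := by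
  refine contMDiff_of_eqOn_zero (isOpen_extChartAt_source (I := I) x₀)
    (isCompact_symm_image_tsupport I x₀ hgc hgt).isClosed ?_ ?_
    (fun x hx => extendChart_eq_zero I x₀ g hx)
  · rintro _ ⟨y, hy, rfl⟩
    exact (extChartAt I x₀).map_target (hgt hy)
  · have h1 : ContMDiffOn I 𝓘(ℝ, F) ∞ (extChartAt I x₀) (extChartAt I x₀).source := by
      rw [extChartAt_source]
      exact contMDiffOn_extChartAt
    exact (hg.contMDiff.comp_contMDiffOn h1).congr fun x hx => indicator_of_mem hx _

end LocalDensities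

section PushforwardDensity

open Set Filter Topology MeasureTheory

variable {E : Type*} [NormedAddCommGroup E] [NormedSpace ℝ E] [FiniteDimensional ℝ E]
  [MeasurableSpace E] [BorelSpace E]
  {F : Type*} [NormedAddCommGroup F] [NormedSpace ℝ F] [FiniteDimensional ℝ F]
  [MeasurableSpace F] [BorelSpace F]
  {N : Type*} [TopologicalSpace N] [ChartedSpace E N] [IsManifold 𝓘(ℝ, E) ∞ N]
  [T2Space N] [SigmaCompactSpace N] [MeasurableSpace N] [BorelSpace N]
  {M : Type*} [TopologicalSpace M] [ChartedSpace F M] [IsManifold 𝓘(ℝ, F) ∞ M]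
  [T2Space M] [MeasurableSpace M] [BorelSpace M]

/-- Locally, the push-forward of a volume by a proper surjective submersion has a smooth positive
density: a partition of unity reduces this to charts in which the submersion is linear. -/
theorem exists_local_density_map {f : N → M} (hf : Manifold.IsSubmersion 𝓘(ℝ, E) 𝓘(ℝ, F) ∞ f)
    (hsurj : Function.Surjective f) (hprop : ∀ K : Set M, IsCompact K → IsCompact (f ⁻¹' K))
    {μ : Measure N} {ρ : N → E → ℝ}
    (hρ : ∀ z, ContDiffOn ℝ ∞ (ρ z) (extChartAt 𝓘(ℝ, E) z).target)
    (hρ0 : ∀ z, ∀ y ∈ (extChartAt 𝓘(ℝ, E) z).target, 0 < ρ z y)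
    (hμ : ∀ z, HasChartDensity 𝓘(ℝ, E) μ z (ρ z)) (x₀ : M) :
    ∀ y₀ ∈ (extChartAt 𝓘(ℝ, F) x₀).target, ∃ (W : Set F) (δ : F → ℝ), IsOpen W ∧ y₀ ∈ W ∧
      W ⊆ (extChartAt 𝓘(ℝ, F) x₀).target ∧ ContDiff ℝ ∞ δ ∧ (∀ y ∈ W, 0 < δ y) ∧
      ∀ s : Set M, MeasurableSet s → s ⊆ (extChartAt 𝓘(ℝ, F) x₀).source →
        extChartAt 𝓘(ℝ, F) x₀ '' s ⊆ W →
        μ.map f s = ∫⁻ y in extChartAt 𝓘(ℝ, F) x₀ '' s, ENNReal.ofReal (δ y)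
          ∂Measure.addHaar := by
  classical
  intro y₀ hy₀
  set φ := extChartAt 𝓘(ℝ, F) x₀ with hφ
  have hfc : ContMDiff 𝓘(ℝ, E) 𝓘(ℝ, F) ∞ f := fun z => (hf.isSubmersionAt z).contMDiffAt
  have hfm : Measurable f := hfc.continuous.measurable
  obtain ⟨ε, hε, hball⟩ := Metric.nhds_basis_closedBall.mem_iff.1
    ((isOpen_extChartAt_target (I := 𝓘(ℝ, F)) x₀).mem_nhds hy₀)
  -- by properness, the lift to `N` of a bump function around `y₀` has compact support
  let χ : ContDiffBump y₀ := ⟨ε / 2, ε, by positivity, by linarith⟩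
  have hχt : tsupport χ ⊆ φ.target := by
    rw [χ.tsupport_eq]; exact hball
  have hχc : ContDiff ℝ ∞ χ := χ.contDiff
  let K : Set M := φ.symm '' tsupport χ
  have hK : IsCompact K := isCompact_symm_image_tsupport _ x₀ χ.hasCompactSupport hχt
  have hKs : K ⊆ φ.source := by
    rintro _ ⟨y, hy, rfl⟩
    exact φ.map_target (hχt hy)
  let c : N → ℝ := fun z => extendChart 𝓘(ℝ, F) x₀ χ (f z)
  have hc : ContMDiff 𝓘(ℝ, E) 𝓘(ℝ, ℝ) ∞ c :=
    (contMDiff_extendChart 𝓘(ℝ, F) x₀ hχc χ.hasCompactSupport hχt).comp hfc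
  have hc0 : ∀ z, 0 ≤ c z := fun z => indicator_nonneg (fun x _ => χ.nonneg) _
  have hcK : ∀ z, f z ∉ K → c z = 0 := fun z hz => extendChart_eq_zero _ x₀ χ hz
  have hfK : IsCompact (f ⁻¹' K) := hprop K hK
  have hcs : tsupport c ⊆ f ⁻¹' K :=
    closure_minimal (fun z hz => by_contra fun h => hz (hcK z h)) hfK.isClosed
  have hcc : HasCompactSupport c := hfK.of_isClosed_subset (isClosed_tsupport c) hcs
  -- a cover of `N` by domains of linearizing charts, and the complement of the support
  have hcov : ∀ z : N, ∃ U : Set N, IsOpen U ∧ z ∈ U ∧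
      ∀ c' : N → ℝ, ContMDiff 𝓘(ℝ, E) 𝓘(ℝ, ℝ) ∞ c' → tsupport c' ⊆ U → tsupport c' ⊆ tsupport c →
        (∀ z', 0 ≤ c' z') →
        ∃ δ : F → ℝ, ContDiff ℝ ∞ δ ∧ (∀ y, 0 ≤ δ y) ∧
        (∀ z', 0 < c' z' → 0 < δ (φ (f z'))) ∧
        ∀ h : M → ENNReal, Measurable h →
          ∫⁻ z', h (f z') * ENNReal.ofReal (c' z') ∂μ =
            ∫⁻ y in φ.target, h (φ.symm y) * ENNReal.ofReal (δ y) ∂Measure.addHaar := by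
    intro z
    by_cases hz : f z ∈ φ.source
    · obtain ⟨p, r, Θ, hpr, hzs, hsub, hp, hΘ, hs⟩ :=
        exists_linearizing_chart (hf.isSubmersionAt z) hz
      refine ⟨Θ.source ∩ (extChartAt 𝓘(ℝ, E) z).source,
        Θ.open_source.inter (isOpen_extChartAt_source z), ⟨hzs, mem_extChartAt_source z⟩,
        fun c' hc' hU hcc' hc0' => ?_⟩
      exact exists_contDiff_density_map_of_tsupport_subset hfm (hρ z) (hρ0 z) (hμ z) p r hpr Θ
        hsub hp hΘ hs hc' (hcc.of_isClosed_subset (isClosed_tsupport c') hcc')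
        (fun x hx => (hU hx).1) (fun x hx => (hU hx).2) hc0'
    · refine ⟨(tsupport c)ᶜ, (isClosed_tsupport c).isOpen_compl,
        fun h => hz (hKs (hcs h)), fun c' hc' hU hcc' hc0' => ?_⟩
      have h0 : ∀ z', c' z' = 0 := fun z' => by
        by_contra h
        have := subset_tsupport _ (Function.mem_support.2 h)
        exact hU this (hcc' this)
      exact ⟨0, contDiff_const, fun _ => le_rfl, fun z' hz' => absurd (h0 z') hz'.ne',
        fun h _ => by simp [h0]⟩
  choose U hU hzU hUδ using hcov
  obtain ⟨g, hg⟩ := SmoothPartitionOfUnity.exists_isSubordinate 𝓘(ℝ, E) (s := (univ : Set N))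
    isClosed_univ U hU (fun z _ => mem_iUnion.2 ⟨z, hzU z⟩)
  have hci : ∀ i, ContMDiff 𝓘(ℝ, E) 𝓘(ℝ, ℝ) ∞ (fun z => c z * g i z) := fun i =>
    hc.mul (g i).contMDiff
  have hc0i : ∀ i z, 0 ≤ c z * g i z := fun i z => mul_nonneg (hc0 z) (g.nonneg i z)
  have hδi := fun i => hUδ i (fun z => c z * g i z) (hci i)
    ((tsupport_mul_subset_right (f := c) (g := g i)).trans (hg i))
    (tsupport_mul_subset_left (f := c) (g := g i)) (hc0i i)
  choose δ hδ hδ0 hδpos hδint using hδi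
  have hfin := g.locallyFinite.finite_nonempty_inter_compact hfK
  let S : Finset N := hfin.toFinset
  have hsum : ∀ z, c z = ∑ i ∈ S, c z * g i z := by
    intro z
    by_cases hz : f z ∈ K
    · have h1 : ∑ᶠ i, g i z = ∑ i ∈ S, g i z := by
        refine finsum_eq_sum_of_support_subset _ fun i hi => ?_
        simp only [S, Finite.coe_toFinset, mem_setOf_eq]
        exact ⟨z, hi, hz⟩
      rw [← Finset.mul_sum, ← h1, g.sum_eq_one (mem_univ z), mul_one]
    · simp [hcK z hz]
  -- near `y₀` the cut-off is `1`, so it does not affect the push-forward there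
  have hc1 : ∀ z, f z ∈ φ.source → φ (f z) ∈ Metric.ball y₀ (ε / 2) → c z = 1 := by
    intro z hz hz'
    simp only [c, extendChart]
    rw [indicator_of_mem hz]
    exact χ.one_of_mem_closedBall (Metric.ball_subset_closedBall hz')
  refine ⟨Metric.ball y₀ (ε / 2), fun y => ∑ i ∈ S, δ i y, Metric.isOpen_ball,
    Metric.mem_ball_self (by positivity),
    (Metric.ball_subset_ball (by linarith)).trans (Metric.ball_subset_closedBall.trans hball),
    ContDiff.sum fun i _ => hδ i, ?_, ?_⟩
  · intro y hy
    have hyt : y ∈ φ.target := hball (Metric.ball_subset_closedBall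
      (Metric.ball_subset_ball (by linarith) hy))
    obtain ⟨z, hz⟩ := hsurj (φ.symm y)
    have hφz : φ (f z) = y := by rw [hz, φ.right_inv hyt]
    have hz1 : c z = 1 := hc1 z (by rw [hz]; exact φ.map_target hyt) (by rwa [hφz])
    have : ∃ i ∈ S, 0 < c z * g i z := by
      by_contra! h
      have := hsum z
      rw [Finset.sum_eq_zero fun i hi => le_antisymm (h i hi) (hc0i i z)] at this
      linarith
    obtain ⟨i, hi, hpos⟩ := this
    refine Finset.sum_pos' (fun i _ => hδ0 i y) ⟨i, hi, ?_⟩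
    rw [← hφz]
    exact hδpos i z hpos
  · intro s hs hsub hsW
    have him := PartialEquiv.image_eq_target_inter_inv_preimage φ hsub
    have hsm : Measurable (s.indicator fun _ => (1 : ENNReal)) := measurable_const.indicator hs
    have h1 : μ.map f s = ∫⁻ z, s.indicator (fun _ => (1 : ENNReal)) (f z) *
        ENNReal.ofReal (c z) ∂μ := by
      rw [Measure.map_apply hfm hs, ← lintegral_indicator_one (hfm hs)]
      refine lintegral_congr fun z => ?_
      by_cases hz : f z ∈ s
      · simp [hz, hc1 z (hsub hz) (hsW ⟨_, hz, rfl⟩)]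
      · simp [hz]
    have h2 : ∀ z, s.indicator (fun _ => (1 : ENNReal)) (f z) * ENNReal.ofReal (c z) =
        ∑ i ∈ S, s.indicator (fun _ => (1 : ENNReal)) (f z) * ENNReal.ofReal (c z * g i z) := by
      intro z
      rw [← Finset.mul_sum, ← ENNReal.ofReal_sum_of_nonneg fun i _ => hc0i i z, ← hsum z]
    have h2m : ∀ i ∈ S, Measurable fun z => s.indicator (fun _ => (1 : ENNReal)) (f z) *
        ENNReal.ofReal (c z * g i z) := fun i _ =>
      (hsm.comp hfm).mul (hci i).continuous.measurable.ennreal_ofReal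
    rw [h1, lintegral_congr h2, lintegral_finsetSum _ h2m]
    simp_rw [hδint _ _ hsm]
    have htm : MeasurableSet φ.target := (isOpen_extChartAt_target x₀).measurableSet
    have h3 : ∀ i, ∫⁻ y in φ.target, s.indicator (fun _ => (1 : ENNReal)) (φ.symm y) *
        ENNReal.ofReal (δ i y) ∂Measure.addHaar =
        ∫⁻ y in φ '' s, ENNReal.ofReal (δ i y) ∂Measure.addHaar := by
      intro i
      rw [← lintegral_indicator htm, ← lintegral_indicator
        (measurableSet_chart_image 𝓘(ℝ, F) x₀ hs hsub), him]
      refine lintegral_congr fun y => ?_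
      by_cases hy : y ∈ φ.target <;> by_cases hy' : φ.symm y ∈ s <;> simp [hy, hy']
    simp_rw [h3]
    rw [← lintegral_finsetSum _ fun i _ => (hδ i).continuous.measurable.ennreal_ofReal]
    refine lintegral_congr fun y => ?_
    rw [ENNReal.ofReal_sum_of_nonneg fun i _ => hδ0 i y]

end PushforwardDensity

/-! ### Divergence and derivatives along vector fields -/

section Divergence

open Set Filter Topology MeasureTheory

variable {E : Type*} [NormedAddCommGroup E] [NormedSpace ℝ E] [FiniteDimensional ℝ E]

theorem divergence_smul {g : E → ℝ} {V : E → E} {y : E} (hg : DifferentiableAt ℝ g y)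
    (hV : DifferentiableAt ℝ V y) :
    divergence (fun y => g y • V y) y = fderiv ℝ g y (V y) + g y * divergence V y := by
  have h : fderiv ℝ (fun y => g y • V y) y = g y • fderiv ℝ V y + (fderiv ℝ g y).smulRight (V y) :=
    (hg.hasFDerivAt.smul hV.hasFDerivAt).fderiv
  have h1 : ((g y • fderiv ℝ V y + (fderiv ℝ g y).smulRight (V y) : E →L[ℝ] E) : E →ₗ[ℝ] E) =
      g y • (fderiv ℝ V y : E →ₗ[ℝ] E) + (fderiv ℝ g y : E →ₗ[ℝ] ℝ).smulRight (V y) := by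
    ext; simp
  rw [divergence, h, h1, map_add, map_smul, LinearMap.trace_smulRight, smul_eq_mul, divergence,
    add_comm]
  rfl

theorem divergence_congr {V W : E → E} {y : E} (h : V =ᶠ[𝓝 y] W) :
    divergence V y = divergence W y := by
  rw [divergence, divergence, h.fderiv_eq]

theorem contDiffOn_divergence {V : E → E} {U : Set E} (hU : IsOpen U) (hV : ContDiffOn ℝ ∞ V U) :
    ContDiffOn ℝ ∞ (divergence V) U := by
  let tr : (E →L[ℝ] E) →ₗ[ℝ] ℝ :=
    (LinearMap.trace ℝ E).comp (LinearMap.toContinuousLinearMap (𝕜 := ℝ) (E := E)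
      (F' := E)).symm.toLinearMap
  have h1 : ContDiff ℝ ∞ tr := (LinearMap.toContinuousLinearMap tr).contDiff
  intro y hy
  have h2 : ContDiffAt ℝ ∞ (fderiv ℝ V) y :=
    (hV.contDiffAt (hU.mem_nhds hy)).fderiv_right (by norm_cast)
  exact (h1.contDiffAt.comp y h2).contDiffWithinAt

variable [MeasurableSpace E] [BorelSpace E]

theorem contDiff_of_eqOn_zero {V : Type*} [NormedAddCommGroup V] [NormedSpace ℝ V] {h : E → V}
    {U K : Set E} (hU : IsOpen U) (hK : IsClosed K) (hKU : K ⊆ U)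
    (hh : ContDiffOn ℝ ∞ h U) (h0 : ∀ x ∉ K, h x = 0) : ContDiff ℝ ∞ h := by
  rw [← contMDiff_iff_contDiff]
  exact contMDiff_of_eqOn_zero hU hK hKU (contMDiffOn_iff_contDiffOn.2 hh) h0

/-- The integral of the divergence of a compactly supported field vanishes. -/
theorem integral_divergence_eq_zero {V : E → E} (hV : ContDiff ℝ ∞ V) (hVc : HasCompactSupport V) :
    ∫ y, divergence V y ∂(Measure.addHaar : Measure E) = 0 := by
  let b := Module.finBasis ℝ E
  have hb : ∀ i, ContDiff ℝ ∞ (fun y => b.coord i (V y)) := fun i =>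
    (LinearMap.toContinuousLinearMap (b.coord i)).contDiff.comp hV
  have hbc : ∀ i, HasCompactSupport (fun y => b.coord i (V y)) := fun i =>
    hVc.comp_left (map_zero (b.coord i))
  have hbd : ∀ i y v, fderiv ℝ (fun y => b.coord i (V y)) y v = b.coord i (fderiv ℝ V y v) := by
    intro i y v
    have := (LinearMap.toContinuousLinearMap (b.coord i)).hasFDerivAt.comp y
      (hV.differentiable (by simp) y).hasFDerivAt
    have h2 : HasFDerivAt (fun y => b.coord i (V y)) _ y := this
    rw [h2.fderiv]
    rfl
  have hint : ∀ i, Integrable (fun y => fderiv ℝ (fun y => b.coord i (V y)) y (b i))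
      (Measure.addHaar : Measure E) := by
    intro i
    refine Continuous.integrable_of_hasCompactSupport ?_ ((hbc i).fderiv_apply (𝕜 := ℝ) (b i))
    exact ((hb i).continuous_fderiv (by simp)).clm_apply continuous_const
  have hdiv : ∀ y, divergence V y = ∑ i, fderiv ℝ (fun y => b.coord i (V y)) y (b i) := by
    intro y
    rw [divergence, LinearMap.trace_eq_matrix_trace ℝ b, Matrix.trace]
    refine Finset.sum_congr rfl fun i _ => ?_
    rw [hbd, Matrix.diag_apply, LinearMap.toMatrix_apply]
    rfl
  simp_rw [hdiv]
  rw [integral_finsetSum _ fun i _ => hint i]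
  refine Finset.sum_eq_zero fun i _ => ?_
  have h1 := integral_mul_fderiv_eq_neg_fderiv_mul_of_integrable (μ := (Measure.addHaar : Measure E))
    (f := fun _ => (1 : ℝ)) (g := fun y => b.coord i (V y)) (v := b i) (by simp)
    (by simpa using hint i)
    (by simpa using (hb i).continuous.integrable_of_hasCompactSupport (hbc i))
    (fun _ _ => by fun_prop) (fun x _ => (hb i).differentiable (by simp) x)
  simpa using h1

/-- Integration by parts for the divergence of a field on an open set. -/
theorem setIntegral_fderiv_apply_eq_neg_mul_divergence {U : Set E} (hU : IsOpen U) {V : E → E}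
    (hV : ContDiffOn ℝ ∞ V U) {g : E → ℝ} (hg : ContDiff ℝ ∞ g) (hgc : HasCompactSupport g)
    (hgU : tsupport g ⊆ U) :
    ∫ y in U, fderiv ℝ g y (V y) ∂(Measure.addHaar : Measure E) =
      - ∫ y in U, g y * divergence V y ∂(Measure.addHaar : Measure E) := by
  have hg0 : ∀ y ∉ tsupport g, g y = 0 := fun y hy => image_eq_zero_of_notMem_tsupport hy
  have hdg0 : ∀ y ∉ tsupport g, fderiv ℝ g y = 0 := fun y hy => by
    have : g =ᶠ[𝓝 y] fun _ => 0 := by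
      filter_upwards [(isClosed_tsupport g).isOpen_compl.mem_nhds hy] with u hu using hg0 u hu
    rw [this.fderiv_eq]; simp
  have hdV := contDiffOn_divergence hU hV
  have hW : ContDiff ℝ ∞ (fun y => g y • V y) := contDiff_of_eqOn_zero hU (isClosed_tsupport g) hgU
    (hg.contDiffOn.smul hV) fun y hy => by simp [hg0 y hy]
  have h1 : ContDiff ℝ ∞ (fun y => fderiv ℝ g y (V y)) := by
    refine contDiff_of_eqOn_zero hU (isClosed_tsupport g) hgU ?_ fun y hy => by simp [hdg0 y hy]
    exact ((hg.fderiv_right (m := ∞) (by norm_cast)).contDiffOn).clm_apply hV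
  have h2 : ContDiff ℝ ∞ (fun y => g y * divergence V y) :=
    contDiff_of_eqOn_zero hU (isClosed_tsupport g) hgU
      (hg.contDiffOn.mul hdV) fun y hy => by simp [hg0 y hy]
  have hs1 : HasCompactSupport (fun y => fderiv ℝ g y (V y)) :=
    HasCompactSupport.intro hgc fun y hy => by simp [hdg0 y hy]
  have hs2 : HasCompactSupport (fun y => g y * divergence V y) :=
    HasCompactSupport.intro hgc fun y hy => by simp [hg0 y hy]
  have hWs : HasCompactSupport (fun y => g y • V y) :=
    HasCompactSupport.intro hgc fun y hy => by simp [hg0 y hy]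
  have hdiv : ∀ y, divergence (fun y => g y • V y) y =
      fderiv ℝ g y (V y) + g y * divergence V y := by
    intro y
    by_cases hy : y ∈ U
    · exact divergence_smul (hg.differentiable (by simp) y)
        ((hV.contDiffAt (hU.mem_nhds hy)).differentiableAt (by simp))
    · have hy' : y ∉ tsupport g := fun h => hy (hgU h)
      have : (fun y => g y • V y) =ᶠ[𝓝 y] fun _ => 0 := by
        filter_upwards [(isClosed_tsupport g).isOpen_compl.mem_nhds hy'] with u hu
        simp [hg0 u hu]
      rw [divergence_congr this, hg0 y hy', hdg0 y hy']
      simp [divergence]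
  have h3 := integral_divergence_eq_zero hW hWs
  simp_rw [hdiv] at h3
  rw [integral_add (h1.continuous.integrable_of_hasCompactSupport hs1)
    (h2.continuous.integrable_of_hasCompactSupport hs2)] at h3
  rw [setIntegral_eq_integral_of_forall_compl_eq_zero,
    setIntegral_eq_integral_of_forall_compl_eq_zero]
  · linarith
  · intro y hy; simp [hg0 y fun h => hy (hgU h)]
  · intro y hy; simp [hdg0 y fun h => hy (hgU h)]

end Divergence

section FieldDerivative

open Set Filter Topology MeasureTheory

variable {E : Type*} [NormedAddCommGroup E] [NormedSpace ℝ E]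
  {H : Type*} [TopologicalSpace H] (I : ModelWithCorners ℝ E H) [I.Boundaryless]
  {N : Type*} [TopologicalSpace N] [ChartedSpace H N] [IsManifold I ∞ N]
  {V : Type*} [NormedAddCommGroup V] [NormedSpace ℝ V]

/-- The derivative of a vector-valued function on a manifold along a vector field. -/
def fieldDeriv (Z : (x : N) → TangentSpace I x) (g : N → V) (x : N) : V :=
  mfderiv I 𝓘(ℝ, V) g x (Z x)

theorem contDiffOn_comp_extChartAt_symm {g : N → V} {U : Set N} (hg : ContMDiffOn I 𝓘(ℝ, V) ∞ g U)
    (x₀ : N) : ContDiffOn ℝ ∞ (fun y => g ((extChartAt I x₀).symm y))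
      ((extChartAt I x₀).target ∩ (extChartAt I x₀).symm ⁻¹' U) := by
  rw [← contMDiffOn_iff_contDiffOn]
  exact hg.comp ((contMDiffOn_extChartAt_symm x₀).mono inter_subset_left) inter_subset_right

theorem fieldDeriv_eq_fderiv (Z : (x : N) → TangentSpace I x) {g : N → V} {x : N} {U : Set N}
    (hU : IsOpen U) (hxU : x ∈ U) (hg : ContMDiffOn I 𝓘(ℝ, V) ∞ g U) {x₀ : N}
    (hx : x ∈ (extChartAt I x₀).source) :
    fieldDeriv I Z g x = fderiv ℝ (fun y => g ((extChartAt I x₀).symm y)) (extChartAt I x₀ x)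
      (chartField I Z x₀ (extChartAt I x₀ x)) := by
  set ψ := extChartAt I x₀
  have h1 : DifferentiableAt ℝ (fun y => g (ψ.symm y)) (ψ x) := by
    refine ((contDiffOn_comp_extChartAt_symm I hg x₀).contDiffAt (IsOpen.mem_nhds ?_ ?_)
      ).differentiableAt (by simp)
    · exact (continuousOn_extChartAt_symm x₀).isOpen_inter_preimage (isOpen_extChartAt_target x₀) hU
    · exact ⟨ψ.map_source hx, by rwa [mem_preimage, ψ.left_inv hx]⟩
  have h2 : MDifferentiableAt I 𝓘(ℝ, E) ψ x :=
    (contMDiffAt_extChartAt' (n := ∞) (by simpa [ψ] using hx)).mdifferentiableAt (by simp)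
  have h3 := (h1.hasFDerivAt.hasMFDerivAt).comp x h2.hasMFDerivAt
  have h4 : g =ᶠ[𝓝 x] (fun y => g (ψ.symm y)) ∘ ψ := by
    filter_upwards [(isOpen_extChartAt_source (I := I) x₀).mem_nhds hx] with x' hx'
    simp only [Function.comp_apply]
    rw [ψ.left_inv hx']
  have h5 := (h3.congr_of_eventuallyEq h4).mfderiv
  rw [chartField_extChartAt I Z hx]
  exact DFunLike.congr_fun h5 (Z x)

theorem contMDiffOn_fieldDeriv [IsManifold I 1 N] {Z : (x : N) → TangentSpace I x}
    (hZ : IsSmoothField I Z) {g : N → V}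
    {U : Set N} (hU : IsOpen U) (hg : ContMDiffOn I 𝓘(ℝ, V) ∞ g U) :
    ContMDiffOn I 𝓘(ℝ, V) ∞ (fieldDeriv I Z g) U := by
  intro x hx
  set ψ := extChartAt I x with hψ
  have hZc := (isSmoothField_iff_contDiffOn_chartField I Z).1 hZ x
  have hO : IsOpen (ψ.target ∩ ψ.symm ⁻¹' U) :=
    (continuousOn_extChartAt_symm x).isOpen_inter_preimage (isOpen_extChartAt_target x) hU
  have h1 : ContDiffOn ℝ ∞ (fun y => fderiv ℝ (fun y => g (ψ.symm y)) y (chartField I Z x y))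
      (ψ.target ∩ ψ.symm ⁻¹' U) := by
    refine ContDiffOn.clm_apply ?_ (hZc.mono inter_subset_left)
    exact (contDiffOn_comp_extChartAt_symm I hg x).fderiv_of_isOpen hO (by norm_cast)
  have hxt : ψ x ∈ ψ.target ∩ ψ.symm ⁻¹' U :=
    ⟨ψ.map_source (mem_extChartAt_source x), by
      rwa [mem_preimage, ψ.left_inv (mem_extChartAt_source x)]⟩
  have h2 : ContMDiffAt I 𝓘(ℝ, V) ∞
      (fun x' => fderiv ℝ (fun y => g (ψ.symm y)) (ψ x') (chartField I Z x (ψ x'))) x :=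
    ((h1.contDiffAt (hO.mem_nhds hxt)).contMDiffAt).comp x contMDiffAt_extChartAt
  refine (h2.congr_of_eventuallyEq ?_).contMDiffWithinAt
  filter_upwards [hU.mem_nhds hx, extChartAt_source_mem_nhds (I := I) x] with x' hx' hs
  exact fieldDeriv_eq_fderiv I Z hU hx' hg hs

theorem fieldDeriv_eq_zero_of_notMem_tsupport (Z : (x : N) → TangentSpace I x) {g : N → V} {x : N}
    (hx : x ∉ tsupport g) : fieldDeriv I Z g x = 0 := by
  have h : g =ᶠ[𝓝 x] fun _ => (0 : V) := by
    filter_upwards [(isClosed_tsupport g).isOpen_compl.mem_nhds hx] with u hu using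
      image_eq_zero_of_notMem_tsupport hu
  have h1 : HasMFDerivAt I 𝓘(ℝ, V) g x (0 : TangentSpace I x →L[ℝ] V) :=
    (hasMFDerivAt_const (0 : V) x).congr_of_eventuallyEq h
  exact DFunLike.congr_fun h1.mfderiv (Z x)

theorem fieldDeriv_sum (Z : (x : N) → TangentSpace I x) {ι : Type*} (S : Finset ι) {g : ι → N → V}
    (hg : ∀ i ∈ S, ContMDiff I 𝓘(ℝ, V) ∞ (g i)) (x : N) :
    fieldDeriv I Z (fun x => ∑ i ∈ S, g i x) x = ∑ i ∈ S, fieldDeriv I Z (g i) x := by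
  have hx := mem_extChartAt_source (I := I) x
  have hs : ContMDiff I 𝓘(ℝ, V) ∞ (fun x => ∑ i ∈ S, g i x) :=
    contMDiff_finsetSum hg
  rw [fieldDeriv_eq_fderiv I Z isOpen_univ (mem_univ x) hs.contMDiffOn hx, fderiv_fun_sum]
  · rw [ContinuousLinearMap.sum_apply]
    refine Finset.sum_congr rfl fun i hi => ?_
    rw [fieldDeriv_eq_fderiv I Z isOpen_univ (mem_univ x) (hg i hi).contMDiffOn hx]
  · intro i hi
    refine ((contDiffOn_comp_extChartAt_symm I (hg i hi).contMDiffOn x (U := univ)).contDiffAt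
      (IsOpen.mem_nhds ?_ ?_)).differentiableAt (by simp)
    · simpa using isOpen_extChartAt_target (I := I) x
    · simp

end FieldDerivative

/-! ### The weak form of invariance -/

section WeakInvariance

open Set Filter Topology MeasureTheory

variable {E : Type*} [NormedAddCommGroup E] [NormedSpace ℝ E] [FiniteDimensional ℝ E]
  [MeasurableSpace E] [BorelSpace E]
  {H : Type*} [TopologicalSpace H] (I : ModelWithCorners ℝ E H) [I.Boundaryless]
  {N : Type*} [TopologicalSpace N] [ChartedSpace H N] [IsManifold I ∞ N] [IsManifold I 1 N]
  [MeasurableSpace N] [BorelSpace N]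

/-- A volume is finite on compact sets. -/
theorem isLocallyFiniteMeasure_of_hasChartDensity {μ : Measure N} {ρ : N → E → ℝ}
    (hρ : ∀ x, ContinuousOn (ρ x) (extChartAt I x).target)
    (hμ : ∀ x, HasChartDensity I μ x (ρ x)) : IsLocallyFiniteMeasure μ := by
  refine ⟨fun x => ?_⟩
  set φ := extChartAt I x
  have ht := (isOpen_extChartAt_target (I := I) x).mem_nhds (mem_extChartAt_target x)
  obtain ⟨K, hKn, hKt, hK⟩ := local_compact_nhds ht
  have hKs : φ.source ∩ φ ⁻¹' K ∈ 𝓝 x :=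
    inter_mem (extChartAt_source_mem_nhds x) ((continuousAt_extChartAt x) hKn)
  refine ⟨_, hKs, ?_⟩
  have hm := measurableSet_source_inter_preimage I x hK.isClosed.measurableSet
  rw [hμ x _ hm inter_subset_left, image_source_inter_preimage I x hKt]
  have h1 : IntegrableOn (ρ x) K Measure.addHaar :=
    ((hρ x).mono hKt).integrableOn_compact hK
  refine lt_of_le_of_lt ?_ h1.2
  exact lintegral_mono fun y => by
    rw [← ofReal_norm_eq_enorm]
    exact ENNReal.ofReal_le_ofReal (le_abs_self _)

/-- Integration by parts for a test function supported in one chart. -/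
theorem integral_fieldDeriv_of_tsupport_subset {Z : (x : N) → TangentSpace I x}
    (hZ : IsSmoothField I Z) {μ : Measure N} {x₀ : N} {ρ : E → ℝ}
    (hρ : ContDiffOn ℝ ∞ ρ (extChartAt I x₀).target)
    (hρ0 : ∀ y ∈ (extChartAt I x₀).target, 0 < ρ y) (hμ : HasChartDensity I μ x₀ ρ)
    {g : N → ℝ} (hg : ContMDiff I 𝓘(ℝ, ℝ) ∞ g) (hgc : HasCompactSupport g)
    (hgs : tsupport g ⊆ (extChartAt I x₀).source) :
    ∫ x, fieldDeriv I Z g x ∂μ =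
      - ∫ y in (extChartAt I x₀).target, g ((extChartAt I x₀).symm y) *
        divergence (fun y => ρ y • chartField I Z x₀ y) y ∂Measure.addHaar := by
  set φ := extChartAt I x₀ with hφ
  have hDm : Measurable (fieldDeriv I Z g) :=
    (contMDiffOn_univ.1 (contMDiffOn_fieldDeriv I hZ isOpen_univ hg.contMDiffOn)
      ).continuous.measurable
  have h1 : ∫ x, fieldDeriv I Z g x ∂μ = ∫ x in φ.source, fieldDeriv I Z g x ∂μ := by
    rw [setIntegral_eq_integral_of_forall_compl_eq_zero]
    intro x hx
    exact fieldDeriv_eq_zero_of_notMem_tsupport I Z fun h => hx (hgs h)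
  have ht : IsOpen φ.target := isOpen_extChartAt_target x₀
  -- the function in the chart, extended by zero
  let G : E → ℝ := φ.target.indicator fun y => g (φ.symm y)
  have hK : IsCompact (φ '' tsupport g) :=
    hgc.image_of_continuousOn ((continuousOn_extChartAt x₀).mono hgs)
  have hKt : φ '' tsupport g ⊆ φ.target := by
    rintro _ ⟨x, hx, rfl⟩
    exact φ.map_source (hgs hx)
  have hG0 : ∀ y ∉ φ '' tsupport g, G y = 0 := by
    intro y hy
    by_cases hyt : y ∈ φ.target
    · simp only [G, indicator_of_mem hyt]
      by_contra h
      exact hy ⟨_, subset_tsupport _ h, φ.right_inv hyt⟩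
    · exact indicator_of_notMem hyt _
  have hGt : ContDiffOn ℝ ∞ G φ.target := by
    have := contDiffOn_comp_extChartAt_symm I (hg.contMDiffOn (s := univ)) x₀
    refine (this.mono fun y hy => ⟨hy, mem_univ _⟩).congr fun y hy => indicator_of_mem hy _
  have hG : ContDiff ℝ ∞ G := contDiff_of_eqOn_zero ht hK.isClosed hKt hGt hG0
  have hGc : HasCompactSupport G := HasCompactSupport.intro hK hG0
  have hGs : tsupport G ⊆ φ.target :=
    (closure_minimal (show Function.support G ⊆ _ from
      fun y hy => by_contra fun h => hy (hG0 y h)) hK.isClosed).trans hKt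
  have hX := (isSmoothField_iff_contDiffOn_chartField I Z).1 hZ x₀
  have h2 := setIntegral_fderiv_apply_eq_neg_mul_divergence ht (hρ.smul hX) hG hGc hGs
  rw [h1, hμ.setIntegral_eq I hρ.continuousOn (fun y hy => (hρ0 y hy).le) hDm]
  refine Eq.trans (setIntegral_congr_fun ht.measurableSet fun y hy => ?_) (h2.trans ?_)
  · have hys := φ.map_target hy
    have h3 := fieldDeriv_eq_fderiv I Z isOpen_univ (mem_univ _) hg.contMDiffOn hys
    rw [φ.right_inv hy] at h3
    have h4 : G =ᶠ[𝓝 y] fun y => g (φ.symm y) := by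
      filter_upwards [ht.mem_nhds hy] with u hu using indicator_of_mem hu _
    change ρ y * fieldDeriv I Z g (φ.symm y) = fderiv ℝ G y (ρ y • chartField I Z x₀ y)
    rw [map_smul, smul_eq_mul, h4.fderiv_eq]
    exact congrArg (ρ y * ·) h3
  · congr 1
    refine setIntegral_congr_fun ht.measurableSet fun y hy => ?_
    simp only [G, indicator_of_mem hy]
    rfl

/-- If a volume is invariant, then the derivative of every test function along the field has
integral zero. -/
theorem integral_fieldDeriv_eq_zero [T2Space N] [SigmaCompactSpace N]
    {Z : (x : N) → TangentSpace I x} (hZ : IsSmoothField I Z) {μ : Measure N}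
    (hμ : IsInvariantVolume I Z μ) {g : N → ℝ} (hg : ContMDiff I 𝓘(ℝ, ℝ) ∞ g)
    (hgc : HasCompactSupport g) : ∫ x, fieldDeriv I Z g x ∂μ = 0 := by
  classical
  choose ρ hρ hρ0 hμd hdiv using hμ
  -- finiteness on compact sets makes the integrands integrable
  haveI := isLocallyFiniteMeasure_of_hasChartDensity I (fun x => (hρ x).continuousOn) hμd
  -- a partition of unity reduces to test functions supported in one chart
  obtain ⟨f, hf⟩ := SmoothPartitionOfUnity.exists_isSubordinate I (s := (univ : Set N))
    isClosed_univ (fun x => (extChartAt I x).source) (fun x => isOpen_extChartAt_source x)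
    (fun x _ => mem_iUnion.2 ⟨x, mem_extChartAt_source x⟩)
  have hfin := f.locallyFinite.finite_nonempty_inter_compact hgc
  let S : Finset N := hfin.toFinset
  have hgi : ∀ i, ContMDiff I 𝓘(ℝ, ℝ) ∞ (fun x => g x * f i x) := fun i => hg.mul (f i).contMDiff
  have hgci : ∀ i, HasCompactSupport (fun x => g x * f i x) := fun i => hgc.mul_right
  have hsum : g = fun x => ∑ i ∈ S, g x * f i x := by
    funext x
    by_cases hx : x ∈ tsupport g
    · have h1 : ∑ᶠ i, f i x = ∑ i ∈ S, f i x := by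
        refine finsum_eq_sum_of_support_subset _ fun i hi => ?_
        simp only [S, Finite.coe_toFinset, mem_setOf_eq]
        exact ⟨x, hi, hx⟩
      rw [← Finset.mul_sum, ← h1, f.sum_eq_one (mem_univ x), mul_one]
    · simp [image_eq_zero_of_notMem_tsupport hx]
  have hcont : ∀ i, Continuous (fieldDeriv I Z fun x => g x * f i x) := fun i =>
    (contMDiffOn_univ.1 (contMDiffOn_fieldDeriv I hZ isOpen_univ (hgi i).contMDiffOn)).continuous
  have hint : ∀ i, Integrable (fieldDeriv I Z fun x => g x * f i x) μ := fun i =>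
    (hcont i).integrable_of_hasCompactSupport (HasCompactSupport.intro (hgci i)
      fun x hx => fieldDeriv_eq_zero_of_notMem_tsupport I Z hx)
  rw [hsum]
  simp_rw [fieldDeriv_sum I Z S fun i _ => hgi i]
  rw [integral_finsetSum _ fun i _ => hint i]
  refine Finset.sum_eq_zero fun i _ => ?_
  rw [integral_fieldDeriv_of_tsupport_subset I hZ (hρ i) (hρ0 i) (hμd i) (hgi i) (hgci i)
    ((tsupport_mul_subset_right (f := g) (g := f i)).trans (hf i)), neg_eq_zero]
  refine setIntegral_eq_zero_of_forall_eq_zero fun y hy => ?_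
  rw [hdiv i y hy, mul_zero]

/-- Conversely, if the derivatives of all test functions along the field have integral zero, then
the divergence vanishes in every chart. -/
theorem divergence_eq_zero_of_integral_fieldDeriv [T2Space N]
    {Z : (x : N) → TangentSpace I x} (hZ : IsSmoothField I Z) {μ : Measure N} {x₀ : N} {ρ : E → ℝ}
    (hρ : ContDiffOn ℝ ∞ ρ (extChartAt I x₀).target)
    (hρ0 : ∀ y ∈ (extChartAt I x₀).target, 0 < ρ y) (hμ : HasChartDensity I μ x₀ ρ)
    (h0 : ∀ g : N → ℝ, ContMDiff I 𝓘(ℝ, ℝ) ∞ g → HasCompactSupport g →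
      ∫ x, fieldDeriv I Z g x ∂μ = 0) :
    ∀ y ∈ (extChartAt I x₀).target,
      divergence (fun y' => ρ y' • chartField I Z x₀ y') y = 0 := by
  set φ := extChartAt I x₀ with hφ
  have ht : IsOpen φ.target := isOpen_extChartAt_target x₀
  have hX := (isSmoothField_iff_contDiffOn_chartField I Z).1 hZ x₀
  have hD := (contDiffOn_divergence ht (hρ.smul hX)).continuousOn
  have hae : ∀ᵐ y ∂(Measure.addHaar : Measure E), y ∈ φ.target →
      divergence (fun y' => ρ y' • chartField I Z x₀ y') y = 0 := by
    -- test functions in the chart extend by zero to the manifold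
    refine ht.ae_eq_zero_of_integral_contDiff_smul_eq_zero
      (hD.locallyIntegrableOn ht.measurableSet) fun g hg hgc hgt => ?_
    have hc := isCompact_symm_image_tsupport I x₀ hgc hgt
    have hs : tsupport (extendChart I x₀ g) ⊆ φ.symm '' tsupport g :=
      closure_minimal (fun x hx => by_contra fun h => hx (extendChart_eq_zero I x₀ g h))
        hc.isClosed
    have hs' : φ.symm '' tsupport g ⊆ φ.source := by
      rintro _ ⟨y, hy, rfl⟩
      exact φ.map_target (hgt hy)
    have h1 := integral_fieldDeriv_of_tsupport_subset I hZ hρ hρ0 hμ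
      (contMDiff_extendChart I x₀ hg hgc hgt)
      (hc.of_isClosed_subset (isClosed_tsupport _) hs) (hs.trans hs')
    rw [h0 _ (contMDiff_extendChart I x₀ hg hgc hgt)
      (hc.of_isClosed_subset (isClosed_tsupport _) hs), eq_comm, neg_eq_zero] at h1
    rw [← setIntegral_eq_integral_of_forall_compl_eq_zero (s := φ.target), ← h1]
    · refine setIntegral_congr_fun ht.measurableSet fun y hy => ?_
      have h2 : extendChart I x₀ g (φ.symm y) = g y :=
        (indicator_of_mem (φ.map_target hy) _).trans (congrArg g (φ.right_inv hy))
      exact congrArg (· * divergence (fun y' => ρ y' • chartField I Z x₀ y') y) h2.symm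
    · intro y hy
      rw [image_eq_zero_of_notMem_tsupport fun h => hy (hgt h), zero_smul]
  have hae' : (fun y => divergence (fun y' => ρ y' • chartField I Z x₀ y') y)
      =ᵐ[Measure.addHaar.restrict φ.target] fun _ => 0 :=
    (ae_restrict_iff' ht.measurableSet).2 hae
  -- the divergence is continuous, so it vanishes everywhere once it vanishes almost everywhere
  exact fun y hy => Measure.eqOn_open_of_ae_eq hae' ht hD continuousOn_const hy

end WeakInvariance

/-! ### Related fields and quotients by compact groups -/

section RelatedFields

open Set Filter Topology MeasureTheory

variable {E : Type*} [NormedAddCommGroup E] [NormedSpace ℝ E] [FiniteDimensional ℝ E]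
  {F : Type*} [NormedAddCommGroup F] [NormedSpace ℝ F] [FiniteDimensional ℝ F]
  {N : Type*} [TopologicalSpace N] [ChartedSpace E N] [IsManifold 𝓘(ℝ, E) ∞ N]
  {M : Type*} [TopologicalSpace M] [ChartedSpace F M] [IsManifold 𝓘(ℝ, F) ∞ M]
  {f : N → M} {Z : (z : N) → TangentSpace 𝓘(ℝ, E) z} {Y : (x : M) → TangentSpace 𝓘(ℝ, F) x}

/-- Derivatives along fields which are related by `f`. -/
theorem fieldDeriv_comp_of_related {V : Type*} [NormedAddCommGroup V] [NormedSpace ℝ V] {z : N}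
    (hf : MDifferentiableAt 𝓘(ℝ, E) 𝓘(ℝ, F) f z)
    (hY : mfderiv 𝓘(ℝ, E) 𝓘(ℝ, F) f z (Z z) = Y (f z)) {g : M → V}
    (hg : MDifferentiableAt 𝓘(ℝ, F) 𝓘(ℝ, V) g (f z)) :
    fieldDeriv 𝓘(ℝ, E) Z (fun z => g (f z)) z = fieldDeriv 𝓘(ℝ, F) Y g (f z) := by
  have h1 := (hg.hasMFDerivAt.comp z hf.hasMFDerivAt).mfderiv
  exact (DFunLike.congr_fun h1 (Z z)).trans
    (congrArg (fun v => mfderiv 𝓘(ℝ, F) 𝓘(ℝ, V) g (f z) v) hY)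

/-- A field which a surjective submersion relates to a smooth field is smooth. -/
theorem isSmoothField_of_related [IsManifold 𝓘(ℝ, E) 1 N] [IsManifold 𝓘(ℝ, F) 1 M]
    (hf : Manifold.IsSubmersion 𝓘(ℝ, E) 𝓘(ℝ, F) ∞ f) (hsurj : Function.Surjective f)
    (hZ : IsSmoothField 𝓘(ℝ, E) Z) (hY : ∀ z, mfderiv 𝓘(ℝ, E) 𝓘(ℝ, F) f z (Z z) = Y (f z)) :
    IsSmoothField 𝓘(ℝ, F) Y := by
  rw [isSmoothField_iff_contDiffOn_chartField]
  intro x₀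
  have ho := isOpen_extChartAt_source (I := 𝓘(ℝ, F)) x₀
  have hfc : ContMDiff 𝓘(ℝ, E) 𝓘(ℝ, F) ∞ f := fun z => (hf.isSubmersionAt z).contMDiffAt
  have hoN := ho.preimage hfc.continuous
  have hφ : ContMDiffOn 𝓘(ℝ, F) 𝓘(ℝ, F) ∞ (extChartAt 𝓘(ℝ, F) x₀) (extChartAt 𝓘(ℝ, F) x₀).source :=
    (contMDiffOn_extChartAt (I := 𝓘(ℝ, F)) (n := ∞) (x := x₀)).mono (by simp)
  have h1 : ContMDiffOn 𝓘(ℝ, E) 𝓘(ℝ, F) ∞ (fun z => extChartAt 𝓘(ℝ, F) x₀ (f z))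
      (f ⁻¹' (extChartAt 𝓘(ℝ, F) x₀).source) :=
    hφ.comp hfc.contMDiffOn fun z hz => hz
  have h2 := contMDiffOn_fieldDeriv 𝓘(ℝ, E) hZ hoN h1
  have h3 : ∀ z ∈ f ⁻¹' (extChartAt 𝓘(ℝ, F) x₀).source,
      chartField 𝓘(ℝ, F) Y x₀ (extChartAt 𝓘(ℝ, F) x₀ (f z)) =
        fieldDeriv 𝓘(ℝ, E) Z (fun z => extChartAt 𝓘(ℝ, F) x₀ (f z)) z := by
    intro z hz
    rw [chartField_extChartAt _ _ hz]
    refine (fieldDeriv_comp_of_related (V := F) ((hfc z).mdifferentiableAt (by simp)) (hY z) ?_).symm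
    exact (hφ.contMDiffAt (ho.mem_nhds hz)).mdifferentiableAt (by simp)
  have h4 : ContMDiffOn 𝓘(ℝ, F) 𝓘(ℝ, F) ∞
      (fun x => chartField 𝓘(ℝ, F) Y x₀ (extChartAt 𝓘(ℝ, F) x₀ x))
      (extChartAt 𝓘(ℝ, F) x₀).source := by
    intro x hx
    obtain ⟨z, rfl⟩ := hsurj x
    refine (contMDiffAt_of_comp_submersion (hf.isSubmersionAt z) ?_).contMDiffWithinAt
    exact (h2.congr h3).contMDiffAt (hoN.mem_nhds hx)
  have h5 := h4.comp (contMDiffOn_extChartAt_symm (I := 𝓘(ℝ, F)) (n := ∞) x₀)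
    (fun y hy => (extChartAt 𝓘(ℝ, F) x₀).map_target hy)
  refine (contMDiffOn_iff_contDiffOn.1 h5).congr fun y hy => ?_
  rw [Function.comp_apply, (extChartAt 𝓘(ℝ, F) x₀).right_inv hy]

/-- The push-forward of an invariant volume by a proper surjective submersion is an invariant volume
of the related field. -/
theorem isInvariantVolume_map_of_related [MeasurableSpace E] [BorelSpace E]
    [MeasurableSpace F] [BorelSpace F] [IsManifold 𝓘(ℝ, E) 1 N] [IsManifold 𝓘(ℝ, F) 1 M]
    [T2Space N] [SigmaCompactSpace N] [MeasurableSpace N] [BorelSpace N]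
    [T2Space M] [MeasurableSpace M] [BorelSpace M]
    (hf : Manifold.IsSubmersion 𝓘(ℝ, E) 𝓘(ℝ, F) ∞ f) (hsurj : Function.Surjective f)
    (hprop : ∀ K : Set M, IsCompact K → IsCompact (f ⁻¹' K))
    (hZ : IsSmoothField 𝓘(ℝ, E) Z) (hY : ∀ z, mfderiv 𝓘(ℝ, E) 𝓘(ℝ, F) f z (Z z) = Y (f z))
    {μ : Measure N} (hμ : IsInvariantVolume 𝓘(ℝ, E) Z μ) :
    IsInvariantVolume 𝓘(ℝ, F) Y (μ.map f) := by
  have hYs := isSmoothField_of_related hf hsurj hZ hY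
  have hfc : ContMDiff 𝓘(ℝ, E) 𝓘(ℝ, F) ∞ f := fun z => (hf.isSubmersionAt z).contMDiffAt
  intro x₀
  choose ρ hρ hρ0 hμd hdiv using id hμ
  obtain ⟨r, hr, hr0, hrd⟩ := exists_hasChartDensity_of_local 𝓘(ℝ, F) x₀
    (exists_local_density_map hf hsurj hprop hρ hρ0 hμd x₀)
  refine ⟨r, hr, hr0, hrd, divergence_eq_zero_of_integral_fieldDeriv 𝓘(ℝ, F) hYs hr hr0 hrd
    fun g hg hgc => ?_⟩
  have hgf : ContMDiff 𝓘(ℝ, E) 𝓘(ℝ, ℝ) ∞ (fun z => g (f z)) := hg.comp hfc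
  have hgfc : HasCompactSupport (fun z => g (f z)) :=
    HasCompactSupport.intro (hprop _ hgc) fun z hz => image_eq_zero_of_notMem_tsupport hz
  have hD : Continuous (fieldDeriv 𝓘(ℝ, F) Y g) :=
    (contMDiffOn_univ.1 (contMDiffOn_fieldDeriv 𝓘(ℝ, F) hYs isOpen_univ hg.contMDiffOn)).continuous
  rw [integral_map hfc.continuous.measurable.aemeasurable hD.measurable.aestronglyMeasurable]
  rw [← integral_fieldDeriv_eq_zero 𝓘(ℝ, E) hZ hμ hgf hgfc]
  congr 1
  funext z
  exact (fieldDeriv_comp_of_related ((hfc z).mdifferentiableAt (by simp)) (hY z)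
    (hg.mdifferentiableAt (by simp))).symm

end RelatedFields

section FreeActions

open Set Filter Topology MeasureTheory

theorem isProperMap_quotientMk_orbitRel {K N : Type*} [TopologicalSpace K] [Group K]
    [CompactSpace K] [IsTopologicalGroup K] [TopologicalSpace N] [MulAction K N] [ContinuousSMul K N] :
    IsProperMap (Quotient.mk (MulAction.orbitRel K N) : N → MulAction.orbitRel.Quotient K N) := by
  refine isProperMap_iff_isClosedMap_and_compact_fibers.2
    ⟨continuous_quotient_mk', MulAction.isClosedMap_quotient, ?_⟩
  intro q
  induction q using Quotient.inductionOn with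
  | h z =>
    have h1 : Quotient.mk (MulAction.orbitRel K N) ⁻¹' {Quotient.mk (MulAction.orbitRel K N) z} =
        range fun k : K => k • z := by
      ext z'
      exact Quotient.eq (r := MulAction.orbitRel K N)
    rw [h1]
    exact isCompact_range (by fun_prop)

theorem t2Space_orbitRel_quotient {K N : Type*} [TopologicalSpace K] [Group K]
    [CompactSpace K] [T2Space K] [IsTopologicalGroup K] [TopologicalSpace N] [T2Space N]
    [MulAction K N] [ContinuousSMul K N] : T2Space (MulAction.orbitRel.Quotient K N) := by
  haveI : ProperSMul K N := by
    rw [properSMul_iff_continuousSMul_ultrafilter_tendsto_t2]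
    refine ⟨inferInstance, fun U x₁ x₂ _ => ?_⟩
    obtain ⟨k, -, hk⟩ := isCompact_univ.ultrafilter_le_nhds (U.map Prod.fst) (by simp)
    exact ⟨k, hk⟩
  exact t2Space_quotient_mulAction_of_properSMul

/-- A field which is invariant under a compact group descends to the orbit space, and averaging over
the orbits makes an invariant volume descend with it. Compactness of the group makes the projection
proper. -/
theorem exists_reduced_field {E : Type*} [NormedAddCommGroup E] [NormedSpace ℝ E] [FiniteDimensional ℝ E]
      {K : Type*} [TopologicalSpace K] [ChartedSpace E K] [Group K] [LieGroup 𝓘(ℝ, E) ∞ K]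
      [T2Space K] [CompactSpace K]
      {E' : Type*} [NormedAddCommGroup E'] [NormedSpace ℝ E'] [FiniteDimensional ℝ E']
      [MeasurableSpace E'] [BorelSpace E']
      {N : Type*} [TopologicalSpace N] [ChartedSpace E' N] [IsManifold 𝓘(ℝ, E') ∞ N]
      [T2Space N] [SecondCountableTopology N] [MeasurableSpace N] [BorelSpace N]
      [MulAction K N] [ContMDiffSMul 𝓘(ℝ, E) 𝓘(ℝ, E') ∞ K N]
      {F : Type*} [NormedAddCommGroup F] [NormedSpace ℝ F] [FiniteDimensional ℝ F]
      [MeasurableSpace F] [BorelSpace F]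
      [ChartedSpace F (MulAction.orbitRel.Quotient K N)]
      [IsManifold 𝓘(ℝ, F) ∞ (MulAction.orbitRel.Quotient K N)]
      [MeasurableSpace (MulAction.orbitRel.Quotient K N)]
      [BorelSpace (MulAction.orbitRel.Quotient K N)]
      (hf : Manifold.IsSubmersion 𝓘(ℝ, E') 𝓘(ℝ, F) ∞
        (Quotient.mk (MulAction.orbitRel K N) : N → MulAction.orbitRel.Quotient K N))
      (Z : (z : N) → TangentSpace 𝓘(ℝ, E') z) (hZ : IsSmoothField 𝓘(ℝ, E') Z)
      (hinv : ∀ (k : K) (z : N), mfderiv 𝓘(ℝ, E') 𝓘(ℝ, E') (fun x : N => k • x) z (Z z) = Z (k • z))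
      (μ : MeasureTheory.Measure N) (hμ : IsInvariantVolume 𝓘(ℝ, E') Z μ) :
      ∃ Zred : (x : MulAction.orbitRel.Quotient K N) → TangentSpace 𝓘(ℝ, F) x,
        (∀ z : N, mfderiv 𝓘(ℝ, E') 𝓘(ℝ, F)
          (Quotient.mk (MulAction.orbitRel K N) : N → MulAction.orbitRel.Quotient K N) z (Z z) =
            Zred (Quotient.mk (MulAction.orbitRel K N) z)) ∧
        IsSmoothField 𝓘(ℝ, F) Zred ∧
        IsInvariantVolume 𝓘(ℝ, F) Zred
          (μ.map (Quotient.mk (MulAction.orbitRel K N) :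
            N → MulAction.orbitRel.Quotient K N)) := by
  haveI : ContinuousSMul K N := ContMDiffSMul.continuousSMul (I := 𝓘(ℝ, E)) (I' := 𝓘(ℝ, E')) ∞
  haveI : IsTopologicalGroup K := topologicalGroup_of_lieGroup 𝓘(ℝ, E) ∞
  haveI := t2Space_orbitRel_quotient (K := K) (N := N)
  haveI : LocallyCompactSpace N := ChartedSpace.locallyCompactSpace E' N
  set f : N → MulAction.orbitRel.Quotient K N := Quotient.mk (MulAction.orbitRel K N) with hfdef
  have hfc : ContMDiff 𝓘(ℝ, E') 𝓘(ℝ, F) ∞ f := fun z => (hf.isSubmersionAt z).contMDiffAt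
  have hfk : ∀ (k : K) (z : N), f (k • z) = f z := fun k z =>
    Quotient.sound (s := MulAction.orbitRel K N) ⟨k, rfl⟩
  have hsurj : Function.Surjective f := Quotient.mk_surjective
  let Y : (x : MulAction.orbitRel.Quotient K N) → TangentSpace 𝓘(ℝ, F) x := fun x =>
    (mfderiv 𝓘(ℝ, E') 𝓘(ℝ, F) f (Quotient.out x) (Z (Quotient.out x)) : F)
  -- by invariance of `Z` the projected vector does not depend on the point of the orbit
  have hY : ∀ z, mfderiv 𝓘(ℝ, E') 𝓘(ℝ, F) f z (Z z) = Y (f z) := by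
    intro z
    obtain ⟨k, hk⟩ : ∃ k : K, k • z = Quotient.out (f z) :=
      (Quotient.exact (Quotient.out_eq (f z)) :)
    have h1 : HasMFDerivAt 𝓘(ℝ, E') 𝓘(ℝ, E') (fun x : N => k • x) z
        (mfderiv 𝓘(ℝ, E') 𝓘(ℝ, E') (fun x : N => k • x) z) :=
      ((ContMDiffSMul.contMDiff_const_smul (I := 𝓘(ℝ, E)) (I' := 𝓘(ℝ, E')) (n := ∞) k).mdifferentiableAt (by simp)).hasMFDerivAt
    have h2 := ((hfc (k • z)).mdifferentiableAt (by simp)).hasMFDerivAt.comp z h1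
    have h3 : (f ∘ fun x : N => k • x) = f := funext fun x => hfk k x
    rw [h3] at h2
    have h4 := DFunLike.congr_fun h2.mfderiv (Z z)
    have h5 : mfderiv 𝓘(ℝ, E') 𝓘(ℝ, F) f z (Z z) =
      (mfderiv 𝓘(ℝ, E') 𝓘(ℝ, F) f (k • z) (Z (k • z)) : F) :=
      h4.trans (congrArg (fun v => (mfderiv 𝓘(ℝ, E') 𝓘(ℝ, F) f (k • z) v : F)) (hinv k z))
    rw [hk] at h5
    exact h5
  exact ⟨Y, hY, isSmoothField_of_related hf hsurj hZ hY,
    isInvariantVolume_map_of_related hf hsurj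
      (fun K hK => isProperMap_quotientMk_orbitRel.isCompact_preimage hK) hZ hY hμ⟩

end FreeActions

/-! ### The adjoint action and the Lie bracket -/

section ParametricDerivatives

open Set Filter Topology

variable {E : Type*} [NormedAddCommGroup E] [NormedSpace ℝ E]
  {N : Type*} [TopologicalSpace N] [ChartedSpace E N] [IsManifold 𝓘(ℝ, E) ∞ N]

/-- The derivative at a fixed point of a map which depends smoothly on a parameter depends smoothly
on the parameter. -/
theorem contMDiffAt_mfderiv_of_uncurry {P E' H' : Type*} [NormedAddCommGroup E'] [NormedSpace ℝ E']
    [TopologicalSpace H'] {J : ModelWithCorners ℝ E' H'} [TopologicalSpace P] [ChartedSpace H' P]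
    [IsManifold J ∞ P] {V : Type*} [NormedAddCommGroup V] [NormedSpace ℝ V]
    {h : P → N → V} {p₀ : P} {x₀ : N}
    (hh : ContMDiffAt (J.prod 𝓘(ℝ, E)) 𝓘(ℝ, V) ∞ (Function.uncurry h) (p₀, x₀))
    (hd : ∀ᶠ p in 𝓝 p₀, MDifferentiableAt 𝓘(ℝ, E) 𝓘(ℝ, V) (h p) x₀) :
    ContMDiffAt (M' := E →L[ℝ] V) J 𝓘(ℝ, E →L[ℝ] V) ∞
      (fun p => mfderiv 𝓘(ℝ, E) 𝓘(ℝ, V) (h p) x₀) p₀ := by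
  set ψ := extChartAt 𝓘(ℝ, E) x₀ with hψ
  have h1 : ContMDiffAt (J.prod 𝓘(ℝ, E)) 𝓘(ℝ, V) ∞
      (Function.uncurry fun (p : P) (a : E) => h p (ψ.symm a)) (p₀, ψ x₀) := by
    have h2 : ContMDiffAt (J.prod 𝓘(ℝ, E)) (J.prod 𝓘(ℝ, E)) ∞
        (fun q : P × E => (q.1, ψ.symm q.2)) (p₀, ψ x₀) := by
      refine contMDiffAt_fst.prodMk ?_
      exact ((contMDiffOn_extChartAt_symm x₀).contMDiffAt
        ((isOpen_extChartAt_target x₀).mem_nhds (mem_extChartAt_target x₀))).comp (p₀, ψ x₀)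
          contMDiffAt_snd
    refine ContMDiffAt.comp (p₀, ψ x₀) (g := Function.uncurry h) ?_ h2
    change ContMDiffAt (J.prod 𝓘(ℝ, E)) 𝓘(ℝ, V) ∞ (Function.uncurry h) (p₀, ψ.symm (ψ x₀))
    rw [extChartAt_to_inv x₀]
    exact hh
  have h3 := ContMDiffAt.mfderiv (m := ∞) (fun (p : P) (a : E) => h p (ψ.symm a)) (fun _ => ψ x₀) h1
    contMDiffAt_const (by simp)
  have h5 := inTangentCoordinates_model_space (I := 𝓘(ℝ, E)) (I' := 𝓘(ℝ, V)) (fun _ : P => ψ x₀)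
    (fun p => h p (ψ.symm (ψ x₀))) (fun p => mfderiv 𝓘(ℝ, E) 𝓘(ℝ, V) (fun a => h p (ψ.symm a)) (ψ x₀))
    p₀
  have h6 := (congrArg (fun f => ContMDiffAt (M' := E →L[ℝ] V) J 𝓘(ℝ, E →L[ℝ] V) ∞ f p₀) h5).mp h3
  refine h6.congr_of_eventuallyEq ?_
  filter_upwards [hd] with p hp
  have h4 : mfderiv 𝓘(ℝ, E) 𝓘(ℝ, V) (h p) x₀ =
      fderivWithin ℝ (fun a => h p (ψ.symm a)) (range 𝓘(ℝ, E)) (ψ x₀) := by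
    unfold mfderiv
    exact if_pos hp
  rw [modelWithCornersSelf_coe, range_id, fderivWithin_univ] at h4
  rw [mfderiv_eq_fderiv]
  exact h4

end ParametricDerivatives

section LieGroups

open Set Filter Topology

variable {E : Type*} [NormedAddCommGroup E] [NormedSpace ℝ E]
  {G : Type*} [TopologicalSpace G] [ChartedSpace E G] [Group G] [LieGroup 𝓘(ℝ, E) ∞ G]

theorem hasMFDerivAt_mul_left (g x : G) : HasMFDerivAt 𝓘(ℝ, E) 𝓘(ℝ, E) (fun u : G => g * u) x
    (mfderiv 𝓘(ℝ, E) 𝓘(ℝ, E) (fun u : G => g * u) x) :=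
  ((contMDiff_mul_left (I := 𝓘(ℝ, E)) (n := ∞) (a := g)).mdifferentiableAt (by simp)).hasMFDerivAt

theorem hasMFDerivAt_mul_right (g x : G) : HasMFDerivAt 𝓘(ℝ, E) 𝓘(ℝ, E) (fun u : G => u * g) x
    (mfderiv 𝓘(ℝ, E) 𝓘(ℝ, E) (fun u : G => u * g) x) :=
  ((contMDiff_mul_right (I := 𝓘(ℝ, E)) (n := ∞) (a := g)).mdifferentiableAt (by simp)).hasMFDerivAt

theorem contMDiff_conj (g : G) :
    ContMDiff 𝓘(ℝ, E) 𝓘(ℝ, E) ∞ (fun x : G => g * x * g⁻¹) :=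
  (contMDiff_const.mul contMDiff_id).mul contMDiff_const

theorem hasMFDerivAt_conj (g : G) : HasMFDerivAt 𝓘(ℝ, E) 𝓘(ℝ, E) (fun x : G => g * x * g⁻¹) 1
    (lieAd E g : E →L[ℝ] E) :=
  ((contMDiff_conj g).mdifferentiableAt (by simp)).hasMFDerivAt

theorem lieAd_one : (lieAd E (1 : G) : E →L[ℝ] E) = ContinuousLinearMap.id ℝ E := by
  have h : (fun x : G => 1 * x * 1⁻¹) = id := by funext x; simp
  have h1 := hasMFDerivAt_conj (E := E) (1 : G)
  rw [h] at h1
  exact hasMFDerivAt_unique h1 (hasMFDerivAt_id (I := 𝓘(ℝ, E)) (1 : G))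

theorem lieAd_mul (g h : G) :
    (lieAd E (g * h) : E →L[ℝ] E) = (lieAd E g : E →L[ℝ] E).comp (lieAd E h : E →L[ℝ] E) := by
  have h1 : HasMFDerivAt 𝓘(ℝ, E) 𝓘(ℝ, E) (fun x : G => g * x * g⁻¹) (h * 1 * h⁻¹)
      (lieAd E g : E →L[ℝ] E) := by
    have : h * 1 * h⁻¹ = 1 := by simp
    rw [this]
    exact hasMFDerivAt_conj g
  have h2 := h1.comp (1 : G) (hasMFDerivAt_conj (E := E) h)
  have h3 : ((fun x : G => g * x * g⁻¹) ∘ fun x : G => h * x * h⁻¹) =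
      fun x : G => g * h * x * (g * h)⁻¹ := by
    funext x
    simp [mul_assoc]
  rw [h3] at h2
  exact hasMFDerivAt_unique (hasMFDerivAt_conj (g * h)) h2

theorem lieAd_mul_apply (g h : G) (x : GroupLieAlgebra 𝓘(ℝ, E) G) :
    lieAd E (g * h) x = lieAd E g (lieAd E h x) :=
  DFunLike.congr_fun (lieAd_mul g h) x

theorem lieAd_one_apply (x : GroupLieAlgebra 𝓘(ℝ, E) G) : lieAd E (1 : G) x = x :=
  DFunLike.congr_fun (lieAd_one (E := E) (G := G)) x

theorem lieAd_inv_apply_lieAd (g : G) (x : GroupLieAlgebra 𝓘(ℝ, E) G) :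
    lieAd E g⁻¹ (lieAd E g x) = x := by
  rw [← lieAd_mul_apply, inv_mul_cancel, lieAd_one_apply]

theorem lieAd_apply_lieAd_inv (g : G) (x : GroupLieAlgebra 𝓘(ℝ, E) G) :
    lieAd E g (lieAd E g⁻¹ x) = x := by
  rw [← lieAd_mul_apply, mul_inv_cancel, lieAd_one_apply]

/-- `g · ξ = Ad_g ξ · g`. -/
theorem mulInvariantVectorField_eq_mfderiv_mul_right (g : G) (ξ : GroupLieAlgebra 𝓘(ℝ, E) G) :
    (mulInvariantVectorField ξ g : E) =
      (mfderiv 𝓘(ℝ, E) 𝓘(ℝ, E) (fun u : G => u * g) 1 : E →L[ℝ] E) (lieAd E g ξ) := by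
  have h1 : HasMFDerivAt 𝓘(ℝ, E) 𝓘(ℝ, E) (fun u : G => u * g) (g * 1 * g⁻¹)
      (mfderiv 𝓘(ℝ, E) 𝓘(ℝ, E) (fun u : G => u * g) 1 : E →L[ℝ] E) := by
    have : g * 1 * g⁻¹ = 1 := by simp
    rw [this]
    exact hasMFDerivAt_mul_right g 1
  have h2 := h1.comp (1 : G) (hasMFDerivAt_conj (E := E) g)
  have h3 : ((fun u : G => u * g) ∘ fun x : G => g * x * g⁻¹) = fun x : G => g * x := by
    funext x
    simp [mul_assoc]
  rw [h3] at h2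
  exact DFunLike.congr_fun (hasMFDerivAt_unique (hasMFDerivAt_mul_left g 1) h2) ξ

theorem contMDiff_lieAd :
    ContMDiff (M' := E →L[ℝ] E) 𝓘(ℝ, E) 𝓘(ℝ, E →L[ℝ] E) ∞ (fun g : G => lieAd E g) := by
  intro g₀
  set ψ := extChartAt 𝓘(ℝ, E) (1 : G) with hψ
  have hc : ContMDiff (𝓘(ℝ, E).prod 𝓘(ℝ, E)) 𝓘(ℝ, E) ∞ (fun q : G × G => q.1 * q.2 * q.1⁻¹) :=
    (contMDiff_fst.mul contMDiff_snd).mul contMDiff_fst.inv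
  have h0 : ∀ g : G, HasMFDerivAt 𝓘(ℝ, E) 𝓘(ℝ, E) ψ (g * 1 * g⁻¹) (ContinuousLinearMap.id ℝ E) := by
    intro g
    have : g * 1 * g⁻¹ = 1 := by simp
    rw [this]
    have h := (mdifferentiableAt_extChartAt (I := 𝓘(ℝ, E)) (mem_chart_source E (1 : G))).hasMFDerivAt
    rw [mfderiv_extChartAt_self] at h
    exact h
  have h1 : ∀ g : G, HasMFDerivAt 𝓘(ℝ, E) 𝓘(ℝ, E) (fun x : G => ψ (g * x * g⁻¹)) 1
      (lieAd E g : E →L[ℝ] E) := fun g => (h0 g).comp (1 : G) (hasMFDerivAt_conj (E := E) g)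
  have h2 : ContMDiffAt (𝓘(ℝ, E).prod 𝓘(ℝ, E)) 𝓘(ℝ, E) ∞
      (Function.uncurry fun (g x : G) => ψ (g * x * g⁻¹)) (g₀, 1) := by
    refine ContMDiffAt.comp (g₀, (1 : G)) (g := ψ) ?_ hc.contMDiffAt
    have : g₀ * 1 * g₀⁻¹ = 1 := by simp
    change ContMDiffAt _ _ _ _ (g₀ * 1 * g₀⁻¹)
    rw [this]
    exact contMDiffAt_extChartAt
  refine (contMDiffAt_mfderiv_of_uncurry h2
    (Eventually.of_forall fun g => (h1 g).mdifferentiableAt)).congr_of_eventuallyEq ?_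
  exact Eventually.of_forall fun g => (h1 g).mfderiv.symm

end LieGroups

section LieBracket

open Set Filter Topology

variable {E : Type*} [NormedAddCommGroup E] [NormedSpace ℝ E]
  (G : Type*) [TopologicalSpace G] [ChartedSpace E G] [Group G] [LieGroup 𝓘(ℝ, E) ∞ G]

variable (E) in
/-- The multiplication of a Lie group in the chart around the identity. -/
def chartMul (p : E × E) : E :=
  extChartAt 𝓘(ℝ, E) (1 : G)
    ((extChartAt 𝓘(ℝ, E) (1 : G)).symm p.1 * (extChartAt 𝓘(ℝ, E) (1 : G)).symm p.2)

variable (E) in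
theorem eventually_contDiffAt_chartMul :
    ∀ᶠ p in 𝓝 (extChartAt 𝓘(ℝ, E) (1 : G) 1, extChartAt 𝓘(ℝ, E) (1 : G) 1),
      ContDiffAt ℝ ∞ (chartMul E G) p := by
  set ψ := extChartAt 𝓘(ℝ, E) (1 : G) with hψ
  have hs : ContMDiffOn 𝓘(ℝ, E) 𝓘(ℝ, E) ∞ ψ.symm ψ.target := contMDiffOn_extChartAt_symm 1
  have h1 : ContMDiffOn 𝓘(ℝ, E × E) 𝓘(ℝ, E) ∞ (fun p : E × E => ψ.symm p.1 * ψ.symm p.2)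
      (ψ.target ×ˢ ψ.target) := by
    refine ContMDiffOn.mul ?_ ?_
    · exact hs.comp contDiff_fst.contMDiff.contMDiffOn fun p hp => hp.1
    · exact hs.comp contDiff_snd.contMDiff.contMDiffOn fun p hp => hp.2
  have ho : IsOpen (ψ.target ×ˢ ψ.target) :=
    (isOpen_extChartAt_target 1).prod (isOpen_extChartAt_target 1)
  have ho' := h1.continuousOn.isOpen_inter_preimage ho (isOpen_extChartAt_source (I := 𝓘(ℝ, E)) (1 : G))
  have he : ψ.symm (ψ 1) = 1 := extChartAt_to_inv 1
  have hmem : (ψ 1, ψ 1) ∈ (ψ.target ×ˢ ψ.target) ∩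
      (fun p : E × E => ψ.symm p.1 * ψ.symm p.2) ⁻¹' (extChartAt 𝓘(ℝ, E) (1 : G)).source := by
    refine ⟨⟨mem_extChartAt_target 1, mem_extChartAt_target 1⟩, ?_⟩
    change ψ.symm (ψ 1) * ψ.symm (ψ 1) ∈ (extChartAt 𝓘(ℝ, E) (1 : G)).source
    rw [he, mul_one]
    exact mem_extChartAt_source 1
  have hφ : ContMDiffOn 𝓘(ℝ, E) 𝓘(ℝ, E) ∞ ψ ψ.source :=
    (contMDiffOn_extChartAt (I := 𝓘(ℝ, E)) (n := ∞) (x := (1 : G))).mono (by simp [ψ])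
  have h2 : ContMDiffOn 𝓘(ℝ, E × E) 𝓘(ℝ, E) ∞ (chartMul E G) _ :=
    hφ.comp (h1.mono inter_subset_left) (fun p hp => hp.2)
  filter_upwards [ho'.mem_nhds hmem] with p hp
  exact (contMDiffOn_iff_contDiffOn.1 h2).contDiffAt (ho'.mem_nhds hp)

variable {G}

theorem mdifferentiableAt_extChartAt_one {g : G} (hg : g ∈ (extChartAt 𝓘(ℝ, E) (1 : G)).source) :
    MDifferentiableAt 𝓘(ℝ, E) 𝓘(ℝ, E) (extChartAt 𝓘(ℝ, E) (1 : G)) g :=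
  haveI : IsManifold 𝓘(ℝ, E) 1 G := .of_le (n := ∞) (by norm_cast)
  mdifferentiableAt_extChartAt (by simpa using hg)

theorem hasMFDerivAt_extChartAt_one :
    HasMFDerivAt 𝓘(ℝ, E) 𝓘(ℝ, E) (extChartAt 𝓘(ℝ, E) (1 : G)) 1 (ContinuousLinearMap.id ℝ E) := by
  have h := (mdifferentiableAt_extChartAt_one (E := E) (mem_extChartAt_source (1 : G))).hasMFDerivAt
  rw [mfderiv_extChartAt_self] at h
  exact h

/-- The invariant field `g · ξ`, read in the chart around the identity, is a partial derivative of the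
multiplication. -/
theorem eventually_fderiv_chartMul_left (ξ : GroupLieAlgebra 𝓘(ℝ, E) G) :
    ∀ᶠ a in 𝓝 (extChartAt 𝓘(ℝ, E) (1 : G) 1),
      chartField 𝓘(ℝ, E) (mulInvariantVectorField ξ) (1 : G) a =
        fderiv ℝ (chartMul E G) (a, extChartAt 𝓘(ℝ, E) (1 : G) 1) (0, (ξ : E)) := by
  set ψ := extChartAt 𝓘(ℝ, E) (1 : G) with hψ
  have hsm : ∀ᶠ a in 𝓝 (ψ 1), ContDiffAt ℝ ∞ (chartMul E G) (a, ψ 1) := by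
    have : Tendsto (fun a => (a, ψ 1)) (𝓝 (ψ 1)) (𝓝 (ψ 1, ψ 1)) := by
      apply Continuous.tendsto'
      · fun_prop
      · rfl
    exact this.eventually (eventually_contDiffAt_chartMul E G)
  filter_upwards [hsm, (isOpen_extChartAt_target (I := 𝓘(ℝ, E)) (1 : G)).mem_nhds
    (mem_extChartAt_target 1)] with a ha hat
  set g := ψ.symm a with hg
  have hgs : g ∈ ψ.source := ψ.map_target hat
  have h1 : HasMFDerivAt 𝓘(ℝ, E) 𝓘(ℝ, E) ψ (g * 1)
      (mfderiv 𝓘(ℝ, E) 𝓘(ℝ, E) ψ g : E →L[ℝ] E) := by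
    rw [mul_one]
    exact (mdifferentiableAt_extChartAt_one hgs).hasMFDerivAt
  have h2 := h1.comp (1 : G) (hasMFDerivAt_mul_left g 1)
  have h3 : HasFDerivAt (fun b => chartMul E G (a, b))
      ((fderiv ℝ (chartMul E G) (a, ψ 1)).comp (ContinuousLinearMap.inr ℝ E E)) (ψ 1) :=
    (ha.differentiableAt (by simp)).hasFDerivAt.comp (ψ 1) (hasFDerivAt_prodMk_right a (ψ 1))
  have h4 := h3.hasMFDerivAt.comp (1 : G) hasMFDerivAt_extChartAt_one
  have h5 : (ψ ∘ fun u => g * u) =ᶠ[𝓝 (1 : G)] (fun b => chartMul E G (a, b)) ∘ ψ := by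
    filter_upwards [extChartAt_source_mem_nhds (I := 𝓘(ℝ, E)) (1 : G)] with u hu
    simp only [Function.comp_apply, chartMul]
    rw [(extChartAt 𝓘(ℝ, E) (1 : G)).left_inv hu]
  exact DFunLike.congr_fun (hasMFDerivAt_unique h2 (h4.congr_of_eventuallyEq h5)) ξ

/-- As `g · ξ = Ad_g ξ · g`, a left-invariant field is also a partial derivative of the
multiplication in its first argument. -/
theorem eventually_fderiv_chartMul_right (ξ : GroupLieAlgebra 𝓘(ℝ, E) G) :
    ∀ᶠ a in 𝓝 (extChartAt 𝓘(ℝ, E) (1 : G) 1),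
      chartField 𝓘(ℝ, E) (mulInvariantVectorField ξ) (1 : G) a =
        fderiv ℝ (chartMul E G) (extChartAt 𝓘(ℝ, E) (1 : G) 1, a)
          ((lieAd E ((extChartAt 𝓘(ℝ, E) (1 : G)).symm a) ξ : E), 0) := by
  set ψ := extChartAt 𝓘(ℝ, E) (1 : G) with hψ
  have hsm : ∀ᶠ a in 𝓝 (ψ 1), ContDiffAt ℝ ∞ (chartMul E G) (ψ 1, a) := by
    have : Tendsto (fun a => (ψ 1, a)) (𝓝 (ψ 1)) (𝓝 (ψ 1, ψ 1)) := by
      apply Continuous.tendsto'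
      · fun_prop
      · rfl
    exact this.eventually (eventually_contDiffAt_chartMul E G)
  filter_upwards [hsm, (isOpen_extChartAt_target (I := 𝓘(ℝ, E)) (1 : G)).mem_nhds
    (mem_extChartAt_target 1)] with a ha hat
  set g := ψ.symm a with hg
  have hgs : g ∈ ψ.source := ψ.map_target hat
  have h1 : HasMFDerivAt 𝓘(ℝ, E) 𝓘(ℝ, E) ψ (1 * g)
      (mfderiv 𝓘(ℝ, E) 𝓘(ℝ, E) ψ g : E →L[ℝ] E) := by
    rw [one_mul]
    exact (mdifferentiableAt_extChartAt_one hgs).hasMFDerivAt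
  have h2 := h1.comp (1 : G) (hasMFDerivAt_mul_right g 1)
  have h3 : HasFDerivAt (fun b => chartMul E G (b, a))
      ((fderiv ℝ (chartMul E G) (ψ 1, a)).comp (ContinuousLinearMap.inl ℝ E E)) (ψ 1) :=
    HasFDerivAt.comp (g := chartMul E G) (f := fun b => (b, a)) (ψ 1)
      (ha.differentiableAt (by simp)).hasFDerivAt (hasFDerivAt_prodMk_left (ψ 1) a)
  have h4 := h3.hasMFDerivAt.comp (1 : G) hasMFDerivAt_extChartAt_one
  have h5 : (ψ ∘ fun u => u * g) =ᶠ[𝓝 (1 : G)] (fun b => chartMul E G (b, a)) ∘ ψ := by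
    filter_upwards [extChartAt_source_mem_nhds (I := 𝓘(ℝ, E)) (1 : G)] with u hu
    simp only [Function.comp_apply, chartMul]
    rw [(extChartAt 𝓘(ℝ, E) (1 : G)).left_inv hu]
  have h6 := DFunLike.congr_fun (hasMFDerivAt_unique h2 (h4.congr_of_eventuallyEq h5)) (lieAd E g ξ)
  refine Eq.trans ?_ h6
  exact congrArg (mfderiv 𝓘(ℝ, E) 𝓘(ℝ, E) ψ g : E →L[ℝ] E)
    (mulInvariantVectorField_eq_mfderiv_mul_right g ξ)

theorem lieBracketWithin_eq_of_eventuallyEq {V W V' W' : E → E} {s : Set E} {x : E} (hs : s = univ)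
    (hV : V =ᶠ[𝓝 x] V') (hW : W =ᶠ[𝓝 x] W') :
    VectorField.lieBracketWithin ℝ V W s x = fderiv ℝ W' x (V' x) - fderiv ℝ V' x (W' x) := by
  rw [hs, VectorField.lieBracketWithin_univ, VectorField.lieBracket, hW.fderiv_eq, hV.fderiv_eq,
    hV.eq_of_nhds, hW.eq_of_nhds]

/-- The bracket is the difference of the mixed second derivatives of the multiplication. -/
theorem bracket_eq_sub_fderiv_fderiv_chartMul (η ξ : GroupLieAlgebra 𝓘(ℝ, E) G) :
    (⁅η, ξ⁆ : GroupLieAlgebra 𝓘(ℝ, E) G) = (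
      fderiv ℝ (fun a => chartField 𝓘(ℝ, E) (mulInvariantVectorField ξ) (1 : G) a)
        (extChartAt 𝓘(ℝ, E) (1 : G) 1) η -
      fderiv ℝ (fun a => chartField 𝓘(ℝ, E) (mulInvariantVectorField η) (1 : G) a)
        (extChartAt 𝓘(ℝ, E) (1 : G) 1) ξ : E) := by
  haveI : IsManifold 𝓘(ℝ, E) 1 G := .of_le (n := ∞) (by norm_cast)
  set ψ := extChartAt 𝓘(ℝ, E) (1 : G) with hψ
  have hX : ∀ ζ : GroupLieAlgebra 𝓘(ℝ, E) G,
      (VectorField.mpullbackWithin 𝓘(ℝ, E) 𝓘(ℝ, E) ψ.symm (mulInvariantVectorField ζ)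
        (range 𝓘(ℝ, E)) : E → E) =ᶠ[𝓝 (ψ 1)]
      chartField 𝓘(ℝ, E) (mulInvariantVectorField ζ) (1 : G) := by
    intro ζ
    filter_upwards [(isOpen_extChartAt_target (I := 𝓘(ℝ, E)) (1 : G)).mem_nhds
      (mem_extChartAt_target 1)] with a ha
    have h1 := mfderiv_extChartAt_comp_mfderivWithin_extChartAt_symm (I := 𝓘(ℝ, E)) ha
    have h2 := mfderivWithin_extChartAt_symm_comp_mfderiv_extChartAt (I := 𝓘(ℝ, E)) ha
    have h3 := ContinuousLinearMap.inverse_eq h2 h1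
    exact DFunLike.congr_fun h3 (mulInvariantVectorField ζ (ψ.symm a))
  have h0 : ∀ ζ : GroupLieAlgebra 𝓘(ℝ, E) G,
      chartField 𝓘(ℝ, E) (mulInvariantVectorField ζ) (1 : G) (ψ 1) = ζ := by
    intro ζ
    rw [chartField_extChartAt 𝓘(ℝ, E) _ (mem_extChartAt_source (1 : G)), mfderiv_extChartAt_self]
    change mfderiv 𝓘(ℝ, E) 𝓘(ℝ, E) (fun u : G => 1 * u) 1 ζ = ζ
    have h : HasMFDerivAt 𝓘(ℝ, E) 𝓘(ℝ, E) (fun u : G => 1 * u) 1 (ContinuousLinearMap.id ℝ E) := by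
      exact (hasMFDerivAt_id (I := 𝓘(ℝ, E)) (1 : G)).congr_of_eventuallyEq
        (Eventually.of_forall fun u => one_mul u)
    exact DFunLike.congr_fun h.mfderiv ζ
  have hu : ψ.symm ⁻¹' univ ∩ range 𝓘(ℝ, E) = univ := by simp
  have h := VectorField.mlieBracketWithin_apply (I := 𝓘(ℝ, E))
      (V := mulInvariantVectorField η) (W := mulInvariantVectorField ξ) (s := univ) (x₀ := (1 : G))
  rw [mfderiv_extChartAt_self] at h
  refine h.trans ((DFunLike.congr_fun (ContinuousLinearMap.inverse_id (R := ℝ) (M := E)) _).trans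
    ((lieBracketWithin_eq_of_eventuallyEq hu (hX η) (hX ξ)).trans ?_))
  rw [h0, h0]

end LieBracket

section AdjointDerivative

open Set Filter Topology

variable {E : Type*} [NormedAddCommGroup E] [NormedSpace ℝ E]
  {G : Type*} [TopologicalSpace G] [ChartedSpace E G] [Group G] [LieGroup 𝓘(ℝ, E) ∞ G]

/-- The orbit map `g ↦ Ad_g ξ`, with values in the model space. -/
def adOrbit (ξ : GroupLieAlgebra 𝓘(ℝ, E) G) (g : G) : E := lieAd E g ξ

theorem mdifferentiableAt_adOrbit (ξ : GroupLieAlgebra 𝓘(ℝ, E) G) (g : G) :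
    MDifferentiableAt 𝓘(ℝ, E) 𝓘(ℝ, E) (adOrbit ξ) g := by
  have h1 : ContMDiffAt (M' := E →L[ℝ] E) 𝓘(ℝ, E) 𝓘(ℝ, E →L[ℝ] E) ∞ (fun g : G => lieAd E g) g :=
    contMDiff_lieAd g
  have h2 : ContDiff ℝ ∞ (fun A : E →L[ℝ] E => A (ξ : E)) := by fun_prop
  exact (h2.contMDiff.contMDiffAt.comp g h1).mdifferentiableAt (by simp)

/-- The derivative of the adjoint action at the identity is the bracket: differentiate
`Ad_g ξ · g = g · ξ`. -/
theorem hasMFDerivAt_adOrbit_one (ξ : GroupLieAlgebra 𝓘(ℝ, E) G) :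
    ∃ L : E →L[ℝ] E, HasMFDerivAt 𝓘(ℝ, E) 𝓘(ℝ, E) (adOrbit ξ) 1 L ∧
      ∀ η : GroupLieAlgebra 𝓘(ℝ, E) G, L η = (⁅η, ξ⁆ : GroupLieAlgebra 𝓘(ℝ, E) G) := by
  set ψ := extChartAt 𝓘(ℝ, E) (1 : G) with hψ
  set e := ψ 1 with he
  let α : E → E := fun a => adOrbit ξ (ψ.symm a)
  have hes : ψ.symm e = 1 := extChartAt_to_inv 1
  have hα0 : α e = ξ := by
    change (lieAd E (ψ.symm e) ξ : E) = ξ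
    rw [hes]
    exact lieAd_one_apply ξ
  have hα : DifferentiableAt ℝ α e := by
    rw [← mdifferentiableAt_iff_differentiableAt]
    refine MDifferentiableAt.comp (I' := 𝓘(ℝ, E)) (M' := G) e (mdifferentiableAt_adOrbit ξ _) ?_
    exact ((contMDiffOn_extChartAt_symm (I := 𝓘(ℝ, E)) (n := ∞) (1 : G)).contMDiffAt
        ((isOpen_extChartAt_target 1).mem_nhds (mem_extChartAt_target 1))).mdifferentiableAt (by simp)
  have hm : ContDiffAt ℝ ∞ (chartMul E G) (e, e) := (eventually_contDiffAt_chartMul E G).self_of_nhds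
  set D := fderiv ℝ (chartMul E G) with hD
  have hDD : HasFDerivAt D (fderiv ℝ D (e, e)) (e, e) :=
    ((hm.fderiv_right (m := ∞) (by simp)).differentiableAt (by simp)).hasFDerivAt
  set DD := fderiv ℝ D (e, e) with hDDdef
  -- the bracket and the derivative of `Ad` are compared by the symmetry of the second derivative
  -- of the multiplication
  have hsymm : ∀ p q : E × E, DD p q = DD q p := fun p q =>
    (hm.isSymmSndFDerivAt (by rw [minSmoothness_of_isRCLikeNormedField]; exact ENat.LEInfty.out)) p q
  have hl : HasFDerivAt (fun a => D (e, a)) (DD.comp (ContinuousLinearMap.inr ℝ E E)) e :=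
    HasFDerivAt.comp (g := D) (f := fun a => (e, a)) e hDD (hasFDerivAt_prodMk_right e e)
  have hr : HasFDerivAt (fun a => D (a, e)) (DD.comp (ContinuousLinearMap.inl ℝ E E)) e :=
    HasFDerivAt.comp (g := D) (f := fun a => (a, e)) e hDD (hasFDerivAt_prodMk_left e e)
  -- the derivative of an invariant field
  have hX : ∀ ζ : GroupLieAlgebra 𝓘(ℝ, E) G, HasFDerivAt
      (fun a => chartField 𝓘(ℝ, E) (mulInvariantVectorField ζ) (1 : G) a)
      ((DD.comp (ContinuousLinearMap.inl ℝ E E)).flip ((0 : E), (ζ : E))) e := by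
    intro ζ
    have h1 := hr.clm_apply (hasFDerivAt_const ((0 : E), (ζ : E)) e)
    have h2 : (D (e, e)).comp (0 : E →L[ℝ] E × E) +
        (DD.comp (ContinuousLinearMap.inl ℝ E E)).flip ((0 : E), (ζ : E)) =
          (DD.comp (ContinuousLinearMap.inl ℝ E E)).flip ((0 : E), (ζ : E)) := by
      ext; simp
    rw [← h2]
    exact h1.congr_of_eventuallyEq (eventually_fderiv_chartMul_left ζ)
  have h1 : HasFDerivAt (fun a => D (e, a) (α a, 0))
      ((D (e, e)).comp ((ContinuousLinearMap.inl ℝ E E).comp (fderiv ℝ α e)) +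
        (DD.comp (ContinuousLinearMap.inr ℝ E E)).flip (α e, 0)) e :=
    hl.clm_apply ((ContinuousLinearMap.inl ℝ E E).hasFDerivAt.comp e hα.hasFDerivAt)
  have h2 := h1.congr_of_eventuallyEq (eventually_fderiv_chartMul_right ξ)
  have h3 := h2.unique (hX ξ)
  have hD1 : ∀ u : E, D (e, e) (u, 0) = u := by
    have h4 : HasFDerivAt (fun a => chartMul E G (a, e))
        ((D (e, e)).comp (ContinuousLinearMap.inl ℝ E E)) e :=
      HasFDerivAt.comp (g := chartMul E G) (f := fun a => (a, e)) e
        (hm.differentiableAt (by simp)).hasFDerivAt (hasFDerivAt_prodMk_left e e)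
    have h5 : (fun a => chartMul E G (a, e)) =ᶠ[𝓝 e] id := by
      filter_upwards [(isOpen_extChartAt_target (I := 𝓘(ℝ, E)) (1 : G)).mem_nhds
        (mem_extChartAt_target 1)] with a ha
      have h6 : chartMul E G (a, e) = ψ (ψ.symm a * ψ.symm e) := rfl
      rw [h6, hes, mul_one]
      exact ψ.right_inv ha
    have h7 := (h4.congr_of_eventuallyEq h5.symm).unique (hasFDerivAt_id e)
    exact fun u => DFunLike.congr_fun h7 u
  refine ⟨fderiv ℝ α e, ?_, fun η => ?_⟩
  · have h8 := (hα.hasFDerivAt.hasMFDerivAt).comp (1 : G) hasMFDerivAt_extChartAt_one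
    refine (h8.congr_of_eventuallyEq ?_ :)
    filter_upwards [extChartAt_source_mem_nhds (I := 𝓘(ℝ, E)) (1 : G)] with u hu
    have : α (ψ u) = adOrbit ξ u := by
      change adOrbit ξ (ψ.symm (ψ u)) = adOrbit ξ u
      rw [(extChartAt 𝓘(ℝ, E) (1 : G)).left_inv hu]
    exact this.symm
  · have h4 := DFunLike.congr_fun h3 (η : E)
    have h5 : D (e, e) (fderiv ℝ α e η, 0) + DD (0, (η : E)) (α e, 0) =
      DD ((η : E), 0) (0, (ξ : E)) := h4
    rw [hD1, hα0, hsymm] at h5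
    refine Eq.trans ?_ (bracket_eq_sub_fderiv_fderiv_chartMul η ξ).symm
    rw [(hX ξ).fderiv, (hX η).fderiv]
    exact eq_sub_of_add_eq h5

/-- The derivative of the adjoint action at `g` in the direction `g · η`. -/
theorem mfderiv_adOrbit_mulInvariantVectorField (ξ η : GroupLieAlgebra 𝓘(ℝ, E) G) (g : G)
    {L : E →L[ℝ] E} (hL : HasMFDerivAt 𝓘(ℝ, E) 𝓘(ℝ, E) (adOrbit ξ) g L) :
    L (mulInvariantVectorField η g) = lieAd E g ⁅η, ξ⁆ := by
  obtain ⟨L₁, hL₁, hb⟩ := hasMFDerivAt_adOrbit_one ξ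
  have h1 : HasMFDerivAt 𝓘(ℝ, E) 𝓘(ℝ, E) (adOrbit ξ) (g * 1) L := by
    rw [mul_one]
    exact hL
  have h2 := h1.comp (1 : G) (hasMFDerivAt_mul_left g 1)
  let A : E →L[ℝ] E := lieAd E g
  have h3 := (A.hasFDerivAt (x := adOrbit ξ (1 : G))).hasMFDerivAt.comp (1 : G) hL₁
  have h4 : adOrbit ξ ∘ (fun u => g * u) = A ∘ adOrbit ξ := by
    funext u
    exact lieAd_mul_apply g u ξ
  rw [h4] at h2
  refine (DFunLike.congr_fun (hasMFDerivAt_unique h2 h3) η).trans ?_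
  exact congrArg A (hb η)

end AdjointDerivative

section BracketAlgebra

theorem HasMFDerivAt.prodMk_modelSpace {E H M V W : Type*} [NormedAddCommGroup E] [NormedSpace ℝ E]
    [TopologicalSpace H] {I : ModelWithCorners ℝ E H} [TopologicalSpace M] [ChartedSpace H M]
    [NormedAddCommGroup V] [NormedSpace ℝ V] [NormedAddCommGroup W] [NormedSpace ℝ W]
    {f : M → V} {g : M → W} {x : M} {f' : E →L[ℝ] V} {g' : E →L[ℝ] W}
    (hf : HasMFDerivAt I 𝓘(ℝ, V) f x f') (hg : HasMFDerivAt I 𝓘(ℝ, W) g x g') :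
    HasMFDerivAt I 𝓘(ℝ, V × W) (fun x => (f x, g x)) x (f'.prod g') := by
  obtain ⟨P, hP⟩ : ∃ P : E →L[ℝ] V × W, HasMFDerivAt I 𝓘(ℝ, V × W) (fun x => (f x, g x)) x P :=
    ⟨_, (hf.mdifferentiableAt.prodMk_space hg.mdifferentiableAt).hasMFDerivAt⟩
  have h1 := ((ContinuousLinearMap.fst ℝ V W).hasFDerivAt (x := (f x, g x))).hasMFDerivAt.comp x hP
  have h2 := ((ContinuousLinearMap.snd ℝ V W).hasFDerivAt (x := (f x, g x))).hasMFDerivAt.comp x hP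
  have h3 : P = f'.prod g' := by
    ext v
    · exact DFunLike.congr_fun (hasMFDerivAt_unique h1 hf) v
    · exact DFunLike.congr_fun (hasMFDerivAt_unique h2 hg) v
  rwa [h3] at hP

variable {E : Type*} [NormedAddCommGroup E] [NormedSpace ℝ E]
  {G : Type*} [TopologicalSpace G] [ChartedSpace E G] [Group G] [LieGroup 𝓘(ℝ, E) ∞ G]

theorem bracket_swap (ξ η : GroupLieAlgebra 𝓘(ℝ, E) G) : ⁅ξ, η⁆ = -⁅η, ξ⁆ :=
  VectorField.mlieBracket_swap_apply

variable (E G) in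
/-- The bracket of the Lie algebra of a Lie group as a bilinear map. -/
def bracketBilin : LinearMap.BilinMap ℝ (GroupLieAlgebra 𝓘(ℝ, E) G) (GroupLieAlgebra 𝓘(ℝ, E) G) :=
  have hr : ∀ (c : ℝ) (η ξ ξ' : GroupLieAlgebra 𝓘(ℝ, E) G), ⁅η + c • ξ', ξ⁆ = ⁅η, ξ⁆ + c • ⁅ξ', ξ⁆ := by
    intro c η ξ ξ'
    obtain ⟨L, -, h⟩ := hasMFDerivAt_adOrbit_one ξ
    have h0 : ∀ a b : E, L (a + c • b) = L a + c • L b := fun a b => by simp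
    have h1 := h0 η ξ'
    refine (h _).symm.trans (h1.trans ?_)
    rw [h η, h ξ']
    rfl
  have ha : ∀ η ξ' ξ : GroupLieAlgebra 𝓘(ℝ, E) G, ⁅η + ξ', ξ⁆ = ⁅η, ξ⁆ + ⁅ξ', ξ⁆ := fun η ξ' ξ => by
    simpa using hr 1 η ξ ξ'
  have hs : ∀ (c : ℝ) (ξ' ξ : GroupLieAlgebra 𝓘(ℝ, E) G), ⁅c • ξ', ξ⁆ = c • ⁅ξ', ξ⁆ := fun c ξ' ξ => by
    have h0 : (⁅(0 : GroupLieAlgebra 𝓘(ℝ, E) G), ξ⁆ : GroupLieAlgebra 𝓘(ℝ, E) G) = 0 := by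
      simpa using ha 0 0 ξ
    simpa [h0] using hr c 0 ξ ξ'
  LinearMap.mk₂ ℝ (fun ξ η => ⁅ξ, η⁆) ha hs
    (fun η ξ ξ' => by rw [bracket_swap, ha, neg_add, ← bracket_swap, ← bracket_swap])
    (fun c η ξ => by rw [bracket_swap, hs, ← smul_neg, ← bracket_swap])

/-- An invariant scalar product makes the operators `ad` skew-symmetric. -/
theorem InertiaData.form_bracket [FiniteDimensional ℝ E] (S : InertiaData E G)
    (η ξ ζ : GroupLieAlgebra 𝓘(ℝ, E) G) :
    S.form ⁅η, ξ⁆ ζ + S.form ξ ⁅η, ζ⁆ = 0 := by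
  obtain ⟨L₁, hL₁, hb₁⟩ := hasMFDerivAt_adOrbit_one ξ
  obtain ⟨L₂, hL₂, hb₂⟩ := hasMFDerivAt_adOrbit_one ζ
  let B : E →L[ℝ] E →L[ℝ] ℝ := LinearMap.toContinuousLinearMap
    ((LinearMap.toContinuousLinearMap (𝕜 := ℝ) (E := E) (F' := ℝ)).toLinearMap ∘ₗ
      (show E →ₗ[ℝ] E →ₗ[ℝ] ℝ from S.form))
  have hB : IsBoundedBilinearMap ℝ fun p : E × E => B p.1 p.2 := B.isBoundedBilinearMap
  have h1 := ((hB.hasFDerivAt (adOrbit ξ (1 : G), adOrbit ζ (1 : G))).hasMFDerivAt).comp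
    (1 : G) (hL₁.prodMk_modelSpace hL₂)
  have h2 : ((fun p : E × E => B p.1 p.2) ∘ fun g : G => (adOrbit ξ g, adOrbit ζ g)) =
      fun _ => S.form ξ ζ := by
    funext g
    exact S.form_ad g ξ ζ
  rw [h2] at h1
  have h3 := DFunLike.congr_fun (hasMFDerivAt_unique h1 (hasMFDerivAt_const (S.form ξ ζ) (1 : G))) η
  have h4 : S.form (lieAd E (1 : G) ξ) (L₂ η) + S.form (L₁ η) (lieAd E (1 : G) ζ) = 0 := h3
  rw [hb₁, hb₂, lieAd_one_apply, lieAd_one_apply] at h4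
  rw [add_comm]
  exact h4

end BracketAlgebra

/-! ### The coset space, vertical and horizontal subspaces -/

section CosetGeometry

open Set Filter Topology

variable {E : Type*} [NormedAddCommGroup E] [NormedSpace ℝ E] [FiniteDimensional ℝ E]
  {G : Type*} [TopologicalSpace G] [ChartedSpace E G] [Group G] [LieGroup 𝓘(ℝ, E) ∞ G]
  {H : Subgroup G} {F : Type*} [NormedAddCommGroup F] [NormedSpace ℝ F]
  [ChartedSpace F (CosetSpace H)] [IsManifold 𝓘(ℝ, F) ∞ (CosetSpace H)]

theorem cosetProj_eq_iff {g g' : G} : cosetProj H g = cosetProj H g' ↔ g' * g⁻¹ ∈ H := by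
  rw [cosetProj, cosetProj, Quotient.eq]
  exact QuotientGroup.rightRel_apply

theorem cosetProj_mul_left {h : G} (hh : h ∈ H) (g : G) : cosetProj H (h * g) = cosetProj H g := by
  rw [cosetProj_eq_iff]
  simpa using H.inv_mem hh

theorem exists_cosetProj_eq (q : CosetSpace H) : ∃ g, cosetProj H g = q := Quotient.exists_rep q

variable (E H F) in
/-- The derivative at `u = 1` of the map `u ↦ H u g`. -/
def cosetDeriv (g : G) : E →L[ℝ] F :=
  mfderiv 𝓘(ℝ, E) 𝓘(ℝ, F) (fun u : G => cosetProj H (u * g)) 1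

theorem hasMFDerivAt_cosetProj (hs : Manifold.IsSubmersion 𝓘(ℝ, E) 𝓘(ℝ, F) ∞ (cosetProj H)) (g : G) :
    HasMFDerivAt 𝓘(ℝ, E) 𝓘(ℝ, F) (cosetProj H) g
      (mfderiv 𝓘(ℝ, E) 𝓘(ℝ, F) (cosetProj H) g : E →L[ℝ] F) :=
  ((hs.isSubmersionAt g).contMDiffAt.mdifferentiableAt (by simp)).hasMFDerivAt

theorem hasMFDerivAt_cosetDeriv (hs : Manifold.IsSubmersion 𝓘(ℝ, E) 𝓘(ℝ, F) ∞ (cosetProj H))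
    (g : G) : HasMFDerivAt 𝓘(ℝ, E) 𝓘(ℝ, F) (fun u : G => cosetProj H (u * g)) 1
      (cosetDeriv E H F g) := by
  have h1 := ((hasMFDerivAt_cosetProj hs (1 * g)).comp (1 : G) (hasMFDerivAt_mul_right g 1))
  exact h1.mdifferentiableAt.hasMFDerivAt

theorem cosetDeriv_apply (hs : Manifold.IsSubmersion 𝓘(ℝ, E) 𝓘(ℝ, F) ∞ (cosetProj H)) (g : G) (x : E) :
    cosetDeriv E H F g x = (mfderiv 𝓘(ℝ, E) 𝓘(ℝ, F) (cosetProj H) g : E →L[ℝ] F)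
      ((mfderiv 𝓘(ℝ, E) 𝓘(ℝ, E) (fun u : G => u * g) 1 : E →L[ℝ] E) x) := by
  have h1 : HasMFDerivAt 𝓘(ℝ, E) 𝓘(ℝ, F) (cosetProj H) (1 * g)
      (mfderiv 𝓘(ℝ, E) 𝓘(ℝ, F) (cosetProj H) g : E →L[ℝ] F) := by
    rw [one_mul]
    exact hasMFDerivAt_cosetProj hs g
  exact DFunLike.congr_fun (hasMFDerivAt_unique (hasMFDerivAt_cosetDeriv hs g)
    (h1.comp (1 : G) (hasMFDerivAt_mul_right g 1))) x

theorem mfderiv_cosetProj_mulInvariantVectorField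
    (hs : Manifold.IsSubmersion 𝓘(ℝ, E) 𝓘(ℝ, F) ∞ (cosetProj H)) (g : G)
    (ξ : GroupLieAlgebra 𝓘(ℝ, E) G) :
    (mfderiv 𝓘(ℝ, E) 𝓘(ℝ, F) (cosetProj H) g (mulInvariantVectorField ξ g) : F) =
      cosetDeriv E H F g (lieAd E g ξ) := by
  exact (congrArg (mfderiv 𝓘(ℝ, E) 𝓘(ℝ, F) (cosetProj H) g : E →L[ℝ] F)
    (mulInvariantVectorField_eq_mfderiv_mul_right g ξ)).trans (cosetDeriv_apply hs g _).symm

theorem mfderiv_mul_right_inv (g : G) (x : E) :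
    (mfderiv 𝓘(ℝ, E) 𝓘(ℝ, E) (fun u : G => u * g) 1 : E →L[ℝ] E)
      ((mfderiv 𝓘(ℝ, E) 𝓘(ℝ, E) (fun u : G => u * g⁻¹) g : E →L[ℝ] E) x) = x := by
  have h1 : HasMFDerivAt 𝓘(ℝ, E) 𝓘(ℝ, E) (fun u : G => u * g) (g * g⁻¹)
      (mfderiv 𝓘(ℝ, E) 𝓘(ℝ, E) (fun u : G => u * g) 1 : E →L[ℝ] E) := by
    rw [mul_inv_cancel]
    exact hasMFDerivAt_mul_right g 1
  have h2 := h1.comp g (hasMFDerivAt_mul_right g⁻¹ g)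
  have h3 : ((fun u : G => u * g) ∘ fun u => u * g⁻¹) = id := by
    funext u
    simp
  rw [h3] at h2
  exact DFunLike.congr_fun (hasMFDerivAt_unique h2 (hasMFDerivAt_id (I := 𝓘(ℝ, E)) g)) x

theorem mfderiv_mul_right_inv' (g : G) (x : E) :
    (mfderiv 𝓘(ℝ, E) 𝓘(ℝ, E) (fun u : G => u * g⁻¹) g : E →L[ℝ] E)
      ((mfderiv 𝓘(ℝ, E) 𝓘(ℝ, E) (fun u : G => u * g) 1 : E →L[ℝ] E) x) = x := by
  have h1 : HasMFDerivAt 𝓘(ℝ, E) 𝓘(ℝ, E) (fun u : G => u * g⁻¹) (1 * g)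
      (mfderiv 𝓘(ℝ, E) 𝓘(ℝ, E) (fun u : G => u * g⁻¹) g : E →L[ℝ] E) := by
    rw [one_mul]
    exact hasMFDerivAt_mul_right g⁻¹ g
  have h2 := h1.comp (1 : G) (hasMFDerivAt_mul_right g 1)
  have h3 : ((fun u : G => u * g⁻¹) ∘ fun u => u * g) = id := by
    funext u
    simp
  rw [h3] at h2
  exact DFunLike.congr_fun (hasMFDerivAt_unique h2 (hasMFDerivAt_id (I := 𝓘(ℝ, E)) (1 : G))) x

theorem surjective_cosetDeriv (hs : Manifold.IsSubmersion 𝓘(ℝ, E) 𝓘(ℝ, F) ∞ (cosetProj H)) (g : G) :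
    Function.Surjective (cosetDeriv E H F g : E →L[ℝ] F) := by
  intro v
  obtain ⟨x, hx⟩ : ∃ x : E, (mfderiv 𝓘(ℝ, E) 𝓘(ℝ, F) (cosetProj H) g : E →L[ℝ] F) x = v :=
    surjective_mfderiv_of_submersion (hs.isSubmersionAt g) v
  refine ⟨(mfderiv 𝓘(ℝ, E) 𝓘(ℝ, E) (fun u : G => u * g⁻¹) g : E →L[ℝ] E) x, ?_⟩
  refine (cosetDeriv_apply hs g _).trans ?_
  let D : E →L[ℝ] F := mfderiv 𝓘(ℝ, E) 𝓘(ℝ, F) (cosetProj H) g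
  exact (congrArg D (mfderiv_mul_right_inv g x)).trans hx

/-- The kernel of the derivative of `u ↦ H u g` is the Lie algebra of `H`. -/
theorem cosetDeriv_eq_zero_iff (hs : Manifold.IsSubmersion 𝓘(ℝ, E) 𝓘(ℝ, F) ∞ (cosetProj H)) (g : G)
    (x : GroupLieAlgebra 𝓘(ℝ, E) G) :
    cosetDeriv E H F g (x : E) = 0 ↔ x ∈ subgroupLieAlgebra E H := by
  constructor
  · intro h
    replace h := (cosetDeriv_apply hs g _).symm.trans h
    obtain ⟨γ, hγ0, hγ, hγd⟩ := exists_curve_in_fibre_of_submersion (hs.isSubmersionAt g) h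
    refine Submodule.subset_span ⟨fun t => γ t * g⁻¹, by simp [hγ0], fun t => ?_, ?_⟩
    · exact cosetProj_eq_iff.1 (hγ t).symm
    · have h1 : HasMFDerivAt 𝓘(ℝ, E) 𝓘(ℝ, E) (fun u : G => u * g⁻¹) (γ 0)
          (mfderiv 𝓘(ℝ, E) 𝓘(ℝ, E) (fun u : G => u * g⁻¹) g : E →L[ℝ] E) := by
        rw [hγ0]
        exact hasMFDerivAt_mul_right g⁻¹ g
      have h2 := h1.comp (0 : ℝ) hγd
      have h3 : ∀ (R R' : E →L[ℝ] E) (x : E), R (R' x) = x →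
          R.comp ((1 : ℝ →L[ℝ] ℝ).smulRight (R' x)) = (1 : ℝ →L[ℝ] ℝ).smulRight x := by
        intro R R' x hx
        ext
        simp [hx]
      exact (h3 _ (mfderiv 𝓘(ℝ, E) 𝓘(ℝ, E) (fun u : G => u * g) 1) (x : E)
        (mfderiv_mul_right_inv' (E := E) g x)) ▸ h2
  · intro h
    let L : GroupLieAlgebra 𝓘(ℝ, E) G →ₗ[ℝ] F :=
      (show E →ₗ[ℝ] F from (cosetDeriv E H F g : E →L[ℝ] F).toLinearMap)
    suffices subgroupLieAlgebra E H ≤ LinearMap.ker L from this h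
    refine Submodule.span_le.2 ?_
    rintro ξ ⟨γ, hγ0, hγ, hγd⟩
    have h1 : HasMFDerivAt 𝓘(ℝ, E) 𝓘(ℝ, F) (fun u : G => cosetProj H (u * g)) (γ 0)
        (cosetDeriv E H F g) := by
      rw [hγ0]
      exact hasMFDerivAt_cosetDeriv hs g
    have h2 := h1.comp (0 : ℝ) hγd
    have h3 : ((fun u : G => cosetProj H (u * g)) ∘ γ) = fun _ => cosetProj H g :=
      funext fun t => cosetProj_mul_left (hγ t) g
    rw [h3] at h2
    have h4 := DFunLike.congr_fun (hasMFDerivAt_unique h2 (hasMFDerivAt_const (cosetProj H g) (0 : ℝ)))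
      (1 : ℝ)
    have h5 : (cosetDeriv E H F g : E →L[ℝ] F) ((1 : ℝ) • (ξ : E)) = 0 := h4
    rw [one_smul] at h5
    exact h5

theorem cosetDeriv_mul_left (hs : Manifold.IsSubmersion 𝓘(ℝ, E) 𝓘(ℝ, F) ∞ (cosetProj H)) {h : G}
    (hh : h ∈ H) (g : G) (x : GroupLieAlgebra 𝓘(ℝ, E) G) :
    cosetDeriv E H F (h * g) (x : E) = cosetDeriv E H F g (lieAd E h⁻¹ x) := by
  have h1 : HasMFDerivAt 𝓘(ℝ, E) 𝓘(ℝ, F) (fun u : G => cosetProj H (u * g)) (h⁻¹ * 1 * h⁻¹⁻¹)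
      (cosetDeriv E H F g) := by
    have : h⁻¹ * 1 * h⁻¹⁻¹ = 1 := by simp
    rw [this]
    exact hasMFDerivAt_cosetDeriv hs g
  have h2 := h1.comp (1 : G) (hasMFDerivAt_conj (E := E) h⁻¹)
  have h3 : ((fun u : G => cosetProj H (u * g)) ∘ fun u => h⁻¹ * u * h⁻¹⁻¹) =
      fun u : G => cosetProj H (u * (h * g)) := by
    funext u
    have := cosetProj_mul_left (H.inv_mem hh) (u * (h * g))
    rw [← this]
    simp [mul_assoc]
  rw [h3] at h2
  exact DFunLike.congr_fun (hasMFDerivAt_unique (hasMFDerivAt_cosetDeriv hs (h * g)) h2) x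

theorem lieAd_mem_subgroupLieAlgebra (hs : Manifold.IsSubmersion 𝓘(ℝ, E) 𝓘(ℝ, F) ∞ (cosetProj H))
    {h : G} (hh : h ∈ H) {x : GroupLieAlgebra 𝓘(ℝ, E) G} (hx : x ∈ subgroupLieAlgebra E H) :
    lieAd E h x ∈ subgroupLieAlgebra E H := by
  rw [← cosetDeriv_eq_zero_iff hs 1] at hx ⊢
  have h1 := cosetDeriv_mul_left hs (H.inv_mem hh) 1 x
  rw [inv_inv] at h1
  rw [← h1, cosetDeriv_eq_zero_iff hs, ← cosetDeriv_eq_zero_iff hs 1]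
  exact hx

end CosetGeometry

namespace InertiaData

open Set Filter Topology

variable {E : Type*} [NormedAddCommGroup E] [NormedSpace ℝ E] [FiniteDimensional ℝ E]
  {G : Type*} [TopologicalSpace G] [ChartedSpace E G] [Group G] [LieGroup 𝓘(ℝ, E) ∞ G]
  (S : InertiaData E G) {H : Subgroup G}

theorem mem_horizontal_iff {g : G} {ξ : GroupLieAlgebra 𝓘(ℝ, E) G} :
    ξ ∈ S.horizontal H g ↔ lieAd E g ξ ∈ S.form.orthogonal (subgroupLieAlgebra E H) := by
  constructor
  · rintro ⟨x, hx, rfl⟩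
    change lieAd E g (lieAd E g⁻¹ x) ∈ _
    rw [lieAd_apply_lieAd_inv]
    exact hx
  · intro h
    exact ⟨_, h, lieAd_inv_apply_lieAd g ξ⟩


theorem mem_vertical_iff {g : G} {ξ : GroupLieAlgebra 𝓘(ℝ, E) G} :
    ξ ∈ vertical H g ↔ lieAd E g ξ ∈ subgroupLieAlgebra E H := by
  constructor
  · rintro ⟨x, hx, rfl⟩
    change lieAd E g (lieAd E g⁻¹ x) ∈ _
    rw [lieAd_apply_lieAd_inv]
    exact hx
  · intro h
    exact ⟨_, h, lieAd_inv_apply_lieAd g ξ⟩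

theorem form_eq_zero_of_mem {g : G} {ξ η : GroupLieAlgebra 𝓘(ℝ, E) G} (hξ : ξ ∈ vertical H g)
    (hη : η ∈ S.horizontal H g) : S.form ξ η = 0 := by
  rw [← S.form_ad g]
  exact S.mem_horizontal_iff.1 hη _ (mem_vertical_iff.1 hξ)

theorem eq_zero_of_form_self {ξ : GroupLieAlgebra 𝓘(ℝ, E) G} (h : S.form ξ ξ = 0) : ξ = 0 := by
  by_contra hne
  exact (S.form_pos ξ hne).ne' h

variable (H) in
theorem isCompl_orthogonal :
    IsCompl (subgroupLieAlgebra E H) (S.form.orthogonal (subgroupLieAlgebra E H)) := by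
  haveI : FiniteDimensional ℝ (GroupLieAlgebra 𝓘(ℝ, E) G) := inferInstanceAs (FiniteDimensional ℝ E)
  rw [LinearMap.BilinForm.isCompl_orthogonal_iff_disjoint]
  · rw [Submodule.disjoint_def]
    intro x hx hx'
    exact S.eq_zero_of_form_self (hx' x hx)
  · intro x y h
    rw [S.form_symm]
    exact h

variable (H) in
theorem exists_add_eq (g : G) (ξ : GroupLieAlgebra 𝓘(ℝ, E) G) :
    ∃ a ∈ vertical H g, ∃ b ∈ S.horizontal H g, a + b = ξ := by
  have h1 : lieAd E g ξ ∈ subgroupLieAlgebra E H ⊔ S.form.orthogonal (subgroupLieAlgebra E H) := by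
    rw [(S.isCompl_orthogonal H).sup_eq_top]
    exact Submodule.mem_top
  obtain ⟨a, ha, b, hb, hab⟩ := Submodule.mem_sup.1 h1
  refine ⟨lieAd E g⁻¹ a, ⟨a, ha, rfl⟩, lieAd E g⁻¹ b, ⟨b, hb, rfl⟩, ?_⟩
  rw [← map_add, hab, lieAd_inv_apply_lieAd]

/-- The scalar product is positive definite, so that the vector chosen in `orthProj` is unique. -/
theorem orthProj_add {g : G} {a b : GroupLieAlgebra 𝓘(ℝ, E) G} (ha : a ∈ vertical H g)
    (hb : b ∈ S.horizontal H g) : S.orthProj (vertical H g) (a + b) = a := by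
  have h1 : a ∈ vertical H g ∧ ∀ ζ ∈ vertical H g, S.form (a + b - a) ζ = 0 := by
    refine ⟨ha, fun ζ hζ => ?_⟩
    rw [add_sub_cancel_left, S.form_symm]
    exact S.form_eq_zero_of_mem hζ hb
  obtain ⟨h2, h3⟩ := Classical.epsilon_spec (p := fun η => η ∈ vertical H g ∧
    ∀ ζ ∈ vertical H g, S.form (a + b - η) ζ = 0) ⟨a, h1⟩
  set c := S.orthProj (vertical H g) (a + b) with hc
  have h4 : c - a ∈ vertical H g := Submodule.sub_mem _ h2 ha
  have h5 : S.form (c - a) (c - a) = 0 := by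
    have h6 := h1.2 _ h4
    have h7 : S.form (a + b - c) (c - a) = 0 := h3 _ h4
    have h8 : c - a = (a + b - a) - (a + b - c) := by abel
    calc S.form (c - a) (c - a) = S.form ((a + b - a) - (a + b - c)) (c - a) := by rw [← h8]
      _ = 0 := by
        rw [map_sub S.form, LinearMap.sub_apply, h6, h7, sub_zero]
  exact sub_eq_zero.1 (S.eq_zero_of_form_self h5)

variable {F : Type*} [NormedAddCommGroup F] [NormedSpace ℝ F]
  [ChartedSpace F (CosetSpace H)] [IsManifold 𝓘(ℝ, F) ∞ (CosetSpace H)]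

/-- The distribution `g⁻¹ 𝔡 g` is constant along the cosets. -/
theorem horizontal_mul_left (hs : Manifold.IsSubmersion 𝓘(ℝ, E) 𝓘(ℝ, F) ∞ (cosetProj H))
    {h : G} (hh : h ∈ H) {g : G} {ξ : GroupLieAlgebra 𝓘(ℝ, E) G} (hξ : ξ ∈ S.horizontal H g) :
    ξ ∈ S.horizontal H (h * g) := by
  rw [mem_horizontal_iff] at hξ ⊢
  intro y hy
  have h1 := hξ _ (lieAd_mem_subgroupLieAlgebra hs (H.inv_mem hh) hy)
  change S.form y (lieAd E (h * g) ξ) = 0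
  have h2 : S.form (lieAd E h⁻¹ y) (lieAd E g ξ) = 0 := h1
  rw [← S.form_ad h, lieAd_apply_lieAd_inv, ← lieAd_mul_apply] at h2
  exact h2

theorem horizontal_congr (hs : Manifold.IsSubmersion 𝓘(ℝ, E) 𝓘(ℝ, F) ∞ (cosetProj H)) {g g' : G}
    (hg : cosetProj H g = cosetProj H g') : S.horizontal H g = S.horizontal H g' := by
  have h1 := cosetProj_eq_iff.1 hg
  have h2 := cosetProj_eq_iff.1 hg.symm
  refine le_antisymm (fun ξ hξ => ?_) (fun ξ hξ => ?_)
  · simpa using S.horizontal_mul_left hs h1 hξ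
  · simpa using S.horizontal_mul_left hs h2 hξ

/-- A tangent vector of the coset space has a horizontal lift. -/
theorem exists_horizontal_lift (hs : Manifold.IsSubmersion 𝓘(ℝ, E) 𝓘(ℝ, F) ∞ (cosetProj H)) (g : G)
    (v : F) : ∃ ξ ∈ S.horizontal H g, cosetDeriv E H F g (lieAd E g ξ) = v := by
  obtain ⟨x, hx⟩ := surjective_cosetDeriv hs g v
  let ξ₀ : GroupLieAlgebra 𝓘(ℝ, E) G := lieAd E g⁻¹ (show GroupLieAlgebra 𝓘(ℝ, E) G from x)
  have hξ₀ : lieAd E g ξ₀ = x := lieAd_apply_lieAd_inv g _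
  obtain ⟨a, ha, b, hb, hab⟩ := S.exists_add_eq H g ξ₀
  refine ⟨b, hb, ?_⟩
  have h1 : cosetDeriv E H F g (lieAd E g a) = 0 :=
    (cosetDeriv_eq_zero_iff hs g _).2 (mem_vertical_iff.1 ha)
  have h2 : lieAd E g ξ₀ = lieAd E g a + lieAd E g b := by rw [← hab, map_add]
  have h3 : cosetDeriv E H F g (lieAd E g ξ₀) =
      cosetDeriv E H F g (lieAd E g a) + cosetDeriv E H F g (lieAd E g b) :=
    (congrArg (cosetDeriv E H F g) h2).trans ((cosetDeriv E H F g).map_add _ _)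
  rw [h1, zero_add] at h3
  rw [← h3, ← hx]
  exact congrArg (cosetDeriv E H F g) hξ₀

/-- A horizontal vector is determined by its projection. -/
theorem eq_of_cosetDeriv_eq (hs : Manifold.IsSubmersion 𝓘(ℝ, E) 𝓘(ℝ, F) ∞ (cosetProj H)) {g : G}
    {ξ η : GroupLieAlgebra 𝓘(ℝ, E) G} (hξ : ξ ∈ S.horizontal H g) (hη : η ∈ S.horizontal H g)
    (h : cosetDeriv E H F g (lieAd E g ξ) = cosetDeriv E H F g (lieAd E g η)) : ξ = η := by
  have h1 : lieAd E g (ξ - η) ∈ subgroupLieAlgebra E H := by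
    rw [← cosetDeriv_eq_zero_iff hs g]
    have h2 : lieAd E g (ξ - η) = lieAd E g ξ - lieAd E g η := map_sub _ _ _
    refine (congrArg (cosetDeriv E H F g) h2).trans (((cosetDeriv E H F g).map_sub _ _).trans ?_)
    exact sub_eq_zero.2 h
  have h2 : ξ - η ∈ S.horizontal H g := Submodule.sub_mem _ hξ hη
  have h3 := S.form_eq_zero_of_mem (mem_vertical_iff.2 h1) h2
  exact sub_eq_zero.1 (S.eq_zero_of_form_self h3)

theorem cosetDeriv_lieAd_congr (hs : Manifold.IsSubmersion 𝓘(ℝ, E) 𝓘(ℝ, F) ∞ (cosetProj H)) {g g' : G}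
    (hg : cosetProj H g = cosetProj H g') (ξ : GroupLieAlgebra 𝓘(ℝ, E) G) :
    cosetDeriv E H F g (lieAd E g ξ) = cosetDeriv E H F g' (lieAd E g' ξ) := by
  have h1 := cosetProj_eq_iff.1 hg
  have h2 := cosetDeriv_mul_left hs h1 g (lieAd E g' ξ)
  rw [inv_mul_cancel_right, ← lieAd_mul_apply] at h2
  simpa using h2.symm

/-- The characterization of the momentum map by an arbitrary representative of the coset. -/
theorem Phi_spec (hs : Manifold.IsSubmersion 𝓘(ℝ, E) 𝓘(ℝ, F) ∞ (cosetProj H)) (g : G)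
    {q : CosetSpace H} (hg : cosetProj H g = q) (v : TangentSpace 𝓘(ℝ, F) q) :
    S.Phi H q v ∈ S.horizontal H g ∧ cosetDeriv E H F g (lieAd E g (S.Phi H q v)) = v := by
  have ho : cosetProj H q.out = q := Quotient.out_eq q
  obtain ⟨ξ, hξ, hξv⟩ := S.exists_horizontal_lift hs q.out v
  obtain ⟨h1, h2⟩ := Classical.epsilon_spec (p := fun ξ => ξ ∈ S.horizontal H q.out ∧
    (mfderiv 𝓘(ℝ, E) 𝓘(ℝ, F) (cosetProj H) q.out (mulInvariantVectorField ξ q.out) : F) = v)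
    ⟨ξ, hξ, (mfderiv_cosetProj_mulInvariantVectorField hs _ ξ).trans hξv⟩
  have h3 : cosetProj H q.out = cosetProj H g := ho.trans hg.symm
  refine ⟨S.horizontal_congr hs h3 ▸ h1, ?_⟩
  exact (cosetDeriv_lieAd_congr hs h3 _).symm.trans
    ((mfderiv_cosetProj_mulInvariantVectorField hs _ _).symm.trans h2)

theorem Phi_eq (hs : Manifold.IsSubmersion 𝓘(ℝ, E) 𝓘(ℝ, F) ∞ (cosetProj H)) {g : G}
    {q : CosetSpace H} (hg : cosetProj H g = q) {v : TangentSpace 𝓘(ℝ, F) q}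
    {ξ : GroupLieAlgebra 𝓘(ℝ, E) G} (hξ : ξ ∈ S.horizontal H g)
    (hv : cosetDeriv E H F g (lieAd E g ξ) = v) : S.Phi H q v = ξ := by
  obtain ⟨h1, h2⟩ := S.Phi_spec hs g hg v
  exact S.eq_of_cosetDeriv_eq hs h1 hξ (h2.trans hv.symm)

end InertiaData

/-! ### The momentum map in coordinates and its structure equation -/

section TangentCoordinates

variable {F : Type*} [NormedAddCommGroup F] [NormedSpace ℝ F]
  {Q : Type*} [TopologicalSpace Q] [ChartedSpace F Q] [IsManifold 𝓘(ℝ, F) ∞ Q]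

variable (F) in
/-- The inverse of the trivialization of the tangent bundle over the chart around `q₀`, with values
in the model space. -/
def tangentSymm (q₀ q : Q) : F →L[ℝ] F :=
  (trivializationAt F (TangentSpace 𝓘(ℝ, F)) q₀).symmL ℝ q

theorem mfderiv_extChartAt_tangentSymm {q₀ q : Q} (hq : q ∈ (extChartAt 𝓘(ℝ, F) q₀).source) (v : F) :
    (mfderiv 𝓘(ℝ, F) 𝓘(ℝ, F) (extChartAt 𝓘(ℝ, F) q₀) q : F →L[ℝ] F) (tangentSymm F q₀ q v) = v := by
  have h1 := TangentBundle.continuousLinearMapAt_trivializationAt (I := 𝓘(ℝ, F)) (x₀ := q₀) (x := q)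
    (by simpa using hq)
  have h2 := (trivializationAt F (TangentSpace 𝓘(ℝ, F)) q₀).continuousLinearMapAt_symmL (R := ℝ)
    (b := q) (by simpa using hq) v
  rw [h1] at h2
  exact h2

theorem tangentSymm_mfderiv_extChartAt {q₀ q : Q} (hq : q ∈ (extChartAt 𝓘(ℝ, F) q₀).source) (v : F) :
    tangentSymm F q₀ q ((mfderiv 𝓘(ℝ, F) 𝓘(ℝ, F) (extChartAt 𝓘(ℝ, F) q₀) q : F →L[ℝ] F) v) = v := by
  have h1 := TangentBundle.continuousLinearMapAt_trivializationAt (I := 𝓘(ℝ, F)) (x₀ := q₀) (x := q)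
    (by simpa using hq)
  have h2 := (trivializationAt F (TangentSpace 𝓘(ℝ, F)) q₀).symmL_continuousLinearMapAt (R := ℝ)
    (b := q) (by simpa using hq) v
  rw [h1] at h2
  exact h2

end TangentCoordinates

namespace InertiaData

open Set Filter Topology

variable {E : Type*} [NormedAddCommGroup E] [NormedSpace ℝ E] [FiniteDimensional ℝ E]
  {G : Type*} [TopologicalSpace G] [ChartedSpace E G] [Group G] [LieGroup 𝓘(ℝ, E) ∞ G]
  (S : InertiaData E G) {H : Subgroup G}
  {F : Type*} [NormedAddCommGroup F] [NormedSpace ℝ F] [FiniteDimensional ℝ F]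
  [ChartedSpace F (CosetSpace H)] [IsManifold 𝓘(ℝ, F) ∞ (CosetSpace H)]

/-- The momentum map on a tangent space of the coset space, as a linear map of the model spaces. -/
def PhiL (hs : Manifold.IsSubmersion 𝓘(ℝ, E) 𝓘(ℝ, F) ∞ (cosetProj H)) (q : CosetSpace H) : F →L[ℝ] E :=
  have key : ∀ (c : ℝ) (v w : F), S.Phi H q (v + c • w : F) = S.Phi H q v + c • S.Phi H q w := by
    intro c v w
    obtain ⟨g, hg⟩ := exists_cosetProj_eq q
    obtain ⟨h1, h2⟩ := S.Phi_spec hs g hg v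
    obtain ⟨h3, h4⟩ := S.Phi_spec hs g hg w
    refine S.Phi_eq hs hg (Submodule.add_mem _ h1 (Submodule.smul_mem _ c h3)) ?_
    have h5 : lieAd E g (S.Phi H q v + c • S.Phi H q w) =
        lieAd E g (S.Phi H q v) + c • lieAd E g (S.Phi H q w) := by
      rw [map_add, map_smul]
    refine (congrArg (cosetDeriv E H F g) h5).trans
      (((cosetDeriv E H F g).map_add _ _).trans ?_)
    exact congrArg₂ (· + ·) h2 (((cosetDeriv E H F g).map_smul c _).trans (congrArg (c • ·) h4))
  have h0 : ∀ v : F, S.Phi H q v = (S.Phi H q v : E) := fun v => rfl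
  LinearMap.toContinuousLinearMap (𝕜 := ℝ) (E := F) (F' := E)
    { toFun := fun v => S.Phi H q v
      map_add' := fun v w => by
        have := key 1 v w
        rw [one_smul, one_smul] at this
        exact this
      map_smul' := fun c v => by
        have h1 := key (-1) v v
        rw [neg_one_smul, neg_one_smul, add_neg_cancel, add_neg_cancel] at h1
        have h2 := key c 0 v
        rw [h1, zero_add, zero_add] at h2
        exact h2 }

/-- The momentum map in the coordinates around `q₀`. -/
def localPhi (hs : Manifold.IsSubmersion 𝓘(ℝ, E) 𝓘(ℝ, F) ∞ (cosetProj H)) (q₀ : CosetSpace H) (y : F) :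
    F →L[ℝ] E :=
  (S.PhiL hs ((extChartAt 𝓘(ℝ, F) q₀).symm y)).comp
    (tangentSymm F q₀ ((extChartAt 𝓘(ℝ, F) q₀).symm y))

variable (E H F) in
/-- The derivative at `u = 1` of the map `u ↦ H u g`, read in the chart around `q₀`. -/
def chartCosetDeriv (q₀ : CosetSpace H) (g : G) : E →L[ℝ] F :=
  mfderiv 𝓘(ℝ, E) 𝓘(ℝ, F) (fun u : G => extChartAt 𝓘(ℝ, F) q₀ (cosetProj H (u * g))) 1

theorem mdifferentiableAt_extChartAt_of_mem {q₀ q : CosetSpace H}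
    (hq : q ∈ (extChartAt 𝓘(ℝ, F) q₀).source) :
    MDifferentiableAt 𝓘(ℝ, F) 𝓘(ℝ, F) (extChartAt 𝓘(ℝ, F) q₀) q :=
  haveI : IsManifold 𝓘(ℝ, F) 1 (CosetSpace H) := .of_le (n := ∞) (by norm_cast)
  mdifferentiableAt_extChartAt (by simpa using hq)

theorem hasMFDerivAt_chartCosetDeriv (hs : Manifold.IsSubmersion 𝓘(ℝ, E) 𝓘(ℝ, F) ∞ (cosetProj H))
    {q₀ : CosetSpace H} {g : G} (hg : cosetProj H g ∈ (extChartAt 𝓘(ℝ, F) q₀).source) :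
    HasMFDerivAt 𝓘(ℝ, E) 𝓘(ℝ, F) (fun u : G => extChartAt 𝓘(ℝ, F) q₀ (cosetProj H (u * g))) 1
      ((mfderiv 𝓘(ℝ, F) 𝓘(ℝ, F) (extChartAt 𝓘(ℝ, F) q₀) (cosetProj H g) : F →L[ℝ] F).comp
        (cosetDeriv E H F g)) := by
  have h1 : HasMFDerivAt 𝓘(ℝ, F) 𝓘(ℝ, F) (extChartAt 𝓘(ℝ, F) q₀) (cosetProj H (1 * g))
      (mfderiv 𝓘(ℝ, F) 𝓘(ℝ, F) (extChartAt 𝓘(ℝ, F) q₀) (cosetProj H g) : F →L[ℝ] F) := by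
    rw [one_mul]
    exact (mdifferentiableAt_extChartAt_of_mem hg).hasMFDerivAt
  exact h1.comp (1 : G) (hasMFDerivAt_cosetDeriv hs g)

theorem chartCosetDeriv_apply (hs : Manifold.IsSubmersion 𝓘(ℝ, E) 𝓘(ℝ, F) ∞ (cosetProj H))
    {q₀ : CosetSpace H} {g : G} (hg : cosetProj H g ∈ (extChartAt 𝓘(ℝ, F) q₀).source) (x : E) :
    chartCosetDeriv E H F q₀ g x =
      (mfderiv 𝓘(ℝ, F) 𝓘(ℝ, F) (extChartAt 𝓘(ℝ, F) q₀) (cosetProj H g) : F →L[ℝ] F)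
        (cosetDeriv E H F g x) :=
  DFunLike.congr_fun (hasMFDerivAt_chartCosetDeriv hs hg).mfderiv x

theorem localPhi_mem (hs : Manifold.IsSubmersion 𝓘(ℝ, E) 𝓘(ℝ, F) ∞ (cosetProj H))
    {q₀ : CosetSpace H} {g : G} (hg : cosetProj H g ∈ (extChartAt 𝓘(ℝ, F) q₀).source) (v : F) :
    (show GroupLieAlgebra 𝓘(ℝ, E) G from
      S.localPhi hs q₀ (extChartAt 𝓘(ℝ, F) q₀ (cosetProj H g)) v) ∈ S.horizontal H g :=
  (S.Phi_spec hs g ((extChartAt 𝓘(ℝ, F) q₀).left_inv hg).symm _).1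

theorem chartCosetDeriv_localPhi (hs : Manifold.IsSubmersion 𝓘(ℝ, E) 𝓘(ℝ, F) ∞ (cosetProj H))
    {q₀ : CosetSpace H} {g : G} (hg : cosetProj H g ∈ (extChartAt 𝓘(ℝ, F) q₀).source) (v : F) :
    chartCosetDeriv E H F q₀ g (lieAd E g
      (S.localPhi hs q₀ (extChartAt 𝓘(ℝ, F) q₀ (cosetProj H g)) v)) = v := by
  have hl := (extChartAt 𝓘(ℝ, F) q₀).left_inv hg
  have h1 := (S.Phi_spec hs g hl.symm
    (tangentSymm F q₀ ((extChartAt 𝓘(ℝ, F) q₀).symm (extChartAt 𝓘(ℝ, F) q₀ (cosetProj H g))) v : F)).2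
  refine (chartCosetDeriv_apply hs hg _).trans ?_
  let D : F →L[ℝ] F := mfderiv 𝓘(ℝ, F) 𝓘(ℝ, F) (extChartAt 𝓘(ℝ, F) q₀) (cosetProj H g)
  refine (congrArg D h1).trans ?_
  rw [hl]
  exact mfderiv_extChartAt_tangentSymm hg v

theorem localPhi_eq (hs : Manifold.IsSubmersion 𝓘(ℝ, E) 𝓘(ℝ, F) ∞ (cosetProj H))
    {q₀ : CosetSpace H} {g : G} (hg : cosetProj H g ∈ (extChartAt 𝓘(ℝ, F) q₀).source) {v : F}
    {ξ : GroupLieAlgebra 𝓘(ℝ, E) G} (hξ : ξ ∈ S.horizontal H g)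
    (hv : chartCosetDeriv E H F q₀ g (lieAd E g ξ) = v) :
    S.localPhi hs q₀ (extChartAt 𝓘(ℝ, F) q₀ (cosetProj H g)) v = ξ := by
  have hl := (extChartAt 𝓘(ℝ, F) q₀).left_inv hg
  refine S.Phi_eq hs hl.symm hξ ?_
  have h1 := (chartCosetDeriv_apply hs hg (lieAd E g ξ)).symm.trans hv
  rw [hl, ← h1]
  exact (tangentSymm_mfderiv_extChartAt hg _).symm

theorem contMDiff_cosetProj (hs : Manifold.IsSubmersion 𝓘(ℝ, E) 𝓘(ℝ, F) ∞ (cosetProj H)) :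
    ContMDiff 𝓘(ℝ, E) 𝓘(ℝ, F) ∞ (cosetProj H) := fun g => (hs.isSubmersionAt g).contMDiffAt

theorem contMDiffAt_chartCosetDeriv (hs : Manifold.IsSubmersion 𝓘(ℝ, E) 𝓘(ℝ, F) ∞ (cosetProj H))
    {q₀ : CosetSpace H} {g : G} (hg : cosetProj H g ∈ (extChartAt 𝓘(ℝ, F) q₀).source) :
    ContMDiffAt 𝓘(ℝ, E) 𝓘(ℝ, E →L[ℝ] F) ∞ (chartCosetDeriv E H F q₀) g := by
  have hc := contMDiff_cosetProj hs
  have hφ : ContMDiffOn 𝓘(ℝ, F) 𝓘(ℝ, F) ∞ (extChartAt 𝓘(ℝ, F) q₀) (extChartAt 𝓘(ℝ, F) q₀).source :=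
    (contMDiffOn_extChartAt (I := 𝓘(ℝ, F)) (n := ∞) (x := q₀)).mono (by simp)
  have ho := isOpen_extChartAt_source (I := 𝓘(ℝ, F)) q₀
  refine contMDiffAt_mfderiv_of_uncurry (J := 𝓘(ℝ, E))
    (h := fun (g u : G) => extChartAt 𝓘(ℝ, F) q₀ (cosetProj H (u * g))) ?_ ?_
  · have h1 : ContMDiff (𝓘(ℝ, E).prod 𝓘(ℝ, E)) 𝓘(ℝ, F) ∞
        (fun p : G × G => cosetProj H (p.2 * p.1)) := hc.comp (contMDiff_snd.mul contMDiff_fst)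
    refine ContMDiffAt.comp (g, (1 : G)) (g := extChartAt 𝓘(ℝ, F) q₀) ?_ h1.contMDiffAt
    refine hφ.contMDiffAt (ho.mem_nhds ?_)
    change cosetProj H (1 * g) ∈ _
    rw [one_mul]
    exact hg
  · filter_upwards [(ho.preimage hc.continuous).mem_nhds hg] with g' hg'
    exact (hasMFDerivAt_chartCosetDeriv hs hg').mdifferentiableAt

theorem contMDiffAt_localPhi_comp (hs : Manifold.IsSubmersion 𝓘(ℝ, E) 𝓘(ℝ, F) ∞ (cosetProj H))
    {q₀ : CosetSpace H} {g₀ : G} (hg : cosetProj H g₀ ∈ (extChartAt 𝓘(ℝ, F) q₀).source) :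
    ContMDiffAt 𝓘(ℝ, E) 𝓘(ℝ, F →L[ℝ] E) ∞
      (fun g => S.localPhi hs q₀ (extChartAt 𝓘(ℝ, F) q₀ (cosetProj H g))) g₀ := by
  let Ad : G → E →L[ℝ] E := fun g => lieAd E g
  have hAd : ContMDiff 𝓘(ℝ, E) 𝓘(ℝ, E →L[ℝ] E) ∞ Ad := contMDiff_lieAd
  -- `j` is an isomorphism to the orthogonal complement of the Lie algebra of `H`, chosen such that
  -- `T g₀ = 1`; near `g₀` the momentum map is `Ad_{g⁻¹} ∘ j ∘ (T g)⁻¹`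
  let j : F →L[ℝ] E := (Ad g₀).comp
    (S.localPhi hs q₀ (extChartAt 𝓘(ℝ, F) q₀ (cosetProj H g₀)))
  let T : G → F →L[ℝ] F := fun g => (chartCosetDeriv E H F q₀ g).comp j
  have hT : ContMDiffAt 𝓘(ℝ, E) 𝓘(ℝ, F →L[ℝ] F) ∞ T g₀ := by
    have h1 : ContDiff ℝ ∞ (fun A : E →L[ℝ] F => A.comp j) := by fun_prop
    exact h1.contMDiff.contMDiffAt.comp g₀ (contMDiffAt_chartCosetDeriv hs hg)
  have hT0 : T g₀ = ContinuousLinearEquiv.refl ℝ F := by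
    ext v
    exact S.chartCosetDeriv_localPhi hs hg v
  have hinv : ContMDiffAt 𝓘(ℝ, E) 𝓘(ℝ, F →L[ℝ] F) ∞ (fun g => ContinuousLinearMap.inverse (T g)) g₀ := by
    refine ContMDiffAt.comp g₀ (g := ContinuousLinearMap.inverse) ?_ hT
    rw [hT0]
    exact (contDiffAt_map_inverse _).contMDiffAt
  have hAdi : ContMDiffAt 𝓘(ℝ, E) 𝓘(ℝ, E →L[ℝ] E) ∞ (fun g => Ad g⁻¹) g₀ :=
    (hAd.comp (contMDiff_inv 𝓘(ℝ, E) ∞)).contMDiffAt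
  have h2 : ContMDiffAt 𝓘(ℝ, E) 𝓘(ℝ, F →L[ℝ] E) ∞
      (fun g => (Ad g⁻¹).comp (j.comp (ContinuousLinearMap.inverse (T g)))) g₀ := by
    have h3 : ContDiff ℝ ∞ (fun A : F →L[ℝ] F => j.comp A) := by fun_prop
    exact hAdi.clm_comp (h3.contMDiff.contMDiffAt.comp g₀ hinv)
  refine h2.congr_of_eventuallyEq ?_
  have hrange := hT.continuousAt.preimage_mem_nhds
    (hT0 ▸ (ContinuousLinearEquiv.refl ℝ F).nhds)
  filter_upwards [hrange, ((isOpen_extChartAt_source (I := 𝓘(ℝ, F)) q₀).preimage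
    (contMDiff_cosetProj hs).continuous).mem_nhds hg] with g hgr hgs
  obtain ⟨e, he⟩ := hgr
  ext v
  have h4 : T g (ContinuousLinearMap.inverse (T g) v) = v := by
    rw [← he]
    simp
  have hj : ∀ w, lieAd E g₀⁻¹ (show GroupLieAlgebra 𝓘(ℝ, E) G from j w) ∈ S.horizontal H g₀ := by
    intro w
    have h5 := S.localPhi_mem hs hg w
    have h6 := lieAd_inv_apply_lieAd g₀ (show GroupLieAlgebra 𝓘(ℝ, E) G from
      S.localPhi hs q₀ (extChartAt 𝓘(ℝ, F) q₀ (cosetProj H g₀)) w)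
    exact h6.symm ▸ h5
  set w := ContinuousLinearMap.inverse (T g) v with hw
  refine S.localPhi_eq hs hgs (ξ := lieAd E g⁻¹ (show GroupLieAlgebra 𝓘(ℝ, E) G from j w)) ?_ ?_
  · rw [mem_horizontal_iff, lieAd_apply_lieAd_inv]
    have := S.mem_horizontal_iff.1 (hj w)
    rwa [lieAd_apply_lieAd_inv] at this
  · exact (congrArg (chartCosetDeriv E H F q₀ g) (lieAd_apply_lieAd_inv g _)).trans h4

/-- The momentum map depends smoothly on the point. -/
theorem contDiffOn_localPhi (hs : Manifold.IsSubmersion 𝓘(ℝ, E) 𝓘(ℝ, F) ∞ (cosetProj H))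
    (q₀ : CosetSpace H) : ContDiffOn ℝ ∞ (S.localPhi hs q₀) (extChartAt 𝓘(ℝ, F) q₀).target := by
  intro y hy
  obtain ⟨g, hg⟩ := exists_cosetProj_eq ((extChartAt 𝓘(ℝ, F) q₀).symm y)
  have hgs : cosetProj H g ∈ (extChartAt 𝓘(ℝ, F) q₀).source := by
    rw [hg]
    exact (extChartAt 𝓘(ℝ, F) q₀).map_target hy
  have h1 : ContMDiffAt 𝓘(ℝ, F) 𝓘(ℝ, F →L[ℝ] E) ∞
      (fun q => S.localPhi hs q₀ (extChartAt 𝓘(ℝ, F) q₀ q)) (cosetProj H g) :=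
    contMDiffAt_of_comp_submersion (hs.isSubmersionAt g) (S.contMDiffAt_localPhi_comp hs hgs)
  rw [hg] at h1
  have h2 := h1.comp y ((contMDiffOn_extChartAt_symm (I := 𝓘(ℝ, F)) (n := ∞) q₀).contMDiffAt
    ((isOpen_extChartAt_target q₀).mem_nhds hy))
  refine (contMDiffAt_iff_contDiffAt.1 (h2.congr_of_eventuallyEq ?_)).contDiffWithinAt
  filter_upwards [(isOpen_extChartAt_target (I := 𝓘(ℝ, F)) q₀).mem_nhds hy] with z hz
  simp only [Function.comp_apply]
  rw [(extChartAt 𝓘(ℝ, F) q₀).right_inv hz]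

end InertiaData

variable (E : Type*) [NormedAddCommGroup E] [NormedSpace ℝ E]
  (G : Type*) [TopologicalSpace G] [ChartedSpace E G] [Group G] [LieGroup 𝓘(ℝ, E) ∞ G] in
/-- The bracket of the Lie algebra as a bilinear map of the model space. -/
def modelBracket : E →ₗ[ℝ] E →ₗ[ℝ] E := bracketBilin E G

namespace InertiaData

open Set Filter Topology

variable {E : Type*} [NormedAddCommGroup E] [NormedSpace ℝ E] [FiniteDimensional ℝ E]
  {G : Type*} [TopologicalSpace G] [ChartedSpace E G] [Group G] [LieGroup 𝓘(ℝ, E) ∞ G]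
  (S : InertiaData E G) {H : Subgroup G}
  {F : Type*} [NormedAddCommGroup F] [NormedSpace ℝ F] [FiniteDimensional ℝ F]
  [ChartedSpace F (CosetSpace H)] [IsManifold 𝓘(ℝ, F) ∞ (CosetSpace H)]

/-- A vector of `g⁻¹ 𝔡 g` is a value of the momentum map. -/
theorem exists_localPhi_eq (hs : Manifold.IsSubmersion 𝓘(ℝ, E) 𝓘(ℝ, F) ∞ (cosetProj H))
    {q₀ : CosetSpace H} {g : G} (hg : cosetProj H g ∈ (extChartAt 𝓘(ℝ, F) q₀).source)
    {ξ : GroupLieAlgebra 𝓘(ℝ, E) G} (hξ : ξ ∈ S.horizontal H g) :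
    ∃ u, S.localPhi hs q₀ (extChartAt 𝓘(ℝ, F) q₀ (cosetProj H g)) u = ξ :=
  ⟨_, S.localPhi_eq hs hg hξ rfl⟩

/-- A smooth curve of vectors `ξ(g) ∈ 𝔡` has its velocity in `𝔡`. -/
theorem mem_orthogonal_of_hasMFDerivAt {W : Submodule ℝ (GroupLieAlgebra 𝓘(ℝ, E) G)} {f : G → E}
    {g : G} {L : E →L[ℝ] E} (hf : HasMFDerivAt 𝓘(ℝ, E) 𝓘(ℝ, E) f g L)
    (h : ∀ᶠ u in 𝓝 g, (show GroupLieAlgebra 𝓘(ℝ, E) G from f u) ∈ S.form.orthogonal W) (x : E) :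
    (show GroupLieAlgebra 𝓘(ℝ, E) G from L x) ∈ S.form.orthogonal W := by
  intro n hn
  let B : E →L[ℝ] ℝ := LinearMap.toContinuousLinearMap (show E →ₗ[ℝ] ℝ from S.form n)
  have h1 := (B.hasFDerivAt (x := f g)).hasMFDerivAt.comp g hf
  have h2 : B ∘ f =ᶠ[𝓝 g] fun _ => 0 := by
    filter_upwards [h] with u hu using hu n hn
  have h3 := hasMFDerivAt_unique h1 ((hasMFDerivAt_const (0 : ℝ) g).congr_of_eventuallyEq h2)
  exact DFunLike.congr_fun h3 x

/-- The structure equation of the momentum map: differentiating `Ad_g Φ ∈ 𝔡` along the horizontal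
lift of `v` shows that `D_v Φ(w) + [Φ(v), Φ(w)]` is horizontal. -/
theorem exists_fderiv_localPhi_add_bracket
    (hs : Manifold.IsSubmersion 𝓘(ℝ, E) 𝓘(ℝ, F) ∞ (cosetProj H)) {q₀ : CosetSpace H} {y : F}
    (hy : y ∈ (extChartAt 𝓘(ℝ, F) q₀).target) (v w : F) :
    ∃ u, S.localPhi hs q₀ y u = fderiv ℝ (S.localPhi hs q₀) y v w +
      modelBracket E G (S.localPhi hs q₀ y v) (S.localPhi hs q₀ y w) := by
  obtain ⟨g, hg⟩ := exists_cosetProj_eq ((extChartAt 𝓘(ℝ, F) q₀).symm y)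
  have hgs : cosetProj H g ∈ (extChartAt 𝓘(ℝ, F) q₀).source := by
    rw [hg]
    exact (extChartAt 𝓘(ℝ, F) q₀).map_target hy
  have hgy : extChartAt 𝓘(ℝ, F) q₀ (cosetProj H g) = y := by
    rw [hg]
    exact (extChartAt 𝓘(ℝ, F) q₀).right_inv hy
  set Ψ := S.localPhi hs q₀ with hΨ
  set φ := extChartAt 𝓘(ℝ, F) q₀ with hφ
  let η : GroupLieAlgebra 𝓘(ℝ, E) G := Ψ y v
  let ζ : E := Ψ y w
  let x : E := mulInvariantVectorField η g
  have hηv : chartCosetDeriv E H F q₀ g (lieAd E g η) = v := by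
    have := S.chartCosetDeriv_localPhi hs hgs v
    rw [hgy] at this
    exact this
  -- the derivative of the point of the coset space
  have hp : HasMFDerivAt 𝓘(ℝ, E) 𝓘(ℝ, F) (fun u : G => φ (cosetProj H u)) g
      ((mfderiv 𝓘(ℝ, F) 𝓘(ℝ, F) φ (cosetProj H g) : F →L[ℝ] F).comp
        (mfderiv 𝓘(ℝ, E) 𝓘(ℝ, F) (cosetProj H) g : E →L[ℝ] F)) :=
    (mdifferentiableAt_extChartAt_of_mem hgs).hasMFDerivAt.comp g (hasMFDerivAt_cosetProj hs g)
  set P := (mfderiv 𝓘(ℝ, F) 𝓘(ℝ, F) φ (cosetProj H g) : F →L[ℝ] F).comp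
        (mfderiv 𝓘(ℝ, E) 𝓘(ℝ, F) (cosetProj H) g : E →L[ℝ] F) with hP
  have hPx : P x = v := by
    refine Eq.trans ?_ hηv
    refine Eq.trans ?_ (chartCosetDeriv_apply hs hgs _).symm
    exact congrArg (mfderiv 𝓘(ℝ, F) 𝓘(ℝ, F) φ (cosetProj H g) : F →L[ℝ] F)
      (mfderiv_cosetProj_mulInvariantVectorField hs g η)
  -- the derivative of `Φ` along the group
  have hΨd : HasFDerivAt (fun z => Ψ z w) ((fderiv ℝ Ψ y).flip w) (φ (cosetProj H g)) := by
    rw [hgy]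
    have h1 : HasFDerivAt Ψ (fderiv ℝ Ψ y) y :=
      (((S.contDiffOn_localPhi hs q₀).contDiffAt ((isOpen_extChartAt_target q₀).mem_nhds hy)
        ).differentiableAt (by simp)).hasFDerivAt
    have h2 := (ContinuousLinearMap.apply ℝ E w).hasFDerivAt.comp y h1
    exact h2
  have hc := hΨd.hasMFDerivAt.comp g hp
  -- the derivative of the adjoint action
  let Ad : G → E →L[ℝ] E := fun g => lieAd E g
  obtain ⟨A', hA'⟩ : ∃ A' : E →L[ℝ] E →L[ℝ] E, HasMFDerivAt 𝓘(ℝ, E) 𝓘(ℝ, E →L[ℝ] E) Ad g A' := by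
    have hAd : ContMDiffAt 𝓘(ℝ, E) 𝓘(ℝ, E →L[ℝ] E) ∞ Ad g := contMDiff_lieAd g
    exact ⟨_, (hAd.mdifferentiableAt (by simp)).hasMFDerivAt⟩
  have hA'x : A' x ζ = lieAd E g ⁅η, (show GroupLieAlgebra 𝓘(ℝ, E) G from ζ)⁆ := by
    have h1 := ((ContinuousLinearMap.apply ℝ E ζ).hasFDerivAt (x := Ad g)).hasMFDerivAt.comp g hA'
    exact mfderiv_adOrbit_mulInvariantVectorField (show GroupLieAlgebra 𝓘(ℝ, E) G from ζ) η g h1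
  have hB : IsBoundedBilinearMap ℝ fun p : (E →L[ℝ] E) × E => p.1 p.2 := isBoundedBilinearMap_apply
  have hf := ((hB.hasFDerivAt (Ad g, Ψ (φ (cosetProj H g)) w)).hasMFDerivAt).comp g
    (hA'.prodMk_modelSpace hc)
  have h1 := S.mem_orthogonal_of_hasMFDerivAt (W := subgroupLieAlgebra E H) hf ?_ x
  · have h2 : lieAd E g (show GroupLieAlgebra 𝓘(ℝ, E) G from (fderiv ℝ Ψ y v w +
        modelBracket E G (Ψ y v) (Ψ y w) : E)) ∈ S.form.orthogonal (subgroupLieAlgebra E H) := by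
      have h3 : lieAd E g (show GroupLieAlgebra 𝓘(ℝ, E) G from (fderiv ℝ Ψ y v w +
          modelBracket E G (Ψ y v) (Ψ y w) : E)) = Ad g (fderiv ℝ Ψ y (P x) w) + A' x ζ := by
        rw [hA'x, hPx]
        exact map_add (Ad g) _ _
      rw [h3]
      have h4 : A' x (Ψ (φ (cosetProj H g)) w) = A' x ζ := by rw [hgy]
      rw [← h4]
      exact h1
    obtain ⟨u, hu⟩ := S.exists_localPhi_eq hs hgs (S.mem_horizontal_iff.2 h2)
    rw [hgy] at hu
    exact ⟨u, hu⟩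
  · filter_upwards [((isOpen_extChartAt_source (I := 𝓘(ℝ, F)) q₀).preimage
      (contMDiff_cosetProj hs).continuous).mem_nhds hgs] with u hu
    exact S.mem_horizontal_iff.1 (S.localPhi_mem hs hu w)

end InertiaData

/-! ### Determinants and traces of bilinear forms -/

section BilinearForms

open Set Filter Topology

variable {F : Type*} [NormedAddCommGroup F] [NormedSpace ℝ F] [FiniteDimensional ℝ F]

/-- Maps that are adjoint with respect to a nondegenerate form have the same trace. -/
theorem trace_eq_of_adjoint {A : F →L[ℝ] F →L[ℝ] ℝ} (hA : Function.Injective A)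
    {M N : F →L[ℝ] F} (h : ∀ u w, A (M u) w = A u (N w)) :
    LinearMap.trace ℝ F M = LinearMap.trace ℝ F N := by
  let a : F →ₗ[ℝ] Module.Dual ℝ F :=
    (LinearMap.toContinuousLinearMap (𝕜 := ℝ) (E := F) (F' := ℝ)).symm.toLinearMap ∘ₗ A.toLinearMap
  have ha : Function.Injective a :=
    (LinearEquiv.injective (LinearMap.toContinuousLinearMap (𝕜 := ℝ) (E := F) (F' := ℝ)).symm).comp hA
  let e : F ≃ₗ[ℝ] Module.Dual ℝ F := LinearEquiv.ofInjectiveOfFinrankEq a ha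
    (Subspace.dual_finrank_eq (K := ℝ) (V := F)).symm
  have he : ∀ u w, e u w = A u w := fun u w => rfl
  have h1 : e.conj (M : F →ₗ[ℝ] F) = Module.Dual.transpose (N : F →ₗ[ℝ] F) := by
    ext p w
    obtain ⟨u, rfl⟩ := e.surjective p
    rw [LinearEquiv.conj_apply_apply, e.symm_apply_apply]
    exact h u w
  rw [← LinearMap.trace_conj' _ e, h1, LinearMap.trace_transpose']

theorem trace_eq_zero_of_skew {A : F →L[ℝ] F →L[ℝ] ℝ} (hA : Function.Injective A)
    {M : F →L[ℝ] F} (h : ∀ u w, A (M u) w = -A u (M w)) : LinearMap.trace ℝ F M = 0 := by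
  have h1 := trace_eq_of_adjoint (N := -M) hA (fun u w => by rw [h u w]; simp)
  have h2 : ((-M : F →L[ℝ] F) : F →ₗ[ℝ] F) = -(M : F →ₗ[ℝ] F) := rfl
  rw [h2, map_neg] at h1
  linarith

variable (F) in
/-- An arbitrary identification of a space with its dual. -/
def dualIdentification : F ≃ₗ[ℝ] (F →L[ℝ] ℝ) :=
  (Module.finBasis ℝ F).toDualEquiv.trans LinearMap.toContinuousLinearMap

/-- The determinant of a bilinear form, with respect to an arbitrary basis. -/
def formDet (A : F →L[ℝ] F →L[ℝ] ℝ) : ℝ :=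
  LinearMap.det ((dualIdentification F).symm.toLinearMap ∘ₗ A.toLinearMap)

theorem formDet_ne_zero {A : F →L[ℝ] F →L[ℝ] ℝ} (hA : Function.Injective A) : formDet A ≠ 0 := by
  have h1 : Function.Injective ((dualIdentification F).symm.toLinearMap ∘ₗ A.toLinearMap) :=
    (LinearEquiv.injective (dualIdentification F).symm).comp hA
  exact (LinearMap.isUnit_det _ ((LinearMap.isUnit_iff_ker_eq_bot _).2
    (LinearMap.ker_eq_bot.2 h1))).ne_zero

theorem formDet_congr {A A' : F →L[ℝ] F →L[ℝ] ℝ} {T : F →L[ℝ] F}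
    (h : ∀ u w, A u w = A' (T u) (T w)) : formDet A = LinearMap.det (T : F →ₗ[ℝ] F) ^ 2 * formDet A' := by
  set J := dualIdentification F with hJ
  let C : (F →L[ℝ] ℝ) ≃ₗ[ℝ] Module.Dual ℝ F := LinearMap.toContinuousLinearMap.symm
  let D : F →ₗ[ℝ] F := (J.trans C).symm.conj (LinearMap.dualMap (T : F →ₗ[ℝ] F))
  have h1 : J.symm.toLinearMap ∘ₗ A.toLinearMap =
      D ∘ₗ (J.symm.toLinearMap ∘ₗ A'.toLinearMap) ∘ₗ (T : F →ₗ[ℝ] F) := by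
    ext u
    apply J.injective
    ext w
    simp only [LinearMap.comp_apply, D, LinearEquiv.conj_apply, LinearEquiv.coe_coe,
      LinearEquiv.symm_symm, LinearEquiv.trans_apply, LinearEquiv.apply_symm_apply,
      LinearEquiv.symm_trans_apply]
    exact h u w
  have h2 : LinearMap.det D = LinearMap.det (T : F →ₗ[ℝ] F) := by
    exact (LinearMap.det_conj (LinearMap.dualMap (T : F →ₗ[ℝ] F)) (J.trans C).symm).trans
      (LinearMap.det_dualMap _)
  rw [formDet, h1, LinearMap.det_comp, LinearMap.det_comp, h2, formDet]
  ring

theorem contDiff_formDet : ContDiff ℝ ∞ (formDet : (F →L[ℝ] F →L[ℝ] ℝ) → ℝ) := by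
  let j : (F →L[ℝ] ℝ) →L[ℝ] F := LinearMap.toContinuousLinearMap (dualIdentification F).symm.toLinearMap
  have h1 : ContDiff ℝ ∞ (fun A : F →L[ℝ] F →L[ℝ] ℝ => j.comp A) := by fun_prop
  exact (contDiff_det (V := F)).comp h1

theorem hasDerivAt_det_one_add_smul (N : F →ₗ[ℝ] F) :
    HasDerivAt (fun t : ℝ => LinearMap.det (1 + t • N)) (LinearMap.trace ℝ F N) 0 := by
  let b := Module.finBasis ℝ F
  have h1 : ∀ t : ℝ, LinearMap.det (1 + t • N) =
      Matrix.det (1 + t • LinearMap.toMatrix b b N) := by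
    intro t
    rw [← LinearMap.det_toMatrix b, map_add, map_smul, LinearMap.toMatrix_one]
  refine HasDerivAt.congr_of_eventuallyEq ?_
    (Eventually.of_forall fun t => (h1 t).trans (Matrix.det_one_add_smul t _))
  rw [LinearMap.trace_eq_matrix_trace ℝ b]
  set p := (Matrix.det (1 + (Polynomial.X : Polynomial ℝ) •
    (LinearMap.toMatrix b b N).map Polynomial.C)).divX.divX
  have h2 := ((hasDerivAt_id (0 : ℝ)).const_mul ((LinearMap.toMatrix b b N).trace)).const_add 1
  have h3 := (p.hasDerivAt (0 : ℝ)).mul ((hasDerivAt_id (0 : ℝ)).pow 2)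
  refine (h2.add h3).congr_deriv ?_
  simp

theorem hasDerivAt_add_smul {V : Type*} [NormedAddCommGroup V] [NormedSpace ℝ V] (x v : V) :
    HasDerivAt (fun t : ℝ => x + t • v) v 0 := by
  simpa using ((hasDerivAt_id (0 : ℝ)).smul_const v).const_add x

/-- Jacobi's formula for the logarithmic derivative of the determinant of a form. -/
theorem fderiv_formDet_of_eq {A A' : F →L[ℝ] F →L[ℝ] ℝ} {N : F →L[ℝ] F}
    (h : ∀ u w, A' u w = A (N u) w) :
    fderiv ℝ (formDet (F := F)) A A' = formDet A * LinearMap.trace ℝ F N := by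
  have h1 := hasDerivAt_add_smul (V := F →L[ℝ] F →L[ℝ] ℝ) A A'
  have h2 : HasFDerivAt (formDet (F := F)) (fderiv ℝ formDet A) (A + (0 : ℝ) • A') := by
    have h0 : A + (0 : ℝ) • A' = A := by
      ext
      simp
    rw [h0]
    exact (contDiff_formDet.differentiable (by simp) A).hasFDerivAt
  have h3 := h2.comp_hasDerivAt (0 : ℝ) h1
  have h4 : ∀ t : ℝ, formDet (A + t • A') = formDet A * LinearMap.det (1 + t • (N : F →ₗ[ℝ] F)) := by
    intro t
    rw [formDet, formDet, ← LinearMap.det_comp]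
    congr 1
    ext u
    apply (dualIdentification F).injective
    ext w
    simp [h u w]
  have h5 := (hasDerivAt_det_one_add_smul (N : F →ₗ[ℝ] F)).const_mul (formDet A)
  refine h3.unique (h5.congr_of_eventuallyEq (Eventually.of_forall fun t => ?_))
  exact h4 t

end BilinearForms

/-! ### The reduced system in coordinates -/

section InverseOfForms

open Set Filter Topology

variable {F : Type*} [NormedAddCommGroup F] [NormedSpace ℝ F] [FiniteDimensional ℝ F]

theorem exists_equiv_of_injective {A : F →L[ℝ] F →L[ℝ] ℝ} (hA : Function.Injective A) :
    ∃ e : F ≃L[ℝ] (F →L[ℝ] ℝ), (e : F →L[ℝ] F →L[ℝ] ℝ) = A := by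
  have h1 : Module.finrank ℝ F = Module.finrank ℝ (F →L[ℝ] ℝ) :=
    (dualIdentification F).finrank_eq
  refine ⟨(LinearEquiv.ofInjectiveOfFinrankEq A.toLinearMap hA h1).toContinuousLinearEquiv, ?_⟩
  ext u w
  rfl

theorem apply_inverse_apply {A : F →L[ℝ] F →L[ℝ] ℝ} (hA : Function.Injective A) (p : F →L[ℝ] ℝ) :
    A (A.inverse p) = p := by
  obtain ⟨e, rfl⟩ := exists_equiv_of_injective hA
  simp

theorem inverse_apply_apply {A : F →L[ℝ] F →L[ℝ] ℝ} (hA : Function.Injective A) (v : F) :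
    A.inverse (A v) = v := hA (apply_inverse_apply hA _)

variable {X : Type*} [NormedAddCommGroup X] [NormedSpace ℝ X]

theorem contDiffOn_inverse_form {A : X → F →L[ℝ] F →L[ℝ] ℝ} {U : Set X} (hA : ContDiffOn ℝ ∞ A U)
    (h : ∀ y ∈ U, Function.Injective (A y)) : ContDiffOn ℝ ∞ (fun y => (A y).inverse) U := by
  intro y hy
  obtain ⟨e, he⟩ := exists_equiv_of_injective (h y hy)
  refine ContDiffAt.comp_contDiffWithinAt (g := ContinuousLinearMap.inverse) y ?_ (hA y hy)
  rw [← he]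
  exact contDiffAt_map_inverse e

end InverseOfForms

/-- A Lie algebra with an invariant scalar product and an inertia operator. -/
structure KineticAlgebra (E : Type*) [NormedAddCommGroup E] [NormedSpace ℝ E] where
  /-- the scalar product -/
  form : E →L[ℝ] E →L[ℝ] ℝ
  /-- the inertia operator -/
  inertia : E →L[ℝ] E
  /-- the Lie bracket -/
  bracket : E →L[ℝ] E →L[ℝ] E
  form_symm : ∀ x y, form x y = form y x
  form_pos : ∀ x, x ≠ 0 → 0 < form x x
  inertia_symm : ∀ x y, form (inertia x) y = form x (inertia y)
  bracket_swap : ∀ x y, bracket x y = -bracket y x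
  form_bracket : ∀ z x y, form (bracket z x) y + form x (bracket z y) = 0

namespace KineticAlgebra

open Set Filter Topology

variable {E : Type*} [NormedAddCommGroup E] [NormedSpace ℝ E]
  {F : Type*} [NormedAddCommGroup F] [NormedSpace ℝ F]

/-- The form `⟨𝓘x, y⟩`. -/
def kin (D : KineticAlgebra E) : E →L[ℝ] E →L[ℝ] ℝ := D.form.comp D.inertia

theorem kin_apply (D : KineticAlgebra E) (x y : E) : D.kin x y = D.form (D.inertia x) y := rfl

theorem kin_symm (D : KineticAlgebra E) (x y : E) : D.kin x y = D.kin y x := by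
  rw [kin_apply, kin_apply, D.inertia_symm, D.form_symm]

/-- The pull-back of a bilinear form by the linear maps `Φ y`. -/
def pullback (K : E →L[ℝ] E →L[ℝ] ℝ) (Φ : F → F →L[ℝ] E) (y : F) : F →L[ℝ] F →L[ℝ] ℝ :=
  K.bilinearComp (Φ y) (Φ y)

theorem pullback_apply (K : E →L[ℝ] E →L[ℝ] ℝ) (Φ : F → F →L[ℝ] E) (y u w : F) :
    pullback K Φ y u w = K (Φ y u) (Φ y w) := rfl

/-- The structure of a reduced LR system in coordinates: a smooth momentum map `Φ`, whose values
`Φ y v` satisfy the structure equation of the horizontal distribution, and a potential `W`. -/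
structure IsLocalSystem (D : KineticAlgebra E) (Φ : F → F →L[ℝ] E) (W : F → ℝ) (U : Set F) :
    Prop where
  isOpen : IsOpen U
  contDiffOn_momentum : ContDiffOn ℝ ∞ Φ U
  contDiffOn_potential : ContDiffOn ℝ ∞ W U
  regular : ∀ y ∈ U, ∀ v, (∀ w, D.kin (Φ y v) (Φ y w) = 0) → v = 0
  structure_eq : ∀ y ∈ U, ∀ v w, ∃ u, Φ y u = fderiv ℝ Φ y v w + D.bracket (Φ y v) (Φ y w)

variable [FiniteDimensional ℝ E] [FiniteDimensional ℝ F]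

/-- The component along the range of `Φ y` in the orthogonal decomposition, as a vector of `F`. -/
def horizontalPart (D : KineticAlgebra E) (Φ : F → F →L[ℝ] E) (y : F) : E →L[ℝ] F :=
  (pullback D.form Φ y).inverse.comp (D.form.bilinearComp (.id ℝ E) (Φ y))

/-- The orthogonal projection to the complement of the range of `Φ y`. -/
def verticalProj (D : KineticAlgebra E) (Φ : F → F →L[ℝ] E) (y : F) : E →L[ℝ] E :=
  .id ℝ E - (Φ y).comp (D.horizontalPart Φ y)

/-- The nonholonomic term `w ↦ ⟨𝓘Φ(u), pr [Φ(v), Φ(w)]⟩`, with `pr` the projection to the complement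
of the range of `Φ`. -/
def gyro (D : KineticAlgebra E) (Φ : F → F →L[ℝ] E) (y u v : F) : F →L[ℝ] ℝ :=
  (D.kin (Φ y u)).comp ((D.verticalProj Φ y).comp ((D.bracket (Φ y v)).comp (Φ y)))

theorem gyro_apply (D : KineticAlgebra E) (Φ : F → F →L[ℝ] E) (y u v w : F) : D.gyro Φ y u v w =
    D.kin (Φ y u) (D.verticalProj Φ y (D.bracket (Φ y v) (Φ y w))) := rfl

/-- The derivative of a form at `y` in the direction of the last argument, evaluated at `v, v`. -/
def quadDeriv (A : F → F →L[ℝ] F →L[ℝ] ℝ) (y v : F) : F →L[ℝ] ℝ :=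
  ((fderiv ℝ A y).flip v).flip v

/-- The force `b` for which the equation of motion is `⟨𝓘Φ(q̈), Φ(ξ)⟩ = b(ξ)`. -/
def force (D : KineticAlgebra E) (Φ : F → F →L[ℝ] E) (W : F → ℝ) (y v : F) : F →L[ℝ] ℝ :=
  (1 / 2 : ℝ) • quadDeriv (pullback D.kin Φ) y v - fderiv ℝ W y - D.gyro Φ y v v -
    fderiv ℝ (pullback D.kin Φ) y v v

/-- The acceleration of the reduced LR system. -/
def accel (D : KineticAlgebra E) (Φ : F → F →L[ℝ] E) (W : F → ℝ) (y v : F) : F :=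
  (pullback D.kin Φ y).inverse (D.force Φ W y v)

/-- The reduced LR system, as a vector field in the coordinates `(q, q̇)`. -/
def localField (D : KineticAlgebra E) (Φ : F → F →L[ℝ] E) (W : F → ℝ) (p : F × F) : F × F :=
  (p.2, D.accel Φ W p.1 p.2)

namespace IsLocalSystem

variable {D : KineticAlgebra E} {Φ : F → F →L[ℝ] E} {W : F → ℝ} {U : Set F}

theorem injective (h : D.IsLocalSystem Φ W U) {y : F} (hy : y ∈ U) : Function.Injective (Φ y) := by
  rw [injective_iff_map_eq_zero]
  intro v hv
  exact h.regular y hy v fun w => by rw [hv]; simp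

theorem injective_metric (h : D.IsLocalSystem Φ W U) {y : F} (hy : y ∈ U) :
    Function.Injective (pullback D.kin Φ y) := by
  rw [injective_iff_map_eq_zero]
  intro v hv
  exact h.regular y hy v fun w => DFunLike.congr_fun hv w

theorem injective_form (h : D.IsLocalSystem Φ W U) {y : F} (hy : y ∈ U) :
    Function.Injective (pullback D.form Φ y) := by
  rw [injective_iff_map_eq_zero]
  intro v hv
  refine h.injective hy (Eq.trans ?_ (map_zero _).symm)
  by_contra hne
  exact (D.form_pos _ hne).ne' (DFunLike.congr_fun hv v)

theorem form_horizontalPart (h : D.IsLocalSystem Φ W U) {y : F} (hy : y ∈ U) (x : E) (w : F) :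
    D.form (Φ y (D.horizontalPart Φ y x)) (Φ y w) = D.form x (Φ y w) :=
  DFunLike.congr_fun (apply_inverse_apply (h.injective_form hy)
    (D.form.bilinearComp (.id ℝ E) (Φ y) x)) w

theorem horizontalPart_eq (h : D.IsLocalSystem Φ W U) {y : F} (hy : y ∈ U) {x : E} {u : F}
    (hu : ∀ w, D.form (Φ y u) (Φ y w) = D.form x (Φ y w)) : D.horizontalPart Φ y x = u := by
  apply h.injective_form hy
  ext w
  exact (h.form_horizontalPart hy x w).trans (hu w).symm

theorem differentiableAt_momentum (h : D.IsLocalSystem Φ W U) {y : F} (hy : y ∈ U) :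
    DifferentiableAt ℝ Φ y :=
  (h.contDiffOn_momentum.contDiffAt (h.isOpen.mem_nhds hy)).differentiableAt (by simp)

theorem contDiffOn_pullback (h : D.IsLocalSystem Φ W U) (K : E →L[ℝ] E →L[ℝ] ℝ) :
    ContDiffOn ℝ ∞ (pullback K Φ) U := by
  refine contDiffOn_clm_apply.2 fun u => contDiffOn_clm_apply.2 fun w => ?_
  have := h.contDiffOn_momentum
  simp only [pullback_apply]
  fun_prop

theorem differentiableAt_pullback (h : D.IsLocalSystem Φ W U) (K : E →L[ℝ] E →L[ℝ] ℝ) {y : F}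
    (hy : y ∈ U) : DifferentiableAt ℝ (pullback K Φ) y :=
  ((h.contDiffOn_pullback K).contDiffAt (h.isOpen.mem_nhds hy)).differentiableAt (by simp)

theorem hasFDerivAt_pullback_apply (h : D.IsLocalSystem Φ W U) (K : E →L[ℝ] E →L[ℝ] ℝ) {y : F}
    (hy : y ∈ U) (u w : F) :
    HasFDerivAt (fun z => pullback K Φ z u w) (((fderiv ℝ (pullback K Φ) y).flip u).flip w) y := by
  have h1 := (h.differentiableAt_pullback K hy).hasFDerivAt
  have h2 := (h1.clm_apply (hasFDerivAt_const u y)).clm_apply (hasFDerivAt_const w y)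
  refine h2.congr_fderiv ?_
  ext v
  simp

theorem fderiv_pullback (h : D.IsLocalSystem Φ W U) (K : E →L[ℝ] E →L[ℝ] ℝ) {y : F} (hy : y ∈ U)
    (v u w : F) : fderiv ℝ (pullback K Φ) y v u w =
      K (fderiv ℝ Φ y v u) (Φ y w) + K (Φ y u) (fderiv ℝ Φ y v w) := by
  have h1 := (h.differentiableAt_momentum hy).hasFDerivAt
  have hu := h1.clm_apply (hasFDerivAt_const u y)
  have hw := h1.clm_apply (hasFDerivAt_const w y)
  have h2 := (K.hasFDerivAt.comp y hu).clm_apply hw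
  have h3 := h2.unique (h.hasFDerivAt_pullback_apply K hy u w)
  have h4 := DFunLike.congr_fun h3 v
  simp at h4
  rw [← h4]
  ring

theorem contDiffOn_verticalProj (h : D.IsLocalSystem Φ W U) :
    ContDiffOn ℝ ∞ (D.verticalProj Φ) U := by
  have h1 := contDiffOn_inverse_form (h.contDiffOn_pullback D.form) fun y hy => h.injective_form hy
  have h2 : ContDiffOn ℝ ∞ (fun y => D.form.bilinearComp (.id ℝ E) (Φ y)) U := by
    refine contDiffOn_clm_apply.2 fun x => contDiffOn_clm_apply.2 fun w => ?_
    exact (D.form x).contDiff.comp_contDiffOn (h.contDiffOn_momentum.clm_apply contDiffOn_const)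
  exact contDiffOn_const.sub (h.contDiffOn_momentum.clm_comp (h1.clm_comp h2))

theorem contDiffOn_force (h : D.IsLocalSystem Φ W U) :
    ContDiffOn ℝ ∞ (fun p : F × F => D.force Φ W p.1 p.2) (U ×ˢ univ) := by
  have hm : MapsTo (Prod.fst : F × F → F) (U ×ˢ univ) U := fun p hp => hp.1
  have hΦ' : ContDiffOn ℝ ∞ (fun p : F × F => fderiv ℝ Φ p.1) (U ×ˢ univ) :=
    (h.contDiffOn_momentum.fderiv_of_isOpen h.isOpen (m := ∞) (by simp)).comp contDiffOn_fst hm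
  have hW : ContDiffOn ℝ ∞ (fun p : F × F => fderiv ℝ W p.1) (U ×ˢ univ) :=
    (h.contDiffOn_potential.fderiv_of_isOpen h.isOpen (m := ∞) (by simp)).comp contDiffOn_fst hm
  have hΦ : ContDiffOn ℝ ∞ (fun p : F × F => Φ p.1) (U ×ˢ univ) :=
    h.contDiffOn_momentum.comp contDiffOn_fst hm
  have hV : ContDiffOn ℝ ∞ (fun p : F × F => D.verticalProj Φ p.1) (U ×ˢ univ) :=
    h.contDiffOn_verticalProj.comp contDiffOn_fst hm
  have hv : ContDiffOn ℝ ∞ (fun p : F × F => p.2) (U ×ˢ univ) := contDiffOn_snd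
  refine contDiffOn_clm_apply.2 fun ξ => ?_
  have hg : ContDiffOn ℝ ∞ (fun p : F × F => D.gyro Φ p.1 p.2 p.2 ξ) (U ×ˢ univ) := by
    simp only [gyro_apply]
    have h1 := hΦ.clm_apply hv
    have h2 : ContDiffOn ℝ ∞ (fun p : F × F => D.kin (Φ p.1 p.2)) (U ×ˢ univ) :=
      D.kin.contDiff.comp_contDiffOn h1
    have h3 : ContDiffOn ℝ ∞ (fun p : F × F => D.bracket (Φ p.1 p.2)) (U ×ˢ univ) :=
      D.bracket.contDiff.comp_contDiffOn h1
    exact h2.clm_apply (hV.clm_apply (h3.clm_apply (hΦ.clm_apply contDiffOn_const)))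
  have hA : ∀ a b c : F × F → F, ContDiffOn ℝ ∞ a (U ×ˢ univ) → ContDiffOn ℝ ∞ b (U ×ˢ univ) →
      ContDiffOn ℝ ∞ c (U ×ˢ univ) → ContDiffOn ℝ ∞
        (fun p : F × F => fderiv ℝ (pullback D.kin Φ) p.1 (a p) (b p) (c p)) (U ×ˢ univ) := by
    intro a b c ha hb hc
    refine ContDiffOn.congr ?_ fun p hp => h.fderiv_pullback D.kin hp.1 (a p) (b p) (c p)
    have h1 : ContDiffOn ℝ ∞ (fun p : F × F => D.kin (fderiv ℝ Φ p.1 (a p) (b p))) (U ×ˢ univ) :=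
      D.kin.contDiff.comp_contDiffOn ((hΦ'.clm_apply ha).clm_apply hb)
    have h2 : ContDiffOn ℝ ∞ (fun p : F × F => D.kin (Φ p.1 (b p))) (U ×ˢ univ) :=
      D.kin.contDiff.comp_contDiffOn (hΦ.clm_apply hb)
    exact (h1.clm_apply (hΦ.clm_apply hc)).add
      (h2.clm_apply ((hΦ'.clm_apply ha).clm_apply hc))
  have hq := hA (fun _ => ξ) _ _ contDiffOn_const hv hv
  have hq' := hA _ _ (fun _ => ξ) hv hv contDiffOn_const
  exact (((contDiffOn_const.mul hq).sub (hW.clm_apply contDiffOn_const)).sub hg).sub hq'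

theorem contDiffOn_accel (h : D.IsLocalSystem Φ W U) :
    ContDiffOn ℝ ∞ (fun p : F × F => D.accel Φ W p.1 p.2) (U ×ˢ univ) := by
  have h1 := contDiffOn_inverse_form (h.contDiffOn_pullback D.kin) fun y hy => h.injective_metric hy
  have hm : MapsTo (Prod.fst : F × F → F) (U ×ˢ univ) U := fun p hp => hp.1
  exact (h1.comp contDiffOn_fst hm).clm_apply h.contDiffOn_force

theorem contDiffOn_localField (h : D.IsLocalSystem Φ W U) :
    ContDiffOn ℝ ∞ (D.localField Φ W) (U ×ˢ univ) :=
  contDiffOn_snd.prodMk h.contDiffOn_accel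

/-- The equation of motion determines the acceleration. -/
theorem eq_accel_iff (h : D.IsLocalSystem Φ W U) {y : F} (hy : y ∈ U) (v a : F) :
    a = D.accel Φ W y v ↔ ∀ ξ, D.kin (Φ y a) (Φ y ξ) = D.force Φ W y v ξ := by
  have h1 : pullback D.kin Φ y (D.accel Φ W y v) = D.force Φ W y v :=
    apply_inverse_apply (h.injective_metric hy) _
  constructor
  · rintro rfl ξ
    exact DFunLike.congr_fun h1 ξ
  · intro h2
    apply h.injective_metric hy
    rw [h1]
    ext ξ
    exact h2 ξ

end IsLocalSystem

end KineticAlgebra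

set_option maxSynthPendingDepth 3

/-! ### The invariant density in coordinates -/

section FormTrace

variable {F : Type*} [NormedAddCommGroup F] [NormedSpace ℝ F] [FiniteDimensional ℝ F]

/-- The trace of the bilinear form `A'` with respect to the nondegenerate form `A`. -/
def formTrace (A A' : F →L[ℝ] F →L[ℝ] ℝ) : ℝ :=
  LinearMap.trace ℝ F (A.inverse.comp A' : F →L[ℝ] F)

theorem formTrace_eq {A A' : F →L[ℝ] F →L[ℝ] ℝ} (hA : Function.Injective A) {N : F →L[ℝ] F}
    (h : ∀ u w, A' u w = A (N u) w) : formTrace A A' = LinearMap.trace ℝ F N := by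
  have h1 : A' = A.comp N := by
    ext u w
    exact h u w
  rw [formTrace, h1]
  congr 1
  ext u
  exact inverse_apply_apply hA (N u)

theorem formTrace_add (A A' A'' : F →L[ℝ] F →L[ℝ] ℝ) :
    formTrace A (A' + A'') = formTrace A A' + formTrace A A'' := by
  rw [formTrace, formTrace, formTrace, ← map_add]
  congr 1
  ext u
  simp

theorem formTrace_neg (A A' : F →L[ℝ] F →L[ℝ] ℝ) : formTrace A (-A') = -formTrace A A' := by
  rw [formTrace, formTrace, ← map_neg]
  congr 1
  ext u
  simp

theorem formTrace_flip {A : F →L[ℝ] F →L[ℝ] ℝ} (hA : Function.Injective A)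
    (hs : ∀ u w, A u w = A w u) (A' : F →L[ℝ] F →L[ℝ] ℝ) :
    formTrace A A'.flip = formTrace A A' := by
  refine trace_eq_of_adjoint hA fun u w => ?_
  have h1 : A (A.inverse (A'.flip u)) = A'.flip u := apply_inverse_apply hA _
  have h2 : A (A.inverse (A' w)) = A' w := apply_inverse_apply hA _
  change A (A.inverse (A'.flip u)) w = A u (A.inverse (A' w))
  rw [hs u, h1, h2]
  rfl

theorem formTrace_eq_zero {A : F →L[ℝ] F →L[ℝ] ℝ} (hA : Function.Injective A)
    (hs : ∀ u w, A u w = A w u) {A' : F →L[ℝ] F →L[ℝ] ℝ} (h : ∀ u w, A' u w = -A' w u) :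
    formTrace A A' = 0 := by
  have h1 : A'.flip = -A' := by
    ext u w
    exact (h w u)
  have h2 := formTrace_flip hA hs A'
  rw [h1, formTrace_neg] at h2
  linarith

theorem trace_prod_eq {V W : Type*} [NormedAddCommGroup V] [NormedSpace ℝ V] [FiniteDimensional ℝ V]
    [NormedAddCommGroup W] [NormedSpace ℝ W] [FiniteDimensional ℝ W] (M : V × W →ₗ[ℝ] V × W) :
    LinearMap.trace ℝ (V × W) M =
      LinearMap.trace ℝ V (LinearMap.fst ℝ V W ∘ₗ M ∘ₗ LinearMap.inl ℝ V W) +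
      LinearMap.trace ℝ W (LinearMap.snd ℝ V W ∘ₗ M ∘ₗ LinearMap.inr ℝ V W) := by
  have h1 : M = LinearMap.inl ℝ V W ∘ₗ (LinearMap.fst ℝ V W ∘ₗ M) +
      LinearMap.inr ℝ V W ∘ₗ (LinearMap.snd ℝ V W ∘ₗ M) := by
    refine LinearMap.ext fun x => ?_
    simp
  conv_lhs => rw [h1, map_add]
  exact congrArg₂ (· + ·) (LinearMap.trace_comp_comm' (LinearMap.inl ℝ V W) (LinearMap.fst ℝ V W ∘ₗ M)).symm
    (LinearMap.trace_comp_comm' (LinearMap.inr ℝ V W) (LinearMap.snd ℝ V W ∘ₗ M)).symm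

end FormTrace

namespace KineticAlgebra

open Set Filter Topology

variable {E : Type*} [NormedAddCommGroup E] [NormedSpace ℝ E] [FiniteDimensional ℝ E]
  {F : Type*} [NormedAddCommGroup F] [NormedSpace ℝ F] [FiniteDimensional ℝ F]

theorem pullback_symm {K : E →L[ℝ] E →L[ℝ] ℝ} (hK : ∀ x y, K x y = K y x) (Φ : F → F →L[ℝ] E)
    (y u w : F) : pullback K Φ y u w = pullback K Φ y w u := hK _ _

/-- The nonholonomic term `⟨𝓘Φ(u), pr [Φ(v), Φ(w)]⟩` as a bilinear form in `u` and `w`. -/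
def gyroForm (D : KineticAlgebra E) (Φ : F → F →L[ℝ] E) (y v : F) : F →L[ℝ] F →L[ℝ] ℝ :=
  D.kin.bilinearComp (Φ y) ((D.verticalProj Φ y).comp ((D.bracket (Φ y v)).comp (Φ y)))

/-- The density, with respect to `dq dq̇`, of the invariant measure: the geometric mean of the squared
volume densities of the kinetic energy and of the normal metric. -/
def density (D : KineticAlgebra E) (Φ : F → F →L[ℝ] E) (y : F) : ℝ :=
  √|formDet (pullback D.kin Φ y) * formDet (pullback D.form Φ y)|

namespace IsLocalSystem

variable {D : KineticAlgebra E} {Φ : F → F →L[ℝ] E} {W : F → ℝ} {U : Set F}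

theorem formDet_mul_ne_zero (h : D.IsLocalSystem Φ W U) {y : F} (hy : y ∈ U) :
    formDet (pullback D.kin Φ y) * formDet (pullback D.form Φ y) ≠ 0 :=
  mul_ne_zero (formDet_ne_zero (h.injective_metric hy)) (formDet_ne_zero (h.injective_form hy))

theorem density_pos (h : D.IsLocalSystem Φ W U) {y : F} (hy : y ∈ U) : 0 < D.density Φ y :=
  Real.sqrt_pos.2 (abs_pos.2 (h.formDet_mul_ne_zero hy))

theorem contDiffOn_formDet_mul (h : D.IsLocalSystem Φ W U) :
    ContDiffOn ℝ ∞ (fun y => formDet (pullback D.kin Φ y) * formDet (pullback D.form Φ y)) U :=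
  (contDiff_formDet.comp_contDiffOn (h.contDiffOn_pullback D.kin)).mul
    (contDiff_formDet.comp_contDiffOn (h.contDiffOn_pullback D.form))

theorem contDiffOn_density (h : D.IsLocalSystem Φ W U) : ContDiffOn ℝ ∞ (D.density Φ) U := by
  intro y hy
  have h1 := h.contDiffOn_formDet_mul.contDiffAt (h.isOpen.mem_nhds hy)
  have h2 := h.formDet_mul_ne_zero hy
  exact ((h1.abs h2).sqrt (abs_ne_zero.2 h2)).contDiffWithinAt

theorem fderiv_formDet_pullback (h : D.IsLocalSystem Φ W U) (K : E →L[ℝ] E →L[ℝ] ℝ) {y : F}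
    (hy : y ∈ U) (hK : Function.Injective (pullback K Φ y)) (v : F) :
    fderiv ℝ (fun z => formDet (pullback K Φ z)) y v =
      formDet (pullback K Φ y) * formTrace (pullback K Φ y) (fderiv ℝ (pullback K Φ) y v) := by
  have h1 := (contDiff_formDet.differentiable (by simp) (pullback K Φ y)).hasFDerivAt.comp y
    (h.differentiableAt_pullback K hy).hasFDerivAt
  have h2 : fderiv ℝ (fun z => formDet (pullback K Φ z)) y v =
      fderiv ℝ formDet (pullback K Φ y) (fderiv ℝ (pullback K Φ) y v) := DFunLike.congr_fun h1.fderiv v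
  rw [h2]
  refine fderiv_formDet_of_eq fun u w => ?_
  exact (DFunLike.congr_fun (apply_inverse_apply hK (fderiv ℝ (pullback K Φ) y v u)) w).symm

/-- The logarithmic derivative of the density: that of the determinant of a form is a trace. -/
theorem fderiv_density (h : D.IsLocalSystem Φ W U) {y : F} (hy : y ∈ U) (v : F) :
    fderiv ℝ (D.density Φ) y v = D.density Φ y * ((1 / 2) *
      (formTrace (pullback D.kin Φ y) (fderiv ℝ (pullback D.kin Φ) y v) +
        formTrace (pullback D.form Φ y) (fderiv ℝ (pullback D.form Φ) y v))) := by
  have hk := h.fderiv_formDet_pullback D.kin hy (h.injective_metric hy) v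
  have hf := h.fderiv_formDet_pullback D.form hy (h.injective_form hy) v
  set tk := formTrace (pullback D.kin Φ y) (fderiv ℝ (pullback D.kin Φ) y v)
  set tf := formTrace (pullback D.form Φ y) (fderiv ℝ (pullback D.form Φ) y v)
  set a : F → ℝ := fun z => formDet (pullback D.kin Φ z)
  set b : F → ℝ := fun z => formDet (pullback D.form Φ z)
  have ha : DifferentiableAt ℝ a y := ((contDiff_formDet.comp_contDiffOn
    (h.contDiffOn_pullback D.kin)).contDiffAt (h.isOpen.mem_nhds hy)).differentiableAt (by simp)
  have hb : DifferentiableAt ℝ b y := ((contDiff_formDet.comp_contDiffOn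
    (h.contDiffOn_pullback D.form)).contDiffAt (h.isOpen.mem_nhds hy)).differentiableAt (by simp)
  have hne : a y * b y ≠ 0 := h.formDet_mul_ne_zero hy
  have hd : DifferentiableAt ℝ (D.density Φ) y :=
    (h.contDiffOn_density.contDiffAt (h.isOpen.mem_nhds hy)).differentiableAt (by simp)
  -- differentiate the identity `σ ^ 4 = (a * b) ^ 2`
  have h4 : ∀ z, D.density Φ z ^ 4 = (a z * b z) ^ 2 := by
    intro z
    have : D.density Φ z ^ 2 = |a z * b z| := Real.sq_sqrt (abs_nonneg _)
    calc D.density Φ z ^ 4 = (D.density Φ z ^ 2) ^ 2 := by ring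
      _ = _ := by rw [this, sq_abs]
  have h5 := hd.hasFDerivAt.pow 4
  have h6 := (ha.hasFDerivAt.mul hb.hasFDerivAt).pow 2
  have h7 := DFunLike.congr_fun (h5.unique (h6.congr_of_eventuallyEq (Eventually.of_forall h4))) v
  simp [hk, hf] at h7
  have h8 : D.density Φ y ^ 3 ≠ 0 := pow_ne_zero _ (h.density_pos hy).ne'
  apply mul_left_cancel₀ h8
  have h9 := h4 y
  have h10 : D.density Φ y ^ 3 * (D.density Φ y * (1 / 2 * (tk + tf))) =
      D.density Φ y ^ 4 * (1 / 2 * (tk + tf)) := by ring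
  rw [h10, h9]
  linear_combination (1 / 4) * h7

/-- The structure equation compares the logarithmic derivatives of the two volume densities: their
difference is minus twice the trace of the nonholonomic term. -/
theorem formTrace_sub (h : D.IsLocalSystem Φ W U) {y : F} (hy : y ∈ U) (v : F) :
    formTrace (pullback D.kin Φ y) (fderiv ℝ (pullback D.kin Φ) y v) -
      formTrace (pullback D.form Φ y) (fderiv ℝ (pullback D.form Φ) y v) =
      -2 * formTrace (pullback D.kin Φ y) (D.gyroForm Φ y v) := by
  have hA := h.injective_metric hy
  have hB := h.injective_form hy
  have hAs := pullback_symm D.kin_symm Φ y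
  have hBs := pullback_symm D.form_symm Φ y
  set A := pullback D.kin Φ y with hAdef
  set B := pullback D.form Φ y with hBdef
  let ad : F →L[ℝ] E := (D.bracket (Φ y v)).comp (Φ y)
  let T : F →L[ℝ] F := (D.horizontalPart Φ y).comp (fderiv ℝ Φ y v + ad)
  let M : F →L[ℝ] F := (D.horizontalPart Φ y).comp ad
  let e : F →L[ℝ] F →L[ℝ] ℝ := D.kin.bilinearComp (Φ y) ad
  -- the structure equation
  have hT : ∀ w, Φ y (T w) = fderiv ℝ Φ y v w + ad w := by
    intro w
    obtain ⟨u, hu⟩ := h.structure_eq y hy v w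
    have h1 : T w = u := h.horizontalPart_eq hy fun w' => by rw [hu]; rfl
    rw [h1, hu]
    rfl
  have hD : ∀ w, fderiv ℝ Φ y v w = Φ y (T w) - ad w := fun w => by rw [hT]; abel
  have hk : fderiv ℝ (pullback D.kin Φ) y v = A.comp T + (A.comp T).flip + -(e + e.flip) := by
    ext u w
    rw [h.fderiv_pullback D.kin hy, hD, hD, map_sub, map_sub, ContinuousLinearMap.sub_apply,
      D.kin_symm (ad u), D.kin_symm (Φ y u) (Φ y (T w))]
    change _ = D.kin (Φ y (T u)) (Φ y w) + D.kin (Φ y (T w)) (Φ y u) +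
      -(D.kin (Φ y u) (ad w) + D.kin (Φ y w) (ad u))
    ring
  -- the bracket terms cancel, as `ad` is skew for the scalar product
  have hf : fderiv ℝ (pullback D.form Φ) y v = B.comp T + (B.comp T).flip := by
    ext u w
    rw [h.fderiv_pullback D.form hy, hD, hD, map_sub, map_sub, ContinuousLinearMap.sub_apply,
      D.form_symm (Φ y u) (Φ y (T w))]
    have h1 : D.form (ad u) (Φ y w) + D.form (Φ y u) (ad w) = 0 := D.form_bracket _ _ _
    change _ = D.form (Φ y (T u)) (Φ y w) + D.form (Φ y (T w)) (Φ y u)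
    linarith
  -- split `[Φ v, Φ w]` into a vertical part, the nonholonomic term, and a horizontal part `M`,
  -- which is skew for the scalar product and so has no trace
  have he : e = D.gyroForm Φ y v + (A.comp M).flip := by
    ext u w
    change D.kin (Φ y u) (ad w) = D.kin (Φ y u) (ad w - Φ y (M w)) + D.kin (Φ y (M w)) (Φ y u)
    rw [map_sub, D.kin_symm (Φ y (M w))]
    ring
  have hM : LinearMap.trace ℝ F M = 0 := by
    refine trace_eq_zero_of_skew hB fun u w => ?_
    have h1 : B (M u) w = D.form (ad u) (Φ y w) := h.form_horizontalPart hy _ _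
    have h2 : B u (M w) = D.form (ad w) (Φ y u) := by
      rw [hBs]
      exact h.form_horizontalPart hy _ _
    have h3 : D.form (ad u) (Φ y w) + D.form (Φ y u) (ad w) = 0 := D.form_bracket _ _ _
    rw [h1, h2, D.form_symm (ad w)]
    linarith
  have hAT : formTrace A (A.comp T) = LinearMap.trace ℝ F T := formTrace_eq hA fun u w => rfl
  have hBT : formTrace B (B.comp T) = LinearMap.trace ℝ F T := formTrace_eq hB fun u w => rfl
  have hAM : formTrace A (A.comp M) = 0 := (formTrace_eq hA fun u w => rfl).trans hM
  have hte : formTrace A e = formTrace A (D.gyroForm Φ y v) := by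
    rw [he, formTrace_add, formTrace_flip hA hAs, hAM, add_zero]
  rw [hk, hf, formTrace_add, formTrace_add, formTrace_add, formTrace_neg, formTrace_add,
    formTrace_flip hA hAs, formTrace_flip hA hAs, formTrace_flip hB hBs, hAT, hBT, hte]
  ring

/-- The derivative of the force with respect to the velocity. -/
theorem fderiv_force_snd (h : D.IsLocalSystem Φ W U) {y : F} (hy : y ∈ U) (v ξ : F) :
    HasFDerivAt (fun v' => D.force Φ W y v' ξ)
      ((1 / 2 : ℝ) • ((fderiv ℝ (pullback D.kin Φ) y ξ v) + (fderiv ℝ (pullback D.kin Φ) y ξ).flip v)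
        - ((D.gyroForm Φ y v).flip ξ +
          (D.kin (Φ y v)).comp ((D.verticalProj Φ y).comp ((D.bracket.flip (Φ y ξ)).comp (Φ y))))
        - ((fderiv ℝ (pullback D.kin Φ) y v).flip ξ +
          ((fderiv ℝ (pullback D.kin Φ) y).flip v).flip ξ)) v := by
  have h1 : HasFDerivAt (fun v' => fderiv ℝ (pullback D.kin Φ) y ξ v' v') _ v :=
    (fderiv ℝ (pullback D.kin Φ) y ξ).hasFDerivAt.clm_apply (hasFDerivAt_id v)
  have h2 : HasFDerivAt (fun v' => fderiv ℝ (pullback D.kin Φ) y v' v' ξ) _ v :=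
    ((fderiv ℝ (pullback D.kin Φ) y).hasFDerivAt.clm_apply (hasFDerivAt_id v)).clm_apply
      (hasFDerivAt_const ξ v)
  have h3 : HasFDerivAt (fun v' => D.kin (Φ y v')
      (D.verticalProj Φ y (D.bracket (Φ y v') (Φ y ξ)))) _ v :=
    (D.kin.comp (Φ y)).hasFDerivAt.clm_apply
      ((D.verticalProj Φ y).comp ((D.bracket.flip (Φ y ξ)).comp (Φ y))).hasFDerivAt
  have h4 := (((h1.const_mul (1 / 2 : ℝ)).sub (hasFDerivAt_const (fderiv ℝ W y ξ) v)).sub h3).sub h2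
  refine HasFDerivAt.congr_fderiv (f := fun v' => D.force Φ W y v' ξ) h4 ?_
  ext u
  simp [gyroForm, gyro]
  ring

end IsLocalSystem

end KineticAlgebra

set_option maxSynthPendingDepth 3

namespace KineticAlgebra

namespace IsLocalSystem

open Set Filter Topology

variable {E : Type*} [NormedAddCommGroup E] [NormedSpace ℝ E] [FiniteDimensional ℝ E]
  {F : Type*} [NormedAddCommGroup F] [NormedSpace ℝ F] [FiniteDimensional ℝ F]
  {D : KineticAlgebra E} {Φ : F → F →L[ℝ] E} {W : F → ℝ} {U : Set F}

theorem fderiv_pullback_symm (h : D.IsLocalSystem Φ W U) {y : F} (hy : y ∈ U) (v u w : F) :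
    fderiv ℝ (pullback D.kin Φ) y v u w = fderiv ℝ (pullback D.kin Φ) y v w u := by
  rw [h.fderiv_pullback D.kin hy, h.fderiv_pullback D.kin hy, D.kin_symm _ (Φ y w),
    D.kin_symm (Φ y u), add_comm]

/-- The divergence of the acceleration with respect to the velocity. -/
theorem trace_fderiv_accel (h : D.IsLocalSystem Φ W U) {y : F} (hy : y ∈ U) {v : F} {N : F →L[ℝ] F}
    (hN : HasFDerivAt (fun v' => D.accel Φ W y v') N v) :
    LinearMap.trace ℝ F N = -formTrace (pullback D.kin Φ y) (D.gyroForm Φ y v) -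
      formTrace (pullback D.kin Φ y) (fderiv ℝ (pullback D.kin Φ) y v) := by
  have hA := h.injective_metric hy
  have hAs := pullback_symm D.kin_symm Φ y
  let R : F →L[ℝ] F →L[ℝ] ℝ := (fderiv ℝ (pullback D.kin Φ) y).flip v
  let K : F →L[ℝ] F →L[ℝ] ℝ :=
    (ContinuousLinearMap.compL ℝ F E ℝ ((D.kin (Φ y v)).comp (D.verticalProj Φ y))).comp
      (D.bracket.bilinearComp (Φ y) (Φ y))
  have hK : ∀ w ξ, K w ξ = D.kin (Φ y v) (D.verticalProj Φ y (D.bracket (Φ y w) (Φ y ξ))) :=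
    fun w ξ => rfl
  let C := D.gyroForm Φ y v
  let Q := fderiv ℝ (pullback D.kin Φ) y v
  -- differentiate the equation of motion in the velocity
  have h1 : ∀ w ξ, (R.flip + -C + -K + -R + -Q) w ξ = pullback D.kin Φ y (N w) ξ := by
    intro w ξ
    have h2 : HasFDerivAt (fun v' => D.force Φ W y v' ξ)
        (((pullback D.kin Φ y).comp N).flip ξ) v := by
      have h3 : HasFDerivAt (fun v' => pullback D.kin Φ y (D.accel Φ W y v') ξ)
          (((pullback D.kin Φ y).comp N).flip ξ) v := by
        refine (((pullback D.kin Φ y).hasFDerivAt.comp v hN).clm_apply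
          (hasFDerivAt_const ξ v)).congr_fderiv ?_
        ext u
        simp
      refine h3.congr_of_eventuallyEq (Eventually.of_forall fun v' => ?_)
      exact ((h.eq_accel_iff hy v' _).1 rfl ξ).symm
    have h4 := DFunLike.congr_fun ((h.fderiv_force_snd hy v ξ).unique h2) w
    refine Eq.trans ?_ h4
    change fderiv ℝ (pullback D.kin Φ) y ξ v w + -(C w ξ) + -(K w ξ) +
      -(fderiv ℝ (pullback D.kin Φ) y w v ξ) + -(Q w ξ) =
      1 / 2 * (fderiv ℝ (pullback D.kin Φ) y ξ v w + fderiv ℝ (pullback D.kin Φ) y ξ w v) -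
        (C w ξ + K w ξ) - (Q w ξ + fderiv ℝ (pullback D.kin Φ) y w v ξ)
    rw [h.fderiv_pullback_symm hy ξ w v]
    ring
  -- `⟨𝓘Φ(v), pr [Φ(w), Φ(ξ)]⟩` is skew in `w` and `ξ`
  have hKt : formTrace (pullback D.kin Φ y) K = 0 := by
    refine formTrace_eq_zero hA hAs fun u w => ?_
    rw [hK, hK, D.bracket_swap, map_neg, map_neg]
  rw [← formTrace_eq hA h1, formTrace_add, formTrace_add, formTrace_add, formTrace_add,
    formTrace_flip hA hAs, formTrace_neg, formTrace_neg, formTrace_neg, formTrace_neg, hKt]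
  ring

/-- The reduced LR system preserves the measure `σ dq dq̇`. -/
theorem divergence_density_smul_localField (h : D.IsLocalSystem Φ W U) {p : F × F} (hp : p.1 ∈ U) :
    divergence (fun p : F × F => D.density Φ p.1 • D.localField Φ W p) p = 0 := by
  have hn : U ×ˢ (univ : Set F) ∈ 𝓝 p := (h.isOpen.prod isOpen_univ).mem_nhds ⟨hp, mem_univ _⟩
  have hσ : HasFDerivAt (fun p : F × F => D.density Φ p.1)
      ((fderiv ℝ (D.density Φ) p.1).comp (ContinuousLinearMap.fst ℝ F F)) p :=
    (((h.contDiffOn_density.contDiffAt (h.isOpen.mem_nhds hp)).differentiableAt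
      (by simp)).hasFDerivAt).comp p hasFDerivAt_fst
  have hS : HasFDerivAt (D.localField Φ W) (fderiv ℝ (D.localField Φ W) p) p :=
    ((h.contDiffOn_localField.contDiffAt hn).differentiableAt (by simp)).hasFDerivAt
  have ha : HasFDerivAt (fun p : F × F => D.accel Φ W p.1 p.2)
      ((ContinuousLinearMap.snd ℝ F F).comp (fderiv ℝ (D.localField Φ W) p)) p :=
    (hasFDerivAt_snd (𝕜 := ℝ) (E := F) (F := F) (p := D.localField Φ W p)).comp p hS
  have hN : HasFDerivAt (fun v => D.accel Φ W p.1 v)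
      (((ContinuousLinearMap.snd ℝ F F).comp (fderiv ℝ (D.localField Φ W) p)).comp
        (ContinuousLinearMap.inr ℝ F F)) p.2 := by
    have h1 : HasFDerivAt (fun v : F => (p.1, v)) (ContinuousLinearMap.inr ℝ F F) p.2 :=
      hasFDerivAt_prodMk_right p.1 p.2
    exact ha.comp p.2 h1
  have h0 : (ContinuousLinearMap.fst ℝ F F).comp (fderiv ℝ (D.localField Φ W) p) =
      ContinuousLinearMap.snd ℝ F F :=
    ((hasFDerivAt_fst (𝕜 := ℝ) (E := F) (F := F) (p := D.localField Φ W p)).comp p hS).unique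
      hasFDerivAt_snd
  have hdiv : divergence (D.localField Φ W) p =
      -formTrace (pullback D.kin Φ p.1) (D.gyroForm Φ p.1 p.2) -
      formTrace (pullback D.kin Φ p.1) (fderiv ℝ (pullback D.kin Φ) p.1 p.2) := by
    rw [divergence, trace_prod_eq, ← h.trace_fderiv_accel hp hN]
    have h2 : LinearMap.fst ℝ F F ∘ₗ (fderiv ℝ (D.localField Φ W) p : F × F →ₗ[ℝ] F × F) ∘ₗ
        LinearMap.inl ℝ F F = 0 := by
      refine LinearMap.ext fun u => ?_
      exact DFunLike.congr_fun h0 (u, 0)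
    rw [h2, map_zero, zero_add]
    rfl
  rw [divergence_smul hσ.differentiableAt hS.differentiableAt, hσ.fderiv, hdiv]
  change fderiv ℝ (D.density Φ) p.1 p.2 + _ = 0
  rw [h.fderiv_density hp]
  linear_combination (-(1 / 2) * D.density Φ p.1) * h.formTrace_sub hp p.2

end IsLocalSystem

end KineticAlgebra

set_option maxSynthPendingDepth 3

/-! ### Changes of coordinates -/

theorem det_lowerTriangular {V W : Type*} [NormedAddCommGroup V] [NormedSpace ℝ V]
    [FiniteDimensional ℝ V] [NormedAddCommGroup W] [NormedSpace ℝ W] [FiniteDimensional ℝ W]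
    {M : V × W →ₗ[ℝ] V × W} (T : V →ₗ[ℝ] V) (S : V →ₗ[ℝ] W) (T' : W →ₗ[ℝ] W)
    (h₁ : ∀ p, (M p).1 = T p.1) (h₂ : ∀ u, (M (u, 0)).2 = S u) (h₃ : ∀ w, (M (0, w)).2 = T' w) :
    LinearMap.det M = LinearMap.det T * LinearMap.det T' := by
  let b := Module.finBasis ℝ V
  let b' := Module.finBasis ℝ W
  rw [← LinearMap.det_toMatrix (b.prod b'), ← LinearMap.det_toMatrix b T,
    ← LinearMap.det_toMatrix b' T', ← Matrix.det_fromBlocks_zero₁₂ _ (LinearMap.toMatrix b b' S)]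
  congr 1
  ext (i | i) (j | j) <;> simp [LinearMap.toMatrix_apply, h₁, h₂, h₃]

namespace KineticAlgebra

open Set Filter Topology

variable {E : Type*} [NormedAddCommGroup E] [NormedSpace ℝ E] [FiniteDimensional ℝ E]
  {F : Type*} [NormedAddCommGroup F] [NormedSpace ℝ F] [FiniteDimensional ℝ F]

/-- The map `τ` is a change of coordinates on `O` between the two coordinate descriptions
`Φ₀, W₀` and `Φ₁, W₁` of a reduced LR system. -/
structure IsTransition (Φ₀ Φ₁ : F → F →L[ℝ] E) (W₀ W₁ : F → ℝ) (τ : F → F) (O : Set F) : Prop where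
  isOpen : IsOpen O
  contDiffOn : ContDiffOn ℝ ∞ τ O
  momentum_eq : ∀ z ∈ O, ∀ v, Φ₀ z v = Φ₁ (τ z) (fderiv ℝ τ z v)
  potential_eq : ∀ z ∈ O, W₀ z = W₁ (τ z)

namespace IsTransition

variable {D : KineticAlgebra E} {Φ₀ Φ₁ : F → F →L[ℝ] E} {W₀ W₁ : F → ℝ} {U₀ U₁ O : Set F}
  {τ : F → F}

theorem surjective_fderiv (t : IsTransition Φ₀ Φ₁ W₀ W₁ τ O) (h₀ : D.IsLocalSystem Φ₀ W₀ U₀) {y : F}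
    (hy : y ∈ O) (hy₀ : y ∈ U₀) : Function.Surjective (fderiv ℝ τ y) := by
  refine LinearMap.injective_iff_surjective (f := (fderiv ℝ τ y : F →ₗ[ℝ] F)).1 ?_
  intro u w huw
  apply h₀.injective hy₀
  rw [t.momentum_eq y hy, t.momentum_eq y hy]
  exact congrArg (Φ₁ (τ y)) huw

theorem verticalProj_eq (t : IsTransition Φ₀ Φ₁ W₀ W₁ τ O) (h₀ : D.IsLocalSystem Φ₀ W₀ U₀)
    (h₁ : D.IsLocalSystem Φ₁ W₁ U₁) {y : F} (hy : y ∈ O) (hy₀ : y ∈ U₀) (hy₁ : τ y ∈ U₁) (x : E) :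
    D.verticalProj Φ₀ y x = D.verticalProj Φ₁ (τ y) x := by
  have h1 : D.horizontalPart Φ₁ (τ y) x = fderiv ℝ τ y (D.horizontalPart Φ₀ y x) := by
    refine h₁.horizontalPart_eq hy₁ fun w => ?_
    obtain ⟨w, rfl⟩ := t.surjective_fderiv h₀ hy hy₀ w
    rw [← t.momentum_eq y hy, ← t.momentum_eq y hy]
    exact h₀.form_horizontalPart hy₀ x w
  change x - Φ₀ y (D.horizontalPart Φ₀ y x) = x - Φ₁ (τ y) (D.horizontalPart Φ₁ (τ y) x)
  rw [t.momentum_eq y hy, h1]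

theorem differentiableAt (t : IsTransition Φ₀ Φ₁ W₀ W₁ τ O) {y : F} (hy : y ∈ O) :
    DifferentiableAt ℝ τ y :=
  (t.contDiffOn.contDiffAt (t.isOpen.mem_nhds hy)).differentiableAt (by simp)

theorem differentiableAt_fderiv (t : IsTransition Φ₀ Φ₁ W₀ W₁ τ O) {y : F} (hy : y ∈ O) :
    DifferentiableAt ℝ (fderiv ℝ τ) y :=
  ((t.contDiffOn.contDiffAt (t.isOpen.mem_nhds hy)).fderiv_right (m := 1)
    (by norm_cast)).differentiableAt (by simp)

theorem fderiv_metric (t : IsTransition Φ₀ Φ₁ W₀ W₁ τ O) (h₀ : D.IsLocalSystem Φ₀ W₀ U₀)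
    (h₁ : D.IsLocalSystem Φ₁ W₁ U₁) {y : F} (hy : y ∈ O) (hy₀ : y ∈ U₀) (hy₁ : τ y ∈ U₁)
    (v u w : F) :
    fderiv ℝ (pullback D.kin Φ₀) y v u w =
      fderiv ℝ (pullback D.kin Φ₁) (τ y) (fderiv ℝ τ y v) (fderiv ℝ τ y u) (fderiv ℝ τ y w) +
      pullback D.kin Φ₁ (τ y) (fderiv ℝ (fderiv ℝ τ) y v u) (fderiv ℝ τ y w) +
      pullback D.kin Φ₁ (τ y) (fderiv ℝ τ y u) (fderiv ℝ (fderiv ℝ τ) y v w) := by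
  have h1 := h₀.hasFDerivAt_pullback_apply D.kin hy₀ u w
  have hτ := (t.differentiableAt hy).hasFDerivAt
  have hτ' := (t.differentiableAt_fderiv hy).hasFDerivAt
  have hA := (h₁.differentiableAt_pullback D.kin hy₁).hasFDerivAt.comp y hτ
  have h2 := (hA.clm_apply (hτ'.clm_apply (hasFDerivAt_const u y))).clm_apply
    (hτ'.clm_apply (hasFDerivAt_const w y))
  have h3 := h1.unique (h2.congr_of_eventuallyEq ?_)
  · refine (DFunLike.congr_fun h3 v).trans ?_
    simp
    ring
  · filter_upwards [t.isOpen.mem_nhds hy] with z hz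
    simp only [pullback_apply, Function.comp_apply]
    rw [t.momentum_eq z hz, t.momentum_eq z hz]

/-- The acceleration transforms like the second derivative of a curve. -/
theorem accel_eq (t : IsTransition Φ₀ Φ₁ W₀ W₁ τ O) (h₀ : D.IsLocalSystem Φ₀ W₀ U₀)
    (h₁ : D.IsLocalSystem Φ₁ W₁ U₁) {y : F} (hy : y ∈ O) (hy₀ : y ∈ U₀) (hy₁ : τ y ∈ U₁) (v : F) :
    fderiv ℝ (fderiv ℝ τ) y v v + fderiv ℝ τ y (D.accel Φ₀ W₀ y v) =
      D.accel Φ₁ W₁ (τ y) (fderiv ℝ τ y v) := by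
  rw [h₁.eq_accel_iff hy₁]
  intro ξ
  obtain ⟨ξ, rfl⟩ := t.surjective_fderiv h₀ hy hy₀ ξ
  have h1 := (h₀.eq_accel_iff hy₀ v _).1 rfl ξ
  have hs : fderiv ℝ (fderiv ℝ τ) y ξ v = fderiv ℝ (fderiv ℝ τ) y v ξ :=
    (t.contDiffOn.contDiffAt (t.isOpen.mem_nhds hy)).isSymmSndFDerivAt
      (by rw [minSmoothness_of_isRCLikeNormedField]; exact ENat.LEInfty.out) ξ v
  have hW : fderiv ℝ W₀ y ξ = fderiv ℝ W₁ (τ y) (fderiv ℝ τ y ξ) := by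
    have h2 : HasFDerivAt W₁ (fderiv ℝ W₁ (τ y)) (τ y) := ((h₁.contDiffOn_potential.contDiffAt
      (h₁.isOpen.mem_nhds hy₁)).differentiableAt (by simp)).hasFDerivAt
    have h3 := (h2.comp y (t.differentiableAt hy).hasFDerivAt).congr_of_eventuallyEq
      (f₁ := W₀) ((t.isOpen.mem_nhds hy |> fun h => Filter.mem_of_superset h t.potential_eq))
    rw [h3.fderiv]
    rfl
  have hc : D.gyro Φ₀ y v v ξ =
      D.gyro Φ₁ (τ y) (fderiv ℝ τ y v) (fderiv ℝ τ y v) (fderiv ℝ τ y ξ) := by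
    rw [gyro_apply, gyro_apply, t.verticalProj_eq h₀ h₁ hy hy₀ hy₁, t.momentum_eq y hy,
      t.momentum_eq y hy]
  have hq := t.fderiv_metric h₀ h₁ hy hy₀ hy₁ ξ v v
  have hv := t.fderiv_metric h₀ h₁ hy hy₀ hy₁ v v ξ
  rw [t.momentum_eq y hy, t.momentum_eq y hy ξ] at h1
  change _ = 1 / 2 * fderiv ℝ (pullback D.kin Φ₀) y ξ v v - fderiv ℝ W₀ y ξ - D.gyro Φ₀ y v v ξ -
    fderiv ℝ (pullback D.kin Φ₀) y v v ξ at h1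
  change _ = 1 / 2 * fderiv ℝ (pullback D.kin Φ₁) (τ y) (fderiv ℝ τ y ξ) (fderiv ℝ τ y v)
      (fderiv ℝ τ y v) - fderiv ℝ W₁ (τ y) (fderiv ℝ τ y ξ) -
      D.gyro Φ₁ (τ y) (fderiv ℝ τ y v) (fderiv ℝ τ y v) (fderiv ℝ τ y ξ) -
    fderiv ℝ (pullback D.kin Φ₁) (τ y) (fderiv ℝ τ y v) (fderiv ℝ τ y v) (fderiv ℝ τ y ξ)
  rw [hq, hv, hW, hc, hs,
    pullback_symm D.kin_symm Φ₁ (τ y) (fderiv ℝ τ y v)] at h1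
  simp only [pullback_apply] at h1
  rw [map_add, map_add, ContinuousLinearMap.add_apply, h1]
  ring

/-- The tangent map of the change of coordinates relates the two local vector fields. -/
theorem fderiv_tangentMap_localField (t : IsTransition Φ₀ Φ₁ W₀ W₁ τ O)
    (h₀ : D.IsLocalSystem Φ₀ W₀ U₀)
    (h₁ : D.IsLocalSystem Φ₁ W₁ U₁) {p : F × F} (hy : p.1 ∈ O) (hy₀ : p.1 ∈ U₀)
    (hy₁ : τ p.1 ∈ U₁) :
    fderiv ℝ (fun p : F × F => (τ p.1, fderiv ℝ τ p.1 p.2)) p (D.localField Φ₀ W₀ p) =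
      D.localField Φ₁ W₁ (τ p.1, fderiv ℝ τ p.1 p.2) := by
  have h1 := (t.differentiableAt hy).hasFDerivAt.comp p hasFDerivAt_fst
  have h2 := ((t.differentiableAt_fderiv hy).hasFDerivAt.comp p hasFDerivAt_fst).clm_apply
    (hasFDerivAt_snd (p := p))
  have h3 := (h1.prodMk h2).fderiv
  refine (DFunLike.congr_fun h3 _).trans ?_
  refine Prod.ext rfl ?_
  refine Eq.trans ?_ (t.accel_eq h₀ h₁ hy hy₀ hy₁ p.2)
  rw [add_comm]
  rfl

/-- The density on the tangent bundle transforms with the square of the determinant, as the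
determinants of both metrics do. -/
theorem density_eq (t : IsTransition Φ₀ Φ₁ W₀ W₁ τ O) {y : F} (hy : y ∈ O) :
    D.density Φ₀ y = (fderiv ℝ τ y).det ^ 2 * D.density Φ₁ (τ y) := by
  have h1 : ∀ K : E →L[ℝ] E →L[ℝ] ℝ, formDet (pullback K Φ₀ y) =
      (fderiv ℝ τ y).det ^ 2 * formDet (pullback K Φ₁ (τ y)) := by
    intro K
    refine formDet_congr fun u w => ?_
    rw [pullback_apply, pullback_apply, t.momentum_eq y hy, t.momentum_eq y hy]
  rw [density, density, h1, h1]
  have h2 : ∀ d a b : ℝ, √|d ^ 2 * a * (d ^ 2 * b)| = d ^ 2 * √|a * b| := by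
    intro d a b
    have h3 : d ^ 2 * a * (d ^ 2 * b) = (d ^ 2) ^ 2 * (a * b) := by ring
    rw [h3, abs_mul, abs_of_nonneg (by positivity : (0 : ℝ) ≤ (d ^ 2) ^ 2),
      Real.sqrt_mul (by positivity), Real.sqrt_sq (by positivity)]
  exact h2 _ _ _

/-- The determinant of the tangent map of the change of coordinates. -/
theorem det_fderiv_tangentMap (t : IsTransition Φ₀ Φ₁ W₀ W₁ τ O) {p : F × F} (hy : p.1 ∈ O) :
    (fderiv ℝ (fun p : F × F => (τ p.1, fderiv ℝ τ p.1 p.2)) p).det = (fderiv ℝ τ p.1).det ^ 2 := by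
  have h1 := (t.differentiableAt hy).hasFDerivAt.comp p hasFDerivAt_fst
  have h2 := ((t.differentiableAt_fderiv hy).hasFDerivAt.comp p hasFDerivAt_fst).clm_apply
    (hasFDerivAt_snd (p := p))
  have h3 := (h1.prodMk h2).fderiv
  refine (congrArg ContinuousLinearMap.det h3).trans ?_
  rw [ContinuousLinearMap.det, sq]
  exact det_lowerTriangular (fderiv ℝ τ p.1 : F →ₗ[ℝ] F)
    (((fderiv ℝ (fderiv ℝ τ) p.1).flip p.2 : F →L[ℝ] F) : F →ₗ[ℝ] F) (fderiv ℝ τ p.1 : F →ₗ[ℝ] F) (fun u => rfl)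
    (fun u => by simp) fun u => by simp

end IsTransition

end KineticAlgebra

set_option maxSynthPendingDepth 3

/-! ### Charts of the tangent bundle and the reduced field -/

section TangentBundleCharts

open Set Filter Topology

variable {F : Type*} [NormedAddCommGroup F] [NormedSpace ℝ F]
  {Q : Type*} [TopologicalSpace Q] [ChartedSpace F Q] [IsManifold 𝓘(ℝ, F) ∞ Q]

theorem mem_extChartAt_tangent_source {w w' : TangentBundle 𝓘(ℝ, F) Q} :
    w' ∈ (extChartAt (𝓘(ℝ, F).tangent) w).source ↔
      w'.proj ∈ (extChartAt 𝓘(ℝ, F) w.proj).source := by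
  simp

theorem mem_extChartAt_tangent_target {w : TangentBundle 𝓘(ℝ, F) Q} {p : F × F} :
    p ∈ (extChartAt (𝓘(ℝ, F).tangent) w).target ↔ p.1 ∈ (extChartAt 𝓘(ℝ, F) w.proj).target := by
  rw [FiberBundle.extChartAt_target]
  constructor
  · exact fun h => h.1.1
  · intro h
    have := (extChartAt 𝓘(ℝ, F) w.proj).map_target h
    exact ⟨⟨h, by simpa using this⟩, mem_univ _⟩

theorem extChartAt_tangent_symm_apply (w : TangentBundle 𝓘(ℝ, F) Q) {p : F × F}
    (hp : p.1 ∈ (extChartAt 𝓘(ℝ, F) w.proj).target) :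
    (extChartAt (𝓘(ℝ, F).tangent) w).symm p = ⟨(extChartAt 𝓘(ℝ, F) w.proj).symm p.1,
      tangentSymm F w.proj ((extChartAt 𝓘(ℝ, F) w.proj).symm p.1) p.2⟩ := by
  have h1 : (extChartAt 𝓘(ℝ, F) w.proj).symm p.1 ∈
      (trivializationAt F (TangentSpace 𝓘(ℝ, F)) w.proj).baseSet := by
    have := (extChartAt 𝓘(ℝ, F) w.proj).map_target hp
    simpa using this
  rw [FiberBundle.extChartAt]
  have h2 : tangentSymm F w.proj ((extChartAt 𝓘(ℝ, F) w.proj).symm p.1) p.2 =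
      (trivializationAt F (TangentSpace 𝓘(ℝ, F)) w.proj).symm
        ((extChartAt 𝓘(ℝ, F) w.proj).symm p.1) p.2 :=
    congrFun ((trivializationAt F (TangentSpace 𝓘(ℝ, F)) w.proj).coe_symmₗ (R := ℝ) h1) p.2
  rw [h2]
  exact ((trivializationAt F (TangentSpace 𝓘(ℝ, F)) w.proj).mk_symm h1 p.2).symm

theorem extChartAt_tangent_apply (w : TangentBundle 𝓘(ℝ, F) Q) {q : Q}
    (hq : q ∈ (extChartAt 𝓘(ℝ, F) w.proj).source) (u : F) :
    extChartAt (𝓘(ℝ, F).tangent) w (⟨q, u⟩ : TangentBundle 𝓘(ℝ, F) Q) =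
      (extChartAt 𝓘(ℝ, F) w.proj q,
        (mfderiv 𝓘(ℝ, F) 𝓘(ℝ, F) (extChartAt 𝓘(ℝ, F) w.proj) q : F →L[ℝ] F) u) := by
  set e := trivializationAt F (TangentSpace 𝓘(ℝ, F)) w.proj with he
  have h1 : q ∈ e.baseSet := by simpa [he] using hq
  have h2 := TangentBundle.continuousLinearMapAt_trivializationAt (I := 𝓘(ℝ, F)) (x₀ := w.proj)
    (x := q) (by simpa using hq)
  have h3 : (e ⟨q, u⟩).2 = (mfderiv 𝓘(ℝ, F) 𝓘(ℝ, F) (extChartAt 𝓘(ℝ, F) w.proj) q : F →L[ℝ] F) u := by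
    refine Eq.trans ?_ (DFunLike.congr_fun h2 u)
    exact (congrFun (e.coe_linearMapAt_of_mem (R := ℝ) h1) u).symm
  rw [FiberBundle.extChartAt]
  refine Prod.ext ?_ h3
  exact congrArg (extChartAt 𝓘(ℝ, F) w.proj) (e.coe_fst' h1)

theorem tangentSymm_chartTrans {q₀ q₁ : Q} {y : F} (hy : y ∈ chartOverlap 𝓘(ℝ, F) q₀ q₁) (v : F) :
    (mfderiv 𝓘(ℝ, F) 𝓘(ℝ, F) (extChartAt 𝓘(ℝ, F) q₁) ((extChartAt 𝓘(ℝ, F) q₀).symm y) : F →L[ℝ] F)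
      (tangentSymm F q₀ ((extChartAt 𝓘(ℝ, F) q₀).symm y) v) =
        fderiv ℝ (chartTrans 𝓘(ℝ, F) q₀ q₁) y v := by
  set q := (extChartAt 𝓘(ℝ, F) q₀).symm y with hq
  have hq0 : q ∈ (extChartAt 𝓘(ℝ, F) q₀).source := (extChartAt 𝓘(ℝ, F) q₀).map_target hy.1
  have hyq : extChartAt 𝓘(ℝ, F) q₀ q = y := (extChartAt 𝓘(ℝ, F) q₀).right_inv hy.1
  have h1 : HasFDerivAt (chartTrans 𝓘(ℝ, F) q₀ q₁) (fderiv ℝ (chartTrans 𝓘(ℝ, F) q₀ q₁) y)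
      (extChartAt 𝓘(ℝ, F) q₀ q) := by
    rw [hyq]
    exact (((contDiffOn_chartTrans 𝓘(ℝ, F) q₀ q₁).contDiffAt
      ((isOpen_chartOverlap 𝓘(ℝ, F) q₀ q₁).mem_nhds hy)).differentiableAt (by simp)).hasFDerivAt
  haveI : IsManifold 𝓘(ℝ, F) 1 Q := .of_le (n := ∞) (by norm_cast)
  have h2 := h1.hasMFDerivAt.comp q
    (mdifferentiableAt_extChartAt (I := 𝓘(ℝ, F)) (x := q₀) (by simpa using hq0)).hasMFDerivAt
  have h3 : extChartAt 𝓘(ℝ, F) q₁ =ᶠ[𝓝 q]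
      chartTrans 𝓘(ℝ, F) q₀ q₁ ∘ extChartAt 𝓘(ℝ, F) q₀ := by
    filter_upwards [(isOpen_extChartAt_source (I := 𝓘(ℝ, F)) q₀).mem_nhds hq0] with z hz
    exact (chartTrans_extChartAt 𝓘(ℝ, F) hz).symm
  have h4 := (h2.congr_of_eventuallyEq h3).mfderiv
  refine (DFunLike.congr_fun h4 _).trans ?_
  exact congrArg (fderiv ℝ (chartTrans 𝓘(ℝ, F) q₀ q₁) y) (mfderiv_extChartAt_tangentSymm hq0 v)

theorem tangentSymm_self (q : Q) (v : F) : tangentSymm F q q v = v := by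
  have hq : q ∈ (extChartAt 𝓘(ℝ, F) q).source := mem_extChartAt_source q
  have h1 := mfderiv_extChartAt_eq_fderiv_chartTrans 𝓘(ℝ, F) hq
  have h2 : chartTrans 𝓘(ℝ, F) q q =ᶠ[𝓝 (extChartAt 𝓘(ℝ, F) q q)] id := by
    filter_upwards [extChartAt_target_mem_nhds (I := 𝓘(ℝ, F)) q] with z hz
    exact (extChartAt 𝓘(ℝ, F) q).right_inv hz
  have h3 := tangentSymm_mfderiv_extChartAt (F := F) hq v
  rw [h1, h2.fderiv_eq, fderiv_id] at h3
  exact h3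

/-- The change of coordinates on the tangent bundle is the tangent map of the change of
coordinates on the base. -/
theorem chartTrans_tangent {w₀ w₁ : TangentBundle 𝓘(ℝ, F) Q} {p : F × F}
    (hp : p.1 ∈ chartOverlap 𝓘(ℝ, F) w₀.proj w₁.proj) :
    chartTrans (𝓘(ℝ, F).tangent) w₀ w₁ p = (chartTrans 𝓘(ℝ, F) w₀.proj w₁.proj p.1,
      fderiv ℝ (chartTrans 𝓘(ℝ, F) w₀.proj w₁.proj) p.1 p.2) := by
  rw [chartTrans, extChartAt_tangent_symm_apply w₀ hp.1]
  refine (extChartAt_tangent_apply w₁ hp.2 _).trans ?_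
  rw [tangentSymm_chartTrans hp]
  rfl

theorem mem_chartOverlap_tangent {w₀ w₁ : TangentBundle 𝓘(ℝ, F) Q} {p : F × F} :
    p ∈ chartOverlap (𝓘(ℝ, F).tangent) w₀ w₁ ↔
      p.1 ∈ chartOverlap 𝓘(ℝ, F) w₀.proj w₁.proj := by
  constructor
  · rintro ⟨h1, h2⟩
    have h3 := mem_extChartAt_tangent_target.1 h1
    refine ⟨h3, ?_⟩
    rw [mem_preimage, extChartAt_tangent_symm_apply w₀ h3] at h2
    exact mem_extChartAt_tangent_source.1 h2
  · rintro ⟨h1, h2⟩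
    refine ⟨mem_extChartAt_tangent_target.2 h1, ?_⟩
    rw [mem_preimage, extChartAt_tangent_symm_apply w₀ h1]
    exact mem_extChartAt_tangent_source.2 h2

theorem isManifold_tangentBundle : IsManifold (𝓘(ℝ, F).tangent) ∞ (TangentBundle 𝓘(ℝ, F) Q) := by
  haveI : IsManifold 𝓘(ℝ, F) (∞ + 1) Q := ‹IsManifold 𝓘(ℝ, F) ∞ Q›
  haveI : ContMDiffVectorBundle ∞ F (TangentSpace 𝓘(ℝ, F) : Q → Type _) 𝓘(ℝ, F) :=
    TangentBundle.contMDiffVectorBundle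
  exact Bundle.TotalSpace.isManifold F (TangentSpace 𝓘(ℝ, F))

end TangentBundleCharts

namespace InertiaData

open Set Filter Topology KineticAlgebra

variable {E : Type*} [NormedAddCommGroup E] [NormedSpace ℝ E] [FiniteDimensional ℝ E]
  {G : Type*} [TopologicalSpace G] [ChartedSpace E G] [Group G] [LieGroup 𝓘(ℝ, E) ∞ G]
  (S : InertiaData E G) {H : Subgroup G}

/-- The Lie algebra of the group, with its scalar product and inertia operator, on the model
space. -/
def kineticAlgebra : KineticAlgebra E where
  form := (show E →ₗ[ℝ] E →ₗ[ℝ] ℝ from S.form).toContinuousBilinearMap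
  inertia := LinearMap.toContinuousLinearMap (show E →ₗ[ℝ] E from S.inertia)
  bracket := (modelBracket E G).toContinuousBilinearMap
  form_symm := S.form_symm
  form_pos := S.form_pos
  inertia_symm := S.inertia_symm
  bracket_swap := fun x y => bracket_swap (E := E) (G := G) x y
  form_bracket := fun z x y => S.form_bracket z x y

variable {F : Type*} [NormedAddCommGroup F] [NormedSpace ℝ F] [FiniteDimensional ℝ F]
  [ChartedSpace F (CosetSpace H)] [IsManifold 𝓘(ℝ, F) ∞ (CosetSpace H)]

variable (F) in
/-- The potential in the coordinates around `q₀`. -/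
def localPotential (V : CosetSpace H → ℝ) (q₀ : CosetSpace H) (y : F) : ℝ :=
  V ((extChartAt 𝓘(ℝ, F) q₀).symm y)

/-- The momentum map of the coset space, in a chart, has the properties from which the invariant
density was derived. -/
theorem isLocalSystem (hs : Manifold.IsSubmersion 𝓘(ℝ, E) 𝓘(ℝ, F) ∞ (cosetProj H))
    (hr : S.IsRegular H) {V : CosetSpace H → ℝ} (hV : ContMDiff 𝓘(ℝ, F) 𝓘(ℝ, ℝ) ∞ V)
    (q₀ : CosetSpace H) :
    S.kineticAlgebra.IsLocalSystem (S.localPhi hs q₀) (localPotential F V q₀)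
      (extChartAt 𝓘(ℝ, F) q₀).target where
  isOpen := isOpen_extChartAt_target q₀
  contDiffOn_momentum := S.contDiffOn_localPhi hs q₀
  contDiffOn_potential := contMDiffOn_iff_contDiffOn.1
    (hV.contMDiffOn.comp (contMDiffOn_extChartAt_symm (I := 𝓘(ℝ, F)) (n := ∞) q₀)
      (t := univ) fun _ _ => mem_univ _)
  structure_eq := fun y hy v w => S.exists_fderiv_localPhi_add_bracket hs hy v w
  regular := by
    intro y hy v hv
    obtain ⟨g, hg⟩ := exists_cosetProj_eq ((extChartAt 𝓘(ℝ, F) q₀).symm y)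
    have hgs : cosetProj H g ∈ (extChartAt 𝓘(ℝ, F) q₀).source := by
      rw [hg]
      exact (extChartAt 𝓘(ℝ, F) q₀).map_target hy
    have hgy : extChartAt 𝓘(ℝ, F) q₀ (cosetProj H g) = y := by
      rw [hg]
      exact (extChartAt 𝓘(ℝ, F) q₀).right_inv hy
    subst hgy
    have h1 := hr g _ (S.localPhi_mem hs hgs v) fun η hη => by
      obtain ⟨u, hu⟩ := S.exists_localPhi_eq hs hgs hη
      rw [← hu]
      exact hv u
    have h2 := S.chartCosetDeriv_localPhi hs hgs v
    have h3 : lieAd E g (show GroupLieAlgebra 𝓘(ℝ, E) G from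
        S.localPhi hs q₀ (extChartAt 𝓘(ℝ, F) q₀ (cosetProj H g)) v) = 0 :=
      (congrArg (lieAd E g) h1).trans (map_zero (lieAd E g))
    rw [← h2]
    exact (congrArg (chartCosetDeriv E H F q₀ g) h3).trans (map_zero (chartCosetDeriv E H F q₀ g))

/-- The momentum map and the potential do not depend on the coordinates. -/
theorem isTransition (hs : Manifold.IsSubmersion 𝓘(ℝ, E) 𝓘(ℝ, F) ∞ (cosetProj H))
    (V : CosetSpace H → ℝ) (q₀ q₁ : CosetSpace H) :
    IsTransition (S.localPhi hs q₀) (S.localPhi hs q₁) (localPotential F V q₀)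
      (localPotential F V q₁) (chartTrans 𝓘(ℝ, F) q₀ q₁) (chartOverlap 𝓘(ℝ, F) q₀ q₁) where
  isOpen := isOpen_chartOverlap 𝓘(ℝ, F) q₀ q₁
  contDiffOn := contDiffOn_chartTrans 𝓘(ℝ, F) q₀ q₁
  momentum_eq := by
    intro y hy v
    have h1 : (extChartAt 𝓘(ℝ, F) q₁).symm (chartTrans 𝓘(ℝ, F) q₀ q₁ y) =
        (extChartAt 𝓘(ℝ, F) q₀).symm y := (extChartAt 𝓘(ℝ, F) q₁).left_inv hy.2
    change S.PhiL hs _ (tangentSymm F q₀ _ v) =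
      S.PhiL hs ((extChartAt 𝓘(ℝ, F) q₁).symm (chartTrans 𝓘(ℝ, F) q₀ q₁ y))
        (tangentSymm F q₁ ((extChartAt 𝓘(ℝ, F) q₁).symm (chartTrans 𝓘(ℝ, F) q₀ q₁ y)) _)
    rw [h1, ← tangentSymm_chartTrans hy]
    exact (congrArg _ (tangentSymm_mfderiv_extChartAt hy.2 _)).symm
  potential_eq := by
    intro y hy
    have h1 : (extChartAt 𝓘(ℝ, F) q₁).symm (chartTrans 𝓘(ℝ, F) q₀ q₁ y) =
        (extChartAt 𝓘(ℝ, F) q₀).symm y := (extChartAt 𝓘(ℝ, F) q₁).left_inv hy.2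
    rw [localPotential, localPotential, h1]

theorem orthProj_eq_verticalProj (hs : Manifold.IsSubmersion 𝓘(ℝ, E) 𝓘(ℝ, F) ∞ (cosetProj H))
    (hr : S.IsRegular H) {V : CosetSpace H → ℝ} (hV : ContMDiff 𝓘(ℝ, F) 𝓘(ℝ, ℝ) ∞ V)
    {q₀ q : CosetSpace H} (hq : q ∈ (extChartAt 𝓘(ℝ, F) q₀).source)
    (ξ : GroupLieAlgebra 𝓘(ℝ, E) G) :
    S.orthProj (vertical H q.out) ξ =
      S.kineticAlgebra.verticalProj (S.localPhi hs q₀) (extChartAt 𝓘(ℝ, F) q₀ q) ξ := by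
  have ho : cosetProj H q.out = q := Quotient.out_eq q
  have hqs : cosetProj H q.out ∈ (extChartAt 𝓘(ℝ, F) q₀).source := by rwa [ho]
  obtain ⟨a, ha, b, hb, rfl⟩ := S.exists_add_eq H q.out ξ
  rw [S.orthProj_add ha hb]
  obtain ⟨u, hu⟩ := S.exists_localPhi_eq hs hqs hb
  rw [ho] at hu
  have h1 : S.kineticAlgebra.horizontalPart (S.localPhi hs q₀) (extChartAt 𝓘(ℝ, F) q₀ q)
      (show E from a + b) = u := by
    refine (S.isLocalSystem hs hr hV q₀).horizontalPart_eq ((extChartAt 𝓘(ℝ, F) q₀).map_source hq)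
      fun w => ?_
    rw [hu]
    have h2 := S.localPhi_mem hs hqs w
    rw [ho] at h2
    have h3 := S.form_eq_zero_of_mem ha h2
    change S.form b _ = S.form (a + b) _
    rw [map_add]
    refine (zero_add _).symm.trans ?_
    exact congrArg (· + S.form b _) h3.symm
  have h4 : S.localPhi hs q₀ (extChartAt 𝓘(ℝ, F) q₀ q) (S.kineticAlgebra.horizontalPart
      (S.localPhi hs q₀) (extChartAt 𝓘(ℝ, F) q₀ q) (show E from a + b)) = b :=
    (congrArg _ h1).trans hu
  refine Eq.trans ?_ (congrArg (fun x : E => (show E from a + b) - x) h4).symm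
  exact (add_sub_cancel_right (show E from a) b).symm

/-- The nonholonomic term in coordinates. -/
theorem curvatureTerm_eq (hs : Manifold.IsSubmersion 𝓘(ℝ, E) 𝓘(ℝ, F) ∞ (cosetProj H))
    (hr : S.IsRegular H) {V : CosetSpace H → ℝ} (hV : ContMDiff 𝓘(ℝ, F) 𝓘(ℝ, ℝ) ∞ V)
    (w : TangentBundle 𝓘(ℝ, F) (CosetSpace H)) (ξ : F) :
    S.curvatureTerm H w ξ = S.kineticAlgebra.gyro (S.localPhi hs w.proj)
      (extChartAt 𝓘(ℝ, F) w.proj w.proj) w.snd w.snd ξ := by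
  have h1 : ∀ v : F, S.localPhi hs w.proj (extChartAt 𝓘(ℝ, F) w.proj w.proj) v =
      S.Phi H w.proj v := by
    intro v
    change S.PhiL hs ((extChartAt 𝓘(ℝ, F) w.proj).symm _) (tangentSymm F w.proj _ v) = _
    rw [extChartAt_to_inv, tangentSymm_self]
    rfl
  have h2 := h1 w.snd
  have h3 := S.orthProj_eq_verticalProj hs hr hV (mem_extChartAt_source (I := 𝓘(ℝ, F)) w.proj)
    ⁅S.Phi H w.proj w.snd, S.Phi H w.proj ξ⁆
  refine Eq.trans ?_ (S.kineticAlgebra.gyro_apply _ _ _ _ ξ).symm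
  refine (congrArg (S.form (S.inertia (S.Phi H w.proj w.snd))) h3).trans ?_
  have h4 : ∀ a b c : E, a = S.Phi H w.proj w.snd → b = S.Phi H w.proj w.snd →
      c = S.Phi H w.proj ξ → S.form (S.inertia (S.Phi H w.proj w.snd))
        (S.kineticAlgebra.verticalProj (S.localPhi hs w.proj) (extChartAt 𝓘(ℝ, F) w.proj w.proj)
          (show GroupLieAlgebra 𝓘(ℝ, E) G from ⁅S.Phi H w.proj w.snd, S.Phi H w.proj ξ⁆)) =
        S.kineticAlgebra.kin a (S.kineticAlgebra.verticalProj (S.localPhi hs w.proj)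
          (extChartAt 𝓘(ℝ, F) w.proj w.proj) (S.kineticAlgebra.bracket b c)) := by
    rintro _ _ _ rfl rfl rfl
    rfl
  exact h4 _ _ _ h2 h2 (h1 ξ)

end InertiaData

set_option maxSynthPendingDepth 3

namespace KineticAlgebra

open Set Filter Topology

variable {E : Type*} [NormedAddCommGroup E] [NormedSpace ℝ E] [FiniteDimensional ℝ E]
  {F : Type*} [NormedAddCommGroup F] [NormedSpace ℝ F] [FiniteDimensional ℝ F]

/-- The Lagrangian in the coordinates `(q, q̇)`. -/
def lagrangian (D : KineticAlgebra E) (Φ : F → F →L[ℝ] E) (W : F → ℝ) (p : F × F) : ℝ :=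
  (1 / 2) * pullback D.kin Φ p.1 p.2 p.2 - W p.1

namespace IsLocalSystem

variable {D : KineticAlgebra E} {Φ : F → F →L[ℝ] E} {W : F → ℝ} {U : Set F}

theorem fderiv_lagrangian (h : D.IsLocalSystem Φ W U) {L : F × F → ℝ} {p : F × F} (hp : p.1 ∈ U)
    (hL : L =ᶠ[𝓝 p] D.lagrangian Φ W) (u ξ : F) :
    fderiv ℝ L p (u, ξ) = (1 / 2) * fderiv ℝ (pullback D.kin Φ) p.1 u p.2 p.2 +
      pullback D.kin Φ p.1 p.2 ξ - fderiv ℝ W p.1 u := by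
  have hA := (h.differentiableAt_pullback D.kin hp).hasFDerivAt.comp p hasFDerivAt_fst
  have hW : HasFDerivAt W (fderiv ℝ W p.1) p.1 := ((h.contDiffOn_potential.contDiffAt
    (h.isOpen.mem_nhds hp)).differentiableAt (by simp)).hasFDerivAt
  have h1 := (((hA.clm_apply (hasFDerivAt_snd (p := p))).clm_apply (hasFDerivAt_snd (p := p))
    ).const_mul (1 / 2 : ℝ)).sub (hW.comp p hasFDerivAt_fst)
  have h2 := DFunLike.congr_fun (h1.congr_of_eventuallyEq hL).fderiv (u, ξ)
  refine h2.trans ?_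
  have hs := pullback_symm D.kin_symm Φ p.1 p.2 ξ
  simp
  rw [← hs]
  ring

theorem hasDerivAt_momentum (h : D.IsLocalSystem Φ W U) {c : ℝ → F × F} {c' : F × F} {t : ℝ}
    (hc : HasDerivAt c c' t) (ht : (c t).1 ∈ U) (ξ : F) :
    HasDerivAt (fun τ => pullback D.kin Φ (c τ).1 (c τ).2 ξ)
      (fderiv ℝ (pullback D.kin Φ) (c t).1 c'.1 (c t).2 ξ + pullback D.kin Φ (c t).1 c'.2 ξ) t := by
  have hA := (h.differentiableAt_pullback D.kin ht).hasFDerivAt.comp (c t) hasFDerivAt_fst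
  have h1 := (hA.clm_apply (hasFDerivAt_snd (p := c t))).clm_apply (hasFDerivAt_const ξ (c t))
  refine (h1.comp_hasDerivAt t hc).congr_deriv ?_
  simp
  ring

/-- The Euler-Lagrange equations with the nonholonomic term are equivalent to the equation for the
acceleration. -/
theorem forall_hasDerivAt_iff (h : D.IsLocalSystem Φ W U) {L : F × F → ℝ} {c : ℝ → F × F}
    {c' : F × F} {t : ℝ} (hc : HasDerivAt c c' t) (ht : (c t).1 ∈ U)
    (hL : L =ᶠ[𝓝 (c t)] D.lagrangian Φ W) (hv : c'.1 = (c t).2) :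
    (∀ ξ, HasDerivAt (fun τ => fderiv ℝ L (c τ) (0, ξ))
      (fderiv ℝ L (c t) (ξ, 0) - D.gyro Φ (c t).1 (c t).2 (c t).2 ξ) t) ↔
      c' = D.localField Φ W (c t) := by
  have hev : ∀ᶠ τ in 𝓝 t, (c τ).1 ∈ U ∧ L =ᶠ[𝓝 (c τ)] D.lagrangian Φ W := by
    have h1 : ∀ᶠ p in 𝓝 (c t), p.1 ∈ U ∧ L =ᶠ[𝓝 p] D.lagrangian Φ W :=
      Filter.Eventually.and ((h.isOpen.preimage continuous_fst).mem_nhds ht) hL.eventuallyEq_nhds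
    exact hc.continuousAt.eventually h1
  have h1 : ∀ ξ, HasDerivAt (fun τ => fderiv ℝ L (c τ) (0, ξ))
      (fderiv ℝ (pullback D.kin Φ) (c t).1 (c t).2 (c t).2 ξ + pullback D.kin Φ (c t).1 c'.2 ξ) t := by
    intro ξ
    have h2 := h.hasDerivAt_momentum hc ht ξ
    rw [hv] at h2
    refine h2.congr_of_eventuallyEq ?_
    filter_upwards [hev] with τ hτ
    rw [h.fderiv_lagrangian hτ.1 hτ.2]
    simp
  have h2 : ∀ ξ, fderiv ℝ L (c t) (ξ, 0) = (1 / 2) * fderiv ℝ (pullback D.kin Φ) (c t).1 ξ (c t).2 (c t).2 -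
      fderiv ℝ W (c t).1 ξ := by
    intro ξ
    rw [h.fderiv_lagrangian ht hL]
    simp
  have h3 : (c' = D.localField Φ W (c t)) ↔ c'.2 = D.accel Φ W (c t).1 (c t).2 :=
    ⟨fun h => congrArg Prod.snd h, fun h => Prod.ext hv h⟩
  rw [h3, h.eq_accel_iff ht]
  refine forall_congr' fun ξ => ?_
  have h4 : D.force Φ W (c t).1 (c t).2 ξ = (1 / 2) * fderiv ℝ (pullback D.kin Φ) (c t).1 ξ (c t).2 (c t).2 -
      fderiv ℝ W (c t).1 ξ - D.gyro Φ (c t).1 (c t).2 (c t).2 ξ -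
      fderiv ℝ (pullback D.kin Φ) (c t).1 (c t).2 (c t).2 ξ := rfl
  rw [h4, ← pullback_apply D.kin, h2]
  constructor
  · intro h5
    have := h5.unique (h1 ξ)
    linarith
  · intro h5
    refine (h1 ξ).congr_deriv ?_
    linarith

end IsLocalSystem

end KineticAlgebra

namespace InertiaData

open Set Filter Topology KineticAlgebra

variable {E : Type*} [NormedAddCommGroup E] [NormedSpace ℝ E] [FiniteDimensional ℝ E]
  {G : Type*} [TopologicalSpace G] [ChartedSpace E G] [Group G] [LieGroup 𝓘(ℝ, E) ∞ G]
  (S : InertiaData E G) {H : Subgroup G}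
  {F : Type*} [NormedAddCommGroup F] [NormedSpace ℝ F] [FiniteDimensional ℝ F]
  [ChartedSpace F (CosetSpace H)] [IsManifold 𝓘(ℝ, F) ∞ (CosetSpace H)]

/-- The vector field on `T(H \ G)` of the reduced LR system. -/
def reducedField (hs : Manifold.IsSubmersion 𝓘(ℝ, E) 𝓘(ℝ, F) ∞ (cosetProj H))
    (V : CosetSpace H → ℝ) : (w : TangentBundle 𝓘(ℝ, F) (CosetSpace H)) →
      TangentSpace (𝓘(ℝ, F).tangent) w :=
  glueField (𝓘(ℝ, F).tangent) fun w =>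
    S.kineticAlgebra.localField (S.localPhi hs w.proj) (localPotential F V w.proj)

theorem chartTrans_tangent_eventuallyEq {w₀ w₁ : TangentBundle 𝓘(ℝ, F) (CosetSpace H)} {p : F × F}
    (hp : p ∈ chartOverlap (𝓘(ℝ, F).tangent) w₀ w₁) :
    chartTrans (𝓘(ℝ, F).tangent) w₀ w₁ =ᶠ[𝓝 p] fun p => (chartTrans 𝓘(ℝ, F) w₀.proj w₁.proj p.1,
      fderiv ℝ (chartTrans 𝓘(ℝ, F) w₀.proj w₁.proj) p.1 p.2) := by
  filter_upwards [(isOpen_chartOverlap (𝓘(ℝ, F).tangent) w₀ w₁).mem_nhds hp] with p' hp'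
  exact chartTrans_tangent (mem_chartOverlap_tangent.1 hp')

variable {S} {V : CosetSpace H → ℝ}

/-- The local fields agree under changes of coordinates, so the glued field is given by them in
every chart. -/
theorem chartField_reducedField (hs : Manifold.IsSubmersion 𝓘(ℝ, E) 𝓘(ℝ, F) ∞ (cosetProj H))
    (hr : S.IsRegular H) (hV : ContMDiff 𝓘(ℝ, F) 𝓘(ℝ, ℝ) ∞ V)
    (w : TangentBundle 𝓘(ℝ, F) (CosetSpace H)) {p : F × F}
    (hp : p ∈ (extChartAt (𝓘(ℝ, F).tangent) w).target) :
    chartField (𝓘(ℝ, F).tangent) (S.reducedField hs V) w p =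
      S.kineticAlgebra.localField (S.localPhi hs w.proj) (localPotential F V w.proj) p := by
  haveI := isManifold_tangentBundle (F := F) (Q := CosetSpace H)
  let X : TangentBundle 𝓘(ℝ, F) (CosetSpace H) → F × F → F × F := fun w =>
    S.kineticAlgebra.localField (S.localPhi hs w.proj) (localPotential F V w.proj)
  suffices hX : ∀ w₀ w₁ : TangentBundle 𝓘(ℝ, F) (CosetSpace H),
      ∀ p ∈ chartOverlap (𝓘(ℝ, F).tangent) w₀ w₁,
      fderiv ℝ (chartTrans (𝓘(ℝ, F).tangent) w₀ w₁) p (X w₀ p) =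
        X w₁ (chartTrans (𝓘(ℝ, F).tangent) w₀ w₁ p) from
    chartField_glueField (𝓘(ℝ, F).tangent) hX w hp
  intro w₀ w₁ p hp
  have hb := mem_chartOverlap_tangent.1 hp
  have h1 : chartTrans 𝓘(ℝ, F) w₀.proj w₁.proj p.1 ∈ (extChartAt 𝓘(ℝ, F) w₁.proj).target :=
    (extChartAt 𝓘(ℝ, F) w₁.proj).map_source hb.2
  rw [chartTrans_tangent hb, (chartTrans_tangent_eventuallyEq hp).fderiv_eq]
  exact (S.isTransition hs V w₀.proj w₁.proj).fderiv_tangentMap_localField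
    (S.isLocalSystem hs hr hV _) (S.isLocalSystem hs hr hV _) hb hb.1 h1

theorem isSmoothField_reducedField (hs : Manifold.IsSubmersion 𝓘(ℝ, E) 𝓘(ℝ, F) ∞ (cosetProj H))
    (hr : S.IsRegular H) (hV : ContMDiff 𝓘(ℝ, F) 𝓘(ℝ, ℝ) ∞ V)
    [IsManifold (𝓘(ℝ, F).tangent) 1 (TangentBundle 𝓘(ℝ, F) (CosetSpace H))] :
    IsSmoothField (𝓘(ℝ, F).tangent) (S.reducedField hs V) := by
  haveI := isManifold_tangentBundle (F := F) (Q := CosetSpace H)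
  rw [isSmoothField_iff_contDiffOn_chartField]
  intro w
  refine ((S.isLocalSystem hs hr hV w.proj).contDiffOn_localField.mono ?_).congr
    fun p hp => chartField_reducedField hs hr hV w hp
  exact fun p hp => ⟨mem_extChartAt_tangent_target.1 hp, mem_univ _⟩

/-- The coset space is compact, so countably many charts cover it. -/
theorem exists_chart_cover [CompactSpace G]
    (hs : Manifold.IsSubmersion 𝓘(ℝ, E) 𝓘(ℝ, F) ∞ (cosetProj H)) :
    ∃ c : ℕ → CosetSpace H, ∀ q, ∃ n, q ∈ (extChartAt 𝓘(ℝ, F) (c n)).source := by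
  haveI : CompactSpace (CosetSpace H) := by
    refine isCompact_univ_iff.1 ?_
    have h1 := isCompact_univ.image (contMDiff_cosetProj hs).continuous
    rwa [image_univ, range_eq_univ.2 (fun q => exists_cosetProj_eq q)] at h1
  obtain ⟨t, ht⟩ := isCompact_univ.elim_finite_subcover
    (fun q : CosetSpace H => (extChartAt 𝓘(ℝ, F) q).source)
    (fun q => isOpen_extChartAt_source q)
    (fun q _ => mem_iUnion.2 ⟨q, mem_extChartAt_source q⟩)
  obtain ⟨q₀⟩ : Nonempty (CosetSpace H) := ⟨cosetProj H 1⟩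
  obtain ⟨c, hc⟩ := (t.countable_toSet.insert q₀).exists_eq_range (Set.insert_nonempty _ _)
  refine ⟨c, fun q => ?_⟩
  obtain ⟨q', hq', hq⟩ := mem_iUnion₂.1 (ht (mem_univ q))
  have h2 : q' ∈ range c := hc ▸ Set.mem_insert_of_mem _ hq'
  obtain ⟨n, rfl⟩ := h2
  exact ⟨n, hq⟩

end InertiaData

set_option maxSynthPendingDepth 3

open Set Filter Topology

/-- A curve in a manifold without boundary has a velocity if and only if its expression in a chart
around the point has. -/
theorem hasMFDerivAt_curve_iff {E : Type*} [NormedAddCommGroup E] [NormedSpace ℝ E]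
    {H : Type*} [TopologicalSpace H] {I : ModelWithCorners ℝ E H}
    {N : Type*} [TopologicalSpace N] [ChartedSpace H N] {γ : ℝ → N} {t : ℝ} {v : E} :
    HasMFDerivAt 𝓘(ℝ, ℝ) I γ t ((1 : ℝ →L[ℝ] ℝ).smulRight v) ↔
      ContinuousAt γ t ∧ HasDerivAt (fun τ => extChartAt I (γ t) (γ τ)) v t := by
  refine and_congr_right fun _ => ?_
  rw [hasDerivAt_iff_hasFDerivAt]
  have h1 : ((1 : ℝ →L[ℝ] ℝ).smulRight v) = ContinuousLinearMap.toSpanSingleton ℝ v := by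
    ext
    simp
  simp only [writtenInExtChartAt, extChartAt_model_space_eq_id, PartialEquiv.refl_symm,
    PartialEquiv.refl_coe, Function.comp_id, modelWithCornersSelf_coe, range_id,
    hasFDerivWithinAt_univ, id]
  rw [← h1]
  exact hasFDerivWithinAt_univ

theorem exists_hasDerivAt_of_mdifferentiableAt {E : Type*} [NormedAddCommGroup E] [NormedSpace ℝ E]
    {H : Type*} [TopologicalSpace H] {I : ModelWithCorners ℝ E H}
    {N : Type*} [TopologicalSpace N] [ChartedSpace H N] {γ : ℝ → N} {t : ℝ}
    (h : MDifferentiableAt 𝓘(ℝ, ℝ) I γ t) :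
    ∃ v : E, HasDerivAt (fun τ => extChartAt I (γ t) (γ τ)) v t := by
  let L : ℝ →L[ℝ] E := mfderiv 𝓘(ℝ, ℝ) I γ t
  have h1 : L = (1 : ℝ →L[ℝ] ℝ).smulRight (L 1) := by
    ext
    simp
  have h2 : HasMFDerivAt 𝓘(ℝ, ℝ) I γ t L := h.hasMFDerivAt
  rw [h1] at h2
  exact ⟨_, (hasMFDerivAt_curve_iff.1 h2).2⟩

namespace InertiaData

open KineticAlgebra MeasureTheory

variable {E : Type*} [NormedAddCommGroup E] [NormedSpace ℝ E] [FiniteDimensional ℝ E]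
  {G : Type*} [TopologicalSpace G] [ChartedSpace E G] [Group G] [LieGroup 𝓘(ℝ, E) ∞ G]
  {S : InertiaData E G} {H : Subgroup G}
  {F : Type*} [NormedAddCommGroup F] [NormedSpace ℝ F] [FiniteDimensional ℝ F]
  [ChartedSpace F (CosetSpace H)] [IsManifold 𝓘(ℝ, F) ∞ (CosetSpace H)]
  {V : CosetSpace H → ℝ}

theorem chartLagrangian_eq (hs : Manifold.IsSubmersion 𝓘(ℝ, E) 𝓘(ℝ, F) ∞ (cosetProj H))
    (w : TangentBundle 𝓘(ℝ, F) (CosetSpace H)) {p : F × F}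
    (hp : p.1 ∈ (extChartAt 𝓘(ℝ, F) w.proj).target) :
    S.chartLagrangian H V w p =
      S.kineticAlgebra.lagrangian (S.localPhi hs w.proj) (localPotential F V w.proj) p := by
  rw [chartLagrangian, extChartAt_tangent_symm_apply w hp]
  rfl

theorem extChartAt_tangent_self (w : TangentBundle 𝓘(ℝ, F) (CosetSpace H)) :
    extChartAt (𝓘(ℝ, F).tangent) w w = (extChartAt 𝓘(ℝ, F) w.proj w.proj, w.snd) := by
  refine (extChartAt_tangent_apply w (mem_extChartAt_source w.proj) w.snd).trans ?_
  have h1 := mfderiv_extChartAt_tangentSymm (F := F) (mem_extChartAt_source (I := 𝓘(ℝ, F)) w.proj)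
    (w.snd)
  refine Prod.ext rfl ?_
  exact (congrArg (mfderiv 𝓘(ℝ, F) 𝓘(ℝ, F) (extChartAt 𝓘(ℝ, F) w.proj) w.proj : F →L[ℝ] F)
    (tangentSymm_self (F := F) w.proj (show F from w.snd))).symm.trans h1

/-- At each time the equation of motion and the velocity of the curve are both read in the chart
around the point of the curve, where the equation can be solved for the acceleration. -/
theorem isReducedField_reducedField (hs : Manifold.IsSubmersion 𝓘(ℝ, E) 𝓘(ℝ, F) ∞ (cosetProj H))
    (hr : S.IsRegular H) (hV : ContMDiff 𝓘(ℝ, F) 𝓘(ℝ, ℝ) ∞ V) :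
    S.IsReducedField H V (S.reducedField hs V) := by
  intro γ s hs'
  refine forall₂_congr fun t ht => ?_
  refine Iff.trans ⟨fun h => h.hasMFDerivAt (hs'.mem_nhds ht), fun h => h.hasMFDerivWithinAt⟩ ?_
  set w := γ t with hw
  set c : ℝ → F × F := fun τ => extChartAt (𝓘(ℝ, F).tangent) w (γ τ) with hc
  have hct : c t = (extChartAt 𝓘(ℝ, F) w.proj w.proj, w.snd) := extChartAt_tangent_self w
  have hsys := S.isLocalSystem hs hr hV w.proj
  have hctU : (c t).1 ∈ (extChartAt 𝓘(ℝ, F) w.proj).target := by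
    rw [hct]
    exact mem_extChartAt_target w.proj
  have hL : S.chartLagrangian H V w =ᶠ[𝓝 (c t)]
      S.kineticAlgebra.lagrangian (S.localPhi hs w.proj) (localPotential F V w.proj) := by
    filter_upwards [((isOpen_extChartAt_target (I := 𝓘(ℝ, F)) w.proj).preimage
      continuous_fst).mem_nhds hctU] with p hp
    exact chartLagrangian_eq hs w hp
  have hZ : S.reducedField hs V w =
      S.kineticAlgebra.localField (S.localPhi hs w.proj) (localPotential F V w.proj) (c t) := rfl
  have hcurv : ∀ ξ : F, S.curvatureTerm H w ξ = S.kineticAlgebra.gyro (S.localPhi hs w.proj)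
      (c t).1 (c t).2 (c t).2 ξ := by
    intro ξ
    rw [hct]
    exact S.curvatureTerm_eq hs hr hV w ξ
  -- the base point in its coordinates
  have hproj : ContinuousAt γ t → ∀ᶠ τ in 𝓝 t, extChartAt 𝓘(ℝ, F) w.proj (γ τ).proj = (c τ).1 := by
    intro hγ
    have h1 : ∀ᶠ τ in 𝓝 t, γ τ ∈ (extChartAt (𝓘(ℝ, F).tangent) w).source :=
      hγ.eventually (extChartAt_source_mem_nhds w)
    filter_upwards [h1] with τ hτ
    have h2 := extChartAt_tangent_apply w (mem_extChartAt_tangent_source.1 hτ) (γ τ).snd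
    exact (congrArg Prod.fst h2).symm
  have hcontproj : ContinuousAt γ t → ContinuousAt (fun τ => (γ τ).proj) t := fun hγ =>
    (FiberBundle.continuous_proj F (TangentSpace 𝓘(ℝ, F))).continuousAt.comp hγ
  constructor
  · intro h
    obtain ⟨hγ, hd⟩ := hasMFDerivAt_curve_iff.1 h
    have hv : (S.kineticAlgebra.localField (S.localPhi hs w.proj) (localPotential F V w.proj)
        (c t)).1 = (c t).2 := rfl
    refine ⟨h.mdifferentiableAt, ?_, ?_⟩
    · refine hasMFDerivAt_curve_iff.2 ⟨hcontproj hγ, ?_⟩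
      have h1 : HasDerivAt (fun τ => (c τ).1) (w.snd : F) t := by
        have h2 := (hasFDerivAt_fst (𝕜 := ℝ) (p := c t)).comp_hasDerivAt t hd
        refine h2.congr_deriv ?_
        exact congrArg Prod.snd hct
      exact h1.congr_of_eventuallyEq (hproj hγ)
    · intro ξ
      rw [hcurv ξ]
      exact (hsys.forall_hasDerivAt_iff hd hctU hL hv).2 hZ ξ
  · rintro ⟨hm, hq, hEL⟩
    have hγ := hm.continuousAt
    obtain ⟨c', hc'⟩ : ∃ c' : F × F, HasDerivAt c c' t := exists_hasDerivAt_of_mdifferentiableAt hm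
    have hv : c'.1 = (c t).2 := by
      have h1 := (hasFDerivAt_fst (𝕜 := ℝ) (p := c t)).comp_hasDerivAt t hc'
      have h2 := (hasMFDerivAt_curve_iff.1 hq).2.congr_of_eventuallyEq
        ((hproj hγ).mono fun τ h => h.symm)
      refine (h1.unique h2).trans ?_
      exact (congrArg Prod.snd hct).symm
    have h3 := (hsys.forall_hasDerivAt_iff hc' hctU hL hv).1 fun ξ => by
      rw [← hcurv ξ]
      exact hEL ξ
    refine hasMFDerivAt_curve_iff.2 ⟨hγ, ?_⟩
    have h4 : c' = S.reducedField hs V (γ t) := h3.trans hZ.symm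
    rw [← h4]
    exact hc'

variable [MeasurableSpace F] [BorelSpace F]
  [MeasurableSpace (TangentBundle 𝓘(ℝ, F) (CosetSpace H))]
  [BorelSpace (TangentBundle 𝓘(ℝ, F) (CosetSpace H))]

/-- The densities `√|det A · det B|` with respect to `dq dq̇` define a global measure. -/
theorem exists_isInvariantVolume_reducedField [CompactSpace G]
    (hs : Manifold.IsSubmersion 𝓘(ℝ, E) 𝓘(ℝ, F) ∞ (cosetProj H))
    (hr : S.IsRegular H) (hV : ContMDiff 𝓘(ℝ, F) 𝓘(ℝ, ℝ) ∞ V) :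
    ∃ μ : Measure (TangentBundle 𝓘(ℝ, F) (CosetSpace H)),
      IsInvariantVolume (𝓘(ℝ, F).tangent) (S.reducedField hs V) μ := by
  haveI := isManifold_tangentBundle (F := F) (Q := CosetSpace H)
  let ρ : TangentBundle 𝓘(ℝ, F) (CosetSpace H) → F × F → ℝ := fun w p =>
    S.kineticAlgebra.density (S.localPhi hs w.proj) p.1
  obtain ⟨c, hc⟩ := exists_chart_cover (F := F) (H := H) hs
  obtain ⟨μ, hμ⟩ := exists_measure_hasChartDensity (𝓘(ℝ, F).tangent) (ρ := ρ)
    (fun w₀ w₁ p hp => by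
      have hb := mem_chartOverlap_tangent.1 hp
      have t := S.isTransition hs V w₀.proj w₁.proj
      rw [(chartTrans_tangent_eventuallyEq hp).fderiv_eq, chartTrans_tangent hb]
      have h1 := t.det_fderiv_tangentMap hb
      rw [h1, abs_of_nonneg (sq_nonneg _)]
      exact t.density_eq hb)
    (fun n => ⟨c n, 0⟩) (fun w => by
      obtain ⟨n, hn⟩ := hc w.proj
      exact ⟨n, mem_extChartAt_tangent_source.2 hn⟩)
  refine ⟨μ, fun w => ⟨ρ w, ?_, ?_, hμ w, ?_⟩⟩
  · exact (S.isLocalSystem hs hr hV w.proj).contDiffOn_density.comp contDiffOn_fst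
      fun p hp => mem_extChartAt_tangent_target.1 hp
  · exact fun p hp => (S.isLocalSystem hs hr hV w.proj).density_pos
      (mem_extChartAt_tangent_target.1 hp)
  · intro p hp
    rw [← (S.isLocalSystem hs hr hV w.proj).divergence_density_smul_localField
      (mem_extChartAt_tangent_target.1 hp)]
    refine divergence_congr ?_
    filter_upwards [(isOpen_extChartAt_target w).mem_nhds hp] with p' hp'
    rw [chartField_reducedField hs hr hV w hp']

end InertiaData

set_option maxSynthPendingDepth 3

/-! ### The Legendre transformation in coordinates -/

namespace KineticAlgebra

open Set Filter Topology

variable {E : Type*} [NormedAddCommGroup E] [NormedSpace ℝ E] [FiniteDimensional ℝ E]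
  {F : Type*} [NormedAddCommGroup F] [NormedSpace ℝ F] [FiniteDimensional ℝ F]

/-- The Legendre transformation in the coordinates `(q, q̇)` and `(q, p)`. -/
def localLegendre (D : KineticAlgebra E) (Φ : F → F →L[ℝ] E) (p : F × F) : F × (F →L[ℝ] ℝ) :=
  (p.1, pullback D.kin Φ p.1 p.2)

/-- The inverse of the Legendre transformation in coordinates. -/
def localLegendreSymm (D : KineticAlgebra E) (Φ : F → F →L[ℝ] E) (z : F × (F →L[ℝ] ℝ)) : F × F :=
  (z.1, (pullback D.kin Φ z.1).inverse z.2)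

/-- The force in the equation `ṗ = ∂L/∂q - ⟨𝓘Φ(q̇), pr [Φ(q̇), Φ(·)]⟩` for the momentum. -/
def momentumForce (D : KineticAlgebra E) (Φ : F → F →L[ℝ] E) (W : F → ℝ) (p : F × F) : F →L[ℝ] ℝ :=
  D.force Φ W p.1 p.2 + fderiv ℝ (pullback D.kin Φ) p.1 p.2 p.2

/-- The reduced LR system, as a vector field in the coordinates `(q, p)`. -/
def momentumField (D : KineticAlgebra E) (Φ : F → F →L[ℝ] E) (W : F → ℝ) (z : F × (F →L[ℝ] ℝ)) :
    F × (F →L[ℝ] ℝ) :=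
  ((D.localLegendreSymm Φ z).2, D.momentumForce Φ W (D.localLegendreSymm Φ z))

/-- The density, with respect to `dq dp`, of the invariant measure on the cotangent bundle. -/
def momentumDensity (D : KineticAlgebra E) (Φ : F → F →L[ℝ] E) (y : F) : ℝ :=
  √|formDet (pullback D.form Φ y) / formDet (pullback D.kin Φ y)|

namespace IsLocalSystem

variable {D : KineticAlgebra E} {Φ : F → F →L[ℝ] E} {W : F → ℝ} {U : Set F}

theorem localLegendre_localLegendreSymm (h : D.IsLocalSystem Φ W U) {z : F × (F →L[ℝ] ℝ)}
    (hz : z.1 ∈ U) : D.localLegendre Φ (D.localLegendreSymm Φ z) = z :=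
  Prod.ext rfl (apply_inverse_apply (h.injective_metric hz) z.2)

theorem localLegendreSymm_localLegendre (h : D.IsLocalSystem Φ W U) {p : F × F}
    (hp : p.1 ∈ U) : D.localLegendreSymm Φ (D.localLegendre Φ p) = p :=
  Prod.ext rfl (inverse_apply_apply (h.injective_metric hp) p.2)

theorem contDiffOn_localLegendre (h : D.IsLocalSystem Φ W U) :
    ContDiffOn ℝ ∞ (D.localLegendre Φ) (U ×ˢ univ) :=
  contDiffOn_fst.prodMk (((h.contDiffOn_pullback D.kin).comp contDiffOn_fst
    fun _ hp => hp.1).clm_apply contDiffOn_snd)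

theorem contDiffOn_localLegendreSymm (h : D.IsLocalSystem Φ W U) :
    ContDiffOn ℝ ∞ (D.localLegendreSymm Φ) (U ×ˢ univ) := by
  have h1 := contDiffOn_inverse_form (h.contDiffOn_pullback D.kin) fun y hy => h.injective_metric hy
  have h2 : ContDiffOn ℝ ∞ (fun z : F × (F →L[ℝ] ℝ) => (pullback D.kin Φ z.1).inverse)
    (U ×ˢ univ) := h1.comp contDiffOn_fst fun _ hz => hz.1
  exact contDiffOn_fst.prodMk (h2.clm_apply contDiffOn_snd)

theorem contDiffOn_momentumForce (h : D.IsLocalSystem Φ W U) :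
    ContDiffOn ℝ ∞ (D.momentumForce Φ W) (U ×ˢ univ) := by
  have hA : ContDiffOn ℝ ∞ (fun p : F × F => fderiv ℝ (pullback D.kin Φ) p.1) (U ×ˢ univ) :=
    ((h.contDiffOn_pullback D.kin).fderiv_of_isOpen h.isOpen (m := ∞) (by simp)).comp
      contDiffOn_fst fun _ hp => hp.1
  exact h.contDiffOn_force.add ((hA.clm_apply contDiffOn_snd).clm_apply contDiffOn_snd)

theorem contDiffOn_momentumField (h : D.IsLocalSystem Φ W U) :
    ContDiffOn ℝ ∞ (D.momentumField Φ W) (U ×ˢ univ) :=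
  (contDiffOn_snd.comp h.contDiffOn_localLegendreSymm (t := univ) fun _ _ => mem_univ _).prodMk
    (h.contDiffOn_momentumForce.comp h.contDiffOn_localLegendreSymm fun _ hz => ⟨hz.1, mem_univ _⟩)

/-- The Legendre transformation carries the field on the tangent bundle to the field on the
cotangent bundle. -/
theorem fderiv_localLegendre_localField (h : D.IsLocalSystem Φ W U) {p : F × F} (hp : p.1 ∈ U) :
    fderiv ℝ (D.localLegendre Φ) p (D.localField Φ W p) =
      D.momentumField Φ W (D.localLegendre Φ p) := by
  have h1 := ((h.differentiableAt_pullback D.kin hp).hasFDerivAt.comp p hasFDerivAt_fst).clm_apply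
    (hasFDerivAt_snd (p := p))
  have h2 := ((hasFDerivAt_fst (𝕜 := ℝ) (p := p)).prodMk h1).fderiv
  refine (DFunLike.congr_fun h2 _).trans ?_
  rw [momentumField, h.localLegendreSymm_localLegendre hp]
  refine Prod.ext rfl ?_
  have h3 : pullback D.kin Φ p.1 (D.accel Φ W p.1 p.2) = D.force Φ W p.1 p.2 :=
    apply_inverse_apply (h.injective_metric hp) _
  exact congrArg (· + fderiv ℝ (pullback D.kin Φ) p.1 p.2 p.2) h3

theorem formDet_div_ne_zero (h : D.IsLocalSystem Φ W U) {y : F} (hy : y ∈ U) :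
    formDet (pullback D.form Φ y) / formDet (pullback D.kin Φ y) ≠ 0 :=
  div_ne_zero (formDet_ne_zero (h.injective_form hy)) (formDet_ne_zero (h.injective_metric hy))

theorem momentumDensity_pos (h : D.IsLocalSystem Φ W U) {y : F} (hy : y ∈ U) :
    0 < D.momentumDensity Φ y :=
  Real.sqrt_pos.2 (abs_pos.2 (h.formDet_div_ne_zero hy))

theorem contDiffOn_momentumDensity (h : D.IsLocalSystem Φ W U) :
    ContDiffOn ℝ ∞ (D.momentumDensity Φ) U := by
  have h0 : ContDiffOn ℝ ∞
      (fun y => formDet (pullback D.form Φ y) / formDet (pullback D.kin Φ y)) U :=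
    (contDiff_formDet.comp_contDiffOn (h.contDiffOn_pullback D.form)).div
      (contDiff_formDet.comp_contDiffOn (h.contDiffOn_pullback D.kin))
      fun y hy => formDet_ne_zero (h.injective_metric hy)
  intro y hy
  have h2 := h.formDet_div_ne_zero hy
  exact (((h0.contDiffAt (h.isOpen.mem_nhds hy)).abs h2).sqrt (abs_ne_zero.2 h2)).contDiffWithinAt

theorem momentumDensity_pow_four_mul (h : D.IsLocalSystem Φ W U) {y : F} (hy : y ∈ U) :
    D.momentumDensity Φ y ^ 4 * formDet (pullback D.kin Φ y) ^ 2 =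
      formDet (pullback D.form Φ y) ^ 2 := by
  have hne : formDet (pullback D.kin Φ y) ≠ 0 := formDet_ne_zero (h.injective_metric hy)
  have h1 : D.momentumDensity Φ y ^ 2 =
      |formDet (pullback D.form Φ y) / formDet (pullback D.kin Φ y)| := Real.sq_sqrt (abs_nonneg _)
  have h2 : D.momentumDensity Φ y ^ 4 = (D.momentumDensity Φ y ^ 2) ^ 2 := by ring
  rw [h2, h1, sq_abs]
  field_simp

/-- By `formTrace_sub`, the logarithmic derivative of the density is the trace of the nonholonomic
term. -/
theorem fderiv_momentumDensity (h : D.IsLocalSystem Φ W U) {y : F} (hy : y ∈ U) (v : F) :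
    fderiv ℝ (D.momentumDensity Φ) y v = D.momentumDensity Φ y *
      formTrace (pullback D.kin Φ y) (D.gyroForm Φ y v) := by
  have hk := h.fderiv_formDet_pullback D.kin hy (h.injective_metric hy) v
  have hf := h.fderiv_formDet_pullback D.form hy (h.injective_form hy) v
  have ht := h.formTrace_sub hy v
  set tk := formTrace (pullback D.kin Φ y) (fderiv ℝ (pullback D.kin Φ) y v)
  set tf := formTrace (pullback D.form Φ y) (fderiv ℝ (pullback D.form Φ) y v)
  set a : F → ℝ := fun z => formDet (pullback D.kin Φ z)
  set b : F → ℝ := fun z => formDet (pullback D.form Φ z)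
  have ha : DifferentiableAt ℝ a y := ((contDiff_formDet.comp_contDiffOn
    (h.contDiffOn_pullback D.kin)).contDiffAt (h.isOpen.mem_nhds hy)).differentiableAt (by simp)
  have hb : DifferentiableAt ℝ b y := ((contDiff_formDet.comp_contDiffOn
    (h.contDiffOn_pullback D.form)).contDiffAt (h.isOpen.mem_nhds hy)).differentiableAt (by simp)
  have hane : a y ≠ 0 := formDet_ne_zero (h.injective_metric hy)
  have hd : DifferentiableAt ℝ (D.momentumDensity Φ) y :=
    (h.contDiffOn_momentumDensity.contDiffAt (h.isOpen.mem_nhds hy)).differentiableAt (by simp)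
  -- differentiate the identity `ρ ^ 4 * a ^ 2 = b ^ 2`
  have h5 := (hd.hasFDerivAt.pow 4).mul (ha.hasFDerivAt.pow 2)
  have h6 := hb.hasFDerivAt.pow 2
  have h7 := DFunLike.congr_fun (h5.unique (h6.congr_of_eventuallyEq
    (Filter.mem_of_superset (h.isOpen.mem_nhds hy) fun z hz => h.momentumDensity_pow_four_mul hz))) v
  simp [hk, hf] at h7
  have h8 : 4 * D.momentumDensity Φ y ^ 3 * a y ^ 2 ≠ 0 :=
    mul_ne_zero (mul_ne_zero (by norm_num) (pow_ne_zero _ (h.momentumDensity_pos hy).ne'))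
      (pow_ne_zero _ hane)
  have h9 : D.momentumDensity Φ y ^ 4 * a y ^ 2 = b y ^ 2 := h.momentumDensity_pow_four_mul hy
  apply mul_left_cancel₀ h8
  linear_combination h7 - 2 * tf * h9 - 2 * D.momentumDensity Φ y ^ 4 * a y ^ 2 * ht

theorem hasFDerivAt_momentumForce_apply (h : D.IsLocalSystem Φ W U) {y : F} (hy : y ∈ U) (v ξ : F) :
    HasFDerivAt (fun v' => D.momentumForce Φ W (y, v') ξ)
      ((1 / 2 : ℝ) • ((fderiv ℝ (pullback D.kin Φ) y ξ v) + (fderiv ℝ (pullback D.kin Φ) y ξ).flip v)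
        - ((D.gyroForm Φ y v).flip ξ +
          (D.kin (Φ y v)).comp ((D.verticalProj Φ y).comp ((D.bracket.flip (Φ y ξ)).comp (Φ y))))) v := by
  have h2 : HasFDerivAt (fun v' => fderiv ℝ (pullback D.kin Φ) y v' v' ξ) _ v :=
    ((fderiv ℝ (pullback D.kin Φ) y).hasFDerivAt.clm_apply (hasFDerivAt_id v)).clm_apply
      (hasFDerivAt_const ξ v)
  refine ((h.fderiv_force_snd hy v ξ).add h2).congr_fderiv ?_
  ext u
  simp

/-- The reduced LR system on the cotangent bundle preserves the measure with the density
`momentumDensity`. -/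
theorem divergence_momentumDensity_smul_momentumField (h : D.IsLocalSystem Φ W U)
    {z : F × (F →L[ℝ] ℝ)} (hz : z.1 ∈ U) :
    divergence (fun z : F × (F →L[ℝ] ℝ) => D.momentumDensity Φ z.1 • D.momentumField Φ W z) z = 0 := by
  have hn : U ×ˢ (univ : Set (F →L[ℝ] ℝ)) ∈ 𝓝 z :=
    (h.isOpen.prod isOpen_univ).mem_nhds ⟨hz, mem_univ _⟩
  have hAi := h.injective_metric hz
  have hAs := pullback_symm D.kin_symm Φ z.1
  set y := z.1 with hy
  set v := (D.localLegendreSymm Φ z).2 with hv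
  have hfst : HasFDerivAt (Prod.fst : F × (F →L[ℝ] ℝ) → F) (ContinuousLinearMap.fst ℝ F (F →L[ℝ] ℝ)) z :=
    hasFDerivAt_fst
  have hσ : HasFDerivAt (fun z : F × (F →L[ℝ] ℝ) => D.momentumDensity Φ z.1)
      ((fderiv ℝ (D.momentumDensity Φ) y).comp (ContinuousLinearMap.fst ℝ F (F →L[ℝ] ℝ))) z :=
    HasFDerivAt.comp (f := Prod.fst) z ((h.contDiffOn_momentumDensity.contDiffAt
      (h.isOpen.mem_nhds hz)).differentiableAt (by simp)).hasFDerivAt hfst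
  have hY : HasFDerivAt (D.momentumField Φ W) (fderiv ℝ (D.momentumField Φ W) z) z :=
    ((h.contDiffOn_momentumField.contDiffAt hn).differentiableAt (by simp)).hasFDerivAt
  set Y' := fderiv ℝ (D.momentumField Φ W) z with hY'
  let N : F × (F →L[ℝ] ℝ) →L[ℝ] F := (ContinuousLinearMap.fst ℝ F (F →L[ℝ] ℝ)).comp Y'
  have hN : HasFDerivAt (fun z => (D.localLegendreSymm Φ z).2) N z :=
    (hasFDerivAt_fst (𝕜 := ℝ) (p := D.momentumField Φ W z)).comp z hY
  -- differentiate the identity `A v = p` between velocity and momentum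
  have hAN : ∀ (u : F) (δ : F →L[ℝ] ℝ) (ξ : F),
      pullback D.kin Φ y (N (u, δ)) ξ = δ ξ - fderiv ℝ (pullback D.kin Φ) y u v ξ := by
    intro u δ ξ
    have h1 := (HasFDerivAt.comp (f := Prod.fst) z
      (h.differentiableAt_pullback D.kin hz).hasFDerivAt hfst).clm_apply hN
    have h2 : (fun z : F × (F →L[ℝ] ℝ) => pullback D.kin Φ z.1 (D.localLegendreSymm Φ z).2)
        =ᶠ[𝓝 z] fun z => z.2 := by
      filter_upwards [hn] with z' hz'
      exact congrArg Prod.snd (h.localLegendre_localLegendreSymm hz'.1)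
    have h3 := h1.unique ((hasFDerivAt_snd (𝕜 := ℝ) (p := z)).congr_of_eventuallyEq h2)
    have h4 : pullback D.kin Φ y (N (u, δ)) + fderiv ℝ (pullback D.kin Φ) y u v = δ :=
      DFunLike.congr_fun h3 (u, δ)
    have h5 := DFunLike.congr_fun h4 ξ
    rw [ContinuousLinearMap.add_apply] at h5
    linarith
  let R : F →L[ℝ] F →L[ℝ] ℝ := (fderiv ℝ (pullback D.kin Φ) y).flip v
  let K : F →L[ℝ] F →L[ℝ] ℝ :=
    (ContinuousLinearMap.compL ℝ F E ℝ ((D.kin (Φ y v)).comp (D.verticalProj Φ y))).comp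
      (D.bracket.bilinearComp (Φ y) (Φ y))
  let C := D.gyroForm Φ y v
  have hK : ∀ w ξ, K w ξ = D.kin (Φ y v) (D.verticalProj Φ y (D.bracket (Φ y w) (Φ y ξ))) :=
    fun w ξ => rfl
  -- the term is skew in `w` and `ξ`
  have hKt : formTrace (pullback D.kin Φ y) K = 0 := by
    refine formTrace_eq_zero hAi hAs fun u w => ?_
    rw [hK, hK, D.bracket_swap, map_neg, map_neg]
  -- the divergence in the positions
  have ht1 : LinearMap.trace ℝ F (LinearMap.fst ℝ F (F →L[ℝ] ℝ) ∘ₗ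
      (Y' : F × (F →L[ℝ] ℝ) →ₗ[ℝ] F × (F →L[ℝ] ℝ)) ∘ₗ LinearMap.inl ℝ F (F →L[ℝ] ℝ)) =
      -formTrace (pullback D.kin Φ y) R := by
    rw [← formTrace_neg]
    refine (formTrace_eq hAi (N := N.comp (ContinuousLinearMap.inl ℝ F (F →L[ℝ] ℝ)))
      fun u ξ => ?_).symm
    have := hAN u 0 ξ
    rw [ContinuousLinearMap.zero_apply, zero_sub] at this
    exact this.symm
  -- the divergence in the momenta
  have ht2 : LinearMap.trace ℝ (F →L[ℝ] ℝ) (LinearMap.snd ℝ F (F →L[ℝ] ℝ) ∘ₗ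
      (Y' : F × (F →L[ℝ] ℝ) →ₗ[ℝ] F × (F →L[ℝ] ℝ)) ∘ₗ LinearMap.inr ℝ F (F →L[ℝ] ℝ)) =
      formTrace (pullback D.kin Φ y) R - formTrace (pullback D.kin Φ y) C := by
    let T : F →L[ℝ] F →L[ℝ] ℝ := R.flip + -C + -K
    have h1 : ∀ δ ξ, (Y' (0, δ)).2 ξ = T ((pullback D.kin Φ y).inverse δ) ξ := by
      intro δ ξ
      have h2 : N (0, δ) = (pullback D.kin Φ y).inverse δ := by
        apply hAi
        ext ξ
        have := hAN 0 δ ξ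
        rw [apply_inverse_apply hAi, this]
        simp
      have hY2 : HasFDerivAt (fun z => (D.momentumField Φ W z).2)
          ((ContinuousLinearMap.snd ℝ F (F →L[ℝ] ℝ)).comp Y') z :=
        (hasFDerivAt_snd (𝕜 := ℝ) (p := D.momentumField Φ W z)).comp z hY
      have hl : HasFDerivAt (fun δ' : F →L[ℝ] ℝ => (y, δ'))
          (ContinuousLinearMap.inr ℝ F (F →L[ℝ] ℝ)) z.2 := hasFDerivAt_prodMk_right y z.2
      have h3 : HasFDerivAt (fun δ' => (D.momentumField Φ W (y, δ')).2)
          (((ContinuousLinearMap.snd ℝ F (F →L[ℝ] ℝ)).comp Y').comp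
            (ContinuousLinearMap.inr ℝ F (F →L[ℝ] ℝ))) z.2 :=
        HasFDerivAt.comp (f := fun δ' => (y, δ')) z.2 hY2 hl
      have h4 := h3.clm_apply (hasFDerivAt_const ξ z.2)
      have h5 := (h.hasFDerivAt_momentumForce_apply (W := W) hz v ξ).comp z.2
        (HasFDerivAt.comp (f := fun δ' => (y, δ')) z.2 hN hl)
      have h6 := DFunLike.congr_fun (h4.unique h5) δ
      have h7 : (Y' (0, δ)).2 ξ = (1 / 2) * (fderiv ℝ (pullback D.kin Φ) y ξ v (N (0, δ)) +
          fderiv ℝ (pullback D.kin Φ) y ξ (N (0, δ)) v) - (C (N (0, δ)) ξ + K (N (0, δ)) ξ) := by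
        refine Eq.trans ?_ h6
        simp
      rw [h7, ← h2, h.fderiv_pullback_symm hz ξ (N (0, δ)) v]
      change _ = fderiv ℝ (pullback D.kin Φ) y ξ v (N (0, δ)) + -(C (N (0, δ)) ξ) + -(K (N (0, δ)) ξ)
      ring
    have h2 : LinearMap.snd ℝ F (F →L[ℝ] ℝ) ∘ₗ
        (Y' : F × (F →L[ℝ] ℝ) →ₗ[ℝ] F × (F →L[ℝ] ℝ)) ∘ₗ LinearMap.inr ℝ F (F →L[ℝ] ℝ) =
        T.toLinearMap ∘ₗ (pullback D.kin Φ y).inverse.toLinearMap := by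
      refine LinearMap.ext fun δ => ContinuousLinearMap.ext fun ξ => h1 δ ξ
    have h3 : formTrace (pullback D.kin Φ y) T =
        formTrace (pullback D.kin Φ y) R - formTrace (pullback D.kin Φ y) C := by
      rw [formTrace_add, formTrace_add, formTrace_neg, formTrace_neg, formTrace_flip hAi hAs, hKt]
      ring
    rw [h2, LinearMap.trace_comp_comm', ← h3]
    rfl
  rw [divergence_smul hσ.differentiableAt hY.differentiableAt, hσ.fderiv, divergence, ← hY',
    trace_prod_eq, ht1, ht2]
  change fderiv ℝ (D.momentumDensity Φ) y v + _ = 0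
  rw [h.fderiv_momentumDensity hz]
  ring

end IsLocalSystem

theorem IsTransition.momentumDensity_eq {D : KineticAlgebra E} {Φ₀ Φ₁ : F → F →L[ℝ] E}
    {W₀ W₁ : F → ℝ} {U₀ O : Set F} {τ : F → F} (t : IsTransition Φ₀ Φ₁ W₀ W₁ τ O)
    (h₀ : D.IsLocalSystem Φ₀ W₀ U₀) {y : F} (hy : y ∈ O) (hy₀ : y ∈ U₀) :
    D.momentumDensity Φ₀ y = D.momentumDensity Φ₁ (τ y) := by
  have h1 : ∀ K : E →L[ℝ] E →L[ℝ] ℝ, formDet (pullback K Φ₀ y) =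
      (fderiv ℝ τ y).det ^ 2 * formDet (pullback K Φ₁ (τ y)) := by
    intro K
    refine formDet_congr fun u w => ?_
    rw [pullback_apply, pullback_apply, t.momentum_eq y hy, t.momentum_eq y hy]
  have h2 : (fderiv ℝ τ y).det ^ 2 ≠ 0 := by
    intro h0
    have h3 := h1 D.kin
    rw [h0, zero_mul] at h3
    exact formDet_ne_zero (h₀.injective_metric hy₀) h3
  rw [momentumDensity, momentumDensity, h1, h1, mul_div_mul_left _ _ h2]

end KineticAlgebra

set_option maxSynthPendingDepth 3

/-! ### Charts of the cotangent bundle -/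

section CotangentBundleCharts

open Set Filter Topology

variable {F : Type*} [NormedAddCommGroup F] [NormedSpace ℝ F]
  {Q : Type*} [TopologicalSpace Q] [ChartedSpace F Q] [IsManifold 𝓘(ℝ, F) ∞ Q]

theorem trivializationAt_cotangent_baseSet (q₀ : Q) :
    (trivializationAt (F →L[ℝ] ℝ)
      (fun q : Q => TangentSpace 𝓘(ℝ, F) q →L[ℝ] Bundle.Trivial Q ℝ q) q₀).baseSet =
      (extChartAt 𝓘(ℝ, F) q₀).source := by
  rw [hom_trivializationAt_baseSet]
  simp

theorem trivializationAt_cotangent_apply {q₀ q : Q} (hq : q ∈ (extChartAt 𝓘(ℝ, F) q₀).source) (α : F →L[ℝ] ℝ) :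
    trivializationAt (F →L[ℝ] ℝ)
      (fun q : Q => TangentSpace 𝓘(ℝ, F) q →L[ℝ] Bundle.Trivial Q ℝ q) q₀ ⟨q, α⟩ =
      (q, α.comp (tangentSymm F q₀ q)) := by
  rw [hom_trivializationAt_apply]
  refine Prod.ext rfl ?_
  ext v
  simp [ContinuousLinearMap.inCoordinates]
  rfl

theorem mem_extChartAt_cotangent_source {p p' : CotangentBundle F Q} :
    p' ∈ (extChartAt (𝓘(ℝ, F).prod 𝓘(ℝ, F →L[ℝ] ℝ)) p).source ↔
      p'.proj ∈ (extChartAt 𝓘(ℝ, F) p.proj).source := by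
  rw [FiberBundle.extChartAt]
  set e := trivializationAt (F →L[ℝ] ℝ)
      (fun q : Q => TangentSpace 𝓘(ℝ, F) q →L[ℝ] Bundle.Trivial Q ℝ q) p.proj with he
  have hb : e.baseSet = (extChartAt 𝓘(ℝ, F) p.proj).source := trivializationAt_cotangent_baseSet _
  have h0 : p' ∈ e.source ↔ p'.proj ∈ (extChartAt 𝓘(ℝ, F) p.proj).source := by
    rw [e.mem_source, hb]
  constructor
  · exact fun h => h0.1 h.1
  · intro h
    refine ⟨h0.2 h, ⟨?_, mem_univ _⟩⟩
    change (e p').1 ∈ _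
    rw [e.coe_fst (h0.2 h)]
    exact h

theorem mem_extChartAt_cotangent_target {p : CotangentBundle F Q} {z : F × (F →L[ℝ] ℝ)} :
    z ∈ (extChartAt (𝓘(ℝ, F).prod 𝓘(ℝ, F →L[ℝ] ℝ)) p).target ↔
      z.1 ∈ (extChartAt 𝓘(ℝ, F) p.proj).target := by
  rw [FiberBundle.extChartAt_target, trivializationAt_cotangent_baseSet]
  constructor
  · exact fun h => h.1.1
  · exact fun h => ⟨⟨h, (extChartAt 𝓘(ℝ, F) p.proj).map_target h⟩, mem_univ _⟩

theorem extChartAt_cotangent_apply (p : CotangentBundle F Q) {q : Q}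
    (hq : q ∈ (extChartAt 𝓘(ℝ, F) p.proj).source) (α : F →L[ℝ] ℝ) :
    extChartAt (𝓘(ℝ, F).prod 𝓘(ℝ, F →L[ℝ] ℝ)) p (⟨q, α⟩ : CotangentBundle F Q) =
      (extChartAt 𝓘(ℝ, F) p.proj q, α.comp (tangentSymm F p.proj q)) := by
  have h1 := trivializationAt_cotangent_apply hq α
  rw [FiberBundle.extChartAt]
  exact congrArg (fun x : Q × (F →L[ℝ] ℝ) => (extChartAt 𝓘(ℝ, F) p.proj x.1, x.2)) h1

theorem extChartAt_cotangent_symm_apply (p : CotangentBundle F Q) {z : F × (F →L[ℝ] ℝ)}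
    (hz : z.1 ∈ (extChartAt 𝓘(ℝ, F) p.proj).target) :
    (extChartAt (𝓘(ℝ, F).prod 𝓘(ℝ, F →L[ℝ] ℝ)) p).symm z =
      ⟨(extChartAt 𝓘(ℝ, F) p.proj).symm z.1, z.2.comp
        (mfderiv 𝓘(ℝ, F) 𝓘(ℝ, F) (extChartAt 𝓘(ℝ, F) p.proj)
          ((extChartAt 𝓘(ℝ, F) p.proj).symm z.1) : F →L[ℝ] F)⟩ := by
  set q := (extChartAt 𝓘(ℝ, F) p.proj).symm z.1 with hq
  have hqs : q ∈ (extChartAt 𝓘(ℝ, F) p.proj).source := (extChartAt 𝓘(ℝ, F) p.proj).map_target hz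
  let D : F →L[ℝ] F := mfderiv 𝓘(ℝ, F) 𝓘(ℝ, F) (extChartAt 𝓘(ℝ, F) p.proj) q
  let x : CotangentBundle F Q := ⟨q, z.2.comp D⟩
  have hx : x ∈ (extChartAt (𝓘(ℝ, F).prod 𝓘(ℝ, F →L[ℝ] ℝ)) p).source :=
    mem_extChartAt_cotangent_source.2 hqs
  have h1 : extChartAt (𝓘(ℝ, F).prod 𝓘(ℝ, F →L[ℝ] ℝ)) p x = z := by
    refine (extChartAt_cotangent_apply p hqs _).trans (Prod.ext ?_ ?_)
    · exact (extChartAt 𝓘(ℝ, F) p.proj).right_inv hz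
    · ext v
      exact congrArg z.2 (mfderiv_extChartAt_tangentSymm hqs v)
  refine Eq.trans ?_ ((extChartAt (𝓘(ℝ, F).prod 𝓘(ℝ, F →L[ℝ] ℝ)) p).left_inv hx)
  rw [h1]

theorem mem_chartOverlap_cotangent {p₀ p₁ : CotangentBundle F Q} {z : F × (F →L[ℝ] ℝ)} :
    z ∈ chartOverlap (𝓘(ℝ, F).prod 𝓘(ℝ, F →L[ℝ] ℝ)) p₀ p₁ ↔
      z.1 ∈ chartOverlap 𝓘(ℝ, F) p₀.proj p₁.proj := by
  constructor
  · rintro ⟨h1, h2⟩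
    have h3 := mem_extChartAt_cotangent_target.1 h1
    refine ⟨h3, ?_⟩
    rw [mem_preimage, extChartAt_cotangent_symm_apply p₀ h3] at h2
    exact mem_extChartAt_cotangent_source.1 h2
  · rintro ⟨h1, h2⟩
    refine ⟨mem_extChartAt_cotangent_target.2 h1, ?_⟩
    rw [mem_preimage, extChartAt_cotangent_symm_apply p₀ h1]
    exact mem_extChartAt_cotangent_source.2 h2

theorem chartTrans_mem_chartOverlap {q₀ q₁ : Q} {y : F} (hy : y ∈ chartOverlap 𝓘(ℝ, F) q₀ q₁) :
    chartTrans 𝓘(ℝ, F) q₀ q₁ y ∈ chartOverlap 𝓘(ℝ, F) q₁ q₀ :=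
  extChartAt_mem_chartOverlap 𝓘(ℝ, F) hy.2 ((extChartAt 𝓘(ℝ, F) q₀).map_target hy.1)

/-- The change of coordinates on the cotangent bundle is the inverse transpose of the tangent map
of the change of coordinates on the base. -/
theorem chartTrans_cotangent {p₀ p₁ : CotangentBundle F Q} {z : F × (F →L[ℝ] ℝ)}
    (hz : z.1 ∈ chartOverlap 𝓘(ℝ, F) p₀.proj p₁.proj) :
    chartTrans (𝓘(ℝ, F).prod 𝓘(ℝ, F →L[ℝ] ℝ)) p₀ p₁ z = (chartTrans 𝓘(ℝ, F) p₀.proj p₁.proj z.1,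
      z.2.comp (fderiv ℝ (chartTrans 𝓘(ℝ, F) p₁.proj p₀.proj)
        (chartTrans 𝓘(ℝ, F) p₀.proj p₁.proj z.1))) := by
  rw [chartTrans, extChartAt_cotangent_symm_apply p₀ hz.1]
  refine (extChartAt_cotangent_apply p₁ hz.2 _).trans (Prod.ext rfl ?_)
  ext v
  have h1 := tangentSymm_chartTrans (chartTrans_mem_chartOverlap hz) v
  have h2 : (extChartAt 𝓘(ℝ, F) p₁.proj).symm (chartTrans 𝓘(ℝ, F) p₀.proj p₁.proj z.1) =
      (extChartAt 𝓘(ℝ, F) p₀.proj).symm z.1 := (extChartAt 𝓘(ℝ, F) p₁.proj).left_inv hz.2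
  rw [h2] at h1
  exact congrArg z.2 h1

theorem fderiv_chartTrans_comp {q₀ q₁ : Q} {y : F} (hy : y ∈ chartOverlap 𝓘(ℝ, F) q₀ q₁) :
    (fderiv ℝ (chartTrans 𝓘(ℝ, F) q₁ q₀) (chartTrans 𝓘(ℝ, F) q₀ q₁ y)).comp
      (fderiv ℝ (chartTrans 𝓘(ℝ, F) q₀ q₁) y) = .id ℝ F := by
  have h1 : ∀ {q₀ q₁ : Q} {y : F}, y ∈ chartOverlap 𝓘(ℝ, F) q₀ q₁ →
      HasFDerivAt (chartTrans 𝓘(ℝ, F) q₀ q₁) (fderiv ℝ (chartTrans 𝓘(ℝ, F) q₀ q₁) y) y :=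
    fun hy => (((contDiffOn_chartTrans 𝓘(ℝ, F) _ _).contDiffAt
      ((isOpen_chartOverlap 𝓘(ℝ, F) _ _).mem_nhds hy)).differentiableAt (by simp)).hasFDerivAt
  have h2 := (h1 (chartTrans_mem_chartOverlap hy)).comp y (h1 hy)
  refine h2.unique ((hasFDerivAt_id y).congr_of_eventuallyEq ?_)
  filter_upwards [(isOpen_chartOverlap 𝓘(ℝ, F) q₀ q₁).mem_nhds hy] with z hz
  change extChartAt 𝓘(ℝ, F) q₀ ((extChartAt 𝓘(ℝ, F) q₁).symm (extChartAt 𝓘(ℝ, F) q₁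
    ((extChartAt 𝓘(ℝ, F) q₀).symm z))) = z
  rw [(extChartAt 𝓘(ℝ, F) q₁).left_inv hz.2, (extChartAt 𝓘(ℝ, F) q₀).right_inv hz.1]

variable [FiniteDimensional ℝ F]

/-- The changes of coordinates on the cotangent bundle preserve the measure `dq dp`. -/
theorem det_fderiv_chartTrans_cotangent {p₀ p₁ : CotangentBundle F Q} {z : F × (F →L[ℝ] ℝ)}
    (hz : z.1 ∈ chartOverlap 𝓘(ℝ, F) p₀.proj p₁.proj) :
    (fderiv ℝ (chartTrans (𝓘(ℝ, F).prod 𝓘(ℝ, F →L[ℝ] ℝ)) p₀ p₁) z).det = 1 := by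
  set τ := chartTrans 𝓘(ℝ, F) p₀.proj p₁.proj with hτ
  set κ := chartTrans 𝓘(ℝ, F) p₁.proj p₀.proj with hκ
  have ho := isOpen_chartOverlap 𝓘(ℝ, F) p₀.proj p₁.proj
  have ho' := isOpen_chartOverlap 𝓘(ℝ, F) p₁.proj p₀.proj
  have h1 : chartTrans (𝓘(ℝ, F).prod 𝓘(ℝ, F →L[ℝ] ℝ)) p₀ p₁ =ᶠ[𝓝 z]
      fun z => (τ z.1, z.2.comp (fderiv ℝ κ (τ z.1))) := by
    filter_upwards [(ho.preimage continuous_fst).mem_nhds hz] with z' hz'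
    exact chartTrans_cotangent hz'
  have hd : HasFDerivAt τ (fderiv ℝ τ z.1) z.1 := (((contDiffOn_chartTrans 𝓘(ℝ, F) _ _).contDiffAt
    (ho.mem_nhds hz)).differentiableAt (by simp)).hasFDerivAt
  have hτz := chartTrans_mem_chartOverlap hz
  have hd' : HasFDerivAt (fderiv ℝ κ) (fderiv ℝ (fderiv ℝ κ) (τ z.1)) (τ z.1) :=
    ((((contDiffOn_chartTrans 𝓘(ℝ, F) _ _).contDiffAt (ho'.mem_nhds hτz)).fderiv_right (m := 1)
      (by norm_cast)).differentiableAt (by simp)).hasFDerivAt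
  have hfst : HasFDerivAt (Prod.fst : F × (F →L[ℝ] ℝ) → F) (ContinuousLinearMap.fst ℝ F (F →L[ℝ] ℝ)) z :=
    hasFDerivAt_fst
  have hsnd : HasFDerivAt (Prod.snd : F × (F →L[ℝ] ℝ) → (F →L[ℝ] ℝ))
      (ContinuousLinearMap.snd ℝ F (F →L[ℝ] ℝ)) z := hasFDerivAt_snd
  have h2 := HasFDerivAt.comp (f := Prod.fst) z hd hfst
  have h3 := hsnd.clm_comp (HasFDerivAt.comp (f := τ ∘ Prod.fst) z hd' h2)
  have h4 := (h2.prodMk h3).fderiv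
  rw [h1.fderiv_eq]
  refine (congrArg ContinuousLinearMap.det h4).trans ?_
  set R := fderiv ℝ κ (τ z.1) with hR
  let tr : (F →L[ℝ] ℝ) →ₗ[ℝ] (F →L[ℝ] ℝ) := (ContinuousLinearMap.compL ℝ F F ℝ).flip R
  -- on the fibre, the change of coordinates is the transpose of the inverse of that on the base
  have htr : LinearMap.det tr = LinearMap.det (R : F →ₗ[ℝ] F) := by
    let C : (F →L[ℝ] ℝ) ≃ₗ[ℝ] Module.Dual ℝ F := LinearMap.toContinuousLinearMap.symm
    have h5 : tr = C.symm.conj (LinearMap.dualMap (R : F →ₗ[ℝ] F)) := by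
      refine LinearMap.ext fun δ => ContinuousLinearMap.ext fun v => rfl
    rw [h5]
    exact (LinearMap.det_conj (LinearMap.dualMap (R : F →ₗ[ℝ] F)) C.symm).trans
      (LinearMap.det_dualMap _)
  have h6 : LinearMap.det (R : F →ₗ[ℝ] F) * LinearMap.det (fderiv ℝ τ z.1 : F →ₗ[ℝ] F) = 1 := by
    rw [← LinearMap.det_comp]
    have := congrArg (fun L : F →L[ℝ] F => LinearMap.det (L : F →ₗ[ℝ] F)) (fderiv_chartTrans_comp hz)
    simpa using this
  rw [ContinuousLinearMap.det, ← h6, mul_comm, ← htr]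
  refine det_lowerTriangular _ ((ContinuousLinearMap.compL ℝ F F ℝ z.2).comp
    ((fderiv ℝ (fderiv ℝ κ) (τ z.1)).comp (fderiv ℝ τ z.1)) : F →L[ℝ] (F →L[ℝ] ℝ)).toLinearMap _
    (fun u => rfl) (fun u => ?_) fun δ => ?_
  · ext v
    simp
  · ext v
    simp [tr, hR]

end CotangentBundleCharts

set_option maxSynthPendingDepth 3

/-! ### The Legendre transformation and the field on the cotangent bundle -/

section MapsInCharts

open Set Filter Topology

variable {E : Type*} [NormedAddCommGroup E] [NormedSpace ℝ E]
  {H : Type*} [TopologicalSpace H] {I : ModelWithCorners ℝ E H} [I.Boundaryless]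
  {N : Type*} [TopologicalSpace N] [ChartedSpace H N] [IsManifold I ∞ N]
  {E' : Type*} [NormedAddCommGroup E'] [NormedSpace ℝ E']
  {H' : Type*} [TopologicalSpace H'] {I' : ModelWithCorners ℝ E' H'} [I'.Boundaryless]
  {N' : Type*} [TopologicalSpace N'] [ChartedSpace H' N'] [IsManifold I' ∞ N']

theorem contMDiffOn_of_eq_in_charts {f : N → N'} {x₀ : N} {x₀' : N'} {κ : E → E'}
    (hκ : ContDiffOn ℝ ∞ κ (extChartAt I x₀).target)
    (hf : ∀ x ∈ (extChartAt I x₀).source, f x ∈ (extChartAt I' x₀').source ∧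
      extChartAt I' x₀' (f x) = κ (extChartAt I x₀ x)) :
    ContMDiffOn I I' ∞ f (extChartAt I x₀).source := by
  have h1 : ContMDiffOn I 𝓘(ℝ, E') ∞ (fun x => κ (extChartAt I x₀ x)) (extChartAt I x₀).source := by
    refine ((contMDiffOn_iff_contDiffOn.2 hκ).comp (t := (extChartAt I x₀).target)
      (contMDiffOn_extChartAt (I := I) (n := ∞) (x := x₀)) ?_).mono (by simp)
    exact fun x hx => (extChartAt I x₀).map_source (by simpa using hx)
  have h2 := (contMDiffOn_extChartAt_symm (I := I') (n := ∞) x₀').comp h1 fun x hx => by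
    change κ (extChartAt I x₀ x) ∈ (extChartAt I' x₀').target
    rw [← (hf x hx).2]
    exact (extChartAt I' x₀').map_source (hf x hx).1
  refine h2.congr fun x hx => ?_
  rw [Function.comp_apply, ← (hf x hx).2, (extChartAt I' x₀').left_inv (hf x hx).1]

/-- Fields which are related by a map are related in charts by its coordinate expression. -/
theorem chartField_eq_of_related {f : N → N'} {Z : (x : N) → TangentSpace I x}
    {Y : (x : N') → TangentSpace I' x} {x₀ x : N} {x₀' : N'} {κ : E → E'}
    (hx : x ∈ (extChartAt I x₀).source) (hfx : f x ∈ (extChartAt I' x₀').source)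
    (hf : MDifferentiableAt I I' f x) (hY : mfderiv I I' f x (Z x) = Y (f x))
    (hκ : DifferentiableAt ℝ κ (extChartAt I x₀ x))
    (h : ∀ᶠ x' in 𝓝 x, extChartAt I' x₀' (f x') = κ (extChartAt I x₀ x')) :
    chartField I' Y x₀' (extChartAt I' x₀' (f x)) =
      fderiv ℝ κ (extChartAt I x₀ x) (chartField I Z x₀ (extChartAt I x₀ x)) := by
  haveI : IsManifold I 1 N := .of_le (n := ∞) (by norm_cast)
  haveI : IsManifold I' 1 N' := .of_le (n := ∞) (by norm_cast)
  have h1 := (mdifferentiableAt_extChartAt (I := I') (x := x₀') (by simpa using hfx)).hasMFDerivAt.comp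
    x hf.hasMFDerivAt
  have h2 := hκ.hasFDerivAt.hasMFDerivAt.comp x
    (mdifferentiableAt_extChartAt (I := I) (x := x₀) (by simpa using hx)).hasMFDerivAt
  have h3 := hasMFDerivAt_unique h1 (h2.congr_of_eventuallyEq h)
  rw [chartField_extChartAt I Z hx, chartField_extChartAt I' Y hfx, ← hY]
  exact DFunLike.congr_fun h3 (Z x)

end MapsInCharts

namespace InertiaData

open Set Filter Topology KineticAlgebra MeasureTheory

variable {E : Type*} [NormedAddCommGroup E] [NormedSpace ℝ E] [FiniteDimensional ℝ E]
  {G : Type*} [TopologicalSpace G] [ChartedSpace E G] [Group G] [LieGroup 𝓘(ℝ, E) ∞ G]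
  {S : InertiaData E G} {H : Subgroup G}
  {F : Type*} [NormedAddCommGroup F] [NormedSpace ℝ F] [FiniteDimensional ℝ F]
  [ChartedSpace F (CosetSpace H)] [IsManifold 𝓘(ℝ, F) ∞ (CosetSpace H)]
  {V : CosetSpace H → ℝ}

theorem isManifold_cotangentBundle : IsManifold (𝓘(ℝ, F).prod 𝓘(ℝ, F →L[ℝ] ℝ)) ∞
    (CotangentBundle F (CosetSpace H)) := by
  haveI : IsManifold 𝓘(ℝ, F) (∞ + 1) (CosetSpace H) := ‹IsManifold 𝓘(ℝ, F) ∞ (CosetSpace H)›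
  haveI : ContMDiffVectorBundle ∞ F (TangentSpace 𝓘(ℝ, F) : CosetSpace H → Type _) 𝓘(ℝ, F) :=
    TangentBundle.contMDiffVectorBundle
  exact Bundle.TotalSpace.isManifold (F →L[ℝ] ℝ)
    (fun q : CosetSpace H => TangentSpace 𝓘(ℝ, F) q →L[ℝ] Bundle.Trivial (CosetSpace H) ℝ q)

/-- The Legendre transformation is `(q, v) ↦ ⟨𝓘Φ(q, v), Φ(q, ·)⟩`. -/
theorem legendre_eq (hs : Manifold.IsSubmersion 𝓘(ℝ, E) 𝓘(ℝ, F) ∞ (cosetProj H))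
    (q : CosetSpace H) (u : F) :
    S.legendre H V (⟨q, u⟩ : TangentBundle 𝓘(ℝ, F) (CosetSpace H)) =
      (⟨q, ((S.kineticAlgebra.kin (S.PhiL hs q u)).comp (S.PhiL hs q) : F →L[ℝ] ℝ)⟩ :
        CotangentBundle F (CosetSpace H)) := by
  have h1 : HasFDerivAt (fun v : F => S.reducedLagrangian H V
      (⟨q, v⟩ : TangentBundle 𝓘(ℝ, F) (CosetSpace H)))
      ((S.kineticAlgebra.kin (S.PhiL hs q u)).comp (S.PhiL hs q)) u := by
    have h2 := ((((S.kineticAlgebra.kin.comp (S.PhiL hs q)).hasFDerivAt (x := u)).clm_apply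
      (S.PhiL hs q).hasFDerivAt).const_mul (1 / 2 : ℝ)).sub_const (V q)
    refine HasFDerivAt.congr_fderiv (f := fun v : F => S.reducedLagrangian H V
      (⟨q, v⟩ : TangentBundle 𝓘(ℝ, F) (CosetSpace H))) h2 ?_
    ext v
    simp
    rw [S.kineticAlgebra.kin_symm (S.PhiL hs q v)]
    ring
  unfold legendre
  exact congrArg (fun α : F →L[ℝ] ℝ => (⟨q, α⟩ : CotangentBundle F (CosetSpace H))) h1.fderiv

/-- The Legendre transformation in charts. -/
theorem extChartAt_legendre (hs : Manifold.IsSubmersion 𝓘(ℝ, E) 𝓘(ℝ, F) ∞ (cosetProj H))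
    (w w' : TangentBundle 𝓘(ℝ, F) (CosetSpace H))
    (hw : w'.proj ∈ (extChartAt 𝓘(ℝ, F) w.proj).source) :
    extChartAt (𝓘(ℝ, F).prod 𝓘(ℝ, F →L[ℝ] ℝ)) (S.legendre H V w) (S.legendre H V w') =
      S.kineticAlgebra.localLegendre (S.localPhi hs w.proj) (extChartAt (𝓘(ℝ, F).tangent) w w') := by
  obtain ⟨q, u⟩ := w'
  rw [legendre_eq hs q u]
  refine (extChartAt_cotangent_apply (S.legendre H V w) hw _).trans ?_
  refine Eq.trans ?_ (congrArg (S.kineticAlgebra.localLegendre (S.localPhi hs w.proj))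
    (extChartAt_tangent_apply w hw u)).symm
  refine Prod.ext rfl ?_
  ext ξ
  have h1 : (extChartAt 𝓘(ℝ, F) w.proj).symm (extChartAt 𝓘(ℝ, F) w.proj q) = q :=
    (extChartAt 𝓘(ℝ, F) w.proj).left_inv hw
  have h2 := tangentSymm_mfderiv_extChartAt (F := F) hw u
  set v : F := (mfderiv 𝓘(ℝ, F) 𝓘(ℝ, F) (extChartAt 𝓘(ℝ, F) w.proj) q : F →L[ℝ] F) u with hv
  change S.kineticAlgebra.kin (S.PhiL hs q u) (S.PhiL hs q (tangentSymm F w.proj q ξ)) =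
    S.kineticAlgebra.kin
      (S.PhiL hs ((extChartAt 𝓘(ℝ, F) w.proj).symm (extChartAt 𝓘(ℝ, F) w.proj q))
        (tangentSymm F w.proj
          ((extChartAt 𝓘(ℝ, F) w.proj).symm (extChartAt 𝓘(ℝ, F) w.proj q)) v))
      (S.PhiL hs ((extChartAt 𝓘(ℝ, F) w.proj).symm (extChartAt 𝓘(ℝ, F) w.proj q))
        (tangentSymm F w.proj
          ((extChartAt 𝓘(ℝ, F) w.proj).symm (extChartAt 𝓘(ℝ, F) w.proj q)) ξ))
  rw [h1, h2]

theorem contMDiff_legendre (hs : Manifold.IsSubmersion 𝓘(ℝ, E) 𝓘(ℝ, F) ∞ (cosetProj H))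
    (hr : S.IsRegular H) (hV : ContMDiff 𝓘(ℝ, F) 𝓘(ℝ, ℝ) ∞ V) :
    ContMDiff (𝓘(ℝ, F).tangent) (𝓘(ℝ, F).prod 𝓘(ℝ, F →L[ℝ] ℝ)) ∞ (S.legendre (F := F) H V) := by
  haveI := isManifold_tangentBundle (F := F) (Q := CosetSpace H)
  haveI := isManifold_cotangentBundle (F := F) (H := H)
  intro w
  refine (contMDiffOn_of_eq_in_charts (x₀ := w) (x₀' := S.legendre H V w)
    (κ := S.kineticAlgebra.localLegendre (S.localPhi hs w.proj)) ?_ fun w' hw' => ?_).contMDiffAt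
    (extChartAt_source_mem_nhds w)
  · exact (S.isLocalSystem hs hr hV w.proj).contDiffOn_localLegendre.mono
      fun p hp => ⟨mem_extChartAt_tangent_target.1 hp, mem_univ _⟩
  · have hb := mem_extChartAt_tangent_source.1 hw'
    exact ⟨mem_extChartAt_cotangent_source.2 hb, extChartAt_legendre hs w w' hb⟩

/-- In charts the Legendre transformation is the metric on each fibre, which is nondegenerate. -/
theorem bijective_legendre (hs : Manifold.IsSubmersion 𝓘(ℝ, E) 𝓘(ℝ, F) ∞ (cosetProj H))
    (hr : S.IsRegular H) (hV : ContMDiff 𝓘(ℝ, F) 𝓘(ℝ, ℝ) ∞ V) :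
    Function.Bijective (S.legendre (F := F) H V) := by
  constructor
  · intro w w' h
    have hb : w'.proj = w.proj :=
      congrArg (fun p : CotangentBundle F (CosetSpace H) => p.proj) h.symm
    have hbw : w.proj ∈ (extChartAt 𝓘(ℝ, F) w.proj).source := mem_extChartAt_source w.proj
    have hbw' : w'.proj ∈ (extChartAt 𝓘(ℝ, F) w.proj).source := by rwa [hb]
    have h1 := extChartAt_legendre (S := S) (V := V) hs w w hbw
    have h2 := extChartAt_legendre (S := S) (V := V) hs w w' hbw'
    rw [← h, h1] at h2
    have hm : ∀ x ∈ (extChartAt (𝓘(ℝ, F).tangent) w).source,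
        (extChartAt (𝓘(ℝ, F).tangent) w x).1 ∈ (extChartAt 𝓘(ℝ, F) w.proj).target := fun x hx =>
      mem_extChartAt_tangent_target.1 ((extChartAt (𝓘(ℝ, F).tangent) w).map_source hx)
    have hw := mem_extChartAt_tangent_source.2 hbw
    have hw' := mem_extChartAt_tangent_source.2 hbw'
    have h3 := congrArg (S.kineticAlgebra.localLegendreSymm (S.localPhi hs w.proj)) h2
    have hsys := S.isLocalSystem hs hr hV w.proj
    rw [hsys.localLegendreSymm_localLegendre (hm w hw),
      hsys.localLegendreSymm_localLegendre (hm w' hw')] at h3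
    exact (extChartAt (𝓘(ℝ, F).tangent) w).injOn hw hw' h3
  · intro p
    let w₀ : TangentBundle 𝓘(ℝ, F) (CosetSpace H) := ⟨p.proj, 0⟩
    have hsys := S.isLocalSystem hs hr hV w₀.proj
    have hp : p ∈ (extChartAt (𝓘(ℝ, F).prod 𝓘(ℝ, F →L[ℝ] ℝ)) (S.legendre H V w₀)).source :=
      mem_extChartAt_cotangent_source.2 (mem_extChartAt_source (I := 𝓘(ℝ, F)) p.proj)
    set z := extChartAt (𝓘(ℝ, F).prod 𝓘(ℝ, F →L[ℝ] ℝ)) (S.legendre H V w₀) p with hz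
    have hzt : z.1 ∈ (extChartAt 𝓘(ℝ, F) w₀.proj).target := mem_extChartAt_cotangent_target.1
      ((extChartAt (𝓘(ℝ, F).prod 𝓘(ℝ, F →L[ℝ] ℝ)) (S.legendre H V w₀)).map_source hp)
    set y := S.kineticAlgebra.localLegendreSymm (S.localPhi hs w₀.proj) z with hy
    have hyt : y ∈ (extChartAt (𝓘(ℝ, F).tangent) w₀).target := mem_extChartAt_tangent_target.2 hzt
    let w := (extChartAt (𝓘(ℝ, F).tangent) w₀).symm y
    have hw : w ∈ (extChartAt (𝓘(ℝ, F).tangent) w₀).source :=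
      (extChartAt (𝓘(ℝ, F).tangent) w₀).map_target hyt
    have hb := mem_extChartAt_tangent_source.1 hw
    refine ⟨w, ?_⟩
    refine (extChartAt (𝓘(ℝ, F).prod 𝓘(ℝ, F →L[ℝ] ℝ)) (S.legendre H V w₀)).injOn
      (mem_extChartAt_cotangent_source (p := S.legendre H V w₀) (p' := S.legendre H V w) |>.2 hb) hp ?_
    rw [extChartAt_legendre hs w₀ w hb, (extChartAt (𝓘(ℝ, F).tangent) w₀).right_inv hyt, hy,
      hsys.localLegendre_localLegendreSymm hzt]

/-- A field which is the image of the reduced field under the Legendre transformation is, in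
charts, the local field in positions and momenta. -/
theorem chartField_eq_momentumField (hs : Manifold.IsSubmersion 𝓘(ℝ, E) 𝓘(ℝ, F) ∞ (cosetProj H))
    (hr : S.IsRegular H) (hV : ContMDiff 𝓘(ℝ, F) 𝓘(ℝ, ℝ) ∞ V)
    {Y : (p : CotangentBundle F (CosetSpace H)) → TangentSpace (𝓘(ℝ, F).prod 𝓘(ℝ, F →L[ℝ] ℝ)) p}
    (hY : ∀ w, mfderiv (𝓘(ℝ, F).tangent) (𝓘(ℝ, F).prod 𝓘(ℝ, F →L[ℝ] ℝ))
      (S.legendre (F := F) H V) w (S.reducedField hs V w) = Y (S.legendre H V w))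
    (p : CotangentBundle F (CosetSpace H)) {z : F × (F →L[ℝ] ℝ)}
    (hz : z ∈ (extChartAt (𝓘(ℝ, F).prod 𝓘(ℝ, F →L[ℝ] ℝ)) p).target) :
    chartField (𝓘(ℝ, F).prod 𝓘(ℝ, F →L[ℝ] ℝ)) Y p z =
      S.kineticAlgebra.momentumField (S.localPhi hs p.proj) (localPotential F V p.proj) z := by
  haveI := isManifold_tangentBundle (F := F) (Q := CosetSpace H)
  haveI := isManifold_cotangentBundle (F := F) (H := H)
  obtain ⟨w₀, rfl⟩ := (bijective_legendre hs hr hV).2 p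
  obtain ⟨w, hw⟩ := (bijective_legendre hs hr hV).2
    ((extChartAt (𝓘(ℝ, F).prod 𝓘(ℝ, F →L[ℝ] ℝ)) (S.legendre H V w₀)).symm z)
  have hws : S.legendre H V w ∈
      (extChartAt (𝓘(ℝ, F).prod 𝓘(ℝ, F →L[ℝ] ℝ)) (S.legendre H V w₀)).source := by
    rw [hw]
    exact (extChartAt (𝓘(ℝ, F).prod 𝓘(ℝ, F →L[ℝ] ℝ)) (S.legendre H V w₀)).map_target hz
  have hb : w.proj ∈ (extChartAt 𝓘(ℝ, F) w₀.proj).source := mem_extChartAt_cotangent_source.1 hws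
  have hwt : w ∈ (extChartAt (𝓘(ℝ, F).tangent) w₀).source := mem_extChartAt_tangent_source.2 hb
  have hsys := S.isLocalSystem hs hr hV w₀.proj
  have ht := (extChartAt (𝓘(ℝ, F).tangent) w₀).map_source hwt
  have hbt := mem_extChartAt_tangent_target.1 ht
  have h1 : extChartAt (𝓘(ℝ, F).prod 𝓘(ℝ, F →L[ℝ] ℝ)) (S.legendre H V w₀) (S.legendre H V w) = z := by
    rw [hw, (extChartAt (𝓘(ℝ, F).prod 𝓘(ℝ, F →L[ℝ] ℝ)) (S.legendre H V w₀)).right_inv hz]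
  have h2 := chartField_eq_of_related (f := S.legendre (F := F) H V) (Z := S.reducedField hs V)
    (Y := Y) (κ := S.kineticAlgebra.localLegendre (S.localPhi hs w₀.proj)) hwt hws
    ((contMDiff_legendre hs hr hV w).mdifferentiableAt (by simp)) (hY w)
    ((hsys.contDiffOn_localLegendre.contDiffAt ((hsys.isOpen.prod isOpen_univ).mem_nhds
      ⟨hbt, mem_univ _⟩)).differentiableAt (by simp))
    (by
      filter_upwards [(isOpen_extChartAt_source w₀).mem_nhds hwt] with w' hw'
      exact extChartAt_legendre hs w₀ w' (mem_extChartAt_tangent_source.1 hw'))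
  rw [h1, chartField_reducedField hs hr hV w₀ ht, hsys.fderiv_localLegendre_localField hbt,
    ← extChartAt_legendre hs w₀ w hb, h1] at h2
  exact h2

theorem isSmoothField_of_legendre (hs : Manifold.IsSubmersion 𝓘(ℝ, E) 𝓘(ℝ, F) ∞ (cosetProj H))
    (hr : S.IsRegular H) (hV : ContMDiff 𝓘(ℝ, F) 𝓘(ℝ, ℝ) ∞ V)
    [IsManifold (𝓘(ℝ, F).prod 𝓘(ℝ, F →L[ℝ] ℝ)) 1 (CotangentBundle F (CosetSpace H))]
    {Y : (p : CotangentBundle F (CosetSpace H)) → TangentSpace (𝓘(ℝ, F).prod 𝓘(ℝ, F →L[ℝ] ℝ)) p}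
    (hY : ∀ w, mfderiv (𝓘(ℝ, F).tangent) (𝓘(ℝ, F).prod 𝓘(ℝ, F →L[ℝ] ℝ))
      (S.legendre (F := F) H V) w (S.reducedField hs V w) = Y (S.legendre H V w)) :
    IsSmoothField (𝓘(ℝ, F).prod 𝓘(ℝ, F →L[ℝ] ℝ)) Y := by
  haveI := isManifold_cotangentBundle (F := F) (H := H)
  rw [isSmoothField_iff_contDiffOn_chartField]
  intro p
  refine ((S.isLocalSystem hs hr hV p.proj).contDiffOn_momentumField.mono ?_).congr
    fun z hz => chartField_eq_momentumField hs hr hV hY p hz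
  exact fun z hz => ⟨mem_extChartAt_cotangent_target.1 hz, mem_univ _⟩

/-- The densities `√|det B / det A|` with respect to `dq dp` define a global measure: both
determinants are multiplied by the same factor under a change of coordinates. -/
theorem exists_isInvariantVolume_of_legendre [CompactSpace G] [MeasurableSpace F] [BorelSpace F]
    [MeasurableSpace (CotangentBundle F (CosetSpace H))]
    [BorelSpace (CotangentBundle F (CosetSpace H))]
    (hs : Manifold.IsSubmersion 𝓘(ℝ, E) 𝓘(ℝ, F) ∞ (cosetProj H))
    (hr : S.IsRegular H) (hV : ContMDiff 𝓘(ℝ, F) 𝓘(ℝ, ℝ) ∞ V)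
    {Y : (p : CotangentBundle F (CosetSpace H)) → TangentSpace (𝓘(ℝ, F).prod 𝓘(ℝ, F →L[ℝ] ℝ)) p}
    (hY : ∀ w, mfderiv (𝓘(ℝ, F).tangent) (𝓘(ℝ, F).prod 𝓘(ℝ, F →L[ℝ] ℝ))
      (S.legendre (F := F) H V) w (S.reducedField hs V w) = Y (S.legendre H V w)) :
    ∃ ν : Measure (CotangentBundle F (CosetSpace H)),
      IsInvariantVolume (𝓘(ℝ, F).prod 𝓘(ℝ, F →L[ℝ] ℝ)) Y ν := by
  haveI := isManifold_cotangentBundle (F := F) (H := H)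
  let ρ : CotangentBundle F (CosetSpace H) → F × (F →L[ℝ] ℝ) → ℝ := fun p z =>
    S.kineticAlgebra.momentumDensity (S.localPhi hs p.proj) z.1
  obtain ⟨c, hc⟩ := exists_chart_cover (F := F) (H := H) hs
  obtain ⟨ν, hν⟩ := exists_measure_hasChartDensity (𝓘(ℝ, F).prod 𝓘(ℝ, F →L[ℝ] ℝ)) (ρ := ρ)
    (fun p₀ p₁ z hz => by
      have hb := mem_chartOverlap_cotangent.1 hz
      rw [det_fderiv_chartTrans_cotangent hb, chartTrans_cotangent hb, abs_one, one_mul]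
      exact (S.isTransition hs V p₀.proj p₁.proj).momentumDensity_eq
        (S.isLocalSystem hs hr hV p₀.proj) hb hb.1)
    (fun n => ⟨c n, 0⟩) (fun p => by
      obtain ⟨n, hn⟩ := hc p.proj
      exact ⟨n, mem_extChartAt_cotangent_source.2 hn⟩)
  refine ⟨ν, fun p => ⟨ρ p, ?_, ?_, hν p, ?_⟩⟩
  · exact (S.isLocalSystem hs hr hV p.proj).contDiffOn_momentumDensity.comp contDiffOn_fst
      fun z hz => mem_extChartAt_cotangent_target.1 hz
  · exact fun z hz => (S.isLocalSystem hs hr hV p.proj).momentumDensity_pos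
      (mem_extChartAt_cotangent_target.1 hz)
  · intro z hz
    rw [← (S.isLocalSystem hs hr hV p.proj).divergence_momentumDensity_smul_momentumField
      (mem_extChartAt_cotangent_target.1 hz)]
    refine divergence_congr ?_
    filter_upwards [(isOpen_extChartAt_target p).mem_nhds hz] with z' hz'
    rw [chartField_eq_momentumField hs hr hV hY p hz']

end InertiaData

end

theorem theorem3p3 :
    -- the reduced LR system on the tangent and the cotangent bundle of `H \ G`
    (∀ {E : Type*} [NormedAddCommGroup E] [NormedSpace ℝ E] [FiniteDimensional ℝ E]
      {G : Type*} [TopologicalSpace G] [ChartedSpace E G] [Group G] [LieGroup 𝓘(ℝ, E) ∞ G]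
      [T2Space G] [CompactSpace G] [ConnectedSpace G]
      (S : InertiaData E G) (H : Subgroup G) (_ : IsClosed (H : Set G)) (_ : S.IsRegular H)
      {F : Type*} [NormedAddCommGroup F] [NormedSpace ℝ F] [FiniteDimensional ℝ F]
      [MeasurableSpace F] [BorelSpace F]
      [ChartedSpace F (CosetSpace H)] [IsManifold 𝓘(ℝ, F) ∞ (CosetSpace H)]
      (_ : Manifold.IsSubmersion 𝓘(ℝ, E) 𝓘(ℝ, F) ∞ (cosetProj H))
      (V : CosetSpace H → ℝ) (_ : ContMDiff 𝓘(ℝ, F) 𝓘(ℝ, ℝ) ∞ V)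
      [MeasurableSpace (TangentBundle 𝓘(ℝ, F) (CosetSpace H))]
      [BorelSpace (TangentBundle 𝓘(ℝ, F) (CosetSpace H))]
      [MeasurableSpace (CotangentBundle F (CosetSpace H))]
      [BorelSpace (CotangentBundle F (CosetSpace H))],
      ∃ Z : (w : TangentBundle 𝓘(ℝ, F) (CosetSpace H)) → TangentSpace (𝓘(ℝ, F).tangent) w,
        S.IsReducedField H V Z ∧
        IsSmoothField (𝓘(ℝ, F).tangent) Z ∧
        (∃ μ : MeasureTheory.Measure (TangentBundle 𝓘(ℝ, F) (CosetSpace H)),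
          IsInvariantVolume (𝓘(ℝ, F).tangent) Z μ) ∧
        ContMDiff (𝓘(ℝ, F).tangent) (𝓘(ℝ, F).prod 𝓘(ℝ, F →L[ℝ] ℝ)) ∞ (S.legendre (F := F) H V) ∧
        Function.Bijective (S.legendre (F := F) H V) ∧
        ∃ Y : (p : CotangentBundle F (CosetSpace H)) →
            TangentSpace (𝓘(ℝ, F).prod 𝓘(ℝ, F →L[ℝ] ℝ)) p,
          (∀ w, mfderiv (𝓘(ℝ, F).tangent) (𝓘(ℝ, F).prod 𝓘(ℝ, F →L[ℝ] ℝ))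
            (S.legendre (F := F) H V) w (Z w) = Y (S.legendre H V w)) ∧
          IsSmoothField (𝓘(ℝ, F).prod 𝓘(ℝ, F →L[ℝ] ℝ)) Y ∧
          ∃ ν : MeasureTheory.Measure (CotangentBundle F (CosetSpace H)),
            IsInvariantVolume (𝓘(ℝ, F).prod 𝓘(ℝ, F →L[ℝ] ℝ)) Y ν) ∧
    -- reduction of an invariant volume by a free action of a compact group
    (∀ {E : Type*} [NormedAddCommGroup E] [NormedSpace ℝ E] [FiniteDimensional ℝ E]
      {K : Type*} [TopologicalSpace K] [ChartedSpace E K] [Group K] [LieGroup 𝓘(ℝ, E) ∞ K]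
      [T2Space K] [CompactSpace K]
      {E' : Type*} [NormedAddCommGroup E'] [NormedSpace ℝ E'] [FiniteDimensional ℝ E']
      [MeasurableSpace E'] [BorelSpace E']
      {N : Type*} [TopologicalSpace N] [ChartedSpace E' N] [IsManifold 𝓘(ℝ, E') ∞ N]
      [T2Space N] [SecondCountableTopology N] [MeasurableSpace N] [BorelSpace N]
      [MulAction K N] [ContMDiffSMul 𝓘(ℝ, E) 𝓘(ℝ, E') ∞ K N]
      (_ : ∀ (k : K) (z : N), k • z = z → k = 1)
      {F : Type*} [NormedAddCommGroup F] [NormedSpace ℝ F] [FiniteDimensional ℝ F]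
      [MeasurableSpace F] [BorelSpace F]
      [ChartedSpace F (MulAction.orbitRel.Quotient K N)]
      [IsManifold 𝓘(ℝ, F) ∞ (MulAction.orbitRel.Quotient K N)]
      [MeasurableSpace (MulAction.orbitRel.Quotient K N)]
      [BorelSpace (MulAction.orbitRel.Quotient K N)]
      (_ : Manifold.IsSubmersion 𝓘(ℝ, E') 𝓘(ℝ, F) ∞
        (Quotient.mk (MulAction.orbitRel K N) : N → MulAction.orbitRel.Quotient K N))
      (Z : (z : N) → TangentSpace 𝓘(ℝ, E') z) (_ : IsSmoothField 𝓘(ℝ, E') Z)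
      (_ : ∀ (k : K) (z : N), mfderiv 𝓘(ℝ, E') 𝓘(ℝ, E') (fun x : N => k • x) z (Z z) = Z (k • z))
      (μ : MeasureTheory.Measure N) (_ : IsInvariantVolume 𝓘(ℝ, E') Z μ),
      ∃ Zred : (x : MulAction.orbitRel.Quotient K N) → TangentSpace 𝓘(ℝ, F) x,
        (∀ z : N, mfderiv 𝓘(ℝ, E') 𝓘(ℝ, F)
          (Quotient.mk (MulAction.orbitRel K N) : N → MulAction.orbitRel.Quotient K N) z (Z z) =
            Zred (Quotient.mk (MulAction.orbitRel K N) z)) ∧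
        IsSmoothField 𝓘(ℝ, F) Zred ∧
        IsInvariantVolume 𝓘(ℝ, F) Zred
          (μ.map (Quotient.mk (MulAction.orbitRel K N) :
            N → MulAction.orbitRel.Quotient K N))) := by
  refine ⟨?_, ?_⟩
  · intro E _ _ _ G _ _ _ _ _ _ _ S H hH hr F _ _ _ _ _ _ _ hs V hV _ _ _ _
    let e := Equiv.ofBijective _ (InertiaData.bijective_legendre (S := S) hs hr hV)
    -- the image of the field on the tangent bundle under the Legendre bijection
    let Y : (p : CotangentBundle F (CosetSpace H)) →
        TangentSpace (𝓘(ℝ, F).prod 𝓘(ℝ, F →L[ℝ] ℝ)) p := fun p =>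
      (mfderiv (𝓘(ℝ, F).tangent) (𝓘(ℝ, F).prod 𝓘(ℝ, F →L[ℝ] ℝ)) (S.legendre (F := F) H V)
        (e.symm p) (S.reducedField hs V (e.symm p)) : F × (F →L[ℝ] ℝ))
    have hY : ∀ w, mfderiv (𝓘(ℝ, F).tangent) (𝓘(ℝ, F).prod 𝓘(ℝ, F →L[ℝ] ℝ))
        (S.legendre (F := F) H V) w (S.reducedField hs V w) = Y (S.legendre H V w) := by
      intro w
      exact congrArg (fun w' => (mfderiv (𝓘(ℝ, F).tangent) (𝓘(ℝ, F).prod 𝓘(ℝ, F →L[ℝ] ℝ))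
        (S.legendre (F := F) H V) w' (S.reducedField hs V w') : F × (F →L[ℝ] ℝ)))
        (e.symm_apply_apply w).symm
    exact ⟨S.reducedField hs V, InertiaData.isReducedField_reducedField hs hr hV,
      InertiaData.isSmoothField_reducedField hs hr hV,
      InertiaData.exists_isInvariantVolume_reducedField hs hr hV,
      InertiaData.contMDiff_legendre hs hr hV, InertiaData.bijective_legendre hs hr hV,
      Y, hY, InertiaData.isSmoothField_of_legendre hs hr hV hY,
      InertiaData.exists_isInvariantVolume_of_legendre hs hr hV hY⟩
  · intro E _ _ _ K _ _ _ _ _ _ E' _ _ _ _ _ N _ _ _ _ _ _ _ _ _ hfree F _ _ _ _ _ _ _ _ _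
      hs Z hZ hinv μ hμ
    exact exists_reduced_field (E := E) hs Z hZ hinv μ hμ
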